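/- **Setting.** Let $A$ be an alphabet with $d\in\{2,3,\dots,\infty\}$ symbols (countably infinite if $d=\infty$), let $\star\notin A$, and let $\sigma$ be the left shift on sequences over $A\cup\{\star\}$. A (non-trivial) *kneading sequence* $\nu$ is either a non-periodic sequence over $A$, or a periodic sequence over $A\cup\{\star\}$ of exact period $p\ge 2$ in which $\star$ occurs exactly once within the period, at the last position ("$\star$-periodic"). Put $\operatorname{diff}(a,b)\in\mathbb N\cup\{\infty\}$ for the first position (counted from $1$) at which $a$ and $b$ carry two different symbols of $A$ ($\star$ is a wild card). Let $X_\nu$ consist of all *precritical points* $w\star\nu$ ($w$ a finite, possibly empty word over $A$; the *depth* is $|w|+1$) and all sequences over $A$ except those of the form $w\nu$ with $w$ a non-empty word over $A$. If $\nu$ is non-periodic, $X_\nu$ has the topology with basis $U_k(a)=\{b\in X_\nu:\operatorname{diff}(a,b)\ge k\}\setminus\partial_k(a)$ ($a\in X_\nu$, $k\ge1$), where $\partial_k(a)$ is the set of precritical points $b\ne a,\nu$ of depth at most $k-1$ with $\operatorname{diff}(a,b)\ge k$. *Critical path.* Let $P_1=\{\star\nu\prec\nu\}$ with $\varphi(\star\nu)=0$,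 $\varphi(\nu)=1$. The ordered set $P_{n+1}$ arises from $P_n$ by inserting, between any two adjacent points $a\prec b$ with $k=\operatorname{diff}(a,b)<\infty$, the precritical point $w''\star\nu$ of depth $k$ for which $w''$ agrees with $a$ and with $b$ at each of the first $k-1$ positions where that sequence does not have $\star$; the value of $\varphi$ at the new point is $(\varphi(a)+\varphi(b))/2$. Let $P_\infty=\bigcup_n P_n$. The set $L_\nu$ of *limits* consists of the sequences $a\in X_\nu$ without $\star$ for which there are nested intervals between adjacent points $l_n\prec r_n$ of $P_n$ with $\varphi(r_n)-\varphi(l_n)\to0$ and $\operatorname{diff}(a,l_n),\operatorname{diff}(a,r_n)\to\infty$; if these intervals shrink to a point of $P_\infty$, this is considered only if $\nu$ is $\star$-periodic, and $a$ is then a limit at that point, from the right or from the left. If $a\prec b$ are adjacent in some $P_n$ and $\operatorname{diff}(a,b)=\infty$ (a *gap*), the *central itinerary* of the gap is the sequence $c\in X_\nu$ without $\star$ with $\operatorname{diff}(a,c)=\operatorname{diff}(c,b)=\infty$. For $\star$-periodic $\nu$, abstract *Fatou intervals* $[c,a]\cong[0,1]$ join each $a\in P_\infty$ to the central itineraries $c$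 of the adjacent gaps and to the limits $c$ at $a$. The *critical path* $C_\nu$ is the union of $P_\infty$, the limits, the central itineraries and the Fatou intervals, with its natural linear order and the order topology. The shift maps a Fatou interval $[c,a]$ to the Fatou interval $[\sigma(c),\sigma(a)]$ by an arbitrarily chosen homeomorphism with $c\mapsto\sigma(c)$, $a\mapsto\sigma(a)$. *Hubbard tree.* $\mathcal H(\nu)=\bigcup_{n\ge0}\sigma^n(C_\nu)$, with the subspace topology of $X_\nu$ if $\nu$ is non-periodic; if $\nu$ is $\star$-periodic of period $p$, then $\mathcal H(\nu)=\bigcup_{k<p}\sigma^k(C_\nu)$ has the quotient topology with respect to the maps $\sigma^k\colon C_\nu\to\mathcal H(\nu)$, $0\le k<p$. The *critical point* is $\star\nu$ and the *critical value* is $\nu$. The *branches* (global arms) at $\tau\in\mathcal H(\nu)$ are the components of $\mathcal H(\nu)\setminus\{\tau\}$; $\tau$ is an *endpoint* if $\mathcal H(\nu)\setminus\{\tau\}$ is connected. Each branch $G$ at $\tau$ defines a *local arm* at $\tau$: the germ at $\tau$ of the sets $N\cap G$, for connected open neighbourhoods $N\not\ni\star\nu$ of $\tau$. For $\tau\ne\star\nu$,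 its $\sigma$-image is the local arm at $\sigma(\tau)$ of the branch $G'$ with $\sigma(N\cap G)\subseteq G'$ for all such $N$. A point $\tau$ is *characteristic* if a single component of $\mathcal H(\nu)\setminus\{\tau\}$ contains the critical point and all points of the orbit of $\tau$ other than $\tau$, but not the critical value. **Corollary (Types of periodic orbits).** Every periodic orbit of $\sigma\colon\mathcal H(\nu)\to\mathcal H(\nu)$ that does not contain the critical point has exactly one of the following types: * *endpoints:* it is an orbit of endpoints; * *primitive:* each of its points has exactly two branches, and both local arms are fixed by the first return map; * *satellite:* each of its points has the same finite number $k\ge2$ of branches, and the first return map permutes the local arms transitively and cyclically; * *evil:* each of its points has the same finite number $k\ge3$ of branches, the first return map permutes the local arms non-transitively, and there is exactly one characteristic point on the orbit, at which the first return map fixes the local arm towards the critical point and permutes all other local arms transitively and cyclically. -/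

import Mathlib

open Set Filter Topology

/-- Infinite sequences over `A ∪ {⋆}`; the symbol `⋆` is `none`, and the entry at (1-based)
position `i + 1` is `a i`. -/
abbrev Itinerary (A : Type*) := ℕ → Option A

namespace Itinerary

/-- The left shift. -/
def shift {A : Type*} (a : Itinerary A) : Itinerary A := fun i => a (i + 1)

/-- The sequence `⋆a`. -/
def star {A : Type*} (a : Itinerary A) : Itinerary A
  | 0 => none
  | i + 1 => a i

/-- The concatenation `w a` of a finite word `w` over `A` and a sequence `a`. -/
def prepend {A : Type*} (w : List A) (a : Itinerary A) : Itinerary A := fun i =>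
  if hi : i < w.length then some w[i] else a (i - w.length)

/-- The sequence lies in `A^∞`, that is, it does not contain the symbol `⋆`. -/
def StarFree {A : Type*} (a : Itinerary A) : Prop := ∀ i, a i ≠ none

/-- `diff(a, b)`: the (1-based) position of the first difference, where `⋆` is a wild card. -/
noncomputable def diff {A : Type*} (a b : Itinerary A) : ℕ∞ :=
  ⨅ (i : ℕ) (_ : ∃ s t : A, a i = some s ∧ b i = some t ∧ s ≠ t), ((i : ℕ∞) + 1)

/-! ### Kneading sequences -/

/-- A non-periodic sequence over `A`. -/
def IsNonperiodic {A : Type*} (ν : Itinerary A) : Prop :=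
  ν.StarFree ∧ ¬ ∃ p : ℕ, 0 < p ∧ ∀ i, ν (i + p) = ν i

/-- A periodic sequence over `A ∪ {⋆}` of exact period `p`, where `⋆` occurs exactly once within
the period, at the last position. -/
def IsStarPeriodic {A : Type*} (ν : Itinerary A) (p : ℕ) : Prop :=
  0 < p ∧ (∀ i, ν (i + p) = ν i) ∧ ∀ i, ν i = none ↔ p ∣ i + 1

/-- A non-trivial abstract kneading sequence (the only one of period `1`, which is excluded,
is `⋆⋆⋆…`). -/
def IsKneading {A : Type*} (ν : Itinerary A) : Prop :=
  ν.IsNonperiodic ∨ ∃ p, 2 ≤ p ∧ ν.IsStarPeriodic p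

/-! ### The space `X_ν` -/

/-- `a` is a precritical point `w⋆ν` of depth `n = |w| + 1`. -/
def IsPrecritical {A : Type*} (ν a : Itinerary A) (n : ℕ) : Prop :=
  ∃ w : List A, w.length + 1 = n ∧ a = prepend w ν.star

/-- The set `X_ν`: all precritical points `w⋆ν`, and all sequences over `A` except those of the
form `wν` with a non-empty word `w`. -/
def X {A : Type*} (ν : Itinerary A) : Set (Itinerary A) :=
  {a | (∃ n, ν.IsPrecritical a n) ∨ (a.StarFree ∧ ∀ w : List A, w ≠ [] → a ≠ prepend w ν)}

/-- The cylinder set `N_k(a)`. -/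
def cylinder {A : Type*} (ν : Itinerary A) (k : ℕ) (a : Itinerary A) : Set (Itinerary A) :=
  {b | b ∈ ν.X ∧ (k : ℕ∞) ≤ diff a b}

/-- The set `∂_k(a)` of precritical points in `N_k(a) \ {a}` of depth at most `k - 1`,
except `ν`. -/
def cylinderBoundary {A : Type*} (ν : Itinerary A) (k : ℕ) (a : Itinerary A) :
    Set (Itinerary A) :=
  {b | b ∈ ν.cylinder k a ∧ b ≠ a ∧ b ≠ ν ∧ ∃ n, n + 1 ≤ k ∧ ν.IsPrecritical b n}

/-- The topology on `X_ν` for non-periodic `ν`, with basis `U_k(a) = N_k(a) \ ∂_k(a)` for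
`a ∈ X_ν` and `k ≥ 1`. (It is written as a topology on all sequences and only used on subsets
of `X_ν`.) -/
@[reducible]
def topologyX {A : Type*} (ν : Itinerary A) : TopologicalSpace (Itinerary A) :=
  TopologicalSpace.generateFrom
    {U | ∃ a ∈ ν.X, ∃ k : ℕ, 1 ≤ k ∧ U = ν.cylinder k a \ ν.cylinderBoundary k a}

/-! ### Precritical points on the critical path -/

/-- The precritical point `w''⋆ν` of depth `k = diff(a, b)` inserted between `a` and `b`: at the
first `k - 1` positions it has the symbol of `a` or of `b`, whichever is not `⋆`. -/
noncomputable def inserted {A : Type*} (ν a b : Itinerary A) : Itinerary A := fun i =>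
  if i + 1 < (diff a b).toNat then (a i).or (b i)
  else if i + 1 = (diff a b).toNat then none
  else ν (i - (diff a b).toNat)

open Classical in
/-- Insert a precritical point between any two adjacent entries `a`, `b` of a list with
`diff(a, b) < ∞`. The second component of an entry is its value under `φ`. -/
noncomputable def refine {A : Type*} (ν : Itinerary A) :
    List (Itinerary A × ℝ) → List (Itinerary A × ℝ)
  | u :: v :: l =>
      if diff u.1 v.1 = ⊤ then u :: refine ν (v :: l)
      else u :: (ν.inserted u.1 v.1, (u.2 + v.2) / 2) :: refine ν (v :: l)
  | l => l

/-- `ν.stage n` is the ordered set `P_{n+1}`, as a list in increasing order, together with the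
values of `φ : P_{n+1} → [0, 1]`. -/
noncomputable def stage {A : Type*} (ν : Itinerary A) : ℕ → List (Itinerary A × ℝ)
  | 0 => [(ν.star, 0), (ν, 1)]
  | n + 1 => ν.refine (ν.stage n)

/-- `u` is an element of `P_∞`, together with its value under `φ`. -/
def InStages {A : Type*} (ν : Itinerary A) (u : Itinerary A × ℝ) : Prop :=
  ∃ n, u ∈ ν.stage n

/-- `u ≺ v` are adjacent in `P_{n+1}`. -/
def Adjacent {A : Type*} (ν : Itinerary A) (n : ℕ) (u v : Itinerary A × ℝ) : Prop :=
  [u, v] <:+: ν.stage n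

/-! ### Limit points and central itineraries -/

/-- `a` is a limit point of `P_∞` whose value `x` under `φ` is not the value of an element
of `P_∞`. -/
def IsInnerLimit {A : Type*} (ν a : Itinerary A) (x : ℝ) : Prop :=
  a ∈ ν.X ∧ a.StarFree ∧ (∀ u, ν.InStages u → u.2 ≠ x) ∧
    ∃ l r : ℕ → Itinerary A × ℝ,
      (∀ n, ν.Adjacent n (l n) (r n) ∧ (l n).2 < x ∧ x < (r n).2) ∧
      Tendsto (fun n => (l n).2) atTop (𝓝 x) ∧ Tendsto (fun n => (r n).2) atTop (𝓝 x) ∧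
      Tendsto (fun n => diff (l n).1 a) atTop (𝓝 ⊤) ∧
      Tendsto (fun n => diff (r n).1 a) atTop (𝓝 ⊤)

/-- `a` is the limit of the right-hand neighbours of `u ∈ P_∞` in `P_n`, as `n → ∞`, and these
neighbours converge to `u` with respect to `φ`. -/
def IsRightLimit {A : Type*} (ν : Itinerary A) (u : Itinerary A × ℝ) (a : Itinerary A) : Prop :=
  a ∈ ν.X ∧ a.StarFree ∧ ∃ y : ℕ → Itinerary A × ℝ,
    (∀ᶠ n in atTop, ν.Adjacent n u (y n)) ∧
    Tendsto (fun n => (y n).2) atTop (𝓝 u.2) ∧ Tendsto (fun n => diff (y n).1 a) atTop (𝓝 ⊤)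

/-- `a` is the limit of the left-hand neighbours of `u ∈ P_∞` in `P_n`, as `n → ∞`, and these
neighbours converge to `u` with respect to `φ`. -/
def IsLeftLimit {A : Type*} (ν : Itinerary A) (u : Itinerary A × ℝ) (a : Itinerary A) : Prop :=
  a ∈ ν.X ∧ a.StarFree ∧ ∃ y : ℕ → Itinerary A × ℝ,
    (∀ᶠ n in atTop, ν.Adjacent n (y n) u) ∧
    Tendsto (fun n => (y n).2) atTop (𝓝 u.2) ∧ Tendsto (fun n => diff (y n).1 a) atTop (𝓝 ⊤)

/-- `c` is the central itinerary in the gap between the adjacent points `u` and `v`. -/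
def IsCentral {A : Type*} (ν : Itinerary A) (u v : Itinerary A × ℝ) (c : Itinerary A) : Prop :=
  (∃ n, ν.Adjacent n u v) ∧ diff u.1 v.1 = ⊤ ∧
    c ∈ ν.X ∧ c.StarFree ∧ diff u.1 c = ⊤ ∧ diff c v.1 = ⊤

end Itinerary

/-! ### The critical path -/

/-- Points are itineraries or interior points of abstract Fatou intervals. The point
`fatou a b t` lies in the interior of the Fatou interval `[b, a]` between a sequence `b` over `A`
(at `t = 0`) and a precritical point `a` (at `t = 1`). -/
inductive TreePoint (A : Type*)
  | itinerary (a : Itinerary A) : TreePoint A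
  | fatou (a b : Itinerary A) (t : Set.Ioo (0 : ℝ) 1) : TreePoint A

/-- `OnPath ν x s`: the point `x` lies on the critical path `C_ν`, at the position `s`. A position
`(y, z)` consists of a value `y` of `φ` and a number `z` that puts the points with that same
value of `φ` in order; positions are ordered lexicographically. An element of `P_∞` with value
`y` is at `(y, 0)`. If `ν` is `⋆`-periodic, then the Fatou interval to the right of it occupies the
positions `(y, z)` with `0 < z < 1`, and the one to the left of it those with `-1 < z < 0`. The other
end of such a Fatou interval is either a limit point, at `(y, 1)` resp. `(y, -1)`, or the central
itinerary in a gap, whose value of `φ` is the midpoint of the gap. -/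
inductive OnPath {A : Type*} (ν : Itinerary A) : TreePoint A → ℝ ×ₗ ℝ → Prop
  | precritical (u : Itinerary A × ℝ) (hu : ν.InStages u) :
      OnPath ν (.itinerary u.1) (toLex (u.2, 0))
  | innerLimit (a : Itinerary A) (y : ℝ) (ha : ν.IsInnerLimit a y) :
      OnPath ν (.itinerary a) (toLex (y, 0))
  | central (u v : Itinerary A × ℝ) (c : Itinerary A) (hc : ν.IsCentral u v c) :
      OnPath ν (.itinerary c) (toLex ((u.2 + v.2) / 2, 0))
  | rightLimit (p : ℕ) (hp : ν.IsStarPeriodic p) (u : Itinerary A × ℝ) (a : Itinerary A)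
      (ha : ν.IsRightLimit u a) :
      OnPath ν (.itinerary a) (toLex (u.2, 1))
  | leftLimit (p : ℕ) (hp : ν.IsStarPeriodic p) (u : Itinerary A × ℝ) (a : Itinerary A)
      (ha : ν.IsLeftLimit u a) :
      OnPath ν (.itinerary a) (toLex (u.2, -1))
  | fatouRight (p : ℕ) (hp : ν.IsStarPeriodic p) (u : Itinerary A × ℝ) (a : Itinerary A)
      (ha : ν.IsRightLimit u a ∨ ∃ v, ν.IsCentral u v a) (t : Set.Ioo (0 : ℝ) 1) :
      OnPath ν (.fatou u.1 a t) (toLex (u.2, 1 - (t : ℝ)))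
  | fatouLeft (p : ℕ) (hp : ν.IsStarPeriodic p) (u : Itinerary A × ℝ) (a : Itinerary A)
      (ha : ν.IsLeftLimit u a ∨ ∃ v, ν.IsCentral v u a) (t : Set.Ioo (0 : ℝ) 1) :
      OnPath ν (.fatou u.1 a t) (toLex (u.2, (t : ℝ) - 1))

/-- The critical path `C_ν`. -/
def CriticalPath {A : Type*} (ν : Itinerary A) : Type _ :=
  {x : TreePoint A // ∃ s, OnPath ν x s}

/-- The order `≺` on the critical path. -/
def CriticalPath.Prec {A : Type*} {ν : Itinerary A} (x y : CriticalPath ν) : Prop :=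
  ∃ s t, OnPath ν x.1 s ∧ OnPath ν y.1 t ∧ s < t

/-- The order topology on the critical path. -/
instance CriticalPath.instTopologicalSpace {A : Type*} (ν : Itinerary A) :
    TopologicalSpace (CriticalPath ν) :=
  TopologicalSpace.generateFrom
    {U | ∃ x : CriticalPath ν, U = {y | y.Prec x} ∨ U = {y | x.Prec y}}

/-! ### The Hubbard tree -/

/-- A choice of the homeomorphisms by which `σ` maps the Fatou intervals `[b, a]` to the Fatou
intervals `[σ(b), σ(a)]`: as these respect the end points, they are given by increasing bijections
of the open unit interval. -/
abbrev FatouMaps (A : Type*) :=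
  Itinerary A → Itinerary A → (Set.Ioo (0 : ℝ) 1 ≃o Set.Ioo (0 : ℝ) 1)

/-- The map `σ` on points. -/
def TreePoint.map {A : Type*} (h : FatouMaps A) : TreePoint A → TreePoint A
  | .itinerary a => .itinerary a.shift
  | .fatou a b t => .fatou a.shift b.shift (h a b t)

/-- The Hubbard tree `H(ν) = ⋃ₙ σⁿ(C_ν)`. -/
def HubbardTree {A : Type*} (ν : Itinerary A) (h : FatouMaps A) : Type _ :=
  {x : TreePoint A // ∃ (n : ℕ) (c : CriticalPath ν), (TreePoint.map h)^[n] c.1 = x}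

namespace HubbardTree

/-- The map `σⁿ : C_ν → H(ν)`. -/
def ofPath {A : Type*} (ν : Itinerary A) (h : FatouMaps A) (n : ℕ) (c : CriticalPath ν) :
    HubbardTree ν h :=
  ⟨(TreePoint.map h)^[n] c.1, n, c, rfl⟩

/-- The itinerary of a point (a dummy value in the interior of Fatou intervals, which do not
occur in the case where this map is used). -/
def itin {A : Type*} {ν : Itinerary A} {h : FatouMaps A} (x : HubbardTree ν h) : Itinerary A :=
  match x.1 with
  | .itinerary a => a
  | .fatou _ b _ => b

open Classical in
/-- The topology of the Hubbard tree: for non-periodic `ν` the subspace topology of `X_ν`, and for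
`⋆`-periodic `ν` of period `p` the topology of `H_{p-1} = ⋃_{k < p} σᵏ(C_ν)`, that is, the quotient
topology with respect to the maps `σᵏ` on `C_ν` for `k < p`. -/
noncomputable instance instTopologicalSpace {A : Type*} (ν : Itinerary A) (h : FatouMaps A) :
    TopologicalSpace (HubbardTree ν h) :=
  if ν.IsNonperiodic then TopologicalSpace.induced itin ν.topologyX
  else ⨆ (p : ℕ) (_ : ν.IsStarPeriodic p) (k : ℕ) (_ : k < p),
    TopologicalSpace.coinduced (ofPath ν h k) inferInstance

/-- The map `σ` on the Hubbard tree. -/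
def σ {A : Type*} {ν : Itinerary A} {h : FatouMaps A} (x : HubbardTree ν h) : HubbardTree ν h :=
  ⟨x.1.map h, by
    obtain ⟨n, c, hc⟩ := x.2
    exact ⟨n + 1, c, by rw [Function.iterate_succ_apply', hc]⟩⟩

/-- The critical point `⋆ν`. -/
noncomputable def criticalPoint {A : Type*} (ν : Itinerary A) (h : FatouMaps A) :
    HubbardTree ν h :=
  ofPath ν h 0 ⟨.itinerary ν.star, _,
    OnPath.precritical (ν.star, 0) ⟨0, by simp [Itinerary.stage]⟩⟩

/-- The critical value `ν`. -/
noncomputable def criticalValue {A : Type*} (ν : Itinerary A) (h : FatouMaps A) :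
    HubbardTree ν h :=
  ofPath ν h 0 ⟨.itinerary ν, _,
    OnPath.precritical (ν, 1) ⟨0, by simp [Itinerary.stage]⟩⟩

/-! ### Arms -/

/-- The global arms (branches) at `x`: the components of `H(ν) \ {x}`. They also serve as labels
for the local arms at `x`. -/
def arms {A : Type*} {ν : Itinerary A} {h : FatouMaps A} (x : HubbardTree ν h) :
    Set (Set (HubbardTree ν h)) :=
  {G | ∃ y, y ≠ x ∧ G = connectedComponentIn {x}ᶜ y}

/-- `x` is an endpoint. -/
def IsEndpoint {A : Type*} {ν : Itinerary A} {h : FatouMaps A} (x : HubbardTree ν h) : Prop :=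
  IsConnected ({x}ᶜ : Set (HubbardTree ν h))

/-- The `σ`-image of the local arm at `x` in the global arm `G` is the local arm at `σ(x)` in the
global arm `G'`: the restriction to `G` of every connected open neighbourhood of `x` that does not
contain the critical point is mapped into `G'`. -/
def MapsArm {A : Type*} {ν : Itinerary A} {h : FatouMaps A} (x : HubbardTree ν h)
    (G G' : Set (HubbardTree ν h)) : Prop :=
  G ∈ arms x ∧ G' ∈ arms (σ x) ∧
    ∀ N : Set (HubbardTree ν h), IsOpen N → IsConnected N → x ∈ N → criticalPoint ν h ∉ N →
      σ '' (N ∩ G) ⊆ G'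

/-- The first return map of the periodic point `x` maps the local arm at `x` in `G` to the local
arm at `x` in `G'`. -/
def ReturnsArm {A : Type*} {ν : Itinerary A} {h : FatouMaps A} (x : HubbardTree ν h)
    (G G' : Set (HubbardTree ν h)) : Prop :=
  ∃ c : ℕ → Set (HubbardTree ν h), c 0 = G ∧ c (Function.minimalPeriod σ x) = G' ∧
    ∀ i < Function.minimalPeriod σ x, MapsArm (σ^[i] x) (c i) (c (i + 1))

/-- The first return map on the local arms of `x` is (well defined and equal to) the
permutation `ρ`. -/
def IsReturnPerm {A : Type*} {ν : Itinerary A} {h : FatouMaps A} (x : HubbardTree ν h)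
    (ρ : Equiv.Perm (arms x)) : Prop :=
  ∀ (G : arms x) (G' : Set (HubbardTree ν h)), ReturnsArm x G G' ↔ (ρ G : Set _) = G'

/-- The forward orbit. -/
def orbit {A : Type*} {ν : Itinerary A} {h : FatouMaps A} (x : HubbardTree ν h) :
    Set (HubbardTree ν h) :=
  {y | ∃ n : ℕ, σ^[n] x = y}

/-- `x` is a characteristic point: a single component of `H(ν) \ {x}` contains the critical point
and all points on the orbit of `x` other than `x`, but not the critical value. -/
def IsCharacteristic {A : Type*} {ν : Itinerary A} {h : FatouMaps A} (x : HubbardTree ν h) :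
    Prop :=
  ∃ G ∈ arms x, criticalPoint ν h ∈ G ∧ (∀ y ∈ orbit x, y ≠ x → y ∈ G) ∧ criticalValue ν h ∉ G

/-! ### Types of periodic orbits -/

/-- The names of the four types. -/
inductive OrbitType
  | endpoints
  | primitive
  | satellite
  | evil

/-- The orbit of the periodic point `τ` has the given type. -/
def HasType {A : Type*} {ν : Itinerary A} {h : FatouMaps A} (τ : HubbardTree ν h) :
    OrbitType → Prop
  | .endpoints => ∀ x ∈ orbit τ, IsEndpoint x
  | .primitive => ∀ x ∈ orbit τ, (arms x).ncard = 2 ∧ IsReturnPerm x 1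
  | .satellite => ∃ k : ℕ, 2 ≤ k ∧ ∀ x ∈ orbit τ, (arms x).ncard = k ∧
      ∃ ρ : Equiv.Perm (arms x), IsReturnPerm x ρ ∧ ρ.IsCycleOn Set.univ
  | .evil => (∃ k : ℕ, 3 ≤ k ∧ ∀ x ∈ orbit τ, (arms x).ncard = k ∧
        ∃ ρ : Equiv.Perm (arms x), IsReturnPerm x ρ ∧ ¬ ∀ G G', ρ.SameCycle G G') ∧
      ∃ x ∈ orbit τ, IsCharacteristic x ∧ (∀ y ∈ orbit τ, IsCharacteristic y → y = x) ∧
        ∃ ρ : Equiv.Perm (arms x), IsReturnPerm x ρ ∧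
          (∀ G : arms x, criticalPoint ν h ∈ (G : Set _) → ρ G = G) ∧
          ρ.IsCycleOn {G : arms x | criticalPoint ν h ∉ (G : Set _)}

end HubbardTree

/-! The whole argument is carried out with itineraries. Let `x` be a sequence without ⋆ and follow
another sequence `a` along it (`track`): while the first symbols agree, both are shifted; when they
differ, the arc from `x` to `a` passes through ⋆ν, its image starts at σ(x) in the direction of ν,
and so `a` is replaced by ν. Two sequences whose tracks along `x` eventually coincide are not
separated by `x` (`Merge`). Hence σ should send the germ at `x` towards `a` to the germ at σ(x)
towards the one-step track of `a`. Since merging can be tested after any number of steps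
(`merge_track_iff`), the induced maps on arms are injective.

The topological half shows that this describes the tree. At a point without ⋆ the classes of `Merge`
are exactly the components of the complement (`connectedComponentIn_eq_side`), and arms are mapped
by tracks (`mapsArm_iff`). Sides are open by `isOpen_side`. They are connected by
`isPreconnected_side`: a piece of a side that is cut off from the rest can only end at the point
itself and is approached there along an image of an interval of the critical path
(`exists_approach`). Such an approach either contains the precritical points at which the track of a
critical orbit point leaves `x`, or part of a Fatou interval ending at `x` (`exists_germ`); both are
determined by the side, so two such pieces intersect. This uses that the critical path is a linear
continuum: a point and its position determine each other, positions are dense and have no holes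
(`OnPath.unique_pos`, `OnPath.unique_point`, `OnPath.exists_between`, `exists_nearest`). It also
uses that inserted points contain ⋆ only in front of a tail ν (`Adjacent.drop_mid_ne`), and, in the
⋆-periodic case, that fewer than p iterates of the critical path cover the tree
(`CriticalPath.exists_lift`).

The dynamical half concerns a periodic orbit without ⋆. If none of its points separates ⋆ν from ν,
the complement of each point is a single side (`merge_of_forall_merge`) and the orbit consists of
endpoints. Otherwise let `y` be the separating orbit point nearest to ν (`exists_nearest_critical`).
All other points of the orbit are on the side of ⋆ν (`merge_star_of_nearest`), so `y` is
characteristic. Every track at `y` is reset to ν at some time; from then on it points at ν or at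
another point of the orbit (`TowardsOrbit`), and at the next visit to `y` it points at ν or at ⋆ν.
So all arms at `y` are led by the return map to the arm of ⋆ν or the arm of ν, and the arm of ⋆ν
goes to one of these two at its first return. By `Function.Injective.exists_perm_of_pair` an
injective map of this kind is a permutation of a finite set which is transitive, or fixes the arm of
⋆ν and is transitive on the others. These alternatives are the satellite case and, with exactly two
or at least three arms, the primitive and the evil case. The permutation is carried to the other
orbit points by conjugation (`exists_returnPerm_iterate`).

A point inside a Fatou interval cuts the tree into the parts `above` and `below`. The chosen maps of
Fatou intervals are increasing and respect the ends, so both arms return to themselves and the orbit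
is primitive. Uniqueness of the type follows by comparing numbers of arms and return permutations
(`HasType.eq`). -/

namespace Itinerary

variable {A : Type*}

/-! ### Shifts, compatibility and proper sequences -/

/-- The sequence without its first `n` symbols. -/
def drop (n : ℕ) (a : Itinerary A) : Itinerary A := fun i => a (i + n)

@[simp] theorem drop_apply (n : ℕ) (a : Itinerary A) (i : ℕ) : drop n a i = a (i + n) := rfl

@[simp] theorem drop_zero (a : Itinerary A) : drop 0 a = a := rfl

theorem drop_drop (m n : ℕ) (a : Itinerary A) : drop m (drop n a) = drop (n + m) a := by
  funext i; simp only [drop_apply]; congr 1; omega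

theorem shift_eq_drop (a : Itinerary A) : a.shift = drop 1 a := rfl

theorem shift_drop (n : ℕ) (a : Itinerary A) : (drop n a).shift = drop (n + 1) a := by
  rw [shift_eq_drop, drop_drop]

@[simp] theorem drop_succ_star (n : ℕ) (a : Itinerary A) : drop (n + 1) a.star = drop n a := rfl

@[simp] theorem shift_star (a : Itinerary A) : a.star.shift = a := rfl

theorem StarFree.drop {a : Itinerary A} (h : a.StarFree) (n : ℕ) : (drop n a).StarFree :=
  fun i => h (i + n)

/-- The sequences have no common position with different symbols of the alphabet. -/
def Compat (a b : Itinerary A) : Prop := ∀ i, a i = none ∨ b i = none ∨ a i = b i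

theorem Compat.drop {a b : Itinerary A} (h : Compat a b) (n : ℕ) : Compat (drop n a) (drop n b) :=
  fun i => h (i + n)

/-- A star occurs exactly in front of the tail `ν`. -/
def Proper (ν a : Itinerary A) : Prop := ∀ i, a i = none ↔ drop (i + 1) a = ν

variable {ν : Itinerary A}

theorem Proper.drop {a : Itinerary A} (h : ν.Proper a) (n : ℕ) : ν.Proper (drop n a) := fun i => by
  rw [drop_drop, drop_apply, h (i + n)]
  have : i + n + 1 = n + (i + 1) := by omega
  rw [this]

theorem Proper.self (h : ν.Proper ν.star) : ν.Proper ν := h.drop 1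

theorem Proper.eq_star {a : Itinerary A} (h : ν.Proper a) (h0 : a 0 = none) : a = ν.star := by
  have := (h 0).1 h0
  funext i
  cases i with
  | zero => exact h0
  | succ i => exact congrFun this i

/-! ### Tracks -/

/-- Follow `a` along the symbol `s`: the shift if `a` begins with `s`, and the critical value
otherwise. -/
noncomputable def step (ν : Itinerary A) (s : Option A) (a : Itinerary A) : Itinerary A :=
  open Classical in if a 0 = s then a.shift else ν

/-- The image of `a` after `n` steps along the sequence `x`. -/
noncomputable def track (ν x : Itinerary A) : ℕ → Itinerary A → Itinerary A
  | 0, a => a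
  | n + 1, a => step ν (x n) (track ν x n a)

@[simp] theorem track_zero (x a : Itinerary A) : track ν x 0 a = a := rfl

theorem track_succ (x a : Itinerary A) (n : ℕ) :
    track ν x (n + 1) a = step ν (x n) (track ν x n a) := rfl

theorem step_of_eq {s : Option A} {a : Itinerary A} (h : a 0 = s) : step ν s a = a.shift := if_pos h

theorem step_of_ne {s : Option A} {a : Itinerary A} (h : a 0 ≠ s) : step ν s a = ν := if_neg h

theorem track_add (x a : Itinerary A) (m n : ℕ) :
    track ν x (m + n) a = track ν (drop m x) n (track ν x m a) := by
  induction n with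
  | zero => rfl
  | succ n ih =>
    rw [← add_assoc, track_succ, track_succ, ih, drop_apply, add_comm n m]

theorem track_congr {x y : Itinerary A} {n : ℕ} (h : ∀ i < n, x i = y i) (a : Itinerary A) :
    track ν x n a = track ν y n a := by
  induction n with
  | zero => rfl
  | succ n ih =>
    rw [track_succ, track_succ, ih fun i hi => h i (by omega), h n (by omega)]

theorem step_star {s : Option A} : step ν s ν.star = ν := by
  by_cases h : ν.star 0 = s
  · rw [step_of_eq h, shift_star]
  · rw [step_of_ne h]

theorem track_one_star (x : Itinerary A) : track ν x 1 ν.star = ν := step_star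

theorem track_mem_of {P : Itinerary A → Prop} (h0 : P ν) (hs : ∀ a, P a → P a.shift)
    {a : Itinerary A} (ha : P a) (x : Itinerary A) (n : ℕ) : P (Itinerary.track ν x n a) := by
  induction n with
  | zero => exact ha
  | succ n ih =>
    rw [track_succ]
    by_cases h : Itinerary.track ν x n a 0 = x n
    · rw [step_of_eq h]; exact hs _ ih
    · rw [step_of_ne h]; exact h0

/-- Along symbols that agree with `a` up to stars, the track of `a` consists of its shifts. -/
theorem track_eq_drop {x a : Itinerary A} {n : ℕ}
    (h : ∀ i < n, a i = x i ∨ (a i = none ∧ drop (i + 1) a = ν)) : track ν x n a = drop n a := by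
  induction n with
  | zero => rfl
  | succ n ih =>
    rw [track_succ, ih fun i hi => h i (by omega)]
    have h0 : drop n a 0 = a n := by simp
    by_cases hn : a n = x n
    · rw [step_of_eq (h0.trans hn), shift_drop]
    · rw [step_of_ne (by rwa [h0])]
      rcases h n (by omega) with h' | h'
      · exact absurd h' hn
      · exact h'.2.symm

theorem Proper.track_eq_drop {x a : Itinerary A} (ha : ν.Proper a) {n : ℕ}
    (h : ∀ i < n, a i = x i ∨ a i = none) : Itinerary.track ν x n a = Itinerary.drop n a :=
  Itinerary.track_eq_drop fun i hi => (h i hi).imp_right fun h' => ⟨h', (ha i).1 h'⟩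

/-! ### Merging: being on the same side -/

/-- The tracks of `a` and `b` along `x` coincide eventually. This means that `a` and `b` are not
separated by `x`. -/
def Merge (ν x a b : Itinerary A) : Prop := ∃ n, track ν x n a = track ν x n b

theorem track_eq_of_le {x a b : Itinerary A} {m n : ℕ} (hmn : m ≤ n)
    (h : track ν x m a = track ν x m b) : track ν x n a = track ν x n b := by
  obtain ⟨k, rfl⟩ := Nat.exists_eq_add_of_le hmn
  rw [track_add, track_add, h]

@[refl] theorem Merge.refl (x a : Itinerary A) : ν.Merge x a a := ⟨0, rfl⟩

@[symm] theorem Merge.symm {x a b : Itinerary A} : ν.Merge x a b → ν.Merge x b a :=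
  fun ⟨n, h⟩ => ⟨n, h.symm⟩

@[trans] theorem Merge.trans {x a b c : Itinerary A} :
    ν.Merge x a b → ν.Merge x b c → ν.Merge x a c := fun ⟨n, h⟩ ⟨m, h'⟩ =>
  ⟨max n m, (track_eq_of_le (le_max_left _ _) h).trans (track_eq_of_le (le_max_right _ _) h')⟩

/-- Equality of tracks persists, so the first `n` steps do not matter. In terms of arms this makes
the maps induced by σ well defined and injective. -/
theorem merge_track_iff {x a b : Itinerary A} (n : ℕ) :
    ν.Merge (drop n x) (track ν x n a) (track ν x n b) ↔ ν.Merge x a b := by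
  constructor
  · rintro ⟨m, h⟩
    exact ⟨n + m, by rwa [track_add, track_add]⟩
  · rintro ⟨m, h⟩
    refine ⟨m, ?_⟩
    rw [← track_add, ← track_add]
    exact track_eq_of_le (by omega) h

/-- Leaving `x` at the same time resets both tracks to ν. -/
theorem merge_of_ne {x a b : Itinerary A} {n : ℕ} (ha : track ν x n a 0 ≠ x n)
    (hb : track ν x n b 0 ≠ x n) : ν.Merge x a b :=
  ⟨n + 1, by rw [track_succ, track_succ, step_of_ne ha, step_of_ne hb]⟩

/-- A track that never leaves `x` consists of the shifts of `a`, and their first symbols spell `x`.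
-/
theorem exists_track_ne {x a : Itinerary A} (h : a ≠ x) : ∃ n, track ν x n a 0 ≠ x n := by
  by_contra! hc
  apply h
  have key : ∀ n, track ν x n a = drop n a := by
    intro n
    induction n with
    | zero => rfl
    | succ n ih => rw [track_succ, step_of_eq (hc n), ih, shift_drop]
  funext n
  have := hc n
  rw [key] at this
  simpa using this

/-- This is the betweenness property of a tree. Up to the first difference of `x` and `y` the tracks
of `a` along both are the same. At that place the track cannot show both symbols, so it leaves `x`
together with `y`, or `y` together with `x`. -/
theorem eq_or_merge_of_drop_eq {x y : Itinerary A} (h : x ≠ y) (a : Itinerary A) :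
    ν.Merge x a y ∨ ν.Merge y a x := by
  classical
  have hex : ∃ n, x n ≠ y n := by
    by_contra! hc
    exact h (funext hc)
  set n := Nat.find hex with hn
  have hlt : ∀ i < n, x i = y i := fun i hi => by
    by_contra hc
    exact Nat.find_min hex hi hc
  have hne : x n ≠ y n := Nat.find_spec hex
  have hy : track ν x n y = drop n y := track_eq_drop fun i hi => Or.inl (hlt i hi).symm
  have hx : track ν y n x = drop n x := track_eq_drop fun i hi => Or.inl (hlt i hi)
  by_cases ha : track ν x n a 0 = x n
  · right
    refine merge_of_ne (n := n) ?_ ?_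
    · rw [← track_congr hlt, ha]; exact hne
    · rw [hx]; simpa using hne
  · left
    refine merge_of_ne (n := n) ha ?_
    rw [hy]; simpa using hne.symm

/-- Along every symbol ⋆ν goes to ν, so a different first symbol of `a` would merge it with ⋆ν at
once. -/
theorem track_one_of_not_merge {x a : Itinerary A} (h : ¬ ν.Merge x a ν.star) :
    track ν x 1 a = drop 1 a ∧ a 0 = x 0 := by
  by_cases h0 : a 0 = x 0
  · exact ⟨step_of_eq h0, h0⟩
  · exact absurd ⟨1, by rw [track_one_star]; exact step_of_ne h0⟩ h

/-- If a point separates another one from ⋆ν, then there is no folding between the two, and the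
image still separates, now from ν. This is the engine of the arguments about orbits. -/
theorem not_merge_succ {x a : Itinerary A} (h : ¬ ν.Merge x a ν.star) :
    ¬ ν.Merge (drop 1 x) (drop 1 a) ν := by
  have := (merge_track_iff (ν := ν) (x := x) (a := a) (b := ν.star) 1).not.2 h
  rwa [(track_one_of_not_merge h).1, track_one_star] at this

/-- A proper sequence compatible with `b ≠ x` is on the same side of `x` as `b`. -/
theorem Proper.merge_of_compat {x a b : Itinerary A} (ha : ν.Proper a) (h : Compat a b)
    (hx : x.StarFree) (hb : b.StarFree) (hbx : b ≠ x) : ν.Merge x a b := by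
  classical
  have hex : ∃ n, b n ≠ x n := by
    by_contra! hc
    exact hbx (funext hc)
  set n := Nat.find hex with hn
  have hlt : ∀ i < n, b i = x i := fun i hi => by
    by_contra hc
    exact Nat.find_min hex hi hc
  have hne : b n ≠ x n := Nat.find_spec hex
  have h1 : Itinerary.track ν x n b = Itinerary.drop n b := Itinerary.track_eq_drop fun i hi => Or.inl (hlt i hi)
  have h2 : Itinerary.track ν x n a = Itinerary.drop n a := ha.track_eq_drop fun i hi => by
    rcases h i with h | h | h
    · exact Or.inr h
    · exact absurd h (hb i)
    · exact Or.inl (h.trans (hlt i hi))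
  refine merge_of_ne (n := n) ?_ ?_
  · rw [h2]
    rcases h n with h | h | h
    · simpa [h] using (hx n).symm
    · exact absurd h (hb n)
    · simpa [h] using hne
  · rw [h1]; simpa using hne

/-! ### The point of an orbit next to the critical value -/

/-- Let no point of the orbit of `y` lie strictly between `y` and `ν`, in the sense that it
separates `⋆ν` from `ν` but not `y` from `ν`. Then the orbit lies on one side of `y`. -/
theorem merge_star_of_nearest {y : Itinerary A}
    (hnear : ∀ r, ¬ ν.Merge (drop r y) ν.star ν → drop r y = y ∨ ν.Merge (drop r y) y ν) (s : ℕ) :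
    drop s y = y ∨ ν.Merge y (drop s y) ν.star := by
  classical
  by_contra! hc
  obtain ⟨hs, hs0⟩ := hc
  -- the last time up to `s` when the orbit is at `y` or separates `⋆ν` from `ν`
  let P : ℕ → Prop := fun r => drop r y = y ∨ ¬ ν.Merge (drop r y) ν.star ν
  have hP0 : P 0 := Or.inl (drop_zero y)
  let r := Nat.findGreatest P s
  have hr : P r := Nat.findGreatest_spec (Nat.zero_le s) hP0
  have hrs : r ≤ s := Nat.findGreatest_le s
  have hbet : ∀ t, r < t → t ≤ s → ν.Merge (drop t y) ν.star ν := fun t h1 h2 => by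
    have := Nat.findGreatest_is_greatest h1 h2
    by_contra h
    exact this (Or.inr h)
  -- the orbit point at time `r` separates `⋆ν` from `y`
  have hyr : drop r y = y ∨ ¬ ν.Merge (drop r y) y ν.star := by
    by_cases h : drop r y = y
    · exact Or.inl h
    · right
      have h' := hr.resolve_left h
      intro hm
      exact h' (hm.symm.trans ((hnear r h').resolve_left h))
  -- Between the times `r` and `s` no orbit point separates ⋆ν from ν, so by `not_merge_succ` the
  -- point at time `r + u` goes on separating the point at time `u` from ⋆ν.
  have hchain : ∀ u, r + u ≤ s → drop (r + u) y = drop u y ∨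
      ¬ ν.Merge (drop (r + u) y) (drop u y) ν.star := by
    intro u
    induction u with
    | zero => intro _; simpa using hyr
    | succ u ih =>
      intro hu
      rcases ih (by omega) with h | h
      · left
        rw [← shift_drop u, ← h, shift_drop]; rfl
      · right
        have := not_merge_succ h
        rw [drop_drop, drop_drop] at this
        intro hm
        exact this (hm.trans (hbet (r + (u + 1)) (by omega) hu))
  -- The point at time `s` separates the one at time `s - r` from ⋆ν, and `y` separates the point at
  -- time `s` from ⋆ν. So `y` also separates the point at time `s - r` from ⋆ν.
  have hi : ¬ ν.Merge y (drop (s - r) y) ν.star ∧ 0 < s - r := by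
    rcases Nat.eq_zero_or_pos (s - r) with h0 | h0
    · have hsr : r = s := by omega
      rw [hsr] at hyr
      have h1 := hyr.resolve_left hs
      rcases eq_or_merge_of_drop_eq (ν := ν) hs ν.star with h | h
      · exact absurd h.symm h1
      · exact absurd h.symm hs0
    · refine ⟨?_, h0⟩
      have h := hchain (s - r) (by omega)
      rw [show r + (s - r) = s by omega] at h
      rcases h with h | h
      · rwa [← h]
      · intro hm
        by_cases hy : drop (s - r) y = y
        · rw [hy] at h
          rcases eq_or_merge_of_drop_eq (ν := ν) hs ν.star with h' | h'
          · exact h h'.symm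
          · exact hs0 h'.symm
        · rcases eq_or_merge_of_drop_eq (ν := ν) hs (drop (s - r) y) with h' | h'
          · rcases eq_or_merge_of_drop_eq (ν := ν) hs ν.star with h2 | h2
            · exact h (h'.trans h2.symm)
            · exact hs0 h2.symm
          · exact hs0 (h'.symm.trans hm)
  have hone : ∀ u, 0 < u → u ≤ s - r → ν.Merge (drop u y) ν.star ν := by
    intro u h0 hu
    have hb := hbet (r + u) (by omega) (by omega)
    rcases hchain u (by omega) with h | h
    · rwa [← h]
    · by_cases he : drop (r + u) y = drop u y
      · rwa [← he]
      have h1 : ν.Merge (drop u y) ν.star (drop (r + u) y) :=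
        (eq_or_merge_of_drop_eq (ν := ν) he ν.star).resolve_left fun h' => h h'.symm
      have h2 : ν.Merge (drop u y) ν (drop (r + u) y) :=
        (eq_or_merge_of_drop_eq (ν := ν) he ν).resolve_left fun h' => h (h'.symm.trans hb.symm)
      exact h1.trans h2.symm
  set i := s - r with hidef
  -- all later times behave in the same way
  have hall : ∀ u, ¬ ν.Merge (drop u y) (drop (u + i) y) ν.star ∧
      (0 < u → ν.Merge (drop u y) ν.star ν) := by
    intro u
    induction u using Nat.strong_induction_on with
    | _ u ih =>
      have hm : 0 < u → ν.Merge (drop u y) ν.star ν := by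
        intro hu
        by_cases hui : u ≤ i
        · exact hone u hu hui
        · have h1 := (ih (u - i) (by omega)).1
          have h2 := (ih (u - i) (by omega)).2 (by omega)
          rw [show u - i + i = u by omega] at h1
          by_cases he : drop (u - i) y = drop u y
          · rwa [← he]
          have h3 : ν.Merge (drop u y) ν.star (drop (u - i) y) :=
            (eq_or_merge_of_drop_eq (ν := ν) he ν.star).resolve_left fun h' => h1 h'.symm
          have h4 : ν.Merge (drop u y) ν (drop (u - i) y) :=
            (eq_or_merge_of_drop_eq (ν := ν) he ν).resolve_left
              fun h' => h1 (h'.symm.trans h2.symm)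
          exact h3.trans h4.symm
      refine ⟨?_, hm⟩
      rcases Nat.eq_zero_or_pos u with rfl | hu
      · simpa using hi.1
      · have h1 := not_merge_succ (ih (u - 1) (by omega)).1
        rw [drop_drop, drop_drop, show u - 1 + 1 = u by omega,
          show u - 1 + i + 1 = u + i by omega] at h1
        intro h
        exact h1 (h.trans (hm hu))
  -- Separation from ⋆ν forces equal first symbols at all times, which makes `y` periodic. Then the
  -- last link of the chain says that the point at time `s` separates `y` from ⋆ν, while `y`
  -- separates that point from ⋆ν; both cannot hold.
  have hyi : drop i y = y := by
    funext u
    have := (track_one_of_not_merge (hall u).1).2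
    simpa [add_comm] using this
  have := hall 0
  simp only [drop_zero, zero_add, hyi] at this
  have h2 := hchain i (by omega)
  rw [show r + i = s by omega, hyi] at h2
  have h3 := h2.resolve_left hs
  rcases eq_or_merge_of_drop_eq (ν := ν) hs ν.star with h | h
  · exact h3 h.symm
  · exact hs0 h.symm

end Itinerary

namespace Itinerary

variable {A : Type*} {ν : Itinerary A}

/-! ### Kneading sequences -/

theorem IsStarPeriodic.add_mul {p : ℕ} (h : ν.IsStarPeriodic p) (i k : ℕ) :
    ν (i + k * p) = ν i := by
  induction k with
  | zero => simp
  | succ k ih => rw [Nat.succ_mul, ← add_assoc, h.2.1, ih]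

theorem IsStarPeriodic.star_eq_none {p : ℕ} (h : ν.IsStarPeriodic p) (n : ℕ) :
    ν.star n = none ↔ p ∣ n := by
  cases n with
  | zero => simp [star]
  | succ n => exact h.2.2 n

theorem IsStarPeriodic.star_add {p : ℕ} (h : ν.IsStarPeriodic p) (n : ℕ) :
    ν.star (n + p) = ν.star n := by
  cases n with
  | zero =>
    rw [(h.star_eq_none 0).2 (dvd_zero p), (h.star_eq_none (0 + p)).2 (by simp)]
  | succ n => rw [show n + 1 + p = n + p + 1 by omega]; exact h.2.1 n

theorem IsStarPeriodic.star_add_mul {p : ℕ} (h : ν.IsStarPeriodic p) (n k : ℕ) :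
    ν.star (n + k * p) = ν.star n := by
  induction k with
  | zero => simp
  | succ k ih => rw [Nat.succ_mul, ← add_assoc, h.star_add, ih]

theorem IsStarPeriodic.drop_star_add_mul {p : ℕ} (h : ν.IsStarPeriodic p) (n k : ℕ) :
    drop (n + k * p) ν.star = drop n ν.star := by
  funext i
  simp only [drop_apply]
  rw [← add_assoc, h.star_add_mul]

theorem IsStarPeriodic.drop_star_of_modEq {p : ℕ} (h : ν.IsStarPeriodic p) {m n : ℕ}
    (hmn : m ≡ n [MOD p]) : drop m ν.star = drop n ν.star := by
  rw [← Nat.mod_add_div m p, ← Nat.mod_add_div n p, mul_comm p, mul_comm p,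
    h.drop_star_add_mul, h.drop_star_add_mul, hmn]

theorem IsStarPeriodic.drop_star_eq_iff {p : ℕ} (h : ν.IsStarPeriodic p) {m n : ℕ} :
    drop m ν.star = drop n ν.star ↔ m ≡ n [MOD p] := by
  refine ⟨fun he => ?_, h.drop_star_of_modEq⟩
  -- The position `m * (p - 1)` completes `m` to a multiple of `p`, so the first sequence has ⋆
  -- there, and hence the second one as well.
  have h1 : p ∣ m * (p - 1) + m := by
    have : m * (p - 1) + m = m * p := by
      obtain ⟨q, rfl⟩ : ∃ q, p = q + 1 := ⟨p - 1, by have := h.1; omega⟩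
      simp [Nat.mul_succ]
    rw [this]; exact dvd_mul_left _ _
  have h2 : p ∣ m * (p - 1) + n := by
    rw [← h.star_eq_none] at h1 ⊢
    have := congrFun he (m * (p - 1))
    simp only [drop_apply] at this
    rw [← this, h1]
  have h3 : (m * (p - 1) + m) ≡ (m * (p - 1) + n) [MOD p] :=
    ((Nat.modEq_zero_iff_dvd.2 h1)).trans (Nat.modEq_zero_iff_dvd.2 h2).symm
  exact Nat.ModEq.add_left_cancel' _ h3

theorem IsNonperiodic.drop_ne (h : ν.IsNonperiodic) {n : ℕ} (hn : 0 < n) : drop n ν ≠ ν :=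
  fun he => h.2 ⟨n, hn, fun i => congrFun he i⟩

theorem IsStarPeriodic.not_isNonperiodic {p : ℕ} (h : ν.IsStarPeriodic p) : ¬ ν.IsNonperiodic :=
  fun h' => h'.1 (p - 1) ((h.2.2 _).2 (by rw [Nat.sub_add_cancel h.1]))

theorem IsKneading.proper_star (h : ν.IsKneading) : ν.Proper ν.star := by
  rcases h with h | ⟨p, hp, h⟩
  · intro i
    cases i with
    | zero => simp [star]
    | succ i =>
      rw [drop_succ_star]
      exact ⟨fun hi => absurd hi (h.1 i), fun hi => absurd hi (h.drop_ne i.succ_pos)⟩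
  · intro i
    have h1 : drop (i + 1) ν.star = ν ↔ drop (i + 1) ν.star = drop (0 + 1) ν.star := Iff.rfl
    rw [h.star_eq_none, h1, h.drop_star_eq_iff, ← Nat.modEq_zero_iff_dvd]
    exact ⟨fun hi => Nat.ModEq.add_right 1 hi, fun hi => Nat.ModEq.add_right_cancel' 1 hi⟩

/-- In ⋆ν the symbol ⋆ occupies a single position, or a single residue class modulo the period. -/
theorem IsKneading.drop_star_eq (h : ν.IsKneading) {i j t : ℕ} (hi : ν.star (i + t) = none)
    (hj : ν.star (j + t) = none) : drop i ν.star = drop j ν.star := by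
  rcases h with h | ⟨p, hp, h⟩
  · have aux : ∀ n, ν.star n = none → n = 0 := fun n hn => by
      cases n with
      | zero => rfl
      | succ n => exact absurd hn (h.1 n)
    have := aux _ hi
    have := aux _ hj
    rw [show i = j by omega]
  · apply h.drop_star_of_modEq
    rw [h.star_eq_none, ← Nat.modEq_zero_iff_dvd] at hi hj
    exact Nat.ModEq.add_right_cancel' t (hi.trans hj.symm)

/-- The excluded sequence ⋆⋆⋆… is the exception: here the period has to be at least 2. -/
theorem IsKneading.star_ne (h : ν.IsKneading) : ν.star ≠ ν := by
  rcases h with h | ⟨p, hp, h⟩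
  · intro he
    exact h.1 0 (congrFun he 0).symm
  · intro he
    have := (congrFun he 0).symm
    rw [star, h.2.2] at this
    have := Nat.le_of_dvd (by omega) this
    omega

/-- The points of the critical orbit. -/
def Crit (ν a : Itinerary A) : Prop := ∃ n, a = drop n ν.star

theorem crit_star : ν.Crit ν.star := ⟨0, rfl⟩

theorem crit_self : ν.Crit ν := ⟨1, rfl⟩

theorem Crit.shift {a : Itinerary A} (h : ν.Crit a) : ν.Crit a.shift := by
  obtain ⟨n, rfl⟩ := h
  exact ⟨n + 1, shift_drop _ _⟩

theorem Crit.drop {a : Itinerary A} (h : ν.Crit a) (n : ℕ) : ν.Crit (drop n a) := by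
  obtain ⟨m, rfl⟩ := h
  exact ⟨m + n, drop_drop _ _ _⟩

theorem Crit.track {a : Itinerary A} (h : ν.Crit a) (x : Itinerary A) (n : ℕ) :
    ν.Crit (track ν x n a) :=
  track_mem_of crit_self (fun _ h => h.shift) h x n

theorem Crit.proper {a : Itinerary A} (h : ν.Crit a) (hν : ν.IsKneading) : ν.Proper a := by
  obtain ⟨n, rfl⟩ := h
  exact hν.proper_star.drop n

theorem Crit.eq_of_none {a b : Itinerary A} (hν : ν.IsKneading) (ha : ν.Crit a) (hb : ν.Crit b)
    {t : ℕ} (hat : a t = none) (hbt : b t = none) : a = b := by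
  obtain ⟨m, rfl⟩ := ha
  obtain ⟨n, rfl⟩ := hb
  rw [drop_apply, add_comm] at hat hbt
  exact hν.drop_star_eq hat hbt

/-- If one of the points starts with ⋆ then its shift is ν, and by properness a point with the same
shift starts with ⋆ as well. Otherwise the first symbols agree. -/
theorem Crit.shift_ne {a b : Itinerary A} (hν : ν.IsKneading) (ha : ν.Crit a) (hb : ν.Crit b)
    (hab : a ≠ b) (h0 : a 0 = none ∨ b 0 = none ∨ a 0 = b 0) : a.shift ≠ b.shift := by
  intro he
  have h1 : ∀ c, c 0 = none → ν.Crit c → c.shift = ν := fun c hc hcc =>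
    ((hcc.proper hν) 0).1 hc
  have h2 : ∀ c, ν.Crit c → c.shift = ν → c 0 = none := fun c hcc hc =>
    ((hcc.proper hν) 0).2 hc
  apply hab
  rcases h0 with h | h | h
  · exact ha.eq_of_none hν hb h (h2 b hb (he ▸ h1 a h ha))
  · exact ha.eq_of_none hν hb (h2 a ha (he ▸ h1 b h hb)) h
  · funext i
    cases i with
    | zero => exact h
    | succ i => exact congrFun he i

theorem Crit.drop_ne {a b : Itinerary A} (hν : ν.IsKneading) (ha : ν.Crit a) (hb : ν.Crit b)
    (hab : a ≠ b) {n : ℕ} (h : ∀ i < n, a i = none ∨ b i = none ∨ a i = b i) :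
    Itinerary.drop n a ≠ Itinerary.drop n b := by
  induction n with
  | zero => simpa
  | succ n ih =>
    rw [← shift_drop, ← shift_drop]
    refine (ha.drop n).shift_ne hν (hb.drop n) (ih fun i hi => h i (by omega)) ?_
    simpa using h n (by omega)

/-! ### The critical value is an endpoint -/

/-- The critical orbit lies on one side of `ν`. -/
theorem drop_self_eq_or_merge (s : ℕ) :
    drop s ν = ν ∨ ν.Merge ν (drop s ν) ν.star :=
  merge_star_of_nearest (fun _ _ => Or.inr (Merge.refl _ _)) s

/-- If a sequence `x` compatible with the critical value does not separate it from the critical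
point, then the critical orbit lies on one side of `x`. -/
theorem IsStarPeriodic.merge {p : ℕ} (h : ν.IsStarPeriodic p) (hν : ν.IsKneading)
    {x : Itinerary A} (hx : x.StarFree) (hνx : Compat ν x) (h0 : ν.Merge x ν.star ν) (a : ℕ) :
    ν.Merge x (drop a ν) ν := by
  classical
  have hP : ν.Proper ν := hν.proper_star.self
  have hxν : ∀ r, drop r x = x ∨ ν.Merge (drop r x) x ν := fun r => by
    by_cases hr : drop r x = x
    · exact Or.inl hr
    · exact Or.inr (hP.merge_of_compat hνx (hx.drop r) hx (Ne.symm hr)).symm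
  -- No orbit point other than `x` separates `x` from ν, because these two are compatible. So `x` is
  -- nearest to ν without any choice.
  have hchar := merge_star_of_nearest (ν := ν) (y := x) fun r _ => hxν r
  have hper : drop (a + p) ν = drop a ν := by
    have := h.drop_star_add_mul (a + 1) 1
    rwa [one_mul, show a + 1 + p = a + p + 1 by omega, drop_succ_star, drop_succ_star] at this
  have hmain : ∀ b, drop b x ≠ x → ν.Merge x (drop b ν) ν := fun b hb =>
    ((hP.drop b).merge_of_compat (hνx.drop b) hx (hx.drop b) hb).trans
      (((hchar b).resolve_left hb).trans h0)
  by_cases hax : drop a x = x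
  swap
  · exact hmain a hax
  -- now `x` is periodic
  rcases Nat.eq_zero_or_pos a with rfl | ha
  · rfl
  -- Starting from the last separating time `r ≤ a`, the point at time `r + i` keeps separating the
  -- point at time `i` from ⋆ν. At `r + i = a` it is `x` itself, so `hchar` gives `drop (a - r) x =
  -- x`; hence the point at time `r` is also `x`, which does not separate ⋆ν from ν.
  have hall : ∀ r, ν.Merge (drop r x) ν.star ν := by
    by_contra! hc
    obtain ⟨r', hr'⟩ := hc
    have hmul : ∀ k, drop (k * a) x = x := fun k => by
      induction k with
      | zero => simp
      | succ k ih => rw [Nat.succ_mul, ← drop_drop, ih, hax]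
    have hmod : ∀ r, drop (r % a) x = drop r x := fun r => by
      conv_rhs => rw [← Nat.mod_add_div r a, mul_comm, add_comm, ← drop_drop, hmul]
    let P : ℕ → Prop := fun r => ¬ ν.Merge (drop r x) ν.star ν
    have hex : ∃ r, r ≤ a ∧ P r := ⟨r' % a, (Nat.mod_lt _ ha).le, by
      simp only [P]; rwa [hmod]⟩
    obtain ⟨r0, hr0, hPr0⟩ := hex
    let r := Nat.findGreatest P a
    have hr : P r := Nat.findGreatest_spec hr0 hPr0
    have hra : r ≤ a := Nat.findGreatest_le a
    have hlt : ∀ t, r < t → t ≤ a → ν.Merge (drop t x) ν.star ν := fun t h1 h2 => by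
      by_contra hc
      exact Nat.findGreatest_is_greatest h1 h2 hc
    have hrx : drop r x ≠ x := fun he => by
      simp only [P] at hr
      rw [he] at hr
      exact hr h0
    have hchain : ∀ i, r + i ≤ a → ¬ ν.Merge (drop (r + i) x) (drop i x) ν.star := by
      intro i
      induction i with
      | zero =>
        intro _ hm
        rw [add_zero, drop_zero] at hm
        exact hr (hm.symm.trans ((hxν r).resolve_left hrx))
      | succ i ih =>
        intro hi hm
        have := not_merge_succ (ih (by omega))
        rw [drop_drop, drop_drop] at this
        exact this (hm.trans (hlt _ (by omega) hi))
    have h1 := hchain (a - r) (by omega)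
    rw [show r + (a - r) = a by omega, hax] at h1
    have h2 := (hchar (a - r)).resolve_right h1
    apply hrx
    calc drop r x = drop r (drop (a - r) x) := by rw [h2]
      _ = drop a x := by rw [drop_drop, Nat.sub_add_cancel hra]
      _ = x := hax
  -- Consequently the track of ⋆ν stays on the side of ⋆ν for ever. At time `a` the tracks of ⋆ν and
  -- ν are still on the same side of `x`, and the latter is `drop a ν`.
  have htr : ∀ n, ν.Merge (drop n x) (track ν x n ν.star) ν.star := fun n => by
    induction n with
    | zero => rfl
    | succ n ih =>
      have := (merge_track_iff 1).2 ih
      rw [drop_drop, track_one_star, ← track_congr (x := drop n x) (y := drop n x)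
        (fun _ _ => rfl), ← track_add] at this
      exact this.trans (hall (n + 1)).symm
  have h1 := (merge_track_iff a).2 h0
  rw [hax] at h1
  have h2 := htr a
  rw [hax] at h2
  have h3 : track ν x a ν = drop a ν := hP.track_eq_drop fun i _ => by
    rcases hνx i with h | h | h
    · exact Or.inr h
    · exact absurd h (hx i)
    · exact Or.inl h
  rw [h3] at h1
  exact h1.symm.trans (h2.trans h0)

/-- A track that has left `x` restarts at ν and does not show ⋆ again before another `p - 1` steps.
So a track showing ⋆ at time `p - 1` has never left, and `a` has its ⋆ at the same place as ν. -/
theorem Crit.eq_of_track_eq_none {p : ℕ} (h : ν.IsStarPeriodic p) (hν : ν.IsKneading)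
    {x a : Itinerary A} (ha : ν.Crit a)
    (hn : Itinerary.track ν x (p - 1) a 0 = none) : a = ν := by
  classical
  by_cases hex : ∃ t, t < p - 1 ∧ Itinerary.track ν x t a 0 ≠ x t
  · exfalso
    let P : ℕ → Prop := fun t => t < p - 1 ∧ Itinerary.track ν x t a 0 ≠ x t
    obtain ⟨t0, ht0⟩ := hex
    let t := Nat.findGreatest P (p - 1)
    have ht : P t := Nat.findGreatest_spec (P := P) (n := p - 1) ht0.1.le ht0
    have hgt : ∀ u, t < u → u < p - 1 → Itinerary.track ν x u a 0 = x u := fun u h1 h2 => by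
      by_contra hc
      exact Nat.findGreatest_is_greatest h1 h2.le ⟨h2, hc⟩
    have hdrop : ∀ u, t + 1 + u ≤ p - 1 →
        Itinerary.track ν x (t + 1 + u) a = Itinerary.drop u ν := fun u => by
      induction u with
      | zero => intro _; rw [add_zero, track_succ, step_of_ne ht.2, drop_zero]
      | succ u ih =>
        intro hu
        have h1 := hgt (t + 1 + u) (by omega) (by omega)
        rw [← add_assoc, track_succ, step_of_eq h1, ih (by omega), shift_drop]
    have := ht.1
    have h1 := hdrop (p - 1 - (t + 1)) (by omega)
    rw [show t + 1 + (p - 1 - (t + 1)) = p - 1 by omega] at h1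
    rw [h1, drop_apply, h.2.2] at hn
    have := Nat.le_of_dvd (by omega) hn
    omega
  · push Not at hex
    have h1 : ∀ t, t ≤ p - 1 → Itinerary.track ν x t a = Itinerary.drop t a := fun t => by
      induction t with
      | zero => intro _; rfl
      | succ t ih =>
        intro ht
        rw [track_succ, step_of_eq (hex t (by omega)), ih (by omega), shift_drop]
    rw [h1 _ le_rfl, drop_apply, zero_add] at hn
    refine ha.eq_of_none hν crit_self hn ((h.2.2 _).2 ?_)
    rw [Nat.sub_add_cancel h.1]

/-- All points of the critical orbit except `ν` are behind the same boundary point of the Fatou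
component of `ν`. -/
theorem Crit.track_pred_eq_star {p : ℕ} (h : ν.IsStarPeriodic p) (hν : ν.IsKneading)
    {x a : Itinerary A} (hxν : ∀ i, i + 1 < p → x i = ν i) (ha : ν.Crit a)
    (haν : a ≠ ν) :
    Itinerary.track ν x (p - 1) a 0 = Itinerary.track ν x (p - 1) ν.star 0 := by
  classical
  by_contra hne
  have hp := h.1
  -- the labels of the iterates of `a`
  let z : ℕ → Itinerary A := fun j => (fun b => (Itinerary.track ν x (p - 1) b).shift)^[j] a
  have hz0 : z 0 = a := rfl
  have hzs : ∀ j, z (j + 1) = (Itinerary.track ν x (p - 1) (z j)).shift := fun j =>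
    Function.iterate_succ_apply' _ _ _
  have hz : ∀ j, ν.Crit (z j) ∧ z j ≠ ν := fun j => by
    induction j with
    | zero => exact ⟨ha, haν⟩
    | succ j ih =>
      have h1 := ih.1.track x (p - 1)
      refine ⟨by rw [hzs]; exact h1.shift, fun hc => ih.2 ?_⟩
      rw [hzs] at hc
      exact ih.1.eq_of_track_eq_none h hν (((h1.proper hν) 0).2 hc)
  -- Each ⋆ of ν is replaced by the symbol shown there by the current iterate `z`. Thus the track of
  -- `a` does not leave `y` at the ends of the periods and runs through all `z j`, while the track
  -- of ν returns to ν after each period.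
  let y : Itinerary A := fun i =>
    if p ∣ i + 1 then Itinerary.track ν x (p - 1) (z (i / p)) 0 else ν i
  have hyνi : ∀ i, ¬ p ∣ i + 1 → y i = ν i := fun i hi => if_neg hi
  have hy : y.StarFree := fun i => by
    by_cases hi : p ∣ i + 1
    · simp only [y, if_pos hi]
      exact fun hc => (hz _).2 ((hz _).1.eq_of_track_eq_none h hν hc)
    · rw [hyνi i hi, Ne, h.2.2]; exact hi
  have hyν : Compat ν y := fun i => by
    by_cases hi : p ∣ i + 1
    · exact Or.inl ((h.2.2 i).2 hi)
    · exact Or.inr (Or.inr (hyνi i hi).symm)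
  have hagree : ∀ j, ∀ i < p - 1, Itinerary.drop (j * p) y i = x i := fun j i hi => by
    have : ¬ p ∣ i + j * p + 1 := by
      rw [show i + j * p + 1 = i + 1 + j * p by ring, Nat.dvd_add_left (dvd_mul_left p j)]
      exact Nat.not_dvd_of_pos_of_lt (by omega) (by omega)
    rw [drop_apply, hyνi _ this, h.add_mul, hxν i (by omega)]
  have hlabel : ∀ j, Itinerary.drop (j * p) y (p - 1) = Itinerary.track ν x (p - 1) (z j) 0 := fun j => by
    have h1 : p ∣ p - 1 + j * p + 1 := by
      rw [show p - 1 + j * p + 1 = p + j * p by omega]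
      exact dvd_add dvd_rfl (dvd_mul_left p j)
    have h2 : (p - 1 + j * p) / p = j := by
      rw [Nat.add_mul_div_right _ _ hp, Nat.div_eq_of_lt (by omega), zero_add]
    rw [drop_apply]; simp only [y, if_pos h1, h2]
  have htr : ∀ j b, Itinerary.track ν (Itinerary.drop (j * p) y) p b =
      step ν (Itinerary.track ν x (p - 1) (z j) 0) (Itinerary.track ν x (p - 1) b) :=
    fun j b => by
      have h1 : Itinerary.track ν (Itinerary.drop (j * p) y) p b =
          Itinerary.track ν (Itinerary.drop (j * p) y) (p - 1 + 1) b := by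
        rw [Nat.sub_add_cancel h.1]
      rw [h1, track_succ, track_congr (hagree j), hlabel]
  have htz : ∀ j, Itinerary.track ν y (j * p) a = z j := fun j => by
    induction j with
    | zero => simp [hz0]
    | succ j ih => rw [Nat.succ_mul, track_add, ih, htr, step_of_eq rfl, hzs]
  have hnu : ∀ j, Itinerary.track ν y (j * p) ν = ν := fun j => by
    rw [hν.proper_star.self.track_eq_drop fun i _ => ?_]
    · have := h.drop_star_add_mul 1 j
      rwa [add_comm, drop_succ_star] at this
    · rcases hyν i with h | h | h
      · exact Or.inr h
      · exact absurd h (hy i)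
      · exact Or.inl h
  -- By assumption ⋆ν shows another symbol than `a` at time `p - 1`, so it leaves `y` there and
  -- becomes ν. Then the whole critical orbit is on one side of `y`, and some `z n` would have to be
  -- ν.
  have h0 : ν.Merge y ν.star ν := by
    refine ⟨p, ?_⟩
    have h1 := htr 0 ν.star
    have h2 := hnu 1
    rw [zero_mul, drop_zero] at h1
    rw [one_mul] at h2
    rw [h1, h2, hz0]
    exact step_of_ne (Ne.symm hne)
  obtain ⟨n, hn⟩ : ν.Merge y a ν := by
    obtain ⟨m, rfl⟩ := ha
    cases m with
    | zero => exact h0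
    | succ m => exact h.merge hν hy hyν h0 m
  have := Itinerary.track_eq_of_le (show n ≤ n * p from Nat.le_mul_of_pos_right n hp) hn
  rw [htz, hnu] at this
  exact (hz n).2 this

end Itinerary

namespace Itinerary

variable {A : Type*} {ν : Itinerary A}

/-! ### The first difference -/

/-- The sequences do not have different symbols of the alphabet at position `i`. -/
def Agree (a b : Itinerary A) (i : ℕ) : Prop := a i = none ∨ b i = none ∨ a i = b i

theorem Agree.symm {a b : Itinerary A} {i : ℕ} (h : Agree a b i) : Agree b a i := by
  rcases h with h | h | h
  · exact Or.inr (Or.inl h)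
  · exact Or.inl h
  · exact Or.inr (Or.inr h.symm)

theorem not_agree_iff {a b : Itinerary A} {i : ℕ} :
    ¬ Agree a b i ↔ ∃ s t : A, a i = some s ∧ b i = some t ∧ s ≠ t := by
  unfold Agree
  rcases ha : a i with _ | s <;> rcases hb : b i with _ | t <;> simp

/-- The number `diff` counts positions from 1, whereas entries are numbered from 0. -/
theorem le_diff_iff {a b : Itinerary A} {n : ℕ} :
    (n : ℕ∞) ≤ diff a b ↔ ∀ i, i + 1 < n → Agree a b i := by
  unfold diff
  rw [le_iInf₂_iff]
  constructor
  · intro h i hi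
    by_contra hc
    have := h i (not_agree_iff.1 hc)
    have : n ≤ i + 1 := by exact_mod_cast this
    omega
  · intro h i hi
    by_contra hc
    have : ¬ n ≤ i + 1 := fun h' => hc (by exact_mod_cast h')
    exact not_agree_iff.2 hi (h i (by omega))

theorem diff_eq_top_iff {a b : Itinerary A} : diff a b = ⊤ ↔ Compat a b := by
  rw [ENat.eq_top_iff_forall_ge]
  constructor
  · intro h i
    exact le_diff_iff.1 (h (i + 2)) i (by omega)
  · intro h m
    exact le_diff_iff.2 fun i _ => h i

/-- The first difference is at position `k`. -/
def Split (a b : Itinerary A) (k : ℕ) : Prop :=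
  (∀ i < k, Agree a b i) ∧ ¬ Agree a b k

theorem Split.symm {a b : Itinerary A} {k : ℕ} (h : Split a b k) : Split b a k :=
  ⟨fun i hi => (h.1 i hi).symm, fun hc => h.2 hc.symm⟩

theorem Split.diff_eq {a b : Itinerary A} {k : ℕ} (h : Split a b k) :
    diff a b = ((k + 1 : ℕ) : ℕ∞) := by
  apply le_antisymm
  · by_contra hc
    have : ((k + 2 : ℕ) : ℕ∞) ≤ diff a b := by
      have := Order.add_one_le_of_lt (not_le.1 hc)
      exact_mod_cast this
    exact h.2 (le_diff_iff.1 this k (by omega))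
  · exact le_diff_iff.2 fun i hi => h.1 i (by omega)

theorem Split.diff_ne_top {a b : Itinerary A} {k : ℕ} (h : Split a b k) : diff a b ≠ ⊤ := by
  rw [h.diff_eq]; exact ENat.natCast_ne_top _

theorem exists_split {a b : Itinerary A} (h : diff a b ≠ ⊤) : ∃ k, Split a b k := by
  classical
  rw [Ne, diff_eq_top_iff] at h
  unfold Compat at h
  push Not at h
  have hex : ∃ k, ¬ Agree a b k := by
    obtain ⟨i, h1, h2, h3⟩ := h
    exact ⟨i, by rintro (h | h | h) <;> contradiction⟩
  refine ⟨Nat.find hex, fun i hi => ?_, Nat.find_spec hex⟩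
  by_contra hc
  exact Nat.find_min hex hi hc

theorem Split.ne {a b : Itinerary A} {k : ℕ} (h : Split a b k) :
    a k ≠ none ∧ b k ≠ none ∧ a k ≠ b k := by
  refine ⟨fun hc => h.2 (Or.inl hc), fun hc => h.2 (Or.inr (Or.inl hc)), fun hc =>
    h.2 (Or.inr (Or.inr hc))⟩

/-- `m` is the precritical point inserted between `a` and `b`, which differ at position `k`. -/
structure IsMid (ν a b : Itinerary A) (k : ℕ) (m : Itinerary A) : Prop where
  split : Split a b k
  lt : ∀ i < k, m i ≠ none ∧ (a i = m i ∨ a i = none) ∧ (b i = m i ∨ b i = none)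
  eq : m k = none
  drop : drop (k + 1) m = ν

theorem IsMid.symm {a b m : Itinerary A} {k : ℕ} (h : ν.IsMid a b k m) : ν.IsMid b a k m :=
  ⟨h.1.symm, fun i hi => ⟨(h.2 i hi).1, (h.2 i hi).2.2, (h.2 i hi).2.1⟩, h.3, h.4⟩

theorem isMid_inserted {a b : Itinerary A} {k : ℕ} (h : Split a b k)
    (hs : ∀ i, ¬ (a i = none ∧ b i = none)) : ν.IsMid a b k (ν.inserted a b) := by
  have hk : (diff a b).toNat = k + 1 := by rw [h.diff_eq]; rfl
  refine ⟨h, fun i hi => ?_, ?_, ?_⟩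
  · have h1 : ν.inserted a b i = (a i).or (b i) := by
      unfold inserted; rw [hk, if_pos (by omega)]
    rw [h1]
    have h2 := hs i
    have h3 := h.1 i hi
    unfold Agree at h3
    rcases ha : a i with _ | s <;> rcases hb : b i with _ | t <;> simp_all
  · unfold inserted
    rw [hk, if_neg (by omega), if_pos rfl]
  · funext i
    rw [drop_apply]
    unfold inserted
    rw [hk, if_neg (by omega), if_neg (by omega), Nat.add_sub_cancel]

/-! ### Reduced pairs -/

/-- After `N` steps the pair `a`, `b` becomes a pair of different points of the critical orbit,
and before it has no difference and no common star. -/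
structure Reduces (ν a b : Itinerary A) (N : ℕ) : Prop where
  left : ν.Crit (drop N a)
  right : ν.Crit (drop N b)
  ne : drop N a ≠ drop N b
  lt : ∀ i < N, Agree a b i ∧ ¬ (a i = none ∧ b i = none)

theorem Reduces.symm {a b : Itinerary A} {N : ℕ} (h : ν.Reduces a b N) : ν.Reduces b a N :=
  ⟨h.2, h.1, h.3.symm, fun i hi => ⟨(h.4 i hi).1.symm, fun hc => (h.4 i hi).2 hc.symm⟩⟩

theorem Reduces.not_none {a b : Itinerary A} {N : ℕ} (hν : ν.IsKneading) (h : ν.Reduces a b N)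
    (i : ℕ) : ¬ (a i = none ∧ b i = none) := by
  rcases lt_or_ge i N with hi | hi
  · exact (h.lt i hi).2
  · rintro ⟨h1, h2⟩
    obtain ⟨j, rfl⟩ := Nat.exists_eq_add_of_le hi
    rw [add_comm] at h1 h2
    exact h.ne (h.left.eq_of_none hν h.right (t := j) h1 h2)

theorem Reduces.le {a b : Itinerary A} {N k : ℕ} (h : ν.Reduces a b N) (hk : Split a b k) :
    N ≤ k := by
  by_contra hc
  exact hk.2 (h.lt k (by omega)).1

/-- After position `k` the inserted point continues with ν. The tail of `a` from position `k` on is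
a critical orbit point that does not start with ⋆, so by properness its shift is not ν. -/
theorem Reduces.child {a b m : Itinerary A} {N k : ℕ} (hν : ν.IsKneading) (h : ν.Reduces a b N)
    (hm : ν.IsMid a b k m) : ν.Reduces a m (k + 1) := by
  have hNk := h.le hm.split
  have hcr : ν.Crit (drop k a) := by
    obtain ⟨j, rfl⟩ := Nat.exists_eq_add_of_le hNk
    rw [← drop_drop]
    exact h.left.drop j
  refine ⟨?_, ?_, ?_, ?_⟩
  · rw [← shift_drop]; exact hcr.shift
  · rw [hm.drop]; exact crit_self
  · rw [hm.drop]
    intro hc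
    have := ((hcr.proper hν) 0).2 (by rw [drop_drop]; exact hc)
    exact hm.split.ne.1 (by simpa using this)
  · intro i hi
    rcases Nat.lt_succ_iff_lt_or_eq.1 hi with hi | rfl
    · have := hm.lt i hi
      refine ⟨?_, fun hc => this.1 hc.2⟩
      rcases this.2.1 with h | h
      · exact Or.inr (Or.inr h)
      · exact Or.inl h
    · exact ⟨Or.inr (Or.inl hm.eq), fun hc => hm.split.ne.1 hc.1⟩

theorem reduces_root (hν : ν.IsKneading) : ν.Reduces ν.star ν 0 :=
  ⟨crit_star, crit_self, by simpa using hν.star_ne, fun i hi => absurd hi (by omega)⟩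

/-! ### Fitting sequences -/

/-- Up to position `B` and as long as `a` and `b` do not differ, they agree with `x` up to
stars. -/
def FitsTo (x a b : Itinerary A) (B : ℕ) : Prop :=
  ∀ i < B, (∀ j ≤ i, Agree a b j) → (a i = x i ∨ a i = none) ∧ (b i = x i ∨ b i = none)

/-- The sequence `x` runs between `a` and `b` as far as these do not differ. -/
def Fits (x a b : Itinerary A) : Prop := ∀ B, FitsTo x a b B

theorem FitsTo.symm {x a b : Itinerary A} {B : ℕ} (h : FitsTo x a b B) : FitsTo x b a B :=
  fun i hi hj => (h i hi fun j hj' => (hj j hj').symm).symm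

theorem Fits.symm {x a b : Itinerary A} (h : Fits x a b) : Fits x b a := fun B => (h B).symm

/-- Before the position where `a` and `b` differ, the inserted point has only symbols of the
alphabet. There it coincides with `x`, and both ends coincide with it up to ⋆. -/
theorem FitsTo.of_child {x a b m : Itinerary A} {B k N : ℕ} (hν : ν.IsKneading)
    (hr : ν.Reduces a b N) (hm : ν.IsMid a b k m) (h : FitsTo x a m B) : FitsTo x a b B := by
  intro i hi hj
  have hik : i < k := by
    by_contra hc
    exact hm.split.2 (hj k (by omega))
  have hr' := hr.child hν hm
  obtain ⟨h1, h2⟩ := h i hi fun j hj => (hr'.lt j (by omega)).1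
  have h3 := hm.lt i hik
  have h4 : m i = x i := h2.resolve_right h3.1
  rw [h4] at h3
  exact h3.2

theorem Fits.of_child {x a b m : Itinerary A} {k N : ℕ} (hν : ν.IsKneading)
    (hr : ν.Reduces a b N) (hm : ν.IsMid a b k m) (h : Fits x a m) : Fits x a b :=
  fun B => (h B).of_child hν hr hm

/-- If `x` fits the left half then it agrees with the left end where the ends differ. -/
theorem Fits.eq_of_child {x a b m : Itinerary A} {k N : ℕ} (hν : ν.IsKneading)
    (hr : ν.Reduces a b N) (hm : ν.IsMid a b k m) (h : Fits x a m) : a k = x k :=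
  ((h (k + 1) k (by omega) fun j hj => ((hr.child hν hm).lt j (by omega)).1).1).resolve_right
    hm.split.ne.1

/-- The pair `a`, `b` reduces after `N` steps, fits `x` up to there, and is reduced to the tracks of
`s` and `t` along `x`. -/
structure Runs (ν x s t a b : Itinerary A) (N : ℕ) : Prop where
  reduces : ν.Reduces a b N
  fits : ∀ i < N, (a i = x i ∨ a i = none) ∧ (b i = x i ∨ b i = none)
  left : track ν x N s = drop N a
  right : track ν x N t = drop N b

theorem Runs.symm {x s t a b : Itinerary A} {N : ℕ} (h : ν.Runs x s t a b N) :
    ν.Runs x t s b a N :=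
  ⟨h.1.symm, fun i hi => (h.2 i hi).symm, h.4, h.3⟩

theorem runs_root (hν : ν.IsKneading) (x : Itinerary A) : ν.Runs x ν.star ν ν.star ν 0 :=
  ⟨reduces_root hν, fun i hi => absurd hi (by omega), rfl, rfl⟩

theorem Runs.track_left {x s t a b : Itinerary A} {N j : ℕ} (hν : ν.IsKneading)
    (h : ν.Runs x s t a b N) (hj : N ≤ j)
    (hf : ∀ i, N ≤ i → i < j → a i = x i ∨ a i = none) :
    track ν x j s = drop j a := by
  obtain ⟨l, rfl⟩ := Nat.exists_eq_add_of_le hj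
  rw [track_add, h.left, (h.reduces.left.proper hν).track_eq_drop, drop_drop]
  intro i hi
  have := hf (i + N) (by omega) (by omega)
  simpa using this

/-- At time `k` the track of `s` stays with `x` and is shifted; the track of `t` leaves `x` and
becomes ν, which is also the tail of the inserted point. -/
theorem Runs.child {x s t a b m : Itinerary A} {k N : ℕ} (hν : ν.IsKneading)
    (h : ν.Runs x s t a b N) (hm : ν.IsMid a b k m) (hf : Fits x a b) (hk : a k = x k) :
    ν.Runs x s t a m (k + 1) := by
  have hNk := h.reduces.le hm.split
  have hfit : ∀ i < k, (a i = x i ∨ a i = none) ∧ (b i = x i ∨ b i = none) := fun i hi =>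
    hf k i hi fun j hj => hm.split.1 j (by omega)
  have hl : track ν x k s = drop k a := h.track_left hν hNk fun i _ hi => (hfit i hi).1
  have hr : track ν x k t = drop k b := h.symm.track_left hν hNk fun i _ hi => (hfit i hi).2
  refine ⟨h.reduces.child hν hm, fun i hi => ?_, ?_, ?_⟩
  · rcases Nat.lt_succ_iff_lt_or_eq.1 hi with hi | rfl
    · refine ⟨(hfit i hi).1, Or.inl ?_⟩
      have h1 := hfit i hi
      have h2 := hm.lt i hi
      have h3 := h.reduces.not_none hν i
      rcases h1.1 with h4 | h4
      · rcases h2.2.1 with h5 | h5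
        · rw [← h5, h4]
        · rcases h2.2.2 with h6 | h6
          · rcases h1.2 with h7 | h7
            · rw [← h6, h7]
            · exact absurd ⟨h5, h7⟩ h3
          · exact absurd ⟨h5, h6⟩ h3
      · rcases h2.2.2 with h6 | h6
        · rcases h1.2 with h7 | h7
          · rw [← h6, h7]
          · exact absurd ⟨h4, h7⟩ h3
        · exact absurd ⟨h4, h6⟩ h3
    · exact ⟨Or.inl hk, Or.inr hm.eq⟩
  · rw [track_succ, hl, step_of_eq (by simpa using hk), shift_drop]
  · rw [track_succ, hr, step_of_ne (by simpa [← hk] using hm.split.ne.2.2.symm), hm.drop]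

/-- If `x` separates `s` and `t` then it runs between `a` and `b` as far as possible. -/
theorem Runs.fits_of_not_merge {x s t a b : Itinerary A} {N : ℕ} (hν : ν.IsKneading)
    (hx : x.StarFree) (h : ν.Runs x s t a b N) (hst : ¬ ν.Merge x s t) : Fits x a b := by
  have key : ∀ i, (∀ j ≤ i, Agree a b j) → ∀ j ≤ i,
      (a j = x j ∨ a j = none) ∧ (b j = x j ∨ b j = none) := by
    intro i
    induction i using Nat.strong_induction_on with
    | _ i ih =>
      intro hi j hj
      rcases lt_or_eq_of_le hj with hj | rfl
      · exact ih j hj (fun l hl => hi l (by omega)) j le_rfl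
      rcases lt_or_ge j N with hjN | hjN
      · exact h.fits j hjN
      have hpre : ∀ l < j, (a l = x l ∨ a l = none) ∧ (b l = x l ∨ b l = none) := fun l hl =>
        ih l hl (fun l' hl' => hi l' (by omega)) l le_rfl
      have h1 := h.track_left hν hjN fun l _ hl => (hpre l hl).1
      have h2 := h.symm.track_left hν hjN fun l _ hl => (hpre l hl).2
      have h3 : a j = x j ∨ b j = x j := by
        by_contra! hc
        exact hst (merge_of_ne (n := j) (by rw [h1]; simpa using hc.1)
          (by rw [h2]; simpa using hc.2))
      rcases h3 with h3 | h3
      · refine ⟨Or.inl h3, ?_⟩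
        rcases hi j le_rfl with h4 | h4 | h4
        · exact absurd (h3.symm.trans h4) (hx j)
        · exact Or.inr h4
        · exact Or.inl (h4.symm.trans h3)
      · refine ⟨?_, Or.inl h3⟩
        rcases hi j le_rfl with h4 | h4 | h4
        · exact Or.inr h4
        · exact absurd (h3.symm.trans h4) (hx j)
        · exact Or.inl (h4.trans h3)
  exact fun B i _ hi => key i hi i le_rfl

/-! ### The stages -/

/-- The entry inserted between two adjacent entries. -/
noncomputable def mid (ν : Itinerary A) (u v : Itinerary A × ℝ) : Itinerary A × ℝ :=
  (ν.inserted u.1 v.1, (u.2 + v.2) / 2)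

theorem refine_cons (u : Itinerary A × ℝ) (l : List (Itinerary A × ℝ)) :
    ∃ l', ν.refine (u :: l) = u :: l' := by
  cases l with
  | nil => exact ⟨_, by rw [refine]; simp⟩
  | cons v l =>
    by_cases h : diff u.1 v.1 = ⊤
    · exact ⟨_, by rw [refine, if_pos h]⟩
    · exact ⟨_, by rw [refine, if_neg h]⟩

theorem pair_infix_cons {α : Type*} {u v w : α} {l : List α} :
    [u, v] <:+: w :: l ↔ (u = w ∧ ∃ l', l = v :: l') ∨ [u, v] <:+: l := by
  rw [List.infix_cons_iff]
  constructor
  · rintro (h | h)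
    · left
      obtain ⟨t, ht⟩ := h
      simp only [List.cons_append, List.nil_append, List.cons.injEq] at ht
      exact ⟨ht.1, t, ht.2.symm⟩
    · exact Or.inr h
  · rintro (⟨rfl, l', rfl⟩ | h)
    · exact Or.inl ⟨l', rfl⟩
    · exact Or.inr h

/-- The pair `u`, `v` arises from the adjacent pair `u'`, `v'` in the next stage. -/
def IsChild (ν : Itinerary A) (u' v' u v : Itinerary A × ℝ) : Prop :=
  (diff u'.1 v'.1 = ⊤ ∧ u = u' ∧ v = v') ∨
    (diff u'.1 v'.1 ≠ ⊤ ∧ ((u = u' ∧ v = ν.mid u' v') ∨ (u = ν.mid u' v' ∧ v = v')))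

theorem pair_infix_refine {u v : Itinerary A × ℝ} {l : List (Itinerary A × ℝ)} :
    [u, v] <:+: ν.refine l ↔ ∃ u' v', [u', v'] <:+: l ∧ ν.IsChild u' v' u v := by
  induction l with
  | nil => simp [refine]
  | cons a l ih =>
    cases l with
    | nil =>
      rw [refine]
      · simp [pair_infix_cons]
      · simp
    | cons b l =>
      obtain ⟨l', hl'⟩ := refine_cons (ν := ν) b l
      have hex : (∃ u' v', [u', v'] <:+: a :: b :: l ∧ ν.IsChild u' v' u v) ↔
          ν.IsChild a b u v ∨ ∃ u' v', [u', v'] <:+: b :: l ∧ ν.IsChild u' v' u v := by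
        constructor
        · rintro ⟨u', v', h1, h2⟩
          rcases pair_infix_cons.1 h1 with ⟨rfl, l', h⟩ | h
          · simp only [List.cons.injEq] at h
            rw [← h.1] at h2
            exact Or.inl h2
          · exact Or.inr ⟨u', v', h, h2⟩
        · rintro (h | ⟨u', v', h1, h2⟩)
          · exact ⟨a, b, pair_infix_cons.2 (Or.inl ⟨rfl, l, rfl⟩), h⟩
          · exact ⟨u', v', pair_infix_cons.2 (Or.inr h1), h2⟩
      rw [hex, ← ih]
      by_cases h : diff a.1 b.1 = ⊤
      · rw [refine, if_pos h, hl', pair_infix_cons, IsChild]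
        simp only [h, List.cons.injEq, exists_and_left, exists_eq', and_true, true_and, ne_eq,
          not_true_eq_false, false_and, or_false]
        rw [eq_comm (a := b)]
      · rw [refine, if_neg h, hl', pair_infix_cons, pair_infix_cons, IsChild]
        simp only [h, List.cons.injEq, exists_and_left, exists_eq', and_true, false_and, ne_eq,
          not_false_eq_true, true_and, false_or, mid]
        rw [eq_comm (b := v), eq_comm (a := b), or_assoc]

theorem adjacent_succ {n : ℕ} {u v : Itinerary A × ℝ} :
    ν.Adjacent (n + 1) u v ↔ ∃ u' v', ν.Adjacent n u' v' ∧ ν.IsChild u' v' u v :=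
  pair_infix_refine

theorem adjacent_zero {u v : Itinerary A × ℝ} :
    ν.Adjacent 0 u v ↔ u = (ν.star, 0) ∧ v = (ν, 1) := by
  have h : ∀ l : Itinerary A × ℝ, ¬ [u, v] <:+: [l] := fun l hl => by
    have := hl.length_le
    simp at this
  unfold Adjacent stage
  rw [pair_infix_cons]
  constructor
  · rintro (⟨rfl, l', h'⟩ | h')
    · simp only [List.cons.injEq] at h'
      exact ⟨rfl, h'.1.symm⟩
    · exact absurd h' (h _)
  · rintro ⟨rfl, rfl⟩
    exact Or.inl ⟨rfl, [], rfl⟩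

theorem refine_isChain {l : List (Itinerary A × ℝ)} (h : l.IsChain fun u v => u.2 < v.2) :
    (ν.refine l).IsChain fun u v => u.2 < v.2 := by
  induction l with
  | nil => simp [refine]
  | cons a l ih =>
    cases l with
    | nil =>
      rw [refine]
      · exact List.isChain_singleton _
      · simp
    | cons b l =>
      obtain ⟨l', hl'⟩ := refine_cons (ν := ν) b l
      rw [List.isChain_cons_cons] at h
      have ih := ih h.2
      by_cases hd : diff a.1 b.1 = ⊤
      · rw [refine, if_pos hd, hl', List.isChain_cons_cons, ← hl']
        exact ⟨h.1, ih⟩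
      · rw [refine, if_neg hd, hl', List.isChain_cons_cons, List.isChain_cons_cons, ← hl']
        exact ⟨by simp only; linarith [h.1], by simp only; linarith [h.1], ih⟩

theorem stage_pairwise (n : ℕ) : (ν.stage n).Pairwise fun u v => u.2 < v.2 := by
  have : IsTrans (Itinerary A × ℝ) fun u v => u.2 < v.2 := ⟨fun _ _ _ h h' => lt_trans h h'⟩
  rw [← List.isChain_iff_pairwise]
  induction n with
  | zero => simp [stage]
  | succ n ih => exact refine_isChain ih

theorem subset_refine (l : List (Itinerary A × ℝ)) : l ⊆ ν.refine l := by
  induction l with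
  | nil => simp
  | cons a l ih =>
    cases l with
    | nil => rw [refine] <;> simp
    | cons b l =>
      by_cases hd : diff a.1 b.1 = ⊤
      · rw [refine, if_pos hd]
        exact List.cons_subset_cons a ih
      · rw [refine, if_neg hd]
        exact List.cons_subset_cons a fun _ hu => List.mem_cons_of_mem _ (ih hu)

theorem stage_subset {m n : ℕ} (h : m ≤ n) : ν.stage m ⊆ ν.stage n := by
  induction n, h using Nat.le_induction with
  | base => exact fun _ h => h
  | succ n _ ih => exact fun _ hu => subset_refine _ (ih hu)

theorem Adjacent.mem_left {n : ℕ} {u v : Itinerary A × ℝ} (h : ν.Adjacent n u v) :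
    u ∈ ν.stage n := h.subset (by simp)

theorem Adjacent.mem_right {n : ℕ} {u v : Itinerary A × ℝ} (h : ν.Adjacent n u v) :
    v ∈ ν.stage n := h.subset (by simp)

theorem Adjacent.lt {n : ℕ} {u v : Itinerary A × ℝ} (h : ν.Adjacent n u v) : u.2 < v.2 := by
  have := (stage_pairwise (ν := ν) n).sublist h.sublist
  simpa using this

/-- There is no element of the stage between adjacent elements. -/
theorem Adjacent.sep {n : ℕ} {u v w : Itinerary A × ℝ} (h : ν.Adjacent n u v)
    (hw : w ∈ ν.stage n) : (w = u ∨ w.2 < u.2) ∨ (w = v ∨ v.2 < w.2) := by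
  obtain ⟨s, t, hst⟩ := h
  have hp := stage_pairwise (ν := ν) n
  rw [← hst] at hw hp
  rw [List.pairwise_append, List.pairwise_append] at hp
  simp only [List.mem_append, List.mem_cons, List.not_mem_nil, or_false] at hw hp
  rcases hw with (h | h | h) | h
  · exact Or.inl (Or.inr (hp.1.2.2 w h u (Or.inl rfl)))
  · exact Or.inl (Or.inl h)
  · exact Or.inr (Or.inl h)
  · exact Or.inr (Or.inr (hp.2.2 v (Or.inr (Or.inr rfl)) w h))

theorem exists_neighbour {α : Type*} {l : List α} {u w : α} (hu : u ∈ l) (hw : w ∈ l)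
    (h : u ≠ w) : ∃ v, [u, v] <:+: l ∨ [v, u] <:+: l := by
  obtain ⟨s, t, rfl⟩ := List.append_of_mem hu
  cases t with
  | cons v t => exact ⟨v, Or.inl ⟨s, t, by simp⟩⟩
  | nil =>
    rcases List.eq_nil_or_concat s with rfl | ⟨s, v, rfl⟩
    · simp only [List.nil_append, List.mem_singleton] at hw
      exact absurd hw.symm h
    · exact ⟨v, Or.inr ⟨s, [], by simp⟩⟩

theorem star_mem_stage (n : ℕ) : (ν.star, (0 : ℝ)) ∈ ν.stage n :=
  stage_subset n.zero_le (by simp [stage])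

theorem self_mem_stage (n : ℕ) : (ν, (1 : ℝ)) ∈ ν.stage n :=
  stage_subset n.zero_le (by simp [stage])

theorem mem_stage_iff {n : ℕ} {u : Itinerary A × ℝ} :
    u ∈ ν.stage n ↔ ∃ v, ν.Adjacent n u v ∨ ν.Adjacent n v u := by
  constructor
  · intro hu
    by_cases h : u = (ν.star, 0)
    · exact exists_neighbour hu (self_mem_stage n) (by rw [h]; simp)
    · exact exists_neighbour hu (star_mem_stage n) h
  · rintro ⟨v, h | h⟩
    · exact h.mem_left
    · exact h.mem_right

theorem eq_of_mem_stage {n : ℕ} {u v : Itinerary A × ℝ} (hu : u ∈ ν.stage n)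
    (hv : v ∈ ν.stage n) (h : u.2 = v.2) : u = v := by
  obtain ⟨w, hw | hw⟩ := mem_stage_iff.1 hu
  · have := hw.lt
    rcases hw.sep hv with (h' | h') | (h' | h')
    · exact h'.symm
    · linarith
    · rw [h'] at h; linarith
    · linarith
  · have := hw.lt
    rcases hw.sep hv with (h' | h') | (h' | h')
    · rw [h'] at h; linarith
    · linarith
    · exact h'.symm
    · linarith

theorem InStages.eq_of_snd_eq {u v : Itinerary A × ℝ} (hu : ν.InStages u) (hv : ν.InStages v)
    (h : u.2 = v.2) : u = v := by
  obtain ⟨m, hm⟩ := hu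
  obtain ⟨n, hn⟩ := hv
  exact eq_of_mem_stage (stage_subset (le_max_left m n) hm) (stage_subset (le_max_right m n) hn) h

theorem InStages.mem_Icc {u : Itinerary A × ℝ} (hu : ν.InStages u) : u.2 ∈ Icc (0 : ℝ) 1 := by
  obtain ⟨n, hn⟩ := hu
  induction n generalizing u with
  | zero =>
    simp only [stage, List.mem_cons, List.not_mem_nil, or_false] at hn
    rcases hn with rfl | rfl <;> simp
  | succ n ih =>
    have key : ∀ u v, ν.Adjacent (n + 1) u v → u.2 ∈ Icc (0 : ℝ) 1 ∧ v.2 ∈ Icc (0 : ℝ) 1 := by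
      intro u v h
      obtain ⟨u', v', h1, h2⟩ := adjacent_succ.1 h
      have hu := ih h1.mem_left
      have hv := ih h1.mem_right
      have hm : (ν.mid u' v').2 ∈ Icc (0 : ℝ) 1 := by
        simp only [mid]
        constructor <;> linarith [hu.1, hu.2, hv.1, hv.2]
      rcases h2 with ⟨_, rfl, rfl⟩ | ⟨_, ⟨rfl, rfl⟩ | ⟨rfl, rfl⟩⟩
      exacts [⟨hu, hv⟩, ⟨hu, hm⟩, ⟨hm, hv⟩]
    obtain ⟨v, h | h⟩ := mem_stage_iff.1 hn
    · exact (key _ _ h).1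
    · exact (key _ _ h).2

/-! ### Invariants of adjacent pairs -/

/-- What a pair of adjacent entries looks like one stage before. -/
theorem Adjacent.cases {n : ℕ} {u v : Itinerary A × ℝ} (h : ν.Adjacent (n + 1) u v) :
    (ν.Adjacent n u v ∧ Compat u.1 v.1) ∨
    (∃ w k, ν.Adjacent n u w ∧ Split u.1 w.1 k ∧ v = ν.mid u w) ∨
    (∃ w k, ν.Adjacent n w v ∧ Split w.1 v.1 k ∧ u = ν.mid w v) := by
  obtain ⟨u', v', h1, ⟨h2, rfl, rfl⟩ | ⟨h2, ⟨rfl, rfl⟩ | ⟨rfl, rfl⟩⟩⟩ := adjacent_succ.1 h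
  · exact Or.inl ⟨h1, diff_eq_top_iff.1 h2⟩
  · obtain ⟨k, hk⟩ := exists_split h2
    exact Or.inr (Or.inl ⟨_, k, h1, hk, rfl⟩)
  · obtain ⟨k, hk⟩ := exists_split h2
    exact Or.inr (Or.inr ⟨_, k, h1, hk, rfl⟩)

theorem Adjacent.succ_of_compat {n : ℕ} {u v : Itinerary A × ℝ} (h : ν.Adjacent n u v)
    (hc : Compat u.1 v.1) : ν.Adjacent (n + 1) u v :=
  adjacent_succ.2 ⟨u, v, h, Or.inl ⟨diff_eq_top_iff.2 hc, rfl, rfl⟩⟩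

theorem Adjacent.of_compat {m n : ℕ} (hmn : m ≤ n) {u v : Itinerary A × ℝ}
    (h : ν.Adjacent m u v) (hc : Compat u.1 v.1) : ν.Adjacent n u v := by
  induction n, hmn using Nat.le_induction with
  | base => exact h
  | succ n _ ih => exact ih.succ_of_compat hc

theorem Adjacent.succ_left {n k : ℕ} {u v : Itinerary A × ℝ} (h : ν.Adjacent n u v)
    (hk : Split u.1 v.1 k) : ν.Adjacent (n + 1) u (ν.mid u v) :=
  adjacent_succ.2 ⟨u, v, h, Or.inr ⟨hk.diff_ne_top, Or.inl ⟨rfl, rfl⟩⟩⟩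

theorem Adjacent.succ_right {n k : ℕ} {u v : Itinerary A × ℝ} (h : ν.Adjacent n u v)
    (hk : Split u.1 v.1 k) : ν.Adjacent (n + 1) (ν.mid u v) v :=
  adjacent_succ.2 ⟨u, v, h, Or.inr ⟨hk.diff_ne_top, Or.inr ⟨rfl, rfl⟩⟩⟩

theorem Reduces.isMid {u v : Itinerary A × ℝ} {N k : ℕ} (hν : ν.IsKneading)
    (h : ν.Reduces u.1 v.1 N) (hk : Split u.1 v.1 k) : ν.IsMid u.1 v.1 k (ν.mid u v).1 :=
  isMid_inserted hk (h.not_none hν)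

/-- A subdivision at position `k ≥ N` replaces `N` by `k + 1`, so `N` grows by at least one in each
stage. Only a gap escapes this bound, because it is not subdivided any more. -/
theorem Adjacent.exists_reduces (hν : ν.IsKneading) {n : ℕ} {u v : Itinerary A × ℝ}
    (h : ν.Adjacent n u v) : ∃ N, ν.Reduces u.1 v.1 N ∧ (n ≤ N ∨ Compat u.1 v.1) := by
  induction n generalizing u v with
  | zero =>
    obtain ⟨rfl, rfl⟩ := adjacent_zero.1 h
    exact ⟨0, reduces_root hν, Or.inl le_rfl⟩
  | succ n ih =>
    have hle : ∀ {a b : Itinerary A} {N k : ℕ}, ν.Reduces a b N → (n ≤ N ∨ Compat a b) →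
        Split a b k → n + 1 ≤ k + 1 := by
      intro a b N k hr hn hk
      rcases hn with hn | hn
      · have := hr.le hk; omega
      · exact absurd (hn k) hk.2
    rcases h.cases with ⟨h1, h2⟩ | ⟨w, k, h1, h2, rfl⟩ | ⟨w, k, h1, h2, rfl⟩
    · obtain ⟨N, hN, _⟩ := ih h1
      exact ⟨N, hN, Or.inr h2⟩
    · obtain ⟨N, hN, hn⟩ := ih h1
      exact ⟨k + 1, hN.child hν (hN.isMid hν h2), Or.inl (hle hN hn h2)⟩
    · obtain ⟨N, hN, hn⟩ := ih h1
      exact ⟨k + 1, (hN.symm.child hν (hN.isMid hν h2).symm).symm, Or.inl (hle hN hn h2)⟩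

theorem Adjacent.not_none (hν : ν.IsKneading) {n : ℕ} {u v : Itinerary A × ℝ}
    (h : ν.Adjacent n u v) (i : ℕ) : ¬ (u.1 i = none ∧ v.1 i = none) := by
  obtain ⟨N, hN, _⟩ := h.exists_reduces hν
  exact hN.not_none hν i

theorem Adjacent.agree (hν : ν.IsKneading) {n : ℕ} {u v : Itinerary A × ℝ}
    (h : ν.Adjacent n u v) {i : ℕ} (hi : i < n) : Agree u.1 v.1 i := by
  obtain ⟨N, hN, h' | h'⟩ := h.exists_reduces hν
  · exact (hN.lt i (by omega)).1
  · exact h' i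

theorem Adjacent.isMid (hν : ν.IsKneading) {n k : ℕ} {u v : Itinerary A × ℝ}
    (h : ν.Adjacent n u v) (hk : Split u.1 v.1 k) : ν.IsMid u.1 v.1 k (ν.mid u v).1 := by
  obtain ⟨N, hN, _⟩ := h.exists_reduces hν
  exact hN.isMid hν hk

/-- A fitting pair is contained in a fitting pair of an earlier stage. -/
theorem Adjacent.exists_fitsTo (hν : ν.IsKneading) {m n B : ℕ} (hmn : m ≤ n)
    {x : Itinerary A} {u v : Itinerary A × ℝ} (h : ν.Adjacent n u v) (hf : FitsTo x u.1 v.1 B) :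
    ∃ u' v', ν.Adjacent m u' v' ∧ FitsTo x u'.1 v'.1 B ∧ u'.2 ≤ u.2 ∧ v.2 ≤ v'.2 := by
  induction n, hmn using Nat.le_induction generalizing u v with
  | base => exact ⟨u, v, h, hf, le_rfl, le_rfl⟩
  | succ n _ ih =>
    rcases h.cases with ⟨h1, h2⟩ | ⟨w, k, h1, h2, rfl⟩ | ⟨w, k, h1, h2, rfl⟩
    · exact ih h1 hf
    · obtain ⟨N, hN, _⟩ := h1.exists_reduces hν
      obtain ⟨u', v', h3, h4, h5, h6⟩ := ih h1 (hf.of_child hν hN (h1.isMid hν h2))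
      exact ⟨u', v', h3, h4, h5, le_trans (by simp only [mid]; linarith [h1.lt]) h6⟩
    · obtain ⟨N, hN, _⟩ := h1.exists_reduces hν
      obtain ⟨u', v', h3, h4, h5, h6⟩ := ih h1
        (hf.symm.of_child hν hN.symm (h1.isMid hν h2).symm).symm
      exact ⟨u', v', h3, h4, le_trans h5 (by simp only [mid]; linarith [h1.lt]), h6⟩

/-- This ties the construction of the critical path to merging: the tails of the two bounds of a
cell are the tracks of ⋆ν and ν along any sequence that fits the cell. -/
theorem Adjacent.exists_runs (hν : ν.IsKneading) {n : ℕ} {x : Itinerary A}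
    {u v : Itinerary A × ℝ} (h : ν.Adjacent n u v)
    (hf : Fits x u.1 v.1) :
    ∃ N, ν.Runs x ν.star ν u.1 v.1 N ∧ (n ≤ N ∨ Compat u.1 v.1) := by
  induction n generalizing u v with
  | zero =>
    obtain ⟨rfl, rfl⟩ := adjacent_zero.1 h
    exact ⟨0, runs_root hν x, Or.inl le_rfl⟩
  | succ n ih =>
    have hle : ∀ {a b : Itinerary A} {N k : ℕ}, ν.Reduces a b N → (n ≤ N ∨ Compat a b) →
        Split a b k → n + 1 ≤ k + 1 := by
      intro a b N k hr hn hk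
      rcases hn with hn | hn
      · have := hr.le hk; omega
      · exact absurd (hn k) hk.2
    rcases h.cases with ⟨h1, h2⟩ | ⟨w, k, h1, h2, rfl⟩ | ⟨w, k, h1, h2, rfl⟩
    · obtain ⟨N, hN, _⟩ := ih h1 hf
      exact ⟨N, hN, Or.inr h2⟩
    · have hm := h1.isMid hν h2
      obtain ⟨N, hN, _⟩ := h1.exists_reduces hν
      have hf' := hf.of_child hν hN hm
      obtain ⟨N', hN', hn⟩ := ih h1 hf'
      exact ⟨k + 1, hN'.child hν hm hf' (hf.eq_of_child hν hN hm),
        Or.inl (hle hN'.reduces hn h2)⟩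
    · have hm := (h1.isMid hν h2).symm
      obtain ⟨N, hN, _⟩ := h1.exists_reduces hν
      have hf' := hf.symm.of_child hν hN.symm hm
      obtain ⟨N', hN', hn⟩ := ih h1 hf'.symm
      exact ⟨k + 1, (hN'.symm.child hν hm hf' (hf.symm.eq_of_child hν hN.symm hm)).symm,
        Or.inl (hle hN'.reduces hn h2)⟩

/-- Only one pair of adjacent entries in a stage fits a given sequence. -/
theorem Adjacent.eq_of_fits (hν : ν.IsKneading) {n : ℕ} {x : Itinerary A}
    {u v u' v' : Itinerary A × ℝ} (h : ν.Adjacent n u v) (h' : ν.Adjacent n u' v')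
    (hf : Fits x u.1 v.1) (hf' : Fits x u'.1 v'.1) : u = u' ∧ v = v' := by
  induction n generalizing u v u' v' with
  | zero =>
    obtain ⟨rfl, rfl⟩ := adjacent_zero.1 h
    obtain ⟨rfl, rfl⟩ := adjacent_zero.1 h'
    exact ⟨rfl, rfl⟩
  | succ n ih =>
    -- the pair one stage before, and the sides
    have key : ∀ {u v : Itinerary A × ℝ}, ν.Adjacent (n + 1) u v → Fits x u.1 v.1 →
        ∃ a b, ν.Adjacent n a b ∧ Fits x a.1 b.1 ∧ ((Compat a.1 b.1 ∧ u = a ∧ v = b) ∨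
          (∃ k, Split a.1 b.1 k ∧ a.1 k = x k ∧ u = a ∧ v = ν.mid a b) ∨
          (∃ k, Split a.1 b.1 k ∧ b.1 k = x k ∧ u = ν.mid a b ∧ v = b)) := by
      intro u v h hf
      rcases h.cases with ⟨h1, h2⟩ | ⟨w, k, h1, h2, rfl⟩ | ⟨w, k, h1, h2, rfl⟩
      · exact ⟨u, v, h1, hf, Or.inl ⟨h2, rfl, rfl⟩⟩
      · have hm := h1.isMid hν h2
        obtain ⟨N, hN, _⟩ := h1.exists_reduces hν
        exact ⟨u, w, h1, hf.of_child hν hN hm,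
          Or.inr (Or.inl ⟨k, h2, hf.eq_of_child hν hN hm, rfl, rfl⟩)⟩
      · have hm := (h1.isMid hν h2).symm
        obtain ⟨N, hN, _⟩ := h1.exists_reduces hν
        exact ⟨w, v, h1, (hf.symm.of_child hν hN.symm hm).symm,
          Or.inr (Or.inr ⟨k, h2, hf.symm.eq_of_child hν hN.symm hm, rfl, rfl⟩)⟩
    have huniq : ∀ {a b : Itinerary A} {k l : ℕ}, Split a b k → Split a b l → k = l := by
      intro a b k l h1 h2
      rcases lt_trichotomy k l with h | h | h
      · exact absurd (h2.1 k h) h1.2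
      · exact h
      · exact absurd (h1.1 l h) h2.2
    obtain ⟨a, b, h1, h2, h3⟩ := key h hf
    obtain ⟨a', b', h1', h2', h3'⟩ := key h' hf'
    obtain ⟨rfl, rfl⟩ := ih h1 h1' h2 h2'
    rcases h3 with ⟨h4, rfl, rfl⟩ | ⟨k, h4, h5, rfl, rfl⟩ | ⟨k, h4, h5, rfl, rfl⟩ <;>
    rcases h3' with ⟨h4', h6, h7⟩ | ⟨k', h4', h5', h6, h7⟩ | ⟨k', h4', h5', h6, h7⟩
    · exact ⟨h6.symm, h7.symm⟩
    · exact absurd (h4 k') h4'.2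
    · exact absurd (h4 k') h4'.2
    · exact absurd (h4' k) h4.2
    · exact ⟨h6.symm, h7.symm⟩
    · obtain rfl := huniq h4 h4'
      exact absurd (h5.trans h5'.symm) h4.ne.2.2
    · exact absurd (h4' k) h4.2
    · obtain rfl := huniq h4 h4'
      exact absurd (h5'.trans h5.symm) h4.ne.2.2
    · exact ⟨h6.symm, h7.symm⟩

/-- A sequence that separates `⋆ν` and `ν` fits a pair of adjacent entries in each stage. -/
theorem exists_adjacent_fits (hν : ν.IsKneading) {x : Itinerary A} (hx : x.StarFree)
    (hs : ¬ ν.Merge x ν.star ν) (n : ℕ) :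
    ∃ u v, ν.Adjacent n u v ∧ Fits x u.1 v.1 ∧ ∃ N, ν.Runs x ν.star ν u.1 v.1 N := by
  induction n with
  | zero => exact ⟨_, _, adjacent_zero.2 ⟨rfl, rfl⟩,
      (runs_root hν x).fits_of_not_merge hν hx hs, 0, runs_root hν x⟩
  | succ n ih =>
    obtain ⟨u, v, h, hf, N, hN⟩ := ih
    by_cases hc : diff u.1 v.1 = ⊤
    · exact ⟨u, v, h.succ_of_compat (diff_eq_top_iff.1 hc), hf, N, hN⟩
    obtain ⟨k, hk⟩ := exists_split hc
    have hm := h.isMid hν hk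
    have hNk := hN.reduces.le hk
    have hfit : ∀ i < k, (u.1 i = x i ∨ u.1 i = none) ∧ (v.1 i = x i ∨ v.1 i = none) :=
      fun i hi => hf k i hi fun j hj => hk.1 j (by omega)
    have hl := hN.track_left hν hNk fun i _ hi => (hfit i hi).1
    have hr := hN.symm.track_left hν hNk fun i _ hi => (hfit i hi).2
    by_cases hu : u.1 k = x k
    · have hr' := hN.child hν hm hf hu
      exact ⟨_, _, h.succ_left hk, hr'.fits_of_not_merge hν hx hs, k + 1, hr'⟩
    · have hv : v.1 k = x k := by
        by_contra hv
        exact hs (merge_of_ne (n := k) (by rw [hl]; simpa using hu) (by rw [hr]; simpa using hv))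
      have hr' := hN.symm.child hν hm.symm hf.symm hv
      exact ⟨_, _, h.succ_right hk, (hr'.fits_of_not_merge hν hx fun h => hs h.symm).symm, k + 1,
        hr'.symm⟩

end Itinerary

namespace Itinerary

variable {A : Type*} {ν : Itinerary A}

/-! ### The inserted points are proper -/

theorem IsMid.fits {a b m : Itinerary A} {k : ℕ} (h : ν.IsMid a b k m) : Fits m a b := by
  intro B i _ hi
  have : i < k := by
    by_contra hc
    exact h.split.2 (hi k (by omega))
  exact (h.lt i this).2

/-- For non-periodic ν a tail ν contains no ⋆, but there is one at position `k`. For ⋆-periodic ν,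
such a tail would send the tracks of ⋆ν and ν along one period of ν; by `Crit.track_pred_eq_star`
both show the same symbol at its end, whereas the bounds differ at `k`. -/
theorem Adjacent.drop_mid_ne (hν : ν.IsKneading) {n k c : ℕ} {u v : Itinerary A × ℝ}
    (h : ν.Adjacent n u v) (hk : Split u.1 v.1 k) (hc : c ≤ k) : drop c (ν.mid u v).1 ≠ ν := by
  have hm := h.isMid hν hk
  set m := (ν.mid u v).1
  intro he
  have h0 : ν (k - c) = none := by
    rw [← he, drop_apply, Nat.sub_add_cancel hc, hm.eq]
  have hP := hν.proper_star.self
  rcases id hν with hn | ⟨p, hp, hs⟩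
  · exact hn.1 _ h0
  obtain ⟨q, hq⟩ := (hs.2.2 _).1 h0
  obtain ⟨q, rfl⟩ : ∃ q', q = q' + 1 := ⟨q - 1, by
    rcases q with _ | q
    · omega
    · rfl⟩
  rw [mul_add, mul_one] at hq
  -- This is the start of the period of the tail ν that ends at position `k`.
  set c' := c + q * p with hc'
  have hqp : p * q = q * p := mul_comm _ _
  have hk' : k = c' + (p - 1) := by omega
  have he' : drop c' m = ν := by
    rw [hc', ← drop_drop, he]
    have := hs.drop_star_add_mul 1 q
    rwa [add_comm, drop_succ_star] at this
  obtain ⟨N, hN, -⟩ := h.exists_runs hν hm.fits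
  have hNk := hN.reduces.le hk
  have hl := hN.track_left hν hNk fun i _ hi => (hm.lt i hi).2.1
  have hr := hN.symm.track_left hν hNk fun i _ hi => (hm.lt i hi).2.2
  rw [hk', track_add, ← hk', he'] at hl hr
  have hl0 := congrFun hl 0
  have hr0 := congrFun hr 0
  rw [drop_apply, zero_add] at hl0 hr0
  have key : ∀ e : Itinerary A, track ν ν (p - 1) e 0 ≠ none → e ≠ ν := by
    rintro e he rfl
    apply he
    rw [track_eq_drop fun i _ => Or.inl rfl, drop_apply, zero_add, hs.2.2, Nat.sub_add_cancel hs.1]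
  have h1 := (crit_star.track m c').track_pred_eq_star hs hν (x := ν) (fun _ _ => rfl)
    (key _ (by rw [hl0]; exact hk.ne.1))
  have h2 := (crit_self.track m c').track_pred_eq_star hs hν (x := ν) (fun _ _ => rfl)
    (key _ (by rw [hr0]; exact hk.ne.2.1))
  exact hk.ne.2.2 (by rw [← hl0, ← hr0, h1, h2])

theorem IsMid.proper {a b m : Itinerary A} {k : ℕ} (hν : ν.IsKneading) (hm : ν.IsMid a b k m)
    (hne : ∀ c ≤ k, Itinerary.drop c m ≠ ν) : ν.Proper m := by
  intro i
  rcases lt_trichotomy i k with hi | rfl | hi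
  · exact ⟨fun h => absurd h (hm.lt i hi).1, fun h => absurd h (hne _ hi)⟩
  · exact ⟨fun _ => hm.drop, fun _ => hm.eq⟩
  · obtain ⟨j, rfl⟩ := Nat.exists_eq_add_of_lt hi
    have h1 : m (k + j + 1) = ν j := by
      rw [← hm.drop, drop_apply]; congr 1; omega
    have h2 : Itinerary.drop (k + j + 1 + 1) m = Itinerary.drop (j + 1) ν := by
      conv_rhs => rw [← hm.drop, drop_drop]
      congr 1; omega
    rw [h1, h2]
    exact hν.proper_star.self j

theorem mem_stage_succ {n : ℕ} {u : Itinerary A × ℝ} (h : u ∈ ν.stage (n + 1)) :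
    u ∈ ν.stage n ∨ ∃ a b k, ν.Adjacent n a b ∧ Split a.1 b.1 k ∧ u = ν.mid a b := by
  obtain ⟨v, hv | hv⟩ := mem_stage_iff.1 h
  · rcases hv.cases with ⟨h, -⟩ | ⟨w, k, h, -, -⟩ | ⟨w, k, h1, hk, rfl⟩
    · exact Or.inl h.mem_left
    · exact Or.inl h.mem_left
    · exact Or.inr ⟨_, _, k, h1, hk, rfl⟩
  · rcases hv.cases with ⟨h, -⟩ | ⟨w, k, h1, hk, rfl⟩ | ⟨w, k, h, -, -⟩
    · exact Or.inl h.mem_right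
    · exact Or.inr ⟨_, _, k, h1, hk, rfl⟩
    · exact Or.inl h.mem_right

theorem InStages.cases {u : Itinerary A × ℝ} (h : ν.InStages u) :
    u = (ν.star, 0) ∨ u = (ν, 1) ∨
      ∃ n a b k, ν.Adjacent n a b ∧ Split a.1 b.1 k ∧ u = ν.mid a b := by
  obtain ⟨n, hn⟩ := h
  induction n with
  | zero =>
    simp only [stage, List.mem_cons, List.not_mem_nil, or_false] at hn
    rcases hn with h | h
    exacts [Or.inl h, Or.inr (Or.inl h)]
  | succ n ih =>
    rcases mem_stage_succ hn with h | ⟨a, b, k, h⟩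
    · exact ih h
    · exact Or.inr (Or.inr ⟨n, a, b, k, h⟩)

theorem InStages.proper (hν : ν.IsKneading) {u : Itinerary A × ℝ} (h : ν.InStages u) :
    ν.Proper u.1 := by
  rcases h.cases with rfl | rfl | ⟨n, a, b, k, h1, hk, rfl⟩
  · exact hν.proper_star
  · exact hν.proper_star.self
  · exact (h1.isMid hν hk).proper hν fun c hc => h1.drop_mid_ne hν hk hc

/-- A pair that has made no step still has ⋆ν as its left end, and ⋆ does not differ from any
symbol. -/
theorem Adjacent.split_pos (hν : ν.IsKneading) {n k : ℕ} {u v : Itinerary A × ℝ}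
    (h : ν.Adjacent n u v) (hk : Split u.1 v.1 k) : 0 < k := by
  have hm := h.isMid hν hk
  obtain ⟨N, hN, -⟩ := h.exists_runs hν hm.fits
  by_contra hc
  obtain rfl : k = 0 := by omega
  have h0 : N = 0 := by have := hN.reduces.le hk; omega
  subst h0
  have := hN.left
  simp only [track_zero, drop_zero] at this
  exact hk.ne.1 (by rw [← this]; rfl)

theorem Adjacent.mid_ne_star (hν : ν.IsKneading) {n k : ℕ} {u v : Itinerary A × ℝ}
    (h : ν.Adjacent n u v) (hk : Split u.1 v.1 k) : (ν.mid u v).1 ≠ ν.star := fun he =>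
  ((h.isMid hν hk).lt 0 (h.split_pos hν hk)).1 (by rw [he]; rfl)

theorem InStages.starFree (hν : ν.IsKneading) {u : Itinerary A × ℝ} (h : ν.InStages u)
    (hu : u.1.StarFree) : u = (ν, 1) ∧ ν.IsNonperiodic := by
  rcases h.cases with rfl | rfl | ⟨n, a, b, k, h1, hk, rfl⟩
  · exact absurd rfl (hu 0)
  · refine ⟨rfl, hν.resolve_right ?_⟩
    rintro ⟨p, hp, hs⟩
    exact hu (p - 1) ((hs.2.2 _).2 (by rw [Nat.sub_add_cancel hs.1]))
  · exact absurd (h1.isMid hν hk).eq (hu k)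

/-- There are no gaps if `ν` is not periodic. -/
theorem Adjacent.not_compat (hn : ν.IsNonperiodic) {n : ℕ} {u v : Itinerary A × ℝ}
    (h : ν.Adjacent n u v) : ¬ Compat u.1 v.1 := by
  have hν : ν.IsKneading := Or.inl hn
  obtain ⟨N, hN, -⟩ := h.exists_reduces hν
  intro hc
  obtain ⟨i, hi⟩ := hN.left
  obtain ⟨j, hj⟩ := hN.right
  -- One shift removes the only ⋆ that can occur and keeps compatible critical orbit points
  -- different. Without ⋆, compatible sequences are equal.
  have hne : drop (i + 1) ν.star ≠ drop (j + 1) ν.star := by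
    have := hN.left.drop_ne hν hN.right hN.ne (n := 1) fun l _ => by
      simpa [drop] using hc (l + N)
    rwa [hi, hj, drop_drop, drop_drop] at this
  apply hne
  funext l
  have := hc (l + 1 + N)
  have h1 := congrFun hi (l + 1)
  have h2 := congrFun hj (l + 1)
  simp only [drop_apply] at h1 h2
  rw [h1, h2, show l + 1 + i = (l + i) + 1 by omega, show l + 1 + j = (l + j) + 1 by omega] at this
  rcases this with h | h | h
  · exact absurd h (hn.1 _)
  · exact absurd h (hn.1 _)
  · exact h

theorem Adjacent.width {n : ℕ} {u v : Itinerary A × ℝ} (h : ν.Adjacent n u v) :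
    v.2 - u.2 = (1 / 2) ^ n ∨ Compat u.1 v.1 := by
  induction n generalizing u v with
  | zero =>
    obtain ⟨rfl, rfl⟩ := adjacent_zero.1 h
    simp
  | succ n ih =>
    rcases h.cases with ⟨h1, h2⟩ | ⟨w, k, h1, h2, rfl⟩ | ⟨w, k, h1, h2, rfl⟩
    · exact Or.inr h2
    · have := (ih h1).resolve_right fun hc => h2.2 (hc k)
      left
      simp only [mid]
      rw [pow_succ]; linarith
    · have := (ih h1).resolve_right fun hc => h2.2 (hc k)
      left
      simp only [mid]
      rw [pow_succ]; linarith

theorem Adjacent.right_unique {n : ℕ} {u v w : Itinerary A × ℝ} (h : ν.Adjacent n u v)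
    (h' : ν.Adjacent n u w) : v = w := by
  have h1 := h.lt
  have h2 := h'.lt
  rcases h.sep h'.mem_right with (h3 | h3) | (h3 | h3)
  · rw [h3] at h2; exact absurd h2 (lt_irrefl _)
  · linarith
  · exact h3.symm
  · rcases h'.sep h.mem_right with (h4 | h4) | (h4 | h4)
    · rw [h4] at h1; exact absurd h1 (lt_irrefl _)
    · linarith
    · exact h4
    · linarith

theorem Adjacent.left_unique {n : ℕ} {u v w : Itinerary A × ℝ} (h : ν.Adjacent n v u)
    (h' : ν.Adjacent n w u) : v = w := by
  have h1 := h.lt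
  have h2 := h'.lt
  rcases h.sep h'.mem_left with (h3 | h3) | (h3 | h3)
  · exact h3.symm
  · rcases h'.sep h.mem_left with (h4 | h4) | (h4 | h4)
    · exact h4
    · linarith
    · rw [h4] at h1; exact absurd h1 (lt_irrefl _)
    · linarith
  · rw [h3] at h2; exact absurd h2 (lt_irrefl _)
  · linarith

/-! ### Positions and cells -/

/-- The position `s` lies strictly between the adjacent entries `u` and `v`. -/
def Around (ν : Itinerary A) (s : ℝ ×ₗ ℝ) (n : ℕ) (u v : Itinerary A × ℝ) : Prop :=
  ν.Adjacent n u v ∧ toLex (u.2, (0 : ℝ)) < s ∧ s < toLex (v.2, (0 : ℝ))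

theorem lex_zero_lt {a b : ℝ} : toLex (a, (0 : ℝ)) < toLex (b, (0 : ℝ)) ↔ a < b := by
  simp [Prod.Lex.toLex_lt_toLex]

theorem Around.le {s : ℝ ×ₗ ℝ} {n : ℕ} {u v : Itinerary A × ℝ} (h : ν.Around s n u v) :
    u.2 ≤ (ofLex s).1 ∧ (ofLex s).1 ≤ v.2 := by
  obtain ⟨-, h1, h2⟩ := h
  rw [Prod.Lex.lt_iff] at h1 h2
  simp only [ofLex_toLex] at h1 h2
  constructor
  · rcases h1 with h | h
    · exact h.le
    · exact h.1.le
  · rcases h2 with h | h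
    · exact h.le
    · exact h.1.le

theorem Around.unique {s : ℝ ×ₗ ℝ} {n : ℕ} {u v u' v' : Itinerary A × ℝ} (h : ν.Around s n u v)
    (h' : ν.Around s n u' v') : u = u' ∧ v = v' := by
  have h1 : u.2 < v'.2 := lex_zero_lt.1 (h.2.1.trans h'.2.2)
  have h2 : u'.2 < v.2 := lex_zero_lt.1 (h'.2.1.trans h.2.2)
  have hu : u = u' := by
    rcases h.1.sep h'.1.mem_left with (h3 | h3) | (h3 | h3)
    · exact h3.symm
    · rcases h'.1.sep h.1.mem_left with (h4 | h4) | (h4 | h4)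
      · exact h4
      · linarith
      · rw [h4] at h1; exact absurd h1 (lt_irrefl _)
      · linarith
    · rw [h3] at h2; exact absurd h2 (lt_irrefl _)
    · linarith
  subst hu
  exact ⟨rfl, h.1.right_unique h'.1⟩

theorem Around.not_mem {s : ℝ ×ₗ ℝ} {n : ℕ} {u v w : Itinerary A × ℝ} (h : ν.Around s n u v)
    (hw : w ∈ ν.stage n) : s ≠ toLex (w.2, 0) := by
  rintro rfl
  have h1 := lex_zero_lt.1 h.2.1
  have h2 := lex_zero_lt.1 h.2.2
  rcases h.1.sep hw with (h | h) | (h | h)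
  · rw [h] at h1; exact absurd h1 (lt_irrefl _)
  · linarith
  · rw [h] at h2; exact absurd h2 (lt_irrefl _)
  · linarith

/-- In stage `m` there is only one cell around `s`. It is therefore the same for all `B`, and it
suffices to check fitting to depth `B` in later stages depending on `B`. -/
theorem exists_around_fits (hν : ν.IsKneading) {s : ℝ ×ₗ ℝ} {m : ℕ} {x : Itinerary A}
    (h : ∀ B, ∃ n ≥ m, ∃ u v, ν.Around s n u v ∧ FitsTo x u.1 v.1 B) :
    ∃ u v, ν.Around s m u v ∧ Fits x u.1 v.1 := by
  have key : ∀ B, ∃ u v, ν.Around s m u v ∧ FitsTo x u.1 v.1 B := fun B => by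
    obtain ⟨n, hn, u, v, h1, h2⟩ := h B
    obtain ⟨u', v', h3, h4, h5, h6⟩ := h1.1.exists_fitsTo hν hn h2
    refine ⟨u', v', ⟨h3, lt_of_le_of_lt ?_ h1.2.1, lt_of_lt_of_le h1.2.2 ?_⟩, h4⟩
    · rw [← not_lt, lex_zero_lt, not_lt]; exact h5
    · rw [← not_lt, lex_zero_lt, not_lt]; exact h6
  obtain ⟨u, v, h1, -⟩ := key 0
  refine ⟨u, v, h1, fun B => ?_⟩
  obtain ⟨u', v', h2, h3⟩ := key B
  obtain ⟨rfl, rfl⟩ := h1.unique h2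
  exact h3

theorem exists_around {s : ℝ ×ₗ ℝ} (h0 : toLex (0, (0 : ℝ)) < s) (h1 : s < toLex (1, (0 : ℝ)))
    (hs : ∀ u, ν.InStages u → s ≠ toLex (u.2, 0)) (n : ℕ) : ∃ u v, ν.Around s n u v := by
  induction n with
  | zero => exact ⟨_, _, adjacent_zero.2 ⟨rfl, rfl⟩, h0, h1⟩
  | succ n ih =>
    obtain ⟨u, v, h, h1, h2⟩ := ih
    by_cases hd : diff u.1 v.1 = ⊤
    · exact ⟨u, v, h.succ_of_compat (diff_eq_top_iff.1 hd), h1, h2⟩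
    obtain ⟨k, hk⟩ := exists_split hd
    have hl := h.succ_left hk
    have hr := h.succ_right hk
    rcases lt_or_gt_of_ne (hs _ ⟨n + 1, hl.mem_right⟩) with h3 | h3
    · exact ⟨_, _, hl, h1, h3⟩
    · exact ⟨_, _, hr, h3, h2⟩

theorem Around.succ {s : ℝ ×ₗ ℝ} {n : ℕ} {u v a b : Itinerary A × ℝ} (h : ν.Around s n u v)
    (h' : ν.Around s (n + 1) a b) :
    (Compat u.1 v.1 ∧ a = u ∧ b = v) ∨
      ∃ k, Split u.1 v.1 k ∧ ((a = u ∧ b = ν.mid u v) ∨ (a = ν.mid u v ∧ b = v)) := by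
  have hlt : ∀ w z : Itinerary A × ℝ, w.2 < z.2 → w.2 < (ν.mid w z).2 ∧ (ν.mid w z).2 < z.2 :=
    fun w z h => by simp only [mid]; constructor <;> linarith
  have aux : ∀ {w z : Itinerary A × ℝ}, w.2 ≤ z.2 → toLex (w.2, (0 : ℝ)) ≤ toLex (z.2, (0 : ℝ)) :=
    fun h => by rw [← not_lt, lex_zero_lt, not_lt]; exact h
  rcases h'.1.cases with ⟨h1, h2⟩ | ⟨w, k, h1, h2, rfl⟩ | ⟨w, k, h1, h2, rfl⟩
  · obtain ⟨rfl, rfl⟩ := h.unique ⟨h1, h'.2⟩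
    exact Or.inl ⟨h2, rfl, rfl⟩
  · obtain ⟨rfl, rfl⟩ := h.unique ⟨h1, h'.2.1, h'.2.2.trans_le (aux (hlt _ _ h1.lt).2.le)⟩
    exact Or.inr ⟨k, h2, Or.inl ⟨rfl, rfl⟩⟩
  · obtain ⟨rfl, rfl⟩ := h.unique ⟨h1, (aux (hlt _ _ h1.lt).1.le).trans_lt h'.2.1, h'.2.2⟩
    exact Or.inr ⟨k, h2, Or.inr ⟨rfl, rfl⟩⟩

/-! ### Elements of the stages -/

/-- An entry missing in stage `n` is inserted later in the middle of a cell that it fits, and that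
cell lies in a cell of stage `n`. -/
theorem InStages.around (hν : ν.IsKneading) {u : Itinerary A × ℝ} (h : ν.InStages u) (n : ℕ) :
    u ∈ ν.stage n ∨ ∃ l r, ν.Around (toLex (u.2, 0)) n l r ∧ Fits u.1 l.1 r.1 := by
  classical
  by_cases hn : u ∈ ν.stage n
  · exact Or.inl hn
  right
  let N := Nat.find h
  have hN : u ∈ ν.stage N := Nat.find_spec h
  have hnN : n < N := by
    by_contra hc
    exact hn (stage_subset (not_lt.1 hc) hN)
  obtain ⟨M, hM⟩ : ∃ M, N = M + 1 := ⟨N - 1, by omega⟩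
  rw [hM] at hN
  rcases mem_stage_succ hN with h' | ⟨a, b, k, h1, h2, rfl⟩
  · exact absurd h' (Nat.find_min h (show M < N by omega))
  refine exists_around_fits hν fun B => ⟨M, by omega, a, b, ⟨h1, ?_, ?_⟩, (h1.isMid hν h2).fits B⟩
  · rw [lex_zero_lt]; simp only [mid]; linarith [h1.lt]
  · rw [lex_zero_lt]; simp only [mid]; linarith [h1.lt]

/-- A half of a cell does not fit the inserted point. -/
theorem IsMid.not_fits {a b m : Itinerary A} {k N : ℕ} (hν : ν.IsKneading)
    (hr : ν.Reduces a b N) (hm : ν.IsMid a b k m) : ¬ Fits m a m := fun hf =>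
  hm.split.ne.1 (by rw [hf.eq_of_child hν hr hm, hm.eq])

/-- As long as two entries with the same itinerary are both missing, they are in the same cell,
because only one cell of a stage fits the itinerary. When one of them is inserted the other cannot
be left for later, since neither half of the cell fits the inserted point. -/
theorem InStages.eq_of_fst_eq (hν : ν.IsKneading) {u v : Itinerary A × ℝ} (hu : ν.InStages u)
    (hv : ν.InStages v) (h : u.1 = v.1) : u = v := by
  -- a new entry is different from all others which are not older
  have key : ∀ {n : ℕ} {a b v : Itinerary A × ℝ} {k : ℕ}, ν.Adjacent n a b → Split a.1 b.1 k →
      ν.InStages v → v ∉ ν.stage n → (ν.mid a b).1 = v.1 → ν.mid a b = v := by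
    intro n a b v k h1 hk hv hvn he
    have hm := h1.isMid hν hk
    obtain ⟨N, hN, -⟩ := h1.exists_reduces hν
    obtain ⟨l, r, h2, h3⟩ := (hv.around hν n).resolve_left hvn
    obtain ⟨rfl, rfl⟩ := h1.eq_of_fits hν h2.1 hm.fits (he ▸ h3)
    rcases hv.around hν (n + 1) with h4 | ⟨l, r, h4, h5⟩
    · rcases mem_stage_succ h4 with h4 | ⟨a', b', k', h6, h5, rfl⟩
      · exact absurd h4 hvn
      · obtain ⟨rfl, rfl⟩ := h1.eq_of_fits hν h6 hm.fits (he ▸ (h6.isMid hν h5).fits)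
        rfl
    · rw [← he] at h5
      rcases h2.succ h4 with ⟨h6, -, -⟩ | ⟨-, -, ⟨rfl, rfl⟩ | ⟨rfl, rfl⟩⟩
      · exact absurd (h6 k) hk.2
      · exact absurd h5 (hm.not_fits hν hN)
      · exact absurd h5.symm (hm.symm.not_fits hν hN.symm)
  have hroot : ∀ {n : ℕ} {a b : Itinerary A × ℝ} {k : ℕ}, ν.Adjacent n a b → Split a.1 b.1 k →
      (ν.mid a b).1 ≠ ν.star ∧ (ν.mid a b).1 ≠ ν := fun h hk =>
    ⟨h.mid_ne_star hν hk, h.drop_mid_ne hν hk (Nat.zero_le _)⟩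
  rcases hu.cases with rfl | rfl | ⟨n, a, b, k, h1, hk, rfl⟩
  · rcases hv.cases with rfl | rfl | ⟨n, a, b, k, h1, hk, rfl⟩
    · rfl
    · exact absurd h hν.star_ne
    · exact absurd h.symm (hroot h1 hk).1
  · rcases hv.cases with rfl | rfl | ⟨n, a, b, k, h1, hk, rfl⟩
    · exact absurd h.symm hν.star_ne
    · rfl
    · exact absurd h.symm (hroot h1 hk).2
  · by_cases hvn : v ∈ ν.stage n
    swap
    · exact key h1 hk hv hvn h
    rcases hv.cases with rfl | rfl | ⟨n', a', b', k', h1', hk', rfl⟩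
    · exact absurd h (hroot h1 hk).1
    · exact absurd h (hroot h1 hk).2
    · refine (key h1' hk' hu (fun hc => ?_) h.symm).symm
      have hle : n' ≤ n := by
        by_contra hc'
        have h2 : ν.Around (toLex ((ν.mid a' b').2, 0)) n' a' b' := by
          refine ⟨h1', ?_, ?_⟩
          · rw [lex_zero_lt]; simp only [mid]; linarith [h1'.lt]
          · rw [lex_zero_lt]; simp only [mid]; linarith [h1'.lt]
        exact h2.not_mem (stage_subset (by omega) hvn) rfl
      have h2 : ν.Around (toLex ((ν.mid a b).2, 0)) n a b := by
        refine ⟨h1, ?_, ?_⟩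
        · rw [lex_zero_lt]; simp only [mid]; linarith [h1.lt]
        · rw [lex_zero_lt]; simp only [mid]; linarith [h1.lt]
      exact h2.not_mem (stage_subset hle hc) rfl

end Itinerary

/-! ### The two itineraries attached to a point of the tree. -/

/-- The itinerary of a point of the tree, where the interior points of a Fatou interval have the
itinerary of its end without star. -/
def TreePoint.body {A : Type*} : TreePoint A → Itinerary A
  | .itinerary a => a
  | .fatou _ b _ => b

/-- The itinerary of a point of the tree, where the interior points of a Fatou interval have the
itinerary of its precritical end. -/
def TreePoint.rep {A : Type*} : TreePoint A → Itinerary A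
  | .itinerary a => a
  | .fatou a _ _ => a

namespace Itinerary

variable {A : Type*} {ν : Itinerary A}

/-! ### Sequences of nested cells -/

section Cells

variable {s : ℝ ×ₗ ℝ} {L R : ℕ → Itinerary A × ℝ}

theorem cells_const (h : ∀ n, ν.Around s n (L n) (R n)) {N n : ℕ} (hn : N ≤ n)
    (hc : Compat (L N).1 (R N).1) : L n = L N ∧ R n = R N := by
  obtain ⟨h1, h2⟩ := (h n).unique ⟨(h N).1.of_compat hn hc, (h N).2⟩
  exact ⟨h1, h2⟩

theorem cells_mono (h : ∀ n, ν.Around s n (L n) (R n)) {m n : ℕ} (hmn : m ≤ n) :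
    (L m).2 ≤ (L n).2 ∧ (R n).2 ≤ (R m).2 := by
  induction n, hmn using Nat.le_induction with
  | base => exact ⟨le_rfl, le_rfl⟩
  | succ n _ ih =>
    have := (h n).1.lt
    rcases (h n).succ (h (n + 1)) with ⟨-, h1, h2⟩ | ⟨-, -, ⟨h1, h2⟩ | ⟨h1, h2⟩⟩
    · rwa [h1, h2]
    · rw [h1, h2]; refine ⟨ih.1, le_trans ?_ ih.2⟩
      simp only [mid]; linarith
    · rw [h1, h2]; refine ⟨le_trans ih.1 ?_, ih.2⟩
      simp only [mid]; linarith

theorem cells_tendsto (h : ∀ n, ν.Around s n (L n) (R n))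
    (hc : ∀ n, ¬ Compat (L n).1 (R n).1) :
    Tendsto (fun n => (L n).2) atTop (𝓝 (ofLex s).1) ∧
      Tendsto (fun n => (R n).2) atTop (𝓝 (ofLex s).1) := by
  have hw : ∀ n, (R n).2 - (L n).2 = (1 / 2) ^ n := fun n => (h n).1.width.resolve_right (hc n)
  have h0 : Tendsto (fun n : ℕ => ((1 : ℝ) / 2) ^ n) atTop (𝓝 0) :=
    tendsto_pow_atTop_nhds_zero_of_lt_one (by norm_num) (by norm_num)
  constructor
  · refine tendsto_of_tendsto_of_tendsto_of_le_of_le (g := fun n => (ofLex s).1 - (1 / 2) ^ n)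
      (h := fun _ => (ofLex s).1) ?_ tendsto_const_nhds (fun n => ?_) (fun n => (h n).le.1)
    · simpa using tendsto_const_nhds.sub h0
    · have := hw n
      have := (h n).le.2
      dsimp only; linarith
  · refine tendsto_of_tendsto_of_tendsto_of_le_of_le (h := fun n => (ofLex s).1 + (1 / 2) ^ n)
      (g := fun _ => (ofLex s).1) tendsto_const_nhds ?_ (fun n => (h n).le.2) (fun n => ?_)
    · simpa using tendsto_const_nhds.add h0
    · have := hw n
      have := (h n).le.1
      dsimp only; linarith

/-- Sequences that fit the same cell agree up to the stage of the cell. -/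
theorem Adjacent.eq_of_fits_of_lt (hν : ν.IsKneading) {n i : ℕ} {u v : Itinerary A × ℝ}
    {x y : Itinerary A} (h : ν.Adjacent n u v) (hx : Fits x u.1 v.1) (hy : Fits y u.1 v.1)
    (hi : i < n) : x i = y i := by
  have h1 := hx n i hi fun j hj => h.agree hν (by omega)
  have h2 := hy n i hi fun j hj => h.agree hν (by omega)
  have h3 := h.not_none hν i
  rcases h1 with ⟨h1 | h1, h1' | h1'⟩
  · rcases h2 with ⟨h2 | h2, h2' | h2'⟩
    · exact h1.symm.trans h2
    · exact h1.symm.trans h2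
    · exact h1'.symm.trans h2'
    · exact absurd ⟨h2, h2'⟩ h3
  · rcases h2.1 with h2 | h2
    · exact h1.symm.trans h2
    · exact absurd ⟨h2, h1'⟩ h3
  · rcases h2.2 with h2 | h2
    · exact h1'.symm.trans h2
    · exact absurd ⟨h1, h2⟩ h3
  · exact absurd ⟨h1, h1'⟩ h3

/-- The sequence which runs through all cells around a position. -/
theorem exists_fits (hν : ν.IsKneading) (h : ∀ n, ν.Around s n (L n) (R n)) :
    ∃ x : Itinerary A, x.StarFree ∧ ∀ n, Fits x (L n).1 (R n).1 := by
  -- Where the bounds of a cell agree, this is their common symbol; it is not ⋆ because adjacent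
  -- entries have no common ⋆. A subdivision does not change it, so position `i` is settled from
  -- stage `i + 1` on.
  let q : ℕ → Itinerary A := fun n i => ((L n).1 i).or ((R n).1 i)
  have hq : ∀ n i, Agree (L n).1 (R n).1 i → q n i ≠ none ∧
      ((L n).1 i = q n i ∨ (L n).1 i = none) ∧ ((R n).1 i = q n i ∨ (R n).1 i = none) := by
    intro n i hi
    have h3 := (h n).1.not_none hν i
    simp only [q]
    unfold Agree at hi
    rcases hl : (L n).1 i with _ | a <;> rcases hr : (R n).1 i with _ | b <;> simp_all
  have hstep : ∀ n i, (∀ j ≤ i, Agree (L n).1 (R n).1 j) →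
      q (n + 1) i = q n i ∧ ∀ j ≤ i, Agree (L (n + 1)).1 (R (n + 1)).1 j := by
    intro n i hi
    rcases (h n).succ (h (n + 1)) with ⟨-, h1, h2⟩ | ⟨k, hk, h12⟩
    · simp only [q]; rw [h1, h2]; exact ⟨rfl, hi⟩
    · have hik : i < k := by
        by_contra hc
        exact hk.2 (hi k (by omega))
      have hm := (h n).1.isMid hν hk
      have hj : ∀ j ≤ i, (ν.mid (L n) (R n)).1 j ≠ none ∧ (ν.mid (L n) (R n)).1 j = q n j ∧
          ((L n).1 j = q n j ∨ (L n).1 j = none) ∧ ((R n).1 j = q n j ∨ (R n).1 j = none) := by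
        intro j hj
        obtain ⟨h3, h4, h5⟩ := hm.lt j (by omega)
        have h6 := hq n j (hi j hj)
        refine ⟨h3, ?_, h6.2⟩
        have h7 := (h n).1.not_none hν j
        rcases h4 with h4 | h4
        · rcases h6.2.1 with h8 | h8
          · exact h4.symm.trans h8
          · exact absurd (h4.symm.trans h8) h3
        · rcases h5 with h5 | h5
          · rcases h6.2.2 with h8 | h8
            · exact h5.symm.trans h8
            · exact absurd (h5.symm.trans h8) h3
          · exact absurd ⟨h4, h5⟩ h7
      rcases h12 with ⟨h1, h2⟩ | ⟨h1, h2⟩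
      · constructor
        · have h3 := hj i le_rfl
          have h4 : ∀ o p : Option A, (o = p ∨ o = none) → o.or p = p := by
            rintro o p (rfl | rfl)
            · rcases o with _ | o <;> rfl
            · rfl
          change ((L (n + 1)).1 i).or ((R (n + 1)).1 i) = q n i
          rw [h1, h2, h3.2.1]
          exact h4 _ _ h3.2.2.1
        · intro j hjj
          have h3 := hj j hjj
          rw [h1, h2]
          unfold Agree
          rw [h3.2.1]
          rcases h3.2.2.1 with h4 | h4
          · exact Or.inr (Or.inr h4)
          · exact Or.inl h4
      · constructor
        · have h3 := hj i le_rfl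
          have h4 : ∀ o p : Option A, o ≠ none → o.or p = o := fun o p ho => by
            rcases o with _ | o
            · exact absurd rfl ho
            · rfl
          change ((L (n + 1)).1 i).or ((R (n + 1)).1 i) = q n i
          rw [h1, h2, h3.2.1]
          exact h4 _ _ (hq n i (hi i le_rfl)).1
        · intro j hjj
          have h3 := hj j hjj
          rw [h1, h2]
          unfold Agree
          rw [h3.2.1]
          rcases h3.2.2.2 with h4 | h4
          · exact Or.inr (Or.inr h4.symm)
          · exact Or.inr (Or.inl h4)
  have hle : ∀ {n m i}, n ≤ m → (∀ j ≤ i, Agree (L n).1 (R n).1 j) →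
      q m i = q n i ∧ ∀ j ≤ i, Agree (L m).1 (R m).1 j := by
    intro n m i hnm hi
    induction m, hnm using Nat.le_induction with
    | base => exact ⟨rfl, hi⟩
    | succ m _ ih =>
      obtain ⟨h1, h2⟩ := hstep m i ih.2
      exact ⟨h1.trans ih.1, h2⟩
  have hag : ∀ i, ∀ j ≤ i, Agree (L (i + 1)).1 (R (i + 1)).1 j := fun i j hj =>
    (h (i + 1)).1.agree hν (by omega)
  refine ⟨fun i => q (i + 1) i, fun i => (hq _ i (hag i i le_rfl)).1, fun n B i _ hi => ?_⟩
  have h1 := (hle (le_max_left n (i + 1)) hi).1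
  have h2 := (hle (le_max_right n (i + 1)) (hag i)).1
  have h3 : q (i + 1) i = q n i := h2.symm.trans h1
  dsimp only
  rw [h3]
  exact (hq n i (hi i le_rfl)).2

/-- A sequence that fits a cell in each stage separates `⋆ν` and `ν`. -/
theorem not_merge_of_fits (hν : ν.IsKneading) {x : Itinerary A}
    (h : ∀ n, ∃ u v, ν.Adjacent n u v ∧ Fits x u.1 v.1) : ¬ ν.Merge x ν.star ν := by
  rintro ⟨j, hj⟩
  obtain ⟨u, v, h1, h2⟩ := h j
  obtain ⟨N, hN, hc⟩ := h1.exists_runs hν h2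
  rcases le_or_gt j N with hjN | hjN
  · have := track_eq_of_le hjN hj
    rw [hN.left, hN.right] at this
    exact hN.reduces.ne this
  -- In a gap `N` need not reach `j`. However, there the tracks go on as shifts of the two ends, and
  -- compatible critical orbit points stay different under shifts.
  · have hcc : Compat u.1 v.1 := hc.resolve_left (by omega)
    have hf : ∀ i, (u.1 i = x i ∨ u.1 i = none) ∧ (v.1 i = x i ∨ v.1 i = none) := fun i =>
      h2 (i + 1) i (by omega) fun j _ => hcc j
    have hl := hN.track_left hν hjN.le fun i _ _ => (hf i).1
    have hr := hN.symm.track_left hν hjN.le fun i _ _ => (hf i).2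
    rw [hl, hr] at hj
    obtain ⟨l, rfl⟩ := Nat.exists_eq_add_of_le hjN.le
    rw [← drop_drop, ← drop_drop] at hj
    exact hN.reduces.left.drop_ne hν hN.reduces.right hN.reduces.ne
      (fun i _ => (hcc.drop N) i) hj

end Cells

/-! ### Limits -/

theorem eventually_agree {y : ℕ → Itinerary A × ℝ} {a : Itinerary A} (ha : a.StarFree)
    (h : Tendsto (fun n => diff (y n).1 a) atTop (𝓝 ⊤)) (B : ℕ) :
    ∀ᶠ n in atTop, ∀ i < B, (y n).1 i = a i ∨ (y n).1 i = none := by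
  have h1 : ∀ᶠ n in atTop, ((B : ℕ) : ℕ∞) < diff (y n).1 a :=
    h.eventually (lt_mem_nhds (ENat.natCast_lt_top B))
  filter_upwards [h1] with n hn i hi
  have h2 : ((B + 1 : ℕ) : ℕ∞) ≤ diff (y n).1 a := by
    have := Order.add_one_le_of_lt hn
    exact_mod_cast this
  rcases le_diff_iff.1 h2 i (by omega) with h | h | h
  · exact Or.inr h
  · exact absurd h (ha i)
  · exact Or.inl h

theorem tendsto_diff_of_fits (hν : ν.IsKneading) {x : Itinerary A} {L R : ℕ → Itinerary A × ℝ}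
    (h : ∀ n, ν.Adjacent n (L n) (R n)) (hf : ∀ n, Fits x (L n).1 (R n).1) :
    Tendsto (fun n => diff (L n).1 x) atTop (𝓝 ⊤) ∧
      Tendsto (fun n => diff (R n).1 x) atTop (𝓝 ⊤) := by
  have key : ∀ (y : ℕ → Itinerary A), (∀ n, ∀ i < n, y n i = x i ∨ y n i = none) →
      Tendsto (fun n => diff (y n) x) atTop (𝓝 ⊤) := by
    intro y hy
    rw [ENat.tendsto_nhds_top_iff_natCast_lt]
    intro B
    filter_upwards [eventually_ge_atTop (B + 1)] with n hn
    have : ((B + 1 : ℕ) : ℕ∞) ≤ diff (y n) x := le_diff_iff.2 fun i hi => by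
      rcases hy n i (by omega) with h | h
      · exact Or.inr (Or.inr h)
      · exact Or.inl h
    exact lt_of_lt_of_le (by exact_mod_cast Nat.lt_succ_self B) this
  exact ⟨key _ fun n i hi => (hf n n i hi fun j hj => (h n).agree hν (by omega)).1,
    key _ fun n i hi => (hf n n i hi fun j hj => (h n).agree hν (by omega)).2⟩

/-- The definition compares only the neighbours with `a`. The end `u` is compared through the next
neighbour: it is the point inserted between `u` and the present one, and agrees with `u` up to ⋆. It
is indeed inserted, as a gap would keep the neighbours away from `u` with respect to φ. -/
theorem IsRightLimit.fits (hν : ν.IsKneading) {u : Itinerary A × ℝ} {a : Itinerary A}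
    (h : ν.IsRightLimit u a) : ∃ y : ℕ → Itinerary A × ℝ, (∀ᶠ n in atTop, ν.Adjacent n u (y n)) ∧
      Tendsto (fun n => (y n).2) atTop (𝓝 u.2) ∧
      ∀ B, ∀ᶠ n in atTop, FitsTo a u.1 (y n).1 B := by
  obtain ⟨-, ha, y, h1, h2, h3⟩ := h
  refine ⟨y, h1, h2, fun B => ?_⟩
  obtain ⟨N, hN⟩ := eventually_atTop.1 h1
  filter_upwards [eventually_agree ha h3 B, (tendsto_add_atTop_nat 1).eventually
    (eventually_agree ha h3 B), eventually_ge_atTop N, eventually_ge_atTop B] with n h4 h5 h6 h7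
  have hn := hN n h6
  have hd : diff u.1 (y n).1 ≠ ⊤ := by
    intro hc
    rw [diff_eq_top_iff] at hc
    have h8 : ∀ m ≥ n, (y m).2 = (y n).2 := fun m hm => by
      rw [(hN m (h6.trans hm)).right_unique (hn.of_compat hm hc)]
    have h9 : Tendsto (fun n => (y n).2) atTop (𝓝 (y n).2) :=
      tendsto_const_nhds.congr' (eventually_atTop.2 ⟨n, fun m hm => (h8 m hm).symm⟩)
    exact hn.lt.ne (tendsto_nhds_unique h2 h9)
  obtain ⟨k, hk⟩ := exists_split hd
  have hm := hn.isMid hν hk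
  have hy := (hN (n + 1) (by omega)).right_unique (hn.succ_left hk)
  intro i hi hj
  have hik : i < k := by
    by_contra hc
    exact hk.2 (hj k (by omega))
  refine ⟨?_, h4 i hi⟩
  have h8 := h5 i hi
  rw [hy] at h8
  obtain ⟨h9, h10, -⟩ := hm.lt i hik
  rw [h8.resolve_right h9] at h10
  exact h10

theorem IsLeftLimit.fits (hν : ν.IsKneading) {u : Itinerary A × ℝ} {a : Itinerary A}
    (h : ν.IsLeftLimit u a) : ∃ y : ℕ → Itinerary A × ℝ, (∀ᶠ n in atTop, ν.Adjacent n (y n) u) ∧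
      Tendsto (fun n => (y n).2) atTop (𝓝 u.2) ∧
      ∀ B, ∀ᶠ n in atTop, FitsTo a (y n).1 u.1 B := by
  obtain ⟨-, ha, y, h1, h2, h3⟩ := h
  refine ⟨y, h1, h2, fun B => ?_⟩
  obtain ⟨N, hN⟩ := eventually_atTop.1 h1
  filter_upwards [eventually_agree ha h3 B, (tendsto_add_atTop_nat 1).eventually
    (eventually_agree ha h3 B), eventually_ge_atTop N, eventually_ge_atTop B] with n h4 h5 h6 h7
  have hn := hN n h6
  have hd : diff (y n).1 u.1 ≠ ⊤ := by
    intro hc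
    rw [diff_eq_top_iff] at hc
    have h8 : ∀ m ≥ n, (y m).2 = (y n).2 := fun m hm => by
      rw [(hN m (h6.trans hm)).left_unique (hn.of_compat hm hc)]
    have h9 : Tendsto (fun n => (y n).2) atTop (𝓝 (y n).2) :=
      tendsto_const_nhds.congr' (eventually_atTop.2 ⟨n, fun m hm => (h8 m hm).symm⟩)
    exact hn.lt.ne (tendsto_nhds_unique h9 h2)
  obtain ⟨k, hk⟩ := exists_split hd
  have hm := hn.isMid hν hk
  have hy := (hN (n + 1) (by omega)).left_unique (hn.succ_right hk)
  intro i hi hj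
  have hik : i < k := by
    by_contra hc
    exact hk.2 (hj k (by omega))
  refine ⟨h4 i hi, ?_⟩
  have h8 := h5 i hi
  rw [hy] at h8
  obtain ⟨h9, -, h10⟩ := hm.lt i hik
  rw [h8.resolve_right h9] at h10
  exact h10

theorem IsCentral.fits {u v : Itinerary A × ℝ} {c : Itinerary A} (h : ν.IsCentral u v c) :
    Fits c u.1 v.1 := by
  obtain ⟨-, -, -, hc, h1, h2⟩ := h
  rw [diff_eq_top_iff] at h1 h2
  intro B i _ _
  constructor
  · rcases h1 i with h | h | h
    · exact Or.inr h
    · exact absurd h (hc i)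
    · exact Or.inl h
  · rcases h2 i with h | h | h
    · exact absurd h (hc i)
    · exact Or.inr h
    · exact Or.inl h.symm

/-- `[a, u]` is a Fatou interval to the right of `u`. -/
def RightEnd (ν : Itinerary A) (u : Itinerary A × ℝ) (a : Itinerary A) : Prop :=
  ν.IsRightLimit u a ∨ ∃ v, ν.IsCentral u v a

/-- `[a, u]` is a Fatou interval to the left of `u`. -/
def LeftEnd (ν : Itinerary A) (u : Itinerary A × ℝ) (a : Itinerary A) : Prop :=
  ν.IsLeftLimit u a ∨ ∃ v, ν.IsCentral v u a

theorem RightEnd.starFree {u : Itinerary A × ℝ} {a : Itinerary A} (h : ν.RightEnd u a) :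
    a.StarFree := by
  rcases h with h | ⟨v, h⟩
  exacts [h.2.1, h.2.2.2.1]

theorem LeftEnd.starFree {u : Itinerary A × ℝ} {a : Itinerary A} (h : ν.LeftEnd u a) :
    a.StarFree := by
  rcases h with h | ⟨v, h⟩
  exacts [h.2.1, h.2.2.2.1]

theorem RightEnd.fits (hν : ν.IsKneading) {u : Itinerary A × ℝ} {a : Itinerary A}
    (h : ν.RightEnd u a) : ∃ y : ℕ → Itinerary A × ℝ, (∀ᶠ n in atTop, ν.Adjacent n u (y n)) ∧
      ∀ B, ∀ᶠ n in atTop, FitsTo a u.1 (y n).1 B := by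
  rcases h with h | ⟨v, h⟩
  · obtain ⟨y, h1, -, h2⟩ := h.fits hν
    exact ⟨y, h1, h2⟩
  · obtain ⟨N, hN⟩ := h.1
    exact ⟨fun _ => v, eventually_atTop.2 ⟨N, fun n hn =>
      hN.of_compat hn (diff_eq_top_iff.1 h.2.1)⟩, fun B => Eventually.of_forall fun _ => h.fits B⟩

theorem LeftEnd.fits (hν : ν.IsKneading) {u : Itinerary A × ℝ} {a : Itinerary A}
    (h : ν.LeftEnd u a) : ∃ y : ℕ → Itinerary A × ℝ, (∀ᶠ n in atTop, ν.Adjacent n (y n) u) ∧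
      ∀ B, ∀ᶠ n in atTop, FitsTo a (y n).1 u.1 B := by
  rcases h with h | ⟨v, h⟩
  · obtain ⟨y, h1, -, h2⟩ := h.fits hν
    exact ⟨y, h1, h2⟩
  · obtain ⟨N, hN⟩ := h.1
    exact ⟨fun _ => v, eventually_atTop.2 ⟨N, fun n hn =>
      hN.of_compat hn (diff_eq_top_iff.1 h.2.1)⟩, fun B => Eventually.of_forall fun _ => h.fits B⟩

/-- The number `z` only selects the side of `u`: the cells around such a position eventually have
`u` as their left bound, whatever `z > 0` is. -/
theorem RightEnd.cells (hν : ν.IsKneading) {u : Itinerary A × ℝ} {a : Itinerary A}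
    (h : ν.RightEnd u a) {z : ℝ} (hz : 0 < z) : ∃ L R : ℕ → Itinerary A × ℝ,
      (∀ n, ν.Around (toLex (u.2, z)) n (L n) (R n) ∧ Fits a (L n).1 (R n).1) ∧
      ∀ᶠ n in atTop, L n = u := by
  obtain ⟨y, h1, h2⟩ := h.fits hν
  have har : ∀ n, ν.Adjacent n u (y n) → ν.Around (toLex (u.2, z)) n u (y n) := fun n hn =>
    ⟨hn, by simp [Prod.Lex.toLex_lt_toLex, hz], by simp [Prod.Lex.toLex_lt_toLex, hn.lt]⟩
  have key : ∀ m, ∃ l r, ν.Around (toLex (u.2, z)) m l r ∧ Fits a l.1 r.1 := fun m =>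
    exists_around_fits hν fun B => by
      obtain ⟨n, h3, h4, h5⟩ := (h1.and ((h2 B).and (eventually_ge_atTop m))).exists
      exact ⟨n, h5, u, y n, har n h3, h4⟩
  choose L R hLR using key
  refine ⟨L, R, hLR, ?_⟩
  filter_upwards [h1] with n hn
  exact ((hLR n).1.unique (har n hn)).1

theorem LeftEnd.cells (hν : ν.IsKneading) {u : Itinerary A × ℝ} {a : Itinerary A}
    (h : ν.LeftEnd u a) {z : ℝ} (hz : z < 0) : ∃ L R : ℕ → Itinerary A × ℝ,
      (∀ n, ν.Around (toLex (u.2, z)) n (L n) (R n) ∧ Fits a (L n).1 (R n).1) ∧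
      ∀ᶠ n in atTop, R n = u := by
  obtain ⟨y, h1, h2⟩ := h.fits hν
  have har : ∀ n, ν.Adjacent n (y n) u → ν.Around (toLex (u.2, z)) n (y n) u := fun n hn =>
    ⟨hn, by simp [Prod.Lex.toLex_lt_toLex, hn.lt], by simp [Prod.Lex.toLex_lt_toLex, hz]⟩
  have key : ∀ m, ∃ l r, ν.Around (toLex (u.2, z)) m l r ∧ Fits a l.1 r.1 := fun m =>
    exists_around_fits hν fun B => by
      obtain ⟨n, h3, h4, h5⟩ := (h1.and ((h2 B).and (eventually_ge_atTop m))).exists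
      exact ⟨n, h5, y n, u, har n h3, h4⟩
  choose L R hLR using key
  refine ⟨L, R, hLR, ?_⟩
  filter_upwards [h1] with n hn
  exact ((hLR n).1.unique (har n hn)).2

theorem RightEnd.compat (hν : ν.IsKneading) {u : Itinerary A × ℝ} {a : Itinerary A}
    (h : ν.RightEnd u a) : Compat u.1 a := by
  obtain ⟨y, h1, h2⟩ := h.fits hν
  intro i
  obtain ⟨n, h3, h4, h5⟩ := (h1.and ((h2 (i + 1)).and (eventually_gt_atTop i))).exists
  rcases (h4 i (by omega) fun j hj => h3.agree hν (by omega)).1 with h | h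
  · exact Or.inr (Or.inr h)
  · exact Or.inl h

theorem LeftEnd.compat (hν : ν.IsKneading) {u : Itinerary A × ℝ} {a : Itinerary A}
    (h : ν.LeftEnd u a) : Compat u.1 a := by
  obtain ⟨y, h1, h2⟩ := h.fits hν
  intro i
  obtain ⟨n, h3, h4, h5⟩ := (h1.and ((h2 (i + 1)).and (eventually_gt_atTop i))).exists
  rcases (h4 i (by omega) fun j hj => h3.agree hν (by omega)).2 with h | h
  · exact Or.inr (Or.inr h)
  · exact Or.inl h

theorem RightEnd.inStages {u : Itinerary A × ℝ} {a : Itinerary A} (h : ν.RightEnd u a) :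
    ν.InStages u := by
  rcases h with ⟨-, -, y, h, -⟩ | ⟨v, ⟨n, h⟩, -⟩
  · obtain ⟨n, hn⟩ := h.exists
    exact ⟨n, hn.mem_left⟩
  · exact ⟨n, h.mem_left⟩

theorem LeftEnd.inStages {u : Itinerary A × ℝ} {a : Itinerary A} (h : ν.LeftEnd u a) :
    ν.InStages u := by
  rcases h with ⟨-, -, y, h, -⟩ | ⟨v, ⟨n, h⟩, -⟩
  · obtain ⟨n, hn⟩ := h.exists
    exact ⟨n, hn.mem_right⟩
  · exact ⟨n, h.mem_right⟩

end Itinerary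

namespace Itinerary

variable {A : Type*} {ν : Itinerary A}

/-! ### Positions on the critical path -/

theorem _root_.OnPath.snd_eq_zero (hn : ν.IsNonperiodic) {z : TreePoint A} {s : ℝ ×ₗ ℝ}
    (h : OnPath ν z s) : (ofLex s).2 = 0 := by
  cases h with
  | precritical => rfl
  | innerLimit => rfl
  | central => rfl
  | rightLimit p hp => exact absurd hn hp.not_isNonperiodic
  | leftLimit p hp => exact absurd hn hp.not_isNonperiodic
  | fatouRight p hp => exact absurd hn hp.not_isNonperiodic
  | fatouLeft p hp => exact absurd hn hp.not_isNonperiodic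

/-- Whether a sequence is eventually constant, as a number. -/
noncomputable def evConst (L : ℕ → Itinerary A × ℝ) : ℝ :=
  open Classical in if ∃ u, ∀ᶠ n in atTop, L n = u then 1 else 0

theorem evConst_of_eventually {L : ℕ → Itinerary A × ℝ} {u : Itinerary A × ℝ}
    (h : ∀ᶠ n in atTop, L n = u) : evConst L = 1 := if_pos ⟨u, h⟩

theorem evConst_of_not {L : ℕ → Itinerary A × ℝ} (h : ∀ u, ¬ ∀ᶠ n in atTop, L n = u) :
    evConst L = 0 := if_neg fun ⟨u, hu⟩ => h u hu

/-- This is a normal form for points of the path: an entry of a stage, or a point determined by the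
nested cells around it. For an itinerary of the second kind, the coordinate `z` records which bounds
become constant: `1 - 0` at a right limit, `0 - 1` at a left limit, `1 - 1` in a gap and `0 - 0` at
an inner limit. -/
theorem _root_.OnPath.kind (hν : ν.IsKneading) {z : TreePoint A} {s : ℝ ×ₗ ℝ} (h : OnPath ν z s) :
    (∃ u, ν.InStages u ∧ z = .itinerary u.1 ∧ s = toLex (u.2, 0)) ∨
    (z.body.StarFree ∧ ∃ L R : ℕ → Itinerary A × ℝ,
      (∀ n, ν.Around s n (L n) (R n) ∧ Fits z.body (L n).1 (R n).1) ∧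
      ((z = .itinerary z.body ∧ ∃ a b : ℝ, Tendsto (fun n => (L n).2) atTop (𝓝 a) ∧
          Tendsto (fun n => (R n).2) atTop (𝓝 b) ∧
          s = toLex ((a + b) / 2, evConst L - evConst R)) ∨
        (∃ u t, z = .fatou u.1 z.body t ∧ ν.RightEnd u z.body ∧ (∀ᶠ n in atTop, L n = u) ∧
          s = toLex (u.2, 1 - (t : ℝ))) ∨
        (∃ u t, z = .fatou u.1 z.body t ∧ ν.LeftEnd u z.body ∧ (∀ᶠ n in atTop, R n = u) ∧
          s = toLex (u.2, (t : ℝ) - 1)))) := by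
  cases h with
  | precritical u hu => exact Or.inl ⟨u, hu, rfl, rfl⟩
  | innerLimit a y ha =>
    obtain ⟨-, hs, hy, l, r, h1, h2, h3, h4, h5⟩ := ha
    have har : ∀ n, ν.Around (toLex (y, (0 : ℝ))) n (l n) (r n) := fun n =>
      ⟨(h1 n).1, lex_zero_lt.2 (h1 n).2.1, lex_zero_lt.2 (h1 n).2.2⟩
    refine Or.inr ⟨hs, l, r, fun n => ⟨har n, ?_⟩, Or.inl ⟨rfl, y, y, h2, h3, ?_⟩⟩
    · obtain ⟨u, v, h6, h7⟩ := exists_around_fits hν (x := a) (m := n) (s := toLex (y, (0 : ℝ)))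
        fun B => by
          obtain ⟨m, h6, h7, h8⟩ := ((eventually_agree hs h4 B).and
            ((eventually_agree hs h5 B).and (eventually_ge_atTop n))).exists
          exact ⟨m, h8, _, _, har m, fun i hi _ => ⟨h6 i hi, h7 i hi⟩⟩
      obtain ⟨h8, h9⟩ := h6.unique (har n)
      rw [h8, h9] at h7
      exact h7
    · have key : ∀ L : ℕ → Itinerary A × ℝ, (∀ n, ν.InStages (L n)) →
          Tendsto (fun n => (L n).2) atTop (𝓝 y) → evConst L = 0 := fun L hL ht =>
        evConst_of_not fun u hu => by
          obtain ⟨n, hn⟩ := hu.exists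
          refine hy u (hn ▸ hL n) (tendsto_nhds_unique (tendsto_const_nhds.congr' ?_) ht)
          filter_upwards [hu] with n hn
          rw [hn]
      rw [key l (fun n => ⟨n, (h1 n).1.mem_left⟩) h2, key r (fun n => ⟨n, (h1 n).1.mem_right⟩) h3]
      simp
  | central u v c hc =>
    obtain ⟨N, hN⟩ := hc.1
    have hcc := diff_eq_top_iff.1 hc.2.1
    have har : ∀ n ≥ N, ν.Around (toLex ((u.2 + v.2) / 2, (0 : ℝ))) n u v := fun n hn =>
      ⟨hN.of_compat hn hcc, lex_zero_lt.2 (by linarith [hN.lt]),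
        lex_zero_lt.2 (by linarith [hN.lt])⟩
    have key : ∀ m, ∃ l r, ν.Around (toLex ((u.2 + v.2) / 2, (0 : ℝ))) m l r ∧
        Fits c l.1 r.1 := fun m => exists_around_fits hν fun B =>
      ⟨max m N, le_max_left _ _, u, v, har _ (le_max_right _ _), hc.fits B⟩
    choose L R hLR using key
    have hL : ∀ n ≥ N, L n = u ∧ R n = v := fun n hn => (hLR n).1.unique (har n hn)
    have h1 : ∀ᶠ n in atTop, L n = u := eventually_atTop.2 ⟨N, fun n hn => (hL n hn).1⟩
    have h2 : ∀ᶠ n in atTop, R n = v := eventually_atTop.2 ⟨N, fun n hn => (hL n hn).2⟩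
    refine Or.inr ⟨hc.2.2.2.1, L, R, hLR, Or.inl ⟨rfl, u.2, v.2, ?_, ?_, ?_⟩⟩
    · exact tendsto_const_nhds.congr' (h1.mono fun n hn => by simp only [hn])
    · exact tendsto_const_nhds.congr' (h2.mono fun n hn => by simp only [hn])
    · rw [evConst_of_eventually h1, evConst_of_eventually h2, sub_self]
  | rightLimit p hp u a ha =>
    obtain ⟨L, R, h1, h2⟩ := RightEnd.cells hν (Or.inl ha) one_pos
    obtain ⟨y, h3, h4, -⟩ := ha.fits hν
    have h5 : ∀ᶠ n in atTop, R n = y n := by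
      filter_upwards [h2, h3] with n hn hn'
      have := (h1 n).1.1
      rw [hn] at this
      exact this.right_unique hn'
    have h6 : Tendsto (fun n => (R n).2) atTop (𝓝 u.2) :=
      h4.congr' (h5.mono fun n hn => by simp only [hn])
    refine Or.inr ⟨ha.2.1, L, R, h1, Or.inl ⟨rfl, u.2, u.2,
      tendsto_const_nhds.congr' (h2.mono fun n hn => by simp only [hn]), h6, ?_⟩⟩
    rw [evConst_of_eventually h2, evConst_of_not]
    · simp
    · intro v hv
      obtain ⟨n, hn, hn'⟩ := (hv.and h2).exists
      have := (h1 n).1.1.lt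
      rw [hn, hn'] at this
      exact this.ne (tendsto_nhds_unique h6
        (tendsto_const_nhds.congr' (hv.mono fun n hn => by simp only [hn])))
  | leftLimit p hp u a ha =>
    obtain ⟨L, R, h1, h2⟩ := LeftEnd.cells hν (Or.inl ha) (z := -1) (by norm_num)
    obtain ⟨y, h3, h4, -⟩ := ha.fits hν
    have h5 : ∀ᶠ n in atTop, L n = y n := by
      filter_upwards [h2, h3] with n hn hn'
      have := (h1 n).1.1
      rw [hn] at this
      exact this.left_unique hn'
    have h6 : Tendsto (fun n => (L n).2) atTop (𝓝 u.2) :=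
      h4.congr' (h5.mono fun n hn => by simp only [hn])
    refine Or.inr ⟨ha.2.1, L, R, h1, Or.inl ⟨rfl, u.2, u.2, h6,
      tendsto_const_nhds.congr' (h2.mono fun n hn => by simp only [hn]), ?_⟩⟩
    rw [evConst_of_eventually h2, evConst_of_not]
    · simp
    · intro v hv
      obtain ⟨n, hn, hn'⟩ := (hv.and h2).exists
      have := (h1 n).1.1.lt
      rw [hn, hn'] at this
      exact this.ne (tendsto_nhds_unique
        (tendsto_const_nhds.congr' (hv.mono fun n hn => by simp only [hn])) h6)
  | fatouRight p hp u a ha t =>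
    obtain ⟨L, R, h1, h2⟩ := RightEnd.cells hν ha (sub_pos.2 t.2.2)
    exact Or.inr ⟨RightEnd.starFree ha, L, R, h1, Or.inr (Or.inl ⟨u, t, rfl, ha, h2, rfl⟩)⟩
  | fatouLeft p hp u a ha t =>
    obtain ⟨L, R, h1, h2⟩ := LeftEnd.cells hν ha (sub_neg.2 t.2.2)
    exact Or.inr ⟨LeftEnd.starFree ha, L, R, h1, Or.inr (Or.inr ⟨u, t, rfl, ha, h2, rfl⟩)⟩

theorem eq_of_cells (hν : ν.IsKneading) {L R : ℕ → Itinerary A × ℝ} {x y : Itinerary A}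
    (h : ∀ n, ν.Adjacent n (L n) (R n)) (hx : ∀ n, Fits x (L n).1 (R n).1)
    (hy : ∀ n, Fits y (L n).1 (R n).1) : x = y := by
  funext i
  exact (h (i + 1)).eq_of_fits_of_lt hν (hx _) (hy _) (Nat.lt_succ_self i)

/-- The last entry is the right neighbour of an entry, and the pair fits `ν`. -/
theorem exists_adjacent_self (hn : ν.StarFree) (n : ℕ) :
    ∃ l, ν.Adjacent n l (ν, 1) ∧ Fits ν l.1 ν := by
  obtain ⟨l, h | h⟩ := mem_stage_iff.1 (self_mem_stage (ν := ν) n)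
  · have := h.lt
    have h1 := (InStages.mem_Icc ⟨n, h.mem_right⟩).2
    simp only at this
    linarith
  · refine ⟨l, h, fun B i _ hi => ⟨?_, Or.inl rfl⟩⟩
    rcases hi i le_rfl with h | h | h
    · exact Or.inr h
    · exact absurd h (hn i)
    · exact Or.inl h

/-- The itinerary determines the cells, as only one pair of each stage fits it, and the cells
determine the position. The only sequence without ⋆ that might be an entry and a limit at once is a
non-periodic ν; but all cells that fit it have the entry ν as right bound, so they shrink to that
entry. -/
theorem _root_.OnPath.unique_pos (hν : ν.IsKneading) {z : TreePoint A} {s t : ℝ ×ₗ ℝ}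
    (hs : OnPath ν z s) (ht : OnPath ν z t) : s = t := by
  have aux : ∀ {t : ℝ ×ₗ ℝ} {u : Itinerary A × ℝ}, OnPath ν z t → ν.InStages u →
      z = .itinerary u.1 → z.body.StarFree → ∀ L R : ℕ → Itinerary A × ℝ,
      (∀ n, ν.Around t n (L n) (R n) ∧ Fits z.body (L n).1 (R n).1) → False := by
    intro t u ht hu hz hs L R hLR
    subst hz
    obtain ⟨rfl, hn⟩ := hu.starFree hν hs
    have hR : ∀ n, R n = (ν, 1) := fun n => by
      obtain ⟨l, h1, h2⟩ := exists_adjacent_self hn.1 n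
      exact ((hLR n).1.1.eq_of_fits hν h1 (hLR n).2 h2).2
    have h1 := (cells_tendsto (fun n => (hLR n).1) fun n => (hLR n).1.1.not_compat hn).2
    simp only [hR] at h1
    have h2 := tendsto_nhds_unique tendsto_const_nhds h1
    have h3 := ht.snd_eq_zero hn
    have h4 := (hLR 0).1.2.2
    rw [hR, Prod.Lex.lt_iff] at h4
    simp only [ofLex_toLex] at h4
    rw [← h2, h3] at h4
    simp at h4
  rcases hs.kind hν with ⟨u, hu, hz, h1⟩ | ⟨h1, L, R, h2, h3⟩
  · rcases ht.kind hν with ⟨u', hu', hz', h1'⟩ | ⟨h1', L', R', h2', h3'⟩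
    · rw [hz] at hz'
      obtain rfl := hu.eq_of_fst_eq hν hu' (by simpa using hz')
      rw [h1, h1']
    · exact (aux ht hu hz h1' L' R' h2').elim
  · rcases ht.kind hν with ⟨u', hu', hz', h1'⟩ | ⟨h1', L', R', h2', h3'⟩
    · exact (aux hs hu' hz' h1 L R h2).elim
    · have hL : L' = L := funext fun n =>
        ((h2' n).1.1.eq_of_fits hν (h2 n).1.1 (h2' n).2 (h2 n).2).1
      have hR : R' = R := funext fun n =>
        ((h2' n).1.1.eq_of_fits hν (h2 n).1.1 (h2' n).2 (h2 n).2).2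
      subst hL hR
      have hboth : ∀ {u v : Itinerary A × ℝ}, (∀ᶠ n in atTop, L' n = u) →
          (∀ᶠ n in atTop, R' n = v) → u ≠ v := by
        rintro u v hu hv rfl
        obtain ⟨n, hn, hn'⟩ := (hu.and hv).exists
        have := (h2 n).1.1.lt
        rw [hn, hn'] at this
        exact lt_irrefl _ this
      rcases h3 with ⟨hz, a, b, h4, h5, rfl⟩ | ⟨u, t, hz, h4, h5, rfl⟩ | ⟨u, t, hz, h4, h5, rfl⟩ <;>
      rcases h3' with ⟨hz', a', b', h4', h5', rfl⟩ | ⟨u', t', hz', h4', h5', rfl⟩ |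
        ⟨u', t', hz', h4', h5', rfl⟩
      · rw [tendsto_nhds_unique h4 h4', tendsto_nhds_unique h5 h5']
      · rw [hz] at hz'; cases hz'
      · rw [hz] at hz'; cases hz'
      · rw [hz'] at hz; cases hz
      · rw [hz] at hz'
        simp only [TreePoint.body, TreePoint.fatou.injEq, true_and] at hz'
        obtain rfl := h4.inStages.eq_of_fst_eq hν h4'.inStages hz'.1
        rw [hz'.2]
      · rw [hz] at hz'
        simp only [TreePoint.body, TreePoint.fatou.injEq, true_and] at hz'
        exact absurd (h4.inStages.eq_of_fst_eq hν h4'.inStages hz'.1) (hboth h5 h5')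
      · rw [hz'] at hz; cases hz
      · rw [hz] at hz'
        simp only [TreePoint.body, TreePoint.fatou.injEq, true_and] at hz'
        exact absurd (h4'.inStages.eq_of_fst_eq hν h4.inStages hz'.1.symm) (hboth h5' h5)
      · rw [hz] at hz'
        simp only [TreePoint.body, TreePoint.fatou.injEq, true_and] at hz'
        obtain rfl := h4.inStages.eq_of_fst_eq hν h4'.inStages hz'.1
        rw [hz'.2]

theorem evConst_eq (L : ℕ → Itinerary A × ℝ) : evConst L = 1 ∨ evConst L = 0 := by
  unfold evConst
  split_ifs
  · exact Or.inl rfl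
  · exact Or.inr rfl

/-- The position determines the cells, and these determine the itinerary without ⋆. Itineraries and
interior points of Fatou intervals are told apart by the second coordinate, which is `0`, `1` or
`-1` only for the former. -/
theorem _root_.OnPath.unique_point (hν : ν.IsKneading) {z z' : TreePoint A} {s : ℝ ×ₗ ℝ}
    (hz : OnPath ν z s) (hz' : OnPath ν z' s) : z = z' := by
  rcases hz.kind hν with ⟨u, hu, h0, h1⟩ | ⟨h1, L, R, h2, h3⟩
  · rcases hz'.kind hν with ⟨u', hu', h0', h1'⟩ | ⟨h1', L', R', h2', h3'⟩
    · have h2 : u.2 = u'.2 := by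
        have := congrArg (fun s => (ofLex s).1) (h1.symm.trans h1')
        simpa using this
      rw [h0, h0', hu.eq_of_snd_eq hu' h2]
    · obtain ⟨n, hn⟩ := hu
      exact absurd h1 ((h2' n).1.not_mem hn)
  · rcases hz'.kind hν with ⟨u', hu', h0', h1'⟩ | ⟨h1', L', R', h2', h3'⟩
    · obtain ⟨n, hn⟩ := hu'
      exact absurd h1' ((h2 n).1.not_mem hn)
    · have hL : L' = L := funext fun n => ((h2' n).1.unique (h2 n).1).1
      have hR : R' = R := funext fun n => ((h2' n).1.unique (h2 n).1).2
      subst hL hR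
      have hb := eq_of_cells hν (fun n => (h2 n).1.1) (fun n => (h2 n).2) (fun n => (h2' n).2)
      have hnum : evConst L' - evConst R' = 0 ∨ evConst L' - evConst R' = 1 ∨
          evConst L' - evConst R' = -1 := by
        rcases evConst_eq L' with h | h <;> rcases evConst_eq R' with h' | h' <;> rw [h, h'] <;>
          norm_num
      rcases h3 with ⟨h0, a, b, h4, h5, h6⟩ | ⟨u, t, h0, h4, h5, h6⟩ | ⟨u, t, h0, h4, h5, h6⟩ <;>
      rcases h3' with ⟨h0', a', b', h4', h5', h6'⟩ | ⟨u', t', h0', h4', h5', h6'⟩ |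
        ⟨u', t', h0', h4', h5', h6'⟩ <;>
      have h7 := congrArg (fun s => (ofLex s).2) (h6.symm.trans h6') <;>
      simp only [ofLex_toLex] at h7
      · rw [h0, h0', hb]
      · have := t'.2.1; have := t'.2.2
        rcases hnum with h | h | h <;> linarith
      · have := t'.2.1; have := t'.2.2
        rcases hnum with h | h | h <;> linarith
      · have := t.2.1; have := t.2.2
        rcases hnum with h | h | h <;> linarith
      · obtain ⟨n, hn, hn'⟩ := (h5.and h5').exists
        rw [h0, h0', hb, ← hn, ← hn', show t = t' from Subtype.ext (by linarith)]
      · have := t.2.2; have := t'.2.2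
        linarith
      · have := t.2.1; have := t.2.2
        rcases hnum with h | h | h <;> linarith
      · have := t.2.2; have := t'.2.2
        linarith
      · obtain ⟨n, hn, hn'⟩ := (h5.and h5').exists
        rw [h0, h0', hb, ← hn, ← hn', show t = t' from Subtype.ext (by linarith)]

/-! ### Membership in `X_ν` -/

theorem drop_prepend (w : List A) (a : Itinerary A) : drop w.length (prepend w a) = a := by
  funext i
  simp only [drop_apply, prepend]
  rw [dif_neg (by omega), Nat.add_sub_cancel]

theorem StarFree.mem_X {x : Itinerary A} (hx : x.StarFree) (h : ∀ n, Itinerary.drop (n + 1) x ≠ ν) :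
    x ∈ ν.X := by
  refine Or.inr ⟨hx, fun w hw he => ?_⟩
  obtain ⟨n, hn⟩ : ∃ n, w.length = n + 1 := ⟨w.length - 1, by
    have := List.length_pos_iff.2 hw; omega⟩
  apply h n
  rw [← hn, he, drop_prepend]

theorem StarFree.drop_ne_of_mem_X {x : Itinerary A} (hx : x.StarFree) (h : x ∈ ν.X) (n : ℕ) :
    Itinerary.drop (n + 1) x ≠ ν := by
  intro he
  rcases h with ⟨m, w, -, hw⟩ | ⟨-, h⟩
  · apply hx w.length
    have := congrFun (drop_prepend w ν.star) 0
    rw [← hw] at this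
    simpa [star] using this
  · apply h (List.ofFn fun i : Fin (n + 1) => (x i).get (Option.ne_none_iff_isSome.1 (hx i)))
    · rw [ne_eq, List.ofFn_eq_nil_iff]; omega
    · funext i
      unfold prepend
      split_ifs with hi
      · simp only [List.getElem_ofFn, Option.some_get]
      · rw [← he]
        rw [List.length_ofFn] at hi ⊢
        rw [drop_apply]
        congr 1; omega

theorem IsStarPeriodic.mem_X {p : ℕ} (h : ν.IsStarPeriodic p) {x : Itinerary A}
    (hx : x.StarFree) : x ∈ ν.X := hx.mem_X fun n he => by
  have : ν (p - 1) = none := (h.2.2 _).2 (by rw [Nat.sub_add_cancel h.1])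
  rw [← he] at this
  exact hx _ this

theorem StarFree.proper {x : Itinerary A} (hx : x.StarFree) (h : x ∈ ν.X) : ν.Proper x := fun i =>
  ⟨fun hi => absurd hi (hx i), fun hi => absurd hi (hx.drop_ne_of_mem_X h i)⟩

theorem Proper.mem_X {x : Itinerary A} (h : ν.Proper x) (hx : x.StarFree) : x ∈ ν.X :=
  hx.mem_X fun n he => hx n ((h n).2 he)

end Itinerary

namespace Itinerary

variable {A : Type*} {ν : Itinerary A}

/-! ### Nested cells and tracks -/

/-- The precritical point whose itinerary starts with the first `k` symbols of `x` and then continues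
with `⋆ν`. -/
def starAt (ν x : Itinerary A) (k : ℕ) : Itinerary A := fun i =>
  if i < k then x i else ν.star (i - k)

theorem starAt_of_lt {x : Itinerary A} {i k : ℕ} (h : i < k) : starAt ν x k i = x i := if_pos h

theorem drop_starAt (x : Itinerary A) (k : ℕ) : drop k (starAt ν x k) = ν.star := by
  funext i
  simp only [drop_apply, starAt]
  rw [if_neg (by omega), Nat.add_sub_cancel]

theorem track_starAt (x : Itinerary A) (k : ℕ) : track ν x k (starAt ν x k) = ν.star := by
  rw [track_eq_drop fun i hi => Or.inl (starAt_of_lt hi), drop_starAt]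

theorem drop_starAt_add (x : Itinerary A) (m k : ℕ) :
    drop m (starAt ν x (m + k)) = starAt ν (drop m x) k := by
  funext i
  simp only [drop_apply, starAt]
  by_cases h : i < k
  · rw [if_pos (by omega), if_pos h]
  · rw [if_neg (by omega), if_neg h]; congr 1; omega

theorem IsMid.eq_starAt {a b m x : Itinerary A} {k : ℕ} (h : ν.IsMid a b k m)
    (hf : Fits x a b) (hs : ∀ i, ¬ (a i = none ∧ b i = none)) : m = starAt ν x k := by
  funext i
  rcases lt_trichotomy i k with hi | rfl | hi
  · rw [starAt_of_lt hi]
    obtain ⟨h1, h2, h3⟩ := h.lt i hi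
    obtain ⟨h4, h5⟩ := hf k i hi fun j hj => h.split.1 j (by omega)
    have h6 := hs i
    rcases h2 with h2 | h2
    · rcases h4 with h4 | h4
      · exact h2.symm.trans h4
      · exact absurd (h2.symm.trans h4) h1
    · rcases h3 with h3 | h3
      · rcases h5 with h5 | h5
        · exact h3.symm.trans h5
        · exact absurd (h3.symm.trans h5) h1
      · exact absurd ⟨h2, h3⟩ h6
  · simp [starAt, star, h.eq]
  · obtain ⟨j, rfl⟩ := Nat.exists_eq_add_of_lt hi
    have h1 : m (k + j + 1) = ν j := by
      rw [← h.drop, drop_apply]; congr 1; omega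
    rw [h1, starAt, if_neg (by omega), show k + j + 1 - k = j + 1 by omega]; rfl

section Cells

variable {s : ℝ ×ₗ ℝ} {L R : ℕ → Itinerary A × ℝ} {x : Itinerary A}

/-- The step from a cell to the next smaller cell. -/
theorem cells_succ (hν : ν.IsKneading) (h : ∀ n, ν.Around s n (L n) (R n))
    (hf : ∀ n, Fits x (L n).1 (R n).1) {n : ℕ} (hc : ¬ Compat (L n).1 (R n).1) :
    ∃ k, n ≤ k ∧ Split (L n).1 (R n).1 k ∧ (ν.mid (L n) (R n)).1 = starAt ν x k ∧
      track ν x k ν.star = drop k (L n).1 ∧ track ν x k ν = drop k (R n).1 ∧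
      (((L n).1 k = x k ∧ L (n + 1) = L n ∧ R (n + 1) = ν.mid (L n) (R n)) ∨
        ((R n).1 k = x k ∧ R (n + 1) = R n ∧ L (n + 1) = ν.mid (L n) (R n))) ∧
      ν.Runs x ν.star ν (L (n + 1)).1 (R (n + 1)).1 (k + 1) := by
  obtain ⟨k, hk⟩ := exists_split (diff_eq_top_iff.not.2 hc)
  have hm := (h n).1.isMid hν hk
  obtain ⟨N, hN, hn⟩ := (h n).1.exists_runs hν (hf n)
  have hNk := hN.reduces.le hk
  have hfit : ∀ i < k, ((L n).1 i = x i ∨ (L n).1 i = none) ∧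
      ((R n).1 i = x i ∨ (R n).1 i = none) := fun i hi =>
    hf n k i hi fun j hj => hk.1 j (by omega)
  have hrest := (h n).succ (h (n + 1))
  refine ⟨k, (hn.resolve_right hc).trans hNk, hk, hm.eq_starAt (hf n) ((h n).1.not_none hν),
    hN.track_left hν hNk fun i _ hi => (hfit i hi).1,
    hN.symm.track_left hν hNk fun i _ hi => (hfit i hi).2, ?_⟩
  rcases hrest with ⟨h1, -, -⟩ | ⟨-, -, ⟨h1, h2⟩ | ⟨h1, h2⟩⟩
  · exact absurd h1 hc
  · have h3 := hf (n + 1)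
    rw [h1, h2] at h3 ⊢
    have h4 := h3.eq_of_child hν hN.reduces hm
    exact ⟨Or.inl ⟨h4, rfl, rfl⟩, hN.child hν hm (hf n) h4⟩
  · have h3 := hf (n + 1)
    rw [h1, h2] at h3 ⊢
    have h4 := h3.symm.eq_of_child hν hN.reduces.symm hm.symm
    exact ⟨Or.inr ⟨h4, rfl, rfl⟩, (hN.symm.child hν hm.symm (hf n).symm h4).symm⟩

/-- The times at which the track of `a` along `x` leaves `x`, but is not at `⋆ν`. -/
def Leaves (ν x a : Itinerary A) (k : ℕ) : Prop :=
  track ν x k a 0 ≠ none ∧ track ν x k a 0 ≠ x k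

/-- Where the track of `⋆ν` or `ν` leaves `x`, the nested cells become smaller. -/
theorem cells_of_leaves (hν : ν.IsKneading) (h : ∀ n, ν.Around s n (L n) (R n))
    (hf : ∀ n, Fits x (L n).1 (R n).1) (hc : ∀ n, ¬ Compat (L n).1 (R n).1) (n₀ : ℕ) :
    ∃ K, ∀ k ≥ K, (ν.Leaves x ν.star k → ∃ n ≥ n₀, (L (n + 1)).1 = starAt ν x k) ∧
      (ν.Leaves x ν k → ∃ n ≥ n₀, (R (n + 1)).1 = starAt ν x k) := by
  classical
  choose K hK using fun n => cells_succ hν h hf (hc n)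
  refine ⟨K n₀, fun k hk => ?_⟩
  -- the first cell which is divided at `k` or later
  have hex : ∃ n, n₀ ≤ n ∧ k ≤ K n := ⟨max n₀ k, le_max_left _ _,
    (le_max_right n₀ k).trans (hK _).1⟩
  obtain ⟨n, hnfind⟩ : ∃ n, n = Nat.find hex := ⟨_, rfl⟩
  obtain ⟨hn, hkn⟩ : n₀ ≤ n ∧ k ≤ K n := hnfind ▸ Nat.find_spec hex
  have key : k = K n ∨ ∃ M ≤ k, ν.Runs x ν.star ν (L n).1 (R n).1 M := by
    rcases eq_or_lt_of_le hn with h0 | h0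
    · left; rw [← h0] at hkn ⊢; omega
    · right
      obtain ⟨m, hm⟩ : ∃ m, n = m + 1 := ⟨n - 1, by omega⟩
      have h1 : ¬ (n₀ ≤ m ∧ k ≤ K m) := Nat.find_min hex (by omega)
      have h2 := (hK m).2.2.2.2.2.2
      rw [← hm] at h2
      exact ⟨K m + 1, by omega, h2⟩
  obtain ⟨-, hs, hmid, hl, hr, hor, -⟩ := hK n
  have hfit : ∀ i < K n, ((L n).1 i = x i ∨ (L n).1 i = none) ∧
      ((R n).1 i = x i ∨ (R n).1 i = none) := fun i hi =>
    hf n (K n) i hi fun j hj => hs.1 j (by omega)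
  -- Strictly before the position where the cell is divided, both bounds agree with `x` up to ⋆. A
  -- track cannot leave `x` there, so `k` is the position of the division.
  have hkey : (ν.Leaves x ν.star k → k = K n) ∧ (ν.Leaves x ν k → k = K n) := by
    rcases key with h1 | ⟨M, hM, hR⟩
    · exact ⟨fun _ => h1, fun _ => h1⟩
    have h2 := hR.track_left hν hM fun i _ hi => (hfit i (by omega)).1
    have h3 := hR.symm.track_left hν hM fun i _ hi => (hfit i (by omega)).2
    constructor
    · intro hle
      by_contra hne
      unfold Leaves at hle
      rw [h2, drop_apply, zero_add] at hle
      rcases (hfit k (by omega)).1 with h4 | h4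
      · exact hle.2 h4
      · exact hle.1 h4
    · intro hle
      by_contra hne
      unfold Leaves at hle
      rw [h3, drop_apply, zero_add] at hle
      rcases (hfit k (by omega)).2 with h4 | h4
      · exact hle.2 h4
      · exact hle.1 h4
  constructor
  · intro hle
    obtain rfl := hkey.1 hle
    unfold Leaves at hle
    rw [hl, drop_apply, zero_add] at hle
    rcases hor with ⟨h1, -, -⟩ | ⟨-, -, h1⟩
    · exact absurd h1 hle.2
    · exact ⟨n, hn, by rw [h1, hmid]⟩
  · intro hle
    obtain rfl := hkey.2 hle
    unfold Leaves at hle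
    rw [hr, drop_apply, zero_add] at hle
    rcases hor with ⟨-, -, h1⟩ | ⟨h1, -, -⟩
    · exact ⟨n, hn, by rw [h1, hmid]⟩
    · exact absurd h1 hle.2

theorem leaves_of_cells_left (hν : ν.IsKneading) (h : ∀ n, ν.Around s n (L n) (R n))
    (hf : ∀ n, Fits x (L n).1 (R n).1) {n : ℕ} (hne : L (n + 1) ≠ L n) :
    ∃ k ≥ n, ν.Leaves x ν.star k := by
  have hc : ¬ Compat (L n).1 (R n).1 := fun hc => hne (cells_const h n.le_succ hc).1
  obtain ⟨k, hk, hs, -, hl, -, ⟨-, h1, -⟩ | ⟨h1, -, -⟩, -⟩ := cells_succ hν h hf hc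
  · exact absurd h1 hne
  · refine ⟨k, hk, ?_, ?_⟩
    · rw [hl, drop_apply, zero_add]; exact hs.ne.1
    · rw [hl, drop_apply, zero_add, ← h1]; exact hs.ne.2.2

theorem leaves_of_cells_right (hν : ν.IsKneading) (h : ∀ n, ν.Around s n (L n) (R n))
    (hf : ∀ n, Fits x (L n).1 (R n).1) {n : ℕ} (hne : R (n + 1) ≠ R n) :
    ∃ k ≥ n, ν.Leaves x ν k := by
  have hc : ¬ Compat (L n).1 (R n).1 := fun hc => hne (cells_const h n.le_succ hc).2
  obtain ⟨k, hk, hs, -, -, hr, ⟨h1, -, -⟩ | ⟨-, h1, -⟩, -⟩ := cells_succ hν h hf hc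
  · refine ⟨k, hk, ?_, ?_⟩
    · rw [hr, drop_apply, zero_add]; exact hs.ne.2.1
    · rw [hr, drop_apply, zero_add, ← h1]; exact hs.ne.2.2.symm
  · exact absurd h1 hne

theorem eventually_const_of_succ {α : Type*} {f : ℕ → α} {N : ℕ}
    (h : ∀ n ≥ N, f (n + 1) = f n) : ∀ᶠ n in atTop, f n = f N := by
  refine eventually_atTop.2 ⟨N, fun n hn => ?_⟩
  induction n, hn using Nat.le_induction with
  | base => rfl
  | succ n hn ih => rw [h n hn, ih]

/-- If the left ends are not eventually constant then the track of `⋆ν` leaves `x` infinitely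
often. -/
theorem leaves_star (hν : ν.IsKneading) (h : ∀ n, ν.Around s n (L n) (R n))
    (hf : ∀ n, Fits x (L n).1 (R n).1) (hL : ∀ u, ¬ ∀ᶠ n in atTop, L n = u) (K : ℕ) :
    ∃ k ≥ K, ν.Leaves x ν.star k := by
  by_contra! hc
  refine hL (L K) (eventually_const_of_succ fun n hn => ?_)
  by_contra hne
  obtain ⟨k, hk, hl⟩ := leaves_of_cells_left hν h hf hne
  exact hc k (hn.trans hk) hl

theorem leaves_self (hν : ν.IsKneading) (h : ∀ n, ν.Around s n (L n) (R n))
    (hf : ∀ n, Fits x (L n).1 (R n).1) (hR : ∀ u, ¬ ∀ᶠ n in atTop, R n = u) (K : ℕ) :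
    ∃ k ≥ K, ν.Leaves x ν k := by
  by_contra! hc
  refine hR (R K) (eventually_const_of_succ fun n hn => ?_)
  by_contra hne
  obtain ⟨k, hk, hl⟩ := leaves_of_cells_right hν h hf hne
  exact hc k (hn.trans hk) hl

theorem not_eventually_left (h : ∀ n, ν.Around s n (L n) (R n))
    (hc : ∀ n, ¬ Compat (L n).1 (R n).1) (hs : ∀ u, ν.InStages u → u.2 ≠ (ofLex s).1)
    (u : Itinerary A × ℝ) : ¬ ∀ᶠ n in atTop, L n = u := by
  intro hu
  obtain ⟨n, hn⟩ := hu.exists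
  refine hs u ⟨n, hn ▸ (h n).1.mem_left⟩ (tendsto_nhds_unique ?_ (cells_tendsto h hc).1)
  exact tendsto_const_nhds.congr' (hu.mono fun n hn => by simp only [hn])

theorem not_eventually_right (h : ∀ n, ν.Around s n (L n) (R n))
    (hc : ∀ n, ¬ Compat (L n).1 (R n).1) (hs : ∀ u, ν.InStages u → u.2 ≠ (ofLex s).1)
    (u : Itinerary A × ℝ) : ¬ ∀ᶠ n in atTop, R n = u := by
  intro hu
  obtain ⟨n, hn⟩ := hu.exists
  refine hs u ⟨n, hn ▸ (h n).1.mem_right⟩ (tendsto_nhds_unique ?_ (cells_tendsto h hc).2)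
  exact tendsto_const_nhds.congr' (hu.mono fun n hn => by simp only [hn])

/-- All points of the critical orbit other than `ν` are on the same side of `ν`. -/
theorem Crit.merge_star {a : Itinerary A} (ha : ν.Crit a) (hne : a ≠ ν) :
    ν.Merge ν a ν.star := by
  obtain ⟨m, rfl⟩ := ha
  rcases m with _ | m
  · rfl
  · rw [drop_succ_star] at hne ⊢
    exact (drop_self_eq_or_merge m).resolve_left hne

theorem track_self (x : Itinerary A) (n : ℕ) : track ν x n x = drop n x :=
  track_eq_drop fun _ _ => Or.inl rfl

/-- Suppose that `x` has a tail ν. If the track of ⋆ν or of ν is at ν there, it never leaves `x`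
again, although both bounds move infinitely often. Otherwise both tracks are critical orbit points
different from ν, hence on the same side of ν, and `x` would not separate ⋆ν from ν. -/
theorem proper_of_cells (hν : ν.IsKneading) (h : ∀ n, ν.Around s n (L n) (R n))
    (hf : ∀ n, Fits x (L n).1 (R n).1) (hx : x.StarFree)
    (hL : ∀ u, ¬ ∀ᶠ n in atTop, L n = u) (hR : ∀ u, ¬ ∀ᶠ n in atTop, R n = u) : ν.Proper x := by
  intro i
  refine ⟨fun hi => absurd hi (hx i), fun hi => ?_⟩
  exfalso
  rcases id hν with hn | ⟨p, hp, hs⟩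
  swap
  · have : ν (p - 1) = none := (hs.2.2 _).2 (by rw [Nat.sub_add_cancel hs.1])
    rw [← hi] at this
    exact hx _ this
  have hm := not_merge_of_fits hν fun n => ⟨_, _, (h n).1, hf n⟩
  have key : ∀ a, track ν x (i + 1) a = ν → ∀ k ≥ i + 1, ¬ ν.Leaves x a k := by
    intro a ha k hk hle
    obtain ⟨j, rfl⟩ := Nat.exists_eq_add_of_le hk
    apply hle.2
    rw [track_add, ha, hi, track_self, drop_apply, ← hi, drop_apply]
    congr 1; omega
  by_cases h1 : track ν x (i + 1) ν.star = ν
  · obtain ⟨k, hk, hle⟩ := leaves_star hν h hf hL (i + 1)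
    exact key _ h1 k hk hle
  by_cases h2 : track ν x (i + 1) ν = ν
  · obtain ⟨k, hk, hle⟩ := leaves_self hν h hf hR (i + 1)
    exact key _ h2 k hk hle
  apply hm
  rw [← merge_track_iff (i + 1), hi]
  exact ((crit_star.track _ _).merge_star h1).trans ((crit_self.track _ _).merge_star h2).symm

/-- What there is around a position which is not the position of an element of a stage. -/
theorem around_cases (hν : ν.IsKneading) (h : ∀ n, ν.Around s n (L n) (R n)) :
    ∃ x : Itinerary A, x.StarFree ∧ (∀ n, Fits x (L n).1 (R n).1) ∧
      ((∃ n, ν.IsCentral (L n) (R n) x) ∨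
      ((∀ n, ¬ Compat (L n).1 (R n).1) ∧ (∀ u, ν.InStages u → u.2 ≠ (ofLex s).1) ∧
        ν.IsInnerLimit x (ofLex s).1) ∨
      ((∀ n, ¬ Compat (L n).1 (R n).1) ∧ ∃ u, ν.InStages u ∧ u.2 = (ofLex s).1 ∧
        ((0 < (ofLex s).2 ∧ (∀ᶠ n in atTop, L n = u) ∧ (x ∈ ν.X → ν.IsRightLimit u x)) ∨
          ((ofLex s).2 < 0 ∧ (∀ᶠ n in atTop, R n = u) ∧ (x ∈ ν.X → ν.IsLeftLimit u x))))) := by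
  obtain ⟨x, hx, hf⟩ := exists_fits hν h
  refine ⟨x, hx, hf, ?_⟩
  by_cases hc : ∃ n, Compat (L n).1 (R n).1
  · left
    obtain ⟨n, hc⟩ := hc
    refine ⟨n, ⟨n, (h n).1⟩, diff_eq_top_iff.2 hc, ?_, hx, diff_eq_top_iff.2 fun i => ?_,
      diff_eq_top_iff.2 fun i => ?_⟩
    · rcases id hν with hn | ⟨p, hp, hs⟩
      · exact absurd hc ((h n).1.not_compat hn)
      · exact hs.mem_X hx
    · rcases (hf n (i + 1) i (by omega) fun j _ => hc j).1 with h | h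
      · exact Or.inr (Or.inr h)
      · exact Or.inl h
    · rcases (hf n (i + 1) i (by omega) fun j _ => hc j).2 with h | h
      · exact Or.inr (Or.inr h.symm)
      · exact Or.inr (Or.inl h)
  right
  push Not at hc
  obtain ⟨ht1, ht2⟩ := cells_tendsto h hc
  obtain ⟨hd1, hd2⟩ := tendsto_diff_of_fits hν (fun n => (h n).1) hf
  by_cases hs : ∀ u, ν.InStages u → u.2 ≠ (ofLex s).1
  · left
    refine ⟨hc, hs, ?_, hx, hs, L, R, fun n => ⟨(h n).1, ?_, ?_⟩, ht1, ht2, hd1, hd2⟩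
    · exact (proper_of_cells hν h hf hx (not_eventually_left h hc hs)
        (not_eventually_right h hc hs)).mem_X hx
    · exact lt_of_le_of_ne (h n).le.1 (hs _ ⟨n, (h n).1.mem_left⟩)
    · exact lt_of_le_of_ne (h n).le.2 (hs _ ⟨n, (h n).1.mem_right⟩).symm
  · right
    push Not at hs
    obtain ⟨u, hu, hus⟩ := hs
    refine ⟨hc, u, hu, hus, ?_⟩
    obtain ⟨N, hN⟩ := hu
    have hse : s = toLex (u.2, (ofLex s).2) := by rw [hus]; rfl
    rcases lt_trichotomy (ofLex s).2 0 with h0 | h0 | h0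
    · right
      have hR : ∀ n ≥ N, R n = u := fun n hn => by
        have h1 := (h n).2.1
        rw [hse, Prod.Lex.toLex_lt_toLex] at h1
        have h2 : (L n).2 < u.2 := h1.resolve_right fun hc => by linarith [hc.2]
        have h3 := (h n).le.2
        rcases (h n).1.sep (stage_subset hn hN) with (h4 | h4) | (h4 | h4)
        · rw [h4] at h2; exact absurd h2 (lt_irrefl _)
        · linarith
        · exact h4.symm
        · linarith
      have hR' : ∀ᶠ n in atTop, R n = u := eventually_atTop.2 ⟨N, hR⟩
      refine ⟨h0, hR', fun hX => ⟨hX, hx, L, ?_, by rwa [hus], hd1⟩⟩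
      filter_upwards [hR'] with n hn
      rw [← hn]; exact (h n).1
    · refine absurd ?_ ((h N).not_mem hN)
      rw [hse, h0]
    · left
      have hL : ∀ n ≥ N, L n = u := fun n hn => by
        have h1 := (h n).2.2
        rw [hse, Prod.Lex.toLex_lt_toLex] at h1
        have h2 : u.2 < (R n).2 := h1.resolve_right fun hc => by linarith [hc.2]
        have h3 := (h n).le.1
        rcases (h n).1.sep (stage_subset hn hN) with (h4 | h4) | (h4 | h4)
        · exact h4.symm
        · linarith
        · rw [h4] at h2; exact absurd h2 (lt_irrefl _)
        · linarith
      have hL' : ∀ᶠ n in atTop, L n = u := eventually_atTop.2 ⟨N, hL⟩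
      refine ⟨h0, hL', fun hX => ⟨hX, hx, R, ?_, by rwa [hus], hd2⟩⟩
      filter_upwards [hL'] with n hn
      rw [← hn]; exact (h n).1

end Cells

theorem exists_cells {s : ℝ ×ₗ ℝ} (h0 : toLex (0, (0 : ℝ)) < s) (h1 : s < toLex (1, (0 : ℝ)))
    (hs : ∀ u, ν.InStages u → s ≠ toLex (u.2, 0)) :
    ∃ L R : ℕ → Itinerary A × ℝ, ∀ n, ν.Around s n (L n) (R n) := by
  choose L R h using exists_around h0 h1 hs
  exact ⟨L, R, h⟩

theorem exists_rightEnd {p : ℕ} (hν : ν.IsKneading) (hs : ν.IsStarPeriodic p) {u : Itinerary A × ℝ}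
    (hu : ν.InStages u) (h1 : u.2 < 1) : ∃ a, ν.RightEnd u a := by
  have h0 := hu.mem_Icc.1
  obtain ⟨L, R, h⟩ := exists_cells (ν := ν) (s := toLex (u.2, (1 : ℝ)))
    (by rw [Prod.Lex.toLex_lt_toLex]; rcases h0.lt_or_eq with h | h
        · exact Or.inl h
        · exact Or.inr ⟨h, one_pos⟩)
    (by rw [Prod.Lex.toLex_lt_toLex]; exact Or.inl h1)
    (fun v _ hc => by simpa using congrArg (fun s => (ofLex s).2) hc)
  obtain ⟨N, hN⟩ := hu
  obtain ⟨x, hx, hf, ⟨n, hc⟩ | ⟨-, h2, -⟩ | ⟨-, v, h2, h3, ⟨-, h4, h5⟩ | ⟨h4, -, -⟩⟩⟩ :=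
    around_cases hν h
  · refine ⟨x, Or.inr ⟨R n, ?_⟩⟩
    have hcc := diff_eq_top_iff.1 hc.2.1
    have h3 := (h n).1.of_compat (le_max_left n N) hcc
    have h4 := (h n).2
    have h5 := (h n).le
    have : L n = u := by
      have h6 := h3.lt
      have h7 := (h n).2.2
      rw [Prod.Lex.toLex_lt_toLex] at h7
      have h8 : u.2 < (R n).2 := h7.resolve_right fun hc => by linarith [hc.2]
      simp only [ofLex_toLex] at h5
      rcases h3.sep (stage_subset (le_max_right n N) hN) with (h9 | h9) | (h9 | h9)
      · exact h9.symm
      · linarith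
      · rw [h9] at h8; exact absurd h8 (lt_irrefl _)
      · linarith
    rw [← this]; exact hc
  · exact absurd rfl (h2 u ⟨N, hN⟩)
  · obtain rfl := h2.eq_of_snd_eq ⟨N, hN⟩ h3
    exact ⟨x, Or.inl (h5 (hs.mem_X hx))⟩
  · simp only [ofLex_toLex] at h4; linarith

theorem exists_leftEnd {p : ℕ} (hν : ν.IsKneading) (hs : ν.IsStarPeriodic p) {u : Itinerary A × ℝ}
    (hu : ν.InStages u) (h1 : 0 < u.2) : ∃ a, ν.LeftEnd u a := by
  have h0 := hu.mem_Icc.2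
  obtain ⟨L, R, h⟩ := exists_cells (ν := ν) (s := toLex (u.2, (-1 : ℝ)))
    (by rw [Prod.Lex.toLex_lt_toLex]; exact Or.inl h1)
    (by rw [Prod.Lex.toLex_lt_toLex]; rcases h0.lt_or_eq with h | h
        · exact Or.inl h
        · exact Or.inr ⟨h, by norm_num⟩)
    (fun v _ hc => by simpa using congrArg (fun s => (ofLex s).2) hc)
  obtain ⟨N, hN⟩ := hu
  obtain ⟨x, hx, hf, ⟨n, hc⟩ | ⟨-, h2, -⟩ | ⟨-, v, h2, h3, ⟨h4, -, -⟩ | ⟨-, h4, h5⟩⟩⟩ :=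
    around_cases hν h
  · refine ⟨x, Or.inr ⟨L n, ?_⟩⟩
    have hcc := diff_eq_top_iff.1 hc.2.1
    have h3 := (h n).1.of_compat (le_max_left n N) hcc
    have h5 := (h n).le
    have : R n = u := by
      have h6 := h3.lt
      have h7 := (h n).2.1
      rw [Prod.Lex.toLex_lt_toLex] at h7
      have h8 : (L n).2 < u.2 := h7.resolve_right fun hc => by linarith [hc.2]
      simp only [ofLex_toLex] at h5
      rcases h3.sep (stage_subset (le_max_right n N) hN) with (h9 | h9) | (h9 | h9)
      · rw [h9] at h8; exact absurd h8 (lt_irrefl _)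
      · linarith
      · exact h9.symm
      · linarith
    rw [← this]; exact hc
  · exact absurd rfl (h2 u ⟨N, hN⟩)
  · simp only [ofLex_toLex] at h4; linarith
  · obtain rfl := h2.eq_of_snd_eq ⟨N, hN⟩ h3
    exact ⟨x, Or.inl (h5 (hs.mem_X hx))⟩

end Itinerary

namespace Itinerary

variable {A : Type*} {ν : Itinerary A}

/-! ### The linear order of the critical path -/

theorem _root_.OnPath.snd_mem {z : TreePoint A} {s : ℝ ×ₗ ℝ} (h : OnPath ν z s) :
    (ofLex s).2 ∈ Icc (-1 : ℝ) 1 := by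
  cases h with
  | precritical => norm_num
  | innerLimit => norm_num
  | central => norm_num
  | rightLimit => norm_num
  | leftLimit => norm_num
  | fatouRight p hp u a ha t =>
    have := t.2.1; have := t.2.2
    constructor <;> simp only [ofLex_toLex] <;> linarith
  | fatouLeft p hp u a ha t =>
    have := t.2.1; have := t.2.2
    constructor <;> simp only [ofLex_toLex] <;> linarith

theorem _root_.OnPath.snd_eq_zero_or {z : TreePoint A} {s : ℝ ×ₗ ℝ} (h : OnPath ν z s) :
    (ofLex s).2 = 0 ∨ ∃ u, ν.InStages u ∧ u.2 = (ofLex s).1 := by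
  cases h with
  | precritical u hu => exact Or.inl rfl
  | innerLimit => exact Or.inl rfl
  | central => exact Or.inl rfl
  | rightLimit p hp u a ha => exact Or.inr ⟨u, RightEnd.inStages (Or.inl ha), rfl⟩
  | leftLimit p hp u a ha => exact Or.inr ⟨u, LeftEnd.inStages (Or.inl ha), rfl⟩
  | fatouRight p hp u a ha t => exact Or.inr ⟨u, RightEnd.inStages ha, rfl⟩
  | fatouLeft p hp u a ha t => exact Or.inr ⟨u, LeftEnd.inStages ha, rfl⟩

theorem _root_.OnPath.mem_Icc (hν : ν.IsKneading) {z : TreePoint A} {s : ℝ ×ₗ ℝ}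
    (h : OnPath ν z s) : s ∈ Icc (toLex ((0 : ℝ), (0 : ℝ))) (toLex (1, 0)) := by
  rcases h.kind hν with ⟨u, hu, -, rfl⟩ | ⟨-, L, R, h1, -⟩
  · constructor
    · rw [← not_lt, lex_zero_lt, not_lt]; exact hu.mem_Icc.1
    · rw [← not_lt, lex_zero_lt, not_lt]; exact hu.mem_Icc.2
  · obtain ⟨h2, h3⟩ := adjacent_zero.1 (h1 0).1.1
    have h4 := (h1 0).1.2
    rw [h2, h3] at h4
    exact ⟨h4.1.le, h4.2.le⟩

/-- Around a position in a gap the bounds are eventually `u` and `v`, which fixes all data in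
`OnPath.kind` except the parameter in a Fatou interval. -/
theorem _root_.OnPath.of_gap (hν : ν.IsKneading) {z : TreePoint A} {s : ℝ ×ₗ ℝ}
    {u v : Itinerary A × ℝ} {n : ℕ} (h : OnPath ν z s) (hs : ν.Around s n u v)
    (hc : Compat u.1 v.1) : s = toLex ((u.2 + v.2) / 2, 0) ∨
      (∃ t ∈ Ioo (0 : ℝ) 1, s = toLex (u.2, 1 - t)) ∨
      ∃ t ∈ Ioo (0 : ℝ) 1, s = toLex (v.2, t - 1) := by
  have har : ∀ m ≥ n, ν.Around s m u v := fun m hm => ⟨hs.1.of_compat hm hc, hs.2⟩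
  rcases h.kind hν with ⟨w, ⟨m, hw⟩, -, h1⟩ | ⟨-, L, R, h1, h2⟩
  · exact absurd h1 ((har (max m n) (le_max_right _ _)).not_mem
      (stage_subset (le_max_left _ _) hw))
  have hL : ∀ᶠ m in atTop, L m = u := eventually_atTop.2 ⟨n, fun m hm =>
    ((h1 m).1.unique (har m hm)).1⟩
  have hR : ∀ᶠ m in atTop, R m = v := eventually_atTop.2 ⟨n, fun m hm =>
    ((h1 m).1.unique (har m hm)).2⟩
  rcases h2 with ⟨-, a, b, ha, hb, h2⟩ | ⟨w, t, -, -, h3, h2⟩ | ⟨w, t, -, -, h3, h2⟩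
  · left
    have h3 : u.2 = a := tendsto_nhds_unique
      (tendsto_const_nhds.congr' (hL.mono fun m hm => by simp only [hm])) ha
    have h4 : v.2 = b := tendsto_nhds_unique
      (tendsto_const_nhds.congr' (hR.mono fun m hm => by simp only [hm])) hb
    rw [h2, evConst_of_eventually hL, evConst_of_eventually hR, sub_self, h3, h4]
  · obtain ⟨m, hm, hm'⟩ := (hL.and h3).exists
    right; left
    exact ⟨t, t.2, by rw [h2, ← hm', hm]⟩
  · obtain ⟨m, hm, hm'⟩ := (hR.and h3).exists
    right; right
    exact ⟨t, t.2, by rw [h2, ← hm', hm]⟩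

theorem exists_onPath_right {p : ℕ} (hp : ν.IsStarPeriodic p) {u : Itinerary A × ℝ}
    {a : Itinerary A} (ha : ν.RightEnd u a) {z : ℝ} (h0 : 0 < z) (h1 : z < 1) :
    ∃ x, OnPath ν x (toLex (u.2, z)) := by
  have := OnPath.fatouRight p hp u a ha ⟨1 - z, by linarith, by linarith⟩
  simp only [sub_sub_cancel] at this
  exact ⟨_, this⟩

theorem exists_onPath_left {p : ℕ} (hp : ν.IsStarPeriodic p) {u : Itinerary A × ℝ}
    {a : Itinerary A} (ha : ν.LeftEnd u a) {z : ℝ} (h0 : -1 < z) (h1 : z < 0) :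
    ∃ x, OnPath ν x (toLex (u.2, z)) := by
  have := OnPath.fatouLeft p hp u a ha ⟨1 + z, by linarith, by linarith⟩
  simp only [add_sub_cancel_left] at this
  exact ⟨_, this⟩

theorem IsNonperiodic.exists_onPath (hn : ν.IsNonperiodic) {y : ℝ} (hy : y ∈ Icc (0 : ℝ) 1) :
    ∃ z, OnPath ν z (toLex (y, 0)) := by
  have hν : ν.IsKneading := Or.inl hn
  by_cases hs : ∃ u, ν.InStages u ∧ u.2 = y
  · obtain ⟨u, hu, rfl⟩ := hs
    exact ⟨_, .precritical u hu⟩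
  push Not at hs
  obtain ⟨L, R, h⟩ := exists_cells (ν := ν) (s := toLex (y, (0 : ℝ)))
    (lex_zero_lt.2 (lt_of_le_of_ne hy.1 (hs _ ⟨0, star_mem_stage 0⟩)))
    (lex_zero_lt.2 (lt_of_le_of_ne hy.2 (hs _ ⟨0, self_mem_stage 0⟩).symm))
    (fun u hu hc => hs u hu (by simpa using (congrArg (fun s => (ofLex s).1) hc).symm))
  obtain ⟨x, hx, hf, ⟨n, hc⟩ | ⟨-, h2, h3⟩ | ⟨-, v, h2, h3, -⟩⟩ := around_cases hν h
  · exact absurd (diff_eq_top_iff.1 hc.2.1) ((h n).1.not_compat hn)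
  · exact ⟨_, .innerLimit x y h3⟩
  · exact absurd h3 (hs v h2)

/-- The critical path has no holes: the points on one side of a position have an extremal point. -/
theorem exists_nearest (hν : ν.IsKneading) {s : ℝ ×ₗ ℝ}
    (hs : s ∈ Icc (toLex ((0 : ℝ), (0 : ℝ))) (toLex (1, 0)))
    (hs2 : (ofLex s).2 ∈ Icc (-1 : ℝ) 1) :
    (∃ z, OnPath ν z s) ∨
    (∃ z t, OnPath ν z t ∧ s < t ∧ ∀ z' t', OnPath ν z' t' → s ≤ t' → t ≤ t') ∨
    (∃ z t, OnPath ν z t ∧ t < s ∧ ∀ z' t', OnPath ν z' t' → t' ≤ s → t' ≤ t) := by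
  by_cases hP : ∃ u, ν.InStages u ∧ s = toLex (u.2, 0)
  · obtain ⟨u, hu, rfl⟩ := hP
    exact Or.inl ⟨_, .precritical u hu⟩
  push Not at hP
  by_cases hC : ∃ z, OnPath ν z s
  · exact Or.inl hC
  right
  obtain ⟨L, R, h⟩ := exists_cells (lt_of_le_of_ne hs.1 (hP _ ⟨0, star_mem_stage 0⟩).symm)
    (lt_of_le_of_ne hs.2 (hP _ ⟨0, self_mem_stage 0⟩)) hP
  -- the case of a point with the same value of `φ`
  have hval : ∀ z, OnPath ν z (toLex ((ofLex s).1, 0)) →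
      (∀ z' t', OnPath ν z' t' → (ofLex t').1 = (ofLex s).1 → (ofLex t').2 = 0) →
      (∃ z t, OnPath ν z t ∧ s < t ∧ ∀ z' t', OnPath ν z' t' → s ≤ t' → t ≤ t') ∨
      (∃ z t, OnPath ν z t ∧ t < s ∧ ∀ z' t', OnPath ν z' t' → t' ≤ s → t' ≤ t) := by
    intro z hz h0
    have hlt : ∀ t : ℝ ×ₗ ℝ, (ofLex t).1 = (ofLex s).1 → (ofLex t).2 = 0 →
        t = toLex ((ofLex s).1, 0) := fun t h1 h2 => by rw [← h1, ← h2]; rfl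
    rcases lt_trichotomy s (toLex ((ofLex s).1, 0)) with h1 | h1 | h1
    · refine Or.inl ⟨z, _, hz, h1, fun z' t' hz' ht' => ?_⟩
      rcases (Prod.Lex.le_iff.1 ht') with h2 | h2
      · exact Prod.Lex.le_iff.2 (Or.inl h2)
      · exact (hlt t' h2.1.symm (h0 z' t' hz' h2.1.symm)).ge
    · exact absurd ⟨z, h1 ▸ hz⟩ hC
    · refine Or.inr ⟨z, _, hz, h1, fun z' t' hz' ht' => ?_⟩
      rcases (Prod.Lex.le_iff.1 ht') with h2 | h2
      · exact Prod.Lex.le_iff.2 (Or.inl h2)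
      · exact (hlt t' h2.1 (h0 z' t' hz' h2.1)).le
  obtain ⟨x, hx, hf, ⟨n, hc⟩ | ⟨hcc, h2, h3⟩ | ⟨hcc, u, h2, h3, h4⟩⟩ := around_cases hν h
  · have hcc := diff_eq_top_iff.1 hc.2.1
    have hlt := (h n).1.lt
    have hle := (h n).le
    obtain ⟨p, hp⟩ : ∃ p, ν.IsStarPeriodic p := by
      rcases id hν with hn | ⟨p, -, hp⟩
      · exact absurd hcc ((h n).1.not_compat hn)
      · exact ⟨p, hp⟩
    have hz := OnPath.central _ _ _ hc
    have hm1 : toLex ((L n).2, (0 : ℝ)) < toLex (((L n).2 + (R n).2) / 2, 0) :=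
      lex_zero_lt.2 (by linarith)
    have hm2 : toLex (((L n).2 + (R n).2) / 2, (0 : ℝ)) < toLex ((R n).2, 0) :=
      lex_zero_lt.2 (by linarith)
    -- The unoccupied positions in a gap lie between the central itinerary and one of its two Fatou
    -- intervals, so the central itinerary is the extremal point.
    rcases lt_trichotomy s (toLex (((L n).2 + (R n).2) / 2, 0)) with h1 | h1 | h1
    · refine Or.inl ⟨_, _, hz, h1, fun z' t' hz' ht' => ?_⟩
      by_contra hlt'
      rw [not_le] at hlt'
      rcases hz'.of_gap hν ⟨(h n).1, (h n).2.1.trans_le ht', hlt'.trans hm2⟩ hcc with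
        h5 | ⟨t, h5, h6⟩ | ⟨t, h5, h6⟩
      · exact absurd h5 hlt'.ne
      · rw [h6, Prod.Lex.le_iff] at ht'
        simp only [ofLex_toLex] at ht'
        have h7 : (ofLex s).1 = (L n).2 ∧ (ofLex s).2 ≤ 1 - t :=
          ht'.resolve_left fun hc => by linarith
        have h8 : s = toLex ((L n).2, (ofLex s).2) := by rw [← h7.1]; rfl
        have h9 := (h n).2.1
        rw [h8, Prod.Lex.toLex_lt_toLex] at h9
        have h10 : 0 < (ofLex s).2 := (h9.resolve_left (lt_irrefl _)).2
        obtain ⟨z, hz⟩ := exists_onPath_right hp (Or.inr ⟨_, hc⟩) h10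
          (by have := h5.1; linarith)
        exact hC ⟨z, h8 ▸ hz⟩
      · rw [h6, Prod.Lex.toLex_lt_toLex] at hlt'
        rcases hlt' with h7 | h7
        · simp only at h7; linarith
        · simp only at h7; linarith [h7.1]
    · exact absurd ⟨_, h1 ▸ hz⟩ hC
    · refine Or.inr ⟨_, _, hz, h1, fun z' t' hz' ht' => ?_⟩
      by_contra hlt'
      rw [not_le] at hlt'
      rcases hz'.of_gap hν ⟨(h n).1, hm1.trans hlt', ht'.trans_lt (h n).2.2⟩ hcc with
        h5 | ⟨t, h5, h6⟩ | ⟨t, h5, h6⟩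
      · exact absurd h5.symm hlt'.ne
      · rw [h6, Prod.Lex.toLex_lt_toLex] at hlt'
        rcases hlt' with h7 | h7
        · simp only at h7; linarith
        · simp only at h7; linarith [h7.1]
      · rw [h6, Prod.Lex.le_iff] at ht'
        simp only [ofLex_toLex] at ht'
        have h7 : (R n).2 = (ofLex s).1 ∧ t - 1 ≤ (ofLex s).2 :=
          ht'.resolve_left fun hc => by linarith
        have h8 : s = toLex ((R n).2, (ofLex s).2) := by rw [h7.1]; rfl
        have h9 := (h n).2.2
        rw [h8, Prod.Lex.toLex_lt_toLex] at h9
        have h10 : (ofLex s).2 < 0 := (h9.resolve_left (lt_irrefl _)).2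
        obtain ⟨z, hz⟩ := exists_onPath_left hp (Or.inr ⟨_, hc⟩)
          (by have := h5.1; linarith) h10
        exact hC ⟨z, h8 ▸ hz⟩
  · refine hval _ (.innerLimit x _ h3) fun z' t' hz' ht' => ?_
    rcases hz'.snd_eq_zero_or with h0 | ⟨u, hu, hut⟩
    · exact h0
    · exact absurd (hut.trans ht') (h2 u hu)
  -- Over the value of an entry: for non-periodic ν that entry is the only point, hence extremal;
  -- for ⋆-periodic ν the limit and its Fatou interval occupy all positions on this side, so `s`
  -- would be occupied.
  · rcases id hν with hn | ⟨p, -, hp⟩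
    · refine hval _ (h3 ▸ OnPath.precritical u h2) fun z' t' hz' ht' => hz'.snd_eq_zero hn
    · exfalso
      have hse : s = toLex (u.2, (ofLex s).2) := by rw [h3]; rfl
      rcases h4 with ⟨h0, -, h5⟩ | ⟨h0, -, h5⟩
      · have h5 := h5 (hp.mem_X hx)
        rcases hs2.2.lt_or_eq with h6 | h6
        · obtain ⟨z, hz⟩ := exists_onPath_right hp (Or.inl h5) h0 h6
          exact hC ⟨z, hse ▸ hz⟩
        · rw [h6] at hse
          exact hC ⟨_, hse ▸ OnPath.rightLimit p hp u x h5⟩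
      · have h5 := h5 (hp.mem_X hx)
        rcases hs2.1.lt_or_eq with h6 | h6
        · obtain ⟨z, hz⟩ := exists_onPath_left hp (Or.inl h5) h6 h0
          exact hC ⟨z, hse ▸ hz⟩
        · rw [← h6] at hse
          exact hC ⟨_, hse ▸ OnPath.leftLimit p hp u x h5⟩

/-- Between any two points of the critical path there is another one. -/
theorem _root_.OnPath.exists_between (hν : ν.IsKneading) {z z' : TreePoint A} {s t : ℝ ×ₗ ℝ}
    (hz : OnPath ν z s) (hz' : OnPath ν z' t) (hst : s < t) :
    ∃ w r, OnPath ν w r ∧ s < r ∧ r < t := by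
  rcases id hν with hn | ⟨p, -, hp⟩
  · have h1 := hz.snd_eq_zero hn
    have h2 := hz'.snd_eq_zero hn
    have hs : s = toLex ((ofLex s).1, 0) := by rw [← h1]; rfl
    have ht : t = toLex ((ofLex t).1, 0) := by rw [← h2]; rfl
    rw [hs, ht, lex_zero_lt] at hst
    have h3 := (Prod.Lex.le_iff.1 (hz.mem_Icc hν).1)
    have h4 := (Prod.Lex.le_iff.1 (hz'.mem_Icc hν).2)
    simp only [ofLex_toLex] at h3 h4
    obtain ⟨w, hw⟩ := hn.exists_onPath (y := ((ofLex s).1 + (ofLex t).1) / 2)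
      ⟨by rcases h3 with h | h
          · linarith
          · linarith [h.1], by
          rcases h4 with h | h
          · linarith
          · linarith [h.1]⟩
    refine ⟨w, _, hw, ?_, ?_⟩
    · rw [hs, lex_zero_lt]; simp only [ofLex_toLex]; linarith
    · rw [ht, lex_zero_lt]; simp only [ofLex_toLex]; linarith
  have ht2 := hz'.snd_mem
  have hte : t = toLex ((ofLex t).1, (ofLex t).2) := rfl
  rw [hte] at hst ⊢
  have hright : ∀ (u : Itinerary A × ℝ) (y : ℝ), 0 ≤ y → y < 1 → (∃ a, ν.RightEnd u a) →
      toLex (u.2, y) < toLex ((ofLex t).1, (ofLex t).2) →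
      ∃ w r, OnPath ν w r ∧ toLex (u.2, y) < r ∧ r < toLex ((ofLex t).1, (ofLex t).2) := by
    rintro u y h0 h1 ⟨a, ha⟩ hlt
    rw [Prod.Lex.toLex_lt_toLex] at hlt
    rcases hlt with h2 | h2
    · obtain ⟨w, hw⟩ := exists_onPath_right hp ha (z := (y + 1) / 2) (by linarith) (by linarith)
      refine ⟨w, _, hw, ?_, ?_⟩ <;> rw [Prod.Lex.toLex_lt_toLex]
      · exact Or.inr ⟨rfl, by simp only; linarith⟩
      · exact Or.inl h2
    · simp only at h2
      obtain ⟨w, hw⟩ := exists_onPath_right hp ha (z := (y + (ofLex t).2) / 2) (by linarith)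
        (by linarith [ht2.2])
      refine ⟨w, _, hw, ?_, ?_⟩ <;> rw [Prod.Lex.toLex_lt_toLex]
      · exact Or.inr ⟨rfl, by simp only; linarith⟩
      · exact Or.inr ⟨h2.1, by simp only; linarith⟩
  have hleft : ∀ (u : Itinerary A × ℝ) (y : ℝ), -1 ≤ y → y < 0 → (∃ a, ν.LeftEnd u a) →
      toLex (u.2, y) < toLex ((ofLex t).1, (ofLex t).2) →
      ∃ w r, OnPath ν w r ∧ toLex (u.2, y) < r ∧ r < toLex ((ofLex t).1, (ofLex t).2) := by
    rintro u y h0 h1 ⟨a, ha⟩ hlt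
    rw [Prod.Lex.toLex_lt_toLex] at hlt
    by_cases h3 : u.2 = (ofLex t).1 ∧ (ofLex t).2 ≤ 0
    · have h2 : y < (ofLex t).2 := (hlt.resolve_left h3.1.not_lt).2
      obtain ⟨w, hw⟩ := exists_onPath_left hp ha (z := (y + (ofLex t).2) / 2) (by linarith)
        (by linarith [h3.2])
      refine ⟨w, _, hw, ?_, ?_⟩ <;> rw [Prod.Lex.toLex_lt_toLex]
      · exact Or.inr ⟨rfl, by simp only; linarith⟩
      · exact Or.inr ⟨h3.1, by simp only; linarith⟩
    · refine ⟨_, _, .precritical u ha.inStages, ?_, ?_⟩ <;> rw [Prod.Lex.toLex_lt_toLex]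
      · exact Or.inr ⟨rfl, h1⟩
      · rcases hlt with h2 | h2
        · exact Or.inl h2
        · exact Or.inr ⟨h2.1, by
            by_contra hc
            exact h3 ⟨h2.1, not_lt.1 hc⟩⟩
  cases hz with
  | precritical u hu =>
    refine hright u 0 le_rfl one_pos (exists_rightEnd hν hp hu ?_) hst
    by_contra hc
    have h1 : u.2 = 1 := le_antisymm hu.mem_Icc.2 (not_lt.1 hc)
    rw [h1] at hst
    exact not_le.2 hst (hz'.mem_Icc hν).2
  | innerLimit a y ha =>
    obtain ⟨-, -, hy, l, r, h1, -, h3, -⟩ := ha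
    have h4 : y < (ofLex t).1 := by
      rw [Prod.Lex.toLex_lt_toLex] at hst
      refine hst.resolve_right fun h => ?_
      simp only at h
      rcases hz'.snd_eq_zero_or with h0 | ⟨u, hu, hut⟩
      · rw [h0] at h; exact lt_irrefl _ h.2
      · exact hy u hu (hut.trans h.1.symm)
    obtain ⟨n, hn⟩ := (h3.eventually (gt_mem_nhds h4)).exists
    refine ⟨_, _, .precritical (r n) ⟨n, (h1 n).1.mem_right⟩, ?_, ?_⟩ <;>
      rw [Prod.Lex.toLex_lt_toLex]
    · exact Or.inl (h1 n).2.2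
    · exact Or.inl hn
  | central u v c hc =>
    obtain ⟨n, hn⟩ := hc.1
    have hlt := hn.lt
    have hcc := diff_eq_top_iff.1 hc.2.1
    by_cases h1 : t < toLex (v.2, 0)
    · rcases hz'.of_gap hν ⟨hn, lt_trans (lex_zero_lt.2 (by linarith)) hst, h1⟩ hcc with
        h2 | ⟨r, h2, h3⟩ | ⟨r, h2, h3⟩
      · rw [← hte] at hst; exact absurd h2 hst.ne'
      · rw [h3, Prod.Lex.toLex_lt_toLex] at hst
        simp only [ofLex_toLex] at hst
        rcases hst with h4 | h4
        · linarith
        · linarith [h4.1]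
      · have := h2.1; have := h2.2
        obtain ⟨w, hw⟩ := exists_onPath_left hp (u := v) (Or.inr ⟨_, hc⟩) (z := r / 2 - 1)
          (by linarith) (by linarith)
        refine ⟨w, _, hw, ?_, ?_⟩
        · rw [Prod.Lex.toLex_lt_toLex]; left; simp only; linarith
        · rw [h3]; simp only [ofLex_toLex]; rw [Prod.Lex.toLex_lt_toLex]; right
          exact ⟨rfl, by simp only; linarith⟩
    · obtain ⟨w, hw⟩ := exists_onPath_left hp (u := v) (Or.inr ⟨_, hc⟩) (z := -1 / 2)
        (by norm_num) (by norm_num)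
      refine ⟨w, _, hw, ?_, ?_⟩
      · rw [Prod.Lex.toLex_lt_toLex]; left; simp only; linarith
      · refine lt_of_lt_of_le ?_ (not_lt.1 h1)
        rw [Prod.Lex.toLex_lt_toLex]; right
        exact ⟨rfl, by norm_num⟩
  | rightLimit p' hp' u a ha =>
    obtain ⟨y, h1, h2, -⟩ := ha.fits hν
    have h4 : u.2 < (ofLex t).1 := by
      rw [Prod.Lex.toLex_lt_toLex] at hst
      refine hst.resolve_right fun h => ?_
      simp only at h
      linarith [ht2.2, h.2]
    obtain ⟨n, hn, hn'⟩ := ((h2.eventually (gt_mem_nhds h4)).and h1).exists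
    refine ⟨_, _, .precritical (y n) ⟨n, hn'.mem_right⟩, ?_, ?_⟩ <;>
      rw [Prod.Lex.toLex_lt_toLex]
    · exact Or.inl hn'.lt
    · exact Or.inl hn
  | leftLimit p' hp' u a ha => exact hleft u _ le_rfl (by norm_num) ⟨a, Or.inl ha⟩ hst
  | fatouRight p' hp' u a ha r =>
    have := r.2.1; have := r.2.2
    exact hright u _ (by linarith) (by linarith) ⟨a, ha⟩ hst
  | fatouLeft p' hp' u a ha r =>
    have := r.2.1; have := r.2.2
    exact hleft u _ (by linarith) (by linarith) ⟨a, ha⟩ hst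

end Itinerary

/-! ### The critical path as a linear continuum. -/

/-- A linear order with suprema of non-empty bounded sets is conditionally complete. -/
@[reducible]
noncomputable def conditionallyCompleteLinearOrderOfExistsIsLUB {α : Type*} [LinearOrder α]
    [Nonempty α] (h : ∀ s : Set α, s.Nonempty → BddAbove s → ∃ a, IsLUB s a) :
    ConditionallyCompleteLinearOrder α := by
  classical
  have h' : ∀ s : Set α, s.Nonempty → BddBelow s → ∃ a, IsGLB s a := fun s hs hb => by
    obtain ⟨a, ha⟩ := h (lowerBounds s) hb ⟨hs.some, fun x hx => hx hs.some_mem⟩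
    exact ⟨a, fun x hx => ha.2 fun y hy => hy hx, fun x hx => ha.1 hx⟩
  let sup : Set α → α := fun s =>
    if hs : s.Nonempty ∧ BddAbove s then (h s hs.1 hs.2).choose else Classical.arbitrary α
  let inf : Set α → α := fun s =>
    if hs : s.Nonempty ∧ BddBelow s then (h' s hs.1 hs.2).choose else Classical.arbitrary α
  exact
    { ‹LinearOrder α›, LinearOrder.toLattice with
      sSup := sup
      sInf := inf
      isLUB_csSup := fun s hs hb => by
        simp only [sup]
        rw [dif_pos ⟨hs, hb⟩]
        exact (h s hs hb).choose_spec
      isGLB_csInf := fun s hs hb => by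
        simp only [inf]
        rw [dif_pos ⟨hs, hb⟩]
        exact (h' s hs hb).choose_spec
      csSup_of_not_bddAbove := fun s hs => by
        simp only [sup]
        rw [dif_neg fun hc => hs hc.2, dif_neg fun hc : (∅ : Set α).Nonempty ∧ _ => Set.not_nonempty_empty hc.1]
      csInf_of_not_bddBelow := fun s hs => by
        simp only [inf]
        rw [dif_neg fun hc => hs hc.2, dif_neg fun hc : (∅ : Set α).Nonempty ∧ _ => Set.not_nonempty_empty hc.1] }

namespace CriticalPath

open Itinerary

variable {A : Type*} {ν : Itinerary A}

/-- The position of a point on the critical path. -/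
noncomputable def pos (z : CriticalPath ν) : ℝ ×ₗ ℝ := z.2.choose

theorem onPath (z : CriticalPath ν) : OnPath ν z.1 z.pos := z.2.choose_spec

/-- The point of the critical path at a position. -/
def ofOnPath {z : TreePoint A} {s : ℝ ×ₗ ℝ} (h : OnPath ν z s) : CriticalPath ν := ⟨z, s, h⟩

variable [hK : Fact ν.IsKneading]

theorem pos_eq {z : CriticalPath ν} {s : ℝ ×ₗ ℝ} (h : OnPath ν z.1 s) : z.pos = s :=
  z.onPath.unique_pos hK.out h

theorem pos_ofOnPath {z : TreePoint A} {s : ℝ ×ₗ ℝ} (h : OnPath ν z s) : (ofOnPath h).pos = s :=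
  pos_eq h

theorem pos_injective : Function.Injective (pos : CriticalPath ν → ℝ ×ₗ ℝ) := fun z z' h =>
  Subtype.ext (z.onPath.unique_point hK.out (h ▸ z'.onPath))

noncomputable instance : LinearOrder (CriticalPath ν) := LinearOrder.lift' pos pos_injective

theorem le_iff {z z' : CriticalPath ν} : z ≤ z' ↔ z.pos ≤ z'.pos := Iff.rfl

theorem lt_iff {z z' : CriticalPath ν} : z < z' ↔ z.pos < z'.pos := Iff.rfl

theorem prec_iff {z z' : CriticalPath ν} : z.Prec z' ↔ z < z' := by
  constructor
  · rintro ⟨s, t, hs, ht, h⟩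
    rwa [lt_iff, pos_eq hs, pos_eq ht]
  · exact fun h => ⟨_, _, z.onPath, z'.onPath, h⟩

instance : OrderTopology (CriticalPath ν) := ⟨by
  unfold instTopologicalSpace
  congr 1
  ext U
  constructor
  · rintro ⟨x, rfl | rfl⟩
    · exact ⟨x, Or.inr (Set.ext fun y => prec_iff)⟩
    · exact ⟨x, Or.inl (Set.ext fun y => prec_iff)⟩
  · rintro ⟨x, rfl | rfl⟩
    · exact ⟨x, Or.inr (Set.ext fun y => prec_iff.symm)⟩
    · exact ⟨x, Or.inl (Set.ext fun y => prec_iff.symm)⟩⟩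

instance : DenselyOrdered (CriticalPath ν) := ⟨fun z z' h => by
  obtain ⟨w, r, hw, h1, h2⟩ := z.onPath.exists_between hK.out z'.onPath h
  exact ⟨ofOnPath hw, by rwa [lt_iff, pos_ofOnPath], by rwa [lt_iff, pos_ofOnPath]⟩⟩

instance : Nonempty (CriticalPath ν) := ⟨⟨_, _, .precritical _ ⟨0, star_mem_stage 0⟩⟩⟩

/-- The lexicographic plane is not complete, but second coordinates of positions lie in `[-1, 1]`.
So a least bound exists among positions with second coordinate at least `-1`; this coordinate is
`-1` if the supremum of the first coordinates is not attained. If no point of the path is there,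
`exists_nearest` moves to the adjacent one. -/
theorem exists_isLUB (S : Set (CriticalPath ν)) (hS : S.Nonempty) : ∃ a, IsLUB S a := by
  classical
  -- the supremum of the positions
  obtain ⟨s, hs2, hub, hlub⟩ : ∃ s : ℝ ×ₗ ℝ, (ofLex s).2 ∈ Icc (-1 : ℝ) 1 ∧
      (∀ z ∈ S, z.pos ≤ s) ∧ ∀ t : ℝ ×ₗ ℝ, -1 ≤ (ofLex t).2 → (∀ z ∈ S, z.pos ≤ t) → s ≤ t := by
    let f : CriticalPath ν → ℝ := fun z => (ofLex z.pos).1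
    let g : CriticalPath ν → ℝ := fun z => (ofLex z.pos).2
    have hg : ∀ z, g z ∈ Icc (-1 : ℝ) 1 := fun z => z.onPath.snd_mem
    have hle : ∀ {z : CriticalPath ν} {t : ℝ ×ₗ ℝ}, z.pos ≤ t ↔ f z < (ofLex t).1 ∨
        f z = (ofLex t).1 ∧ g z ≤ (ofLex t).2 := Prod.Lex.le_iff
    have hbf : BddAbove (f '' S) := ⟨1, by
      rintro _ ⟨z, -, rfl⟩
      rcases hle.1 (z.onPath.mem_Icc hK.out).2 with h | h
      exacts [h.le, h.1.le]⟩
    have hf : ∀ z ∈ S, f z ≤ sSup (f '' S) := fun z hz => le_csSup hbf ⟨z, hz, rfl⟩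
    have hf' : ∀ y, (∀ z ∈ S, f z ≤ y) → sSup (f '' S) ≤ y := fun y hy =>
      csSup_le (hS.image f) (by rintro _ ⟨z, hz, rfl⟩; exact hy z hz)
    by_cases hatt : ∃ z ∈ S, f z = sSup (f '' S)
    · let T := {z ∈ S | f z = sSup (f '' S)}
      have hT : T.Nonempty := hatt
      have hbg : BddAbove (g '' T) := ⟨1, by rintro _ ⟨z, -, rfl⟩; exact (hg z).2⟩
      refine ⟨toLex (sSup (f '' S), sSup (g '' T)), ⟨?_, ?_⟩, ?_, ?_⟩
      · obtain ⟨z, hz⟩ := hT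
        exact (hg z).1.trans (le_csSup hbg ⟨z, hz, rfl⟩)
      · exact csSup_le (hT.image g) (by rintro _ ⟨z, -, rfl⟩; exact (hg z).2)
      · intro z hz
        rw [hle]
        rcases (hf z hz).lt_or_eq with h | h
        · exact Or.inl h
        · exact Or.inr ⟨h, le_csSup hbg ⟨z, ⟨hz, h⟩, rfl⟩⟩
      · intro t _ ht
        rw [Prod.Lex.le_iff]
        have h1 : sSup (f '' S) ≤ (ofLex t).1 := hf' _ fun z hz => by
          rcases hle.1 (ht z hz) with h | h
          exacts [h.le, h.1.le]
        rcases h1.lt_or_eq with h | h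
        · exact Or.inl h
        · refine Or.inr ⟨h, csSup_le (hT.image g) ?_⟩
          rintro _ ⟨z, ⟨hz, hz'⟩, rfl⟩
          rcases hle.1 (ht z hz) with h2 | h2
          · exact absurd h2 (by rw [← h, hz']; exact lt_irrefl _)
          · exact h2.2
    · push Not at hatt
      refine ⟨toLex (sSup (f '' S), -1), by norm_num, ?_, ?_⟩
      · intro z hz
        rw [hle]
        exact Or.inl (lt_of_le_of_ne (hf z hz) (hatt z hz))
      · intro t ht' ht
        rw [Prod.Lex.le_iff]
        have h1 : sSup (f '' S) ≤ (ofLex t).1 := hf' _ fun z hz => by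
          rcases hle.1 (ht z hz) with h | h
          exacts [h.le, h.1.le]
        rcases h1.lt_or_eq with h | h
        · exact Or.inl h
        · exact Or.inr ⟨h, ht'⟩
  have hs : s ∈ Icc (toLex ((0 : ℝ), (0 : ℝ))) (toLex (1, 0)) := by
    constructor
    · obtain ⟨z, hz⟩ := hS
      exact (z.onPath.mem_Icc hK.out).1.trans (hub z hz)
    · exact hlub _ (by norm_num) fun z _ => (z.onPath.mem_Icc hK.out).2
  have hup : ∀ b ∈ upperBounds S, s ≤ b.pos := fun b hb =>
    hlub _ b.onPath.snd_mem.1 fun z hz => hb hz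
  rcases exists_nearest hK.out hs hs2 with ⟨z, hz⟩ | ⟨z, t, hz, h1, h2⟩ | ⟨z, t, hz, h1, h2⟩
  · have h3 := pos_ofOnPath hz
    refine ⟨ofOnPath hz, fun w hw => ?_, fun b hb => ?_⟩
    · rw [le_iff, h3]; exact hub w hw
    · rw [le_iff, h3]; exact hup b hb
  · have h3 := pos_ofOnPath hz
    refine ⟨ofOnPath hz, fun w hw => ?_, fun b hb => ?_⟩
    · rw [le_iff, h3]; exact (hub w hw).trans h1.le
    · rw [le_iff, h3]; exact h2 _ _ b.onPath (hup b hb)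
  · have h3 := pos_ofOnPath hz
    refine ⟨ofOnPath hz, fun w hw => ?_, fun b hb => ?_⟩
    · rw [le_iff, h3]; exact h2 _ _ w.onPath (hub w hw)
    · rw [le_iff, h3]; exact h1.le.trans (hup b hb)

noncomputable instance : ConditionallyCompleteLinearOrder (CriticalPath ν) :=
  conditionallyCompleteLinearOrderOfExistsIsLUB fun S hS _ => exists_isLUB S hS

instance : LocallyConnectedSpace (CriticalPath ν) := by
  rw [locallyConnectedSpace_iff_connected_subsets]
  intro x U hU
  obtain ⟨b, c, -, h1, h2⟩ := exists_Icc_mem_subset_of_mem_nhds hU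
  exact ⟨_, h1, isPreconnected_Icc, h2⟩

instance : PreconnectedSpace (CriticalPath ν) := inferInstance

/-- Walking from a point outside a closed set until the set is reached. -/
theorem exists_nearest_of_isClosed {S : Set (CriticalPath ν)} (hS : IsClosed S)
    (hne : S.Nonempty) {c : CriticalPath ν} (hc : c ∉ S) :
    ∃ x ∈ S, (x < c ∧ Disjoint (Ioc x c) S) ∨ (c < x ∧ Disjoint (Ico c x) S) := by
  by_cases h : (S ∩ Iic c).Nonempty
  · have hb : BddAbove (S ∩ Iic c) := ⟨c, fun x hx => hx.2⟩
    have hm := (hS.inter isClosed_Iic).csSup_mem h hb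
    refine ⟨_, hm.1, Or.inl ⟨lt_of_le_of_ne hm.2 fun he => hc (he ▸ hm.1), ?_⟩⟩
    rw [Set.disjoint_left]
    exact fun z hz hzS => not_le.2 hz.1 (le_csSup hb ⟨hzS, hz.2⟩)
  · have h' : (S ∩ Ici c).Nonempty := by
      obtain ⟨z, hz⟩ := hne
      refine ⟨z, hz, ?_⟩
      by_contra hlt
      exact h ⟨z, hz, (not_le.1 hlt : z < c).le⟩
    have hb : BddBelow (S ∩ Ici c) := ⟨c, fun x hx => hx.2⟩
    have hm := (hS.inter isClosed_Ici).csInf_mem h' hb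
    refine ⟨_, hm.1, Or.inr ⟨lt_of_le_of_ne hm.2 fun he => hc (he ▸ hm.1), ?_⟩⟩
    rw [Set.disjoint_left]
    exact fun z hz hzS => not_le.2 hz.2 (csInf_le hb ⟨hzS, hz.1⟩)

end CriticalPath

namespace Itinerary

variable {A : Type*} {ν : Itinerary A}

theorem exists_right_neighbour {n : ℕ} {u : Itinerary A × ℝ} (hu : u ∈ ν.stage n)
    (h1 : u.2 < 1) : ∃ r, ν.Adjacent n u r := by
  have h0 := (InStages.mem_Icc ⟨n, hu⟩).1
  obtain ⟨l, r, h⟩ := exists_around (ν := ν) (s := toLex (u.2, (1 : ℝ)))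
    (by rw [Prod.Lex.toLex_lt_toLex]; rcases h0.lt_or_eq with h | h
        · exact Or.inl h
        · exact Or.inr ⟨h, one_pos⟩)
    (by rw [Prod.Lex.toLex_lt_toLex]; exact Or.inl h1)
    (fun v _ hc => by simpa using congrArg (fun s => (ofLex s).2) hc) n
  have h5 := h.le
  have h7 := h.2.2
  rw [Prod.Lex.toLex_lt_toLex] at h7
  have h8 : u.2 < r.2 := h7.resolve_right fun hc => by linarith [hc.2]
  simp only [ofLex_toLex] at h5
  rcases h.1.sep hu with (h9 | h9) | (h9 | h9)
  · exact ⟨r, h9 ▸ h.1⟩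
  · linarith
  · rw [h9] at h8; exact absurd h8 (lt_irrefl _)
  · linarith

theorem exists_left_neighbour {n : ℕ} {u : Itinerary A × ℝ} (hu : u ∈ ν.stage n)
    (h1 : 0 < u.2) : ∃ l, ν.Adjacent n l u := by
  have h0 := (InStages.mem_Icc ⟨n, hu⟩).2
  obtain ⟨l, r, h⟩ := exists_around (ν := ν) (s := toLex (u.2, (-1 : ℝ)))
    (by rw [Prod.Lex.toLex_lt_toLex]; exact Or.inl h1)
    (by rw [Prod.Lex.toLex_lt_toLex]; rcases h0.lt_or_eq with h | h
        · exact Or.inl h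
        · exact Or.inr ⟨h, by norm_num⟩)
    (fun v _ hc => by simpa using congrArg (fun s => (ofLex s).2) hc) n
  have h5 := h.le
  have h7 := h.2.1
  rw [Prod.Lex.toLex_lt_toLex] at h7
  have h8 : l.2 < u.2 := h7.resolve_right fun hc => by linarith [hc.2]
  simp only [ofLex_toLex] at h5
  rcases h.1.sep hu with (h9 | h9) | (h9 | h9)
  · rw [h9] at h8; exact absurd h8 (lt_irrefl _)
  · linarith
  · exact ⟨l, h9 ▸ h.1⟩
  · linarith

/-! ### Properties of the points on the critical path -/

theorem _root_.OnPath.proper_rep (hν : ν.IsKneading) {z : TreePoint A} {s : ℝ ×ₗ ℝ}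
    (h : OnPath ν z s) : ν.Proper z.rep := by
  cases h with
  | precritical u hu => exact hu.proper hν
  | innerLimit a y ha => exact ha.2.1.proper ha.1
  | central u v c hc => exact hc.2.2.2.1.proper hc.2.2.1
  | rightLimit p hp u a ha => exact ha.2.1.proper ha.1
  | leftLimit p hp u a ha => exact ha.2.1.proper ha.1
  | fatouRight p hp u a ha t => exact (RightEnd.inStages ha).proper hν
  | fatouLeft p hp u a ha t => exact (LeftEnd.inStages ha).proper hν

theorem _root_.OnPath.of_fatou {a b : Itinerary A} {t : Ioo (0 : ℝ) 1} {s : ℝ ×ₗ ℝ}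
    (h : OnPath ν (.fatou a b t) s) : (∃ p, ν.IsStarPeriodic p) ∧ ∃ u, u.1 = a ∧
      ((ν.RightEnd u b ∧ s = toLex (u.2, 1 - (t : ℝ))) ∨
        (ν.LeftEnd u b ∧ s = toLex (u.2, (t : ℝ) - 1))) := by
  cases h with
  | fatouRight p hp u a ha t => exact ⟨⟨p, hp⟩, u, rfl, Or.inl ⟨ha, rfl⟩⟩
  | fatouLeft p hp u a ha t => exact ⟨⟨p, hp⟩, u, rfl, Or.inr ⟨ha, rfl⟩⟩

theorem IsStarPeriodic.not_starFree {p : ℕ} (hp : ν.IsStarPeriodic p) : ¬ ν.StarFree := fun h =>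
  h (p - 1) ((hp.2.2 _).2 (by rw [Nat.sub_add_cancel hp.1]))

theorem Proper.merge_of_runs {x a b : Itinerary A} {s t : Itinerary A} {N : ℕ}
    (ha : ν.Proper a) (hc : Compat a x) (hx : x.StarFree) (h : ν.Runs x s t a b N) :
    ν.Merge x a s := by
  refine ⟨N, ?_⟩
  rw [h.left, ha.track_eq_drop]
  intro i _
  rcases hc i with h | h | h
  · exact Or.inr h
  · exact absurd h (hx i)
  · exact Or.inl h

theorem RightEnd.not_merge (hν : ν.IsKneading) {u : Itinerary A × ℝ} {b : Itinerary A}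
    (h : ν.RightEnd u b) : ¬ ν.Merge b ν.star ν ∧ ν.Merge b u.1 ν.star := by
  obtain ⟨L, R, h1, h2⟩ := h.cells hν one_pos
  refine ⟨not_merge_of_fits hν fun n => ⟨_, _, (h1 n).1.1, (h1 n).2⟩, ?_⟩
  obtain ⟨n, hn⟩ := h2.exists
  obtain ⟨N, hN, -⟩ := (h1 n).1.1.exists_runs hν (h1 n).2
  rw [hn] at hN
  exact (h.inStages.proper hν).merge_of_runs (h.compat hν) h.starFree hN

theorem LeftEnd.not_merge (hν : ν.IsKneading) {u : Itinerary A × ℝ} {b : Itinerary A}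
    (h : ν.LeftEnd u b) : ¬ ν.Merge b ν.star ν ∧ ν.Merge b u.1 ν := by
  obtain ⟨L, R, h1, h2⟩ := h.cells hν (z := -1) (by norm_num)
  refine ⟨not_merge_of_fits hν fun n => ⟨_, _, (h1 n).1.1, (h1 n).2⟩, ?_⟩
  obtain ⟨n, hn⟩ := h2.exists
  obtain ⟨N, hN, -⟩ := (h1 n).1.1.exists_runs hν (h1 n).2
  rw [hn] at hN
  exact (h.inStages.proper hν).merge_of_runs (h.compat hν) h.starFree hN.symm

theorem _root_.OnPath.body_fits (hν : ν.IsKneading) {z : TreePoint A} {s : ℝ ×ₗ ℝ}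
    {n : ℕ} {l r : Itinerary A × ℝ} (hz : OnPath ν z s) (h : ν.Around s n l r) :
    Fits z.body l.1 r.1 := by
  rcases hz.kind hν with ⟨u, hu, rfl, rfl⟩ | ⟨-, L, R, h1, -⟩
  · rcases hu.around hν n with h2 | ⟨l', r', h2, h3⟩
    · exact absurd rfl (h.not_mem h2)
    · obtain ⟨rfl, rfl⟩ := h.unique h2
      exact h3
  · obtain ⟨h2, h3⟩ := h.unique (h1 n).1
    rw [h2, h3]; exact (h1 n).2

theorem _root_.OnPath.rep_eq (hν : ν.IsKneading) {z : TreePoint A} {u : Itinerary A × ℝ} {y : ℝ}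
    (hu : ν.InStages u) (h1 : -1 < y) (h2 : y < 1) (hz : OnPath ν z (toLex (u.2, y))) :
    z.rep = u.1 := by
  rcases hz.kind hν with ⟨v, hv, rfl, h⟩ | ⟨-, L, R, h, ⟨h3, a, b, -, -, h4⟩ |
      ⟨v, t, h3, h4, -, h5⟩ | ⟨v, t, h3, h4, -, h5⟩⟩
  · have := congrArg (fun s => (ofLex s).1) h
    rw [hu.eq_of_snd_eq hv (by simpa using this)]; rfl
  · have h5 := congrArg (fun s => (ofLex s).2) h4
    simp only [ofLex_toLex] at h5
    have h6 : y = 0 := by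
      rcases evConst_eq L with h7 | h7 <;> rcases evConst_eq R with h8 | h8 <;> rw [h7, h8] at h5 <;>
        linarith
    rw [h6] at hz
    rw [hz.unique_point hν (.precritical u hu)]; rfl
  · have := congrArg (fun s => (ofLex s).1) h5
    rw [h3, hu.eq_of_snd_eq h4.inStages (by simpa using this)]; rfl
  · have := congrArg (fun s => (ofLex s).1) h5
    rw [h3, hu.eq_of_snd_eq h4.inStages (by simpa using this)]; rfl

end Itinerary

namespace CriticalPath

open Itinerary

variable {A : Type*} {ν : Itinerary A} [hK : Fact ν.IsKneading]

/-! ### Neighbourhoods -/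

/-- A point near `z` has the same itinerary up to a given position, except that `⋆` is replaced by
a symbol. -/
theorem exists_isOpen_near (z : CriticalPath ν) (M : ℕ) : ∃ O : Set (CriticalPath ν), IsOpen O ∧
    z ∈ O ∧ ∀ z' ∈ O, z' = z ∨ ∀ i < M, z'.1.body i ≠ none ∧
      (z.1.body i = z'.1.body i ∨ z.1.body i = none) := by
  have hν := hK.out
  rcases z.onPath.kind hν with ⟨u, ⟨m, hu⟩, h1, h2⟩ | ⟨h0, L, R, h1, -⟩
  -- Late enough for `u` to be present and for adjacent entries to agree in the first `M` positions.
  · let n := max m M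
    have hun : u ∈ ν.stage n := stage_subset (le_max_left _ _) hu
    have hMn : M ≤ n := le_max_right _ _
    have hopen1 : IsOpen {z' : CriticalPath ν | ∀ r, ν.Adjacent n u r →
        z'.pos < toLex (r.2, 0)} := by
      by_cases hr : ∃ r, ν.Adjacent n u r
      · obtain ⟨r, hr⟩ := hr
        convert isOpen_Iio (a := ofOnPath (.precritical r ⟨n, hr.mem_right⟩)) using 1
        ext z'
        rw [mem_Iio, lt_iff, pos_ofOnPath]
        exact ⟨fun h => h r hr, fun h r' hr' => hr.right_unique hr' ▸ h⟩
      · convert isOpen_univ using 1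
        ext z'
        simp only [mem_univ, iff_true]
        exact fun r hr' => absurd ⟨r, hr'⟩ hr
    have hopen2 : IsOpen {z' : CriticalPath ν | ∀ l, ν.Adjacent n l u →
        toLex (l.2, 0) < z'.pos} := by
      by_cases hl : ∃ l, ν.Adjacent n l u
      · obtain ⟨l, hl⟩ := hl
        convert isOpen_Ioi (a := ofOnPath (.precritical l ⟨n, hl.mem_left⟩)) using 1
        ext z'
        rw [mem_Ioi, lt_iff, pos_ofOnPath]
        exact ⟨fun h => h l hl, fun h l' hl' => hl.left_unique hl' ▸ h⟩
      · convert isOpen_univ using 1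
        ext z'
        simp only [mem_univ, iff_true]
        exact fun l hl' => absurd ⟨l, hl'⟩ hl
    refine ⟨_, hopen1.inter hopen2, ⟨fun r hr => ?_, fun l hl => ?_⟩, fun z' hz' => ?_⟩
    · rw [h2, lex_zero_lt]; exact hr.lt
    · rw [h2, lex_zero_lt]; exact hl.lt
    have hbody : z.1.body = u.1 := by rw [h1]; rfl
    rw [hbody]
    have key : ∀ {x : Itinerary A} {l r : Itinerary A × ℝ}, ν.Adjacent n l r → Fits x l.1 r.1 →
        ∀ i < M, x i ≠ none ∧ (l.1 i = x i ∨ l.1 i = none) ∧ (r.1 i = x i ∨ r.1 i = none) := by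
      intro x l r h hf i hi
      have h3 := hf n i (by omega) fun j hj => h.agree hν (by omega)
      refine ⟨fun h4 => h.not_none hν i ?_, h3⟩
      rw [h4, or_self, or_self] at h3
      exact h3
    rcases lt_trichotomy z' z with h3 | h3 | h3
    · right
      rw [lt_iff, h2] at h3
      have h4 : 0 < u.2 := by
        by_contra hc
        have h5 := (z'.onPath.mem_Icc hν).1.trans_lt h3
        rw [lex_zero_lt] at h5
        exact hc h5
      obtain ⟨l, hl⟩ := exists_left_neighbour hun h4
      exact fun i hi => ⟨(key hl (z'.onPath.body_fits hν ⟨hl, hz'.2 l hl, h3⟩) i hi).1,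
        (key hl (z'.onPath.body_fits hν ⟨hl, hz'.2 l hl, h3⟩) i hi).2.2⟩
    · exact Or.inl h3
    · right
      rw [lt_iff, h2] at h3
      have h4 : u.2 < 1 := by
        by_contra hc
        have h5 := h3.trans_le (z'.onPath.mem_Icc hν).2
        rw [lex_zero_lt] at h5
        exact hc h5
      obtain ⟨r, hr⟩ := exists_right_neighbour hun h4
      exact fun i hi => ⟨(key hr (z'.onPath.body_fits hν ⟨hr, h3, hz'.1 r hr⟩) i hi).1,
        (key hr (z'.onPath.body_fits hν ⟨hr, h3, hz'.1 r hr⟩) i hi).2.1⟩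
  · refine ⟨Ioo (ofOnPath (.precritical (L M) ⟨M, (h1 M).1.1.mem_left⟩))
      (ofOnPath (.precritical (R M) ⟨M, (h1 M).1.1.mem_right⟩)), isOpen_Ioo, ?_, fun z' hz' => ?_⟩
    · rw [mem_Ioo, lt_iff, lt_iff, pos_ofOnPath, pos_ofOnPath]
      exact (h1 M).1.2
    · rw [mem_Ioo, lt_iff, lt_iff, pos_ofOnPath, pos_ofOnPath] at hz'
      right
      intro i hi
      have h2 := (h1 M).1.1.eq_of_fits_of_lt hν (h1 M).2
        (z'.onPath.body_fits hν ⟨(h1 M).1.1, hz'⟩) hi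
      exact ⟨by rw [← h2]; exact h0 i, Or.inl h2⟩

/-- The interior points of a Fatou interval on the critical path. -/
theorem exists_fatou {a b : Itinerary A} {t : Ioo (0 : ℝ) 1} {z : CriticalPath ν}
    (hz : z.1 = .fatou a b t) : ∃ F : Ioo (0 : ℝ) 1 → CriticalPath ν,
      (∀ t, (F t).1 = .fatou a b t) ∧ (StrictMono F ∨ StrictAnti F) ∧ OrdConnected (range F) := by
  have hν := hK.out
  have h := z.onPath
  rw [hz] at h
  obtain ⟨⟨p, hp⟩, u, rfl, ⟨hu, -⟩ | ⟨hu, -⟩⟩ := h.of_fatou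
  · have hp' : ∀ t : Ioo (0 : ℝ) 1, (ofOnPath (.fatouRight p hp u b hu t)).pos =
        toLex (u.2, 1 - (t : ℝ)) := fun t => pos_ofOnPath _
    refine ⟨fun t => ofOnPath (.fatouRight p hp u b hu t), fun t => rfl, Or.inr ?_, ⟨?_⟩⟩
    · intro t t' htt'
      rw [lt_iff, hp', hp', Prod.Lex.toLex_lt_toLex]
      exact Or.inr ⟨rfl, by have : (t : ℝ) < t' := htt'; simp only; linarith⟩
    · rintro _ ⟨t₁, rfl⟩ _ ⟨t₂, rfl⟩ w ⟨h1, h2⟩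
      rw [le_iff, hp', Prod.Lex.le_iff] at h1 h2
      simp only [ofLex_toLex] at h1 h2
      have h3 : (ofLex w.pos).1 = u.2 := by
        rcases h1 with h1 | h1
        · rcases h2 with h2 | h2
          · linarith
          · exact h2.1
        · exact h1.1.symm
      have h4 := (h1.resolve_left (by rw [h3]; exact lt_irrefl _)).2
      have h5 := (h2.resolve_left (by rw [h3]; exact lt_irrefl _)).2
      have := t₁.2.2; have := t₂.2.1
      refine ⟨⟨1 - (ofLex w.pos).2, by linarith, by linarith⟩, pos_injective ?_⟩
      rw [hp', ← h3]
      simp only [sub_sub_cancel]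
      rfl
  · have hp' : ∀ t : Ioo (0 : ℝ) 1, (ofOnPath (.fatouLeft p hp u b hu t)).pos =
        toLex (u.2, (t : ℝ) - 1) := fun t => pos_ofOnPath _
    refine ⟨fun t => ofOnPath (.fatouLeft p hp u b hu t), fun t => rfl, Or.inl ?_, ⟨?_⟩⟩
    · intro t t' htt'
      rw [lt_iff, hp', hp', Prod.Lex.toLex_lt_toLex]
      exact Or.inr ⟨rfl, by have : (t : ℝ) < t' := htt'; simp only; linarith⟩
    · rintro _ ⟨t₁, rfl⟩ _ ⟨t₂, rfl⟩ w ⟨h1, h2⟩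
      rw [le_iff, hp', Prod.Lex.le_iff] at h1 h2
      simp only [ofLex_toLex] at h1 h2
      have h3 : (ofLex w.pos).1 = u.2 := by
        rcases h1 with h1 | h1
        · rcases h2 with h2 | h2
          · linarith
          · exact h2.1
        · exact h1.1.symm
      have h4 := (h1.resolve_left (by rw [h3]; exact lt_irrefl _)).2
      have h5 := (h2.resolve_left (by rw [h3]; exact lt_irrefl _)).2
      have := t₁.2.1; have := t₂.2.2
      refine ⟨⟨1 + (ofLex w.pos).2, by linarith, by linarith⟩, pos_injective ?_⟩
      rw [hp', ← h3]
      simp only [add_sub_cancel_left]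
      rfl

/-- The points of a part of a Fatou interval form an open connected set. -/
theorem isOpen_fatou (a b : Itinerary A) {T : Set (Ioo (0 : ℝ) 1)} (hT : IsOpen T)
    (hT' : T.OrdConnected) : IsOpen {z : CriticalPath ν | ∃ t ∈ T, z.1 = .fatou a b t} ∧
    IsPreconnected {z : CriticalPath ν | ∃ t ∈ T, z.1 = .fatou a b t} := by
  rcases Set.eq_empty_or_nonempty {z : CriticalPath ν | ∃ t ∈ T, z.1 = .fatou a b t} with
    h | ⟨z, t, -, hz⟩
  · rw [h]; exact ⟨isOpen_empty, isPreconnected_empty⟩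
  obtain ⟨F, hF, hmono, hF'⟩ := exists_fatou hz
  have hset : {z : CriticalPath ν | ∃ t ∈ T, z.1 = .fatou a b t} = F '' T := by
    ext w
    constructor
    · rintro ⟨t, h1, h2⟩
      exact ⟨t, h1, Subtype.ext ((hF t).trans h2.symm)⟩
    · rintro ⟨t, h1, rfl⟩
      exact ⟨t, h1, hF t⟩
  rw [hset]
  constructor
  · rw [isOpen_iff_mem_nhds]
    rintro _ ⟨t, h1, rfl⟩
    obtain ⟨t₁, t₂, h2, h3⟩ := mem_nhds_iff_exists_Ioo_subset.1 (hT.mem_nhds h1)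
    rcases hmono with hm | hm
    · refine Filter.mem_of_superset (Ioo_mem_nhds (hm h2.1) (hm h2.2)) ?_
      rintro w ⟨h7, h8⟩
      obtain ⟨t', rfl⟩ := hF'.out ⟨t₁, rfl⟩ ⟨t₂, rfl⟩ ⟨h7.le, h8.le⟩
      exact ⟨t', h3 ⟨hm.lt_iff_lt.1 h7, hm.lt_iff_lt.1 h8⟩, rfl⟩
    · refine Filter.mem_of_superset (Ioo_mem_nhds (hm h2.2) (hm h2.1)) ?_
      rintro w ⟨h7, h8⟩
      obtain ⟨t', rfl⟩ := hF'.out ⟨t₂, rfl⟩ ⟨t₁, rfl⟩ ⟨h7.le, h8.le⟩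
      exact ⟨t', h3 ⟨hm.lt_iff_gt.1 h8, hm.lt_iff_gt.1 h7⟩, rfl⟩
  · refine OrdConnected.isPreconnected ⟨?_⟩
    rintro _ ⟨t₁, h1, rfl⟩ _ ⟨t₂, h2, rfl⟩ w ⟨h3, h4⟩
    obtain ⟨t, rfl⟩ := hF'.out ⟨t₁, rfl⟩ ⟨t₂, rfl⟩ ⟨h3, h4⟩
    refine ⟨t, ?_, rfl⟩
    rcases hmono with hm | hm
    · exact hT'.out h1 h2 ⟨hm.le_iff_le.1 h3, hm.le_iff_le.1 h4⟩
    · exact hT'.out h2 h1 ⟨hm.le_iff_ge.1 h4, hm.le_iff_ge.1 h3⟩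

/-- On each side of `u` where the path continues there is a Fatou interval, and one of its points at
distance less than `δ` serves as a bound. At the two ends of the path the missing side needs no
bound. -/
theorem exists_isOpen_pos {p : ℕ} (hp : ν.IsStarPeriodic p) {z : CriticalPath ν}
    {u : Itinerary A × ℝ} (hu : ν.InStages u) (hz : z.pos = toLex (u.2, 0)) {δ : ℝ} (hδ : 0 < δ) :
    ∃ O : Set (CriticalPath ν), IsOpen O ∧ z ∈ O ∧ ∀ z' ∈ O,
      ∃ y, -δ < y ∧ y < δ ∧ z'.pos = toLex (u.2, y) := by
  have hν := hK.out
  obtain ⟨ε, h0, hε⟩ := exists_between (lt_min hδ one_pos)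
  have hε1 := hε.trans_le (min_le_right _ _)
  have hεδ := hε.trans_le (min_le_left _ _)
  have hopen1 : ∃ O : Set (CriticalPath ν), IsOpen O ∧ z ∈ O ∧ ∀ z' ∈ O,
      z'.pos < toLex (u.2, δ) := by
    rcases hu.mem_Icc.2.lt_or_eq with h3 | h3
    · obtain ⟨a, ha⟩ := exists_rightEnd hν hp hu h3
      obtain ⟨w, hw⟩ := exists_onPath_right hp ha h0 hε1
      refine ⟨Iio (ofOnPath hw), isOpen_Iio, ?_, fun z' hz' => ?_⟩
      · rw [mem_Iio, lt_iff, pos_ofOnPath, hz, Prod.Lex.toLex_lt_toLex]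
        exact Or.inr ⟨rfl, h0⟩
      · rw [mem_Iio, lt_iff, pos_ofOnPath] at hz'
        refine hz'.trans ?_
        rw [Prod.Lex.toLex_lt_toLex]
        exact Or.inr ⟨rfl, hεδ⟩
    · refine ⟨univ, isOpen_univ, mem_univ _, fun z' _ => ?_⟩
      refine (z'.onPath.mem_Icc hν).2.trans_lt ?_
      rw [h3, Prod.Lex.toLex_lt_toLex]
      exact Or.inr ⟨rfl, hδ⟩
  have hopen2 : ∃ O : Set (CriticalPath ν), IsOpen O ∧ z ∈ O ∧ ∀ z' ∈ O,
      toLex (u.2, -δ) < z'.pos := by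
    rcases hu.mem_Icc.1.lt_or_eq with h3 | h3
    · obtain ⟨a, ha⟩ := exists_leftEnd hν hp hu h3
      obtain ⟨w, hw⟩ := exists_onPath_left hp ha (neg_lt_neg hε1) (neg_lt_zero.2 h0)
      refine ⟨Ioi (ofOnPath hw), isOpen_Ioi, ?_, fun z' hz' => ?_⟩
      · rw [mem_Ioi, lt_iff, pos_ofOnPath, hz, Prod.Lex.toLex_lt_toLex]
        exact Or.inr ⟨rfl, neg_lt_zero.2 h0⟩
      · rw [mem_Ioi, lt_iff, pos_ofOnPath] at hz'
        refine lt_trans ?_ hz'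
        rw [Prod.Lex.toLex_lt_toLex]
        exact Or.inr ⟨rfl, neg_lt_neg hεδ⟩
    · refine ⟨univ, isOpen_univ, mem_univ _, fun z' _ => ?_⟩
      refine lt_of_lt_of_le ?_ (z'.onPath.mem_Icc hν).1
      rw [← h3, Prod.Lex.toLex_lt_toLex]
      exact Or.inr ⟨rfl, neg_lt_zero.2 hδ⟩
  obtain ⟨O₁, ho1, hz1, h3⟩ := hopen1
  obtain ⟨O₂, ho2, hz2, h4⟩ := hopen2
  refine ⟨O₁ ∩ O₂, ho1.inter ho2, ⟨hz1, hz2⟩, fun z' hz' => ?_⟩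
  have h5 := h3 z' hz'.1
  have h6 := h4 z' hz'.2
  rw [Prod.Lex.lt_iff] at h5 h6
  simp only [ofLex_toLex] at h5 h6
  have h7 : (ofLex z'.pos).1 = u.2 := by
    rcases h5 with h5 | h5
    · rcases h6 with h6 | h6
      · linarith
      · exact h6.1.symm
    · exact h5.1
  exact ⟨(ofLex z'.pos).2, (h6.resolve_left (by rw [h7]; exact lt_irrefl _)).2,
    (h5.resolve_left (by rw [h7]; exact lt_irrefl _)).2, by rw [← h7]; rfl⟩

/-- If `ν` is `⋆`-periodic, then the precritical end of the Fatou interval is locally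
constant. -/
theorem exists_isOpen_rep_eq {p : ℕ} (hp : ν.IsStarPeriodic p) {z : CriticalPath ν}
    (hz : ¬ z.1.rep.StarFree) : ∃ O : Set (CriticalPath ν), IsOpen O ∧ z ∈ O ∧
      ∀ z' ∈ O, z'.1.rep = z.1.rep := by
  have hν := hK.out
  rcases z.onPath.kind hν with ⟨u, hu, h1, h2⟩ | ⟨h0, L, R, -, h1⟩
  · obtain ⟨O, hO, hzO, h3⟩ := exists_isOpen_pos hp hu h2 one_pos
    refine ⟨O, hO, hzO, fun z' hz' => ?_⟩
    obtain ⟨y, h4, h5, h6⟩ := h3 z' hz'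
    have h7 := z'.onPath
    rw [h6] at h7
    rw [h7.rep_eq hν hu h4 h5, h1]
    rfl
  · have h2 : ∃ a t, z.1 = .fatou a z.1.body t := by
      rcases h1 with ⟨h1, -⟩ | ⟨u, t, h1, -⟩ | ⟨u, t, h1, -⟩
      · rw [h1] at hz; exact absurd h0 hz
      · exact ⟨_, _, h1⟩
      · exact ⟨_, _, h1⟩
    obtain ⟨a, t, h2⟩ := h2
    refine ⟨_, (isOpen_fatou a z.1.body isOpen_univ ordConnected_univ).1, ⟨t, trivial, h2⟩, ?_⟩
    rintro z' ⟨t', -, h3⟩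
    rw [h3, h2]; rfl

/-- Near a precritical point of the critical path, the Fatou intervals are close to their end. -/
theorem exists_isOpen_fatou_near {p : ℕ} (hp : ν.IsStarPeriodic p) {z : CriticalPath ν}
    {x : Itinerary A} (hz : z.1 = .itinerary x) (hx : ¬ x.StarFree) {ε : ℝ} (hε : ε < 1) :
    ∃ O : Set (CriticalPath ν), IsOpen O ∧ z ∈ O ∧
      ∀ z' ∈ O, ∀ a b t, z'.1 = .fatou a b t → ε < t := by
  have hν := hK.out
  rcases z.onPath.kind hν with ⟨u, hu, h1, h2⟩ | ⟨h0, -⟩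
  · obtain ⟨O, hO, hzO, h3⟩ := exists_isOpen_pos hp hu h2 (sub_pos.2 hε)
    refine ⟨O, hO, hzO, fun z' hz' a b t h => ?_⟩
    obtain ⟨y, h4, h5, h6⟩ := h3 z' hz'
    have h7 := z'.onPath
    rw [h] at h7
    obtain ⟨-, v, -, ⟨-, h8⟩ | ⟨-, h8⟩⟩ := h7.of_fatou
    all_goals
      have h9 := congrArg (fun s => (ofLex s).2) (h6.symm.trans h8)
      simp only [ofLex_toLex] at h9
      linarith
  · rw [hz] at h0; exact absurd h0 hx

end CriticalPath

/-! ### Fatou intervals recovered from nested cells. -/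

namespace Itinerary

variable {A : Type*} {ν : Itinerary A}

theorem tendsto_snd_of_eventually {L : ℕ → Itinerary A × ℝ} {u : Itinerary A × ℝ}
    (h : ∀ᶠ n in atTop, L n = u) : Tendsto (fun n => (L n).2) atTop (𝓝 u.2) :=
  tendsto_const_nhds.congr' (h.mono fun n hn => by simp only [hn])

section Ends

variable {s : ℝ ×ₗ ℝ} {L R : ℕ → Itinerary A × ℝ} {x : Itinerary A}

theorem not_eventually_both (h : ∀ n, ν.Around s n (L n) (R n))
    (hc : ∀ n, ¬ Compat (L n).1 (R n).1) {u v : Itinerary A × ℝ} (hu : ∀ᶠ n in atTop, L n = u)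
    (hv : ∀ᶠ n in atTop, R n = v) : False := by
  obtain ⟨n, hn, hn'⟩ := (hu.and hv).exists
  have h1 := tendsto_nhds_unique (tendsto_snd_of_eventually hu) (cells_tendsto h hc).1
  have h2 := tendsto_nhds_unique (tendsto_snd_of_eventually hv) (cells_tendsto h hc).2
  have h3 := (h n).1.lt
  rw [hn, hn', h1, h2] at h3
  exact lt_irrefl _ h3

theorem rightEnd_of_cells {p : ℕ} (hν : ν.IsKneading) (hp : ν.IsStarPeriodic p)
    (h : ∀ n, ν.Around s n (L n) (R n)) (hf : ∀ n, Fits x (L n).1 (R n).1)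
    {u : Itinerary A × ℝ} (hu : ∀ᶠ n in atTop, L n = u) : ν.RightEnd u x := by
  obtain ⟨y, hy, hf', h1⟩ := around_cases hν h
  obtain rfl := eq_of_cells hν (fun n => (h n).1) hf hf'
  rcases h1 with ⟨n, hc⟩ | ⟨hc, h2, -⟩ | ⟨hc, v, -, -, ⟨-, h4, h5⟩ | ⟨-, h4, -⟩⟩
  · obtain ⟨m, hm, hnm⟩ := (hu.and (eventually_ge_atTop n)).exists
    rw [← hm, (cells_const h hnm (diff_eq_top_iff.1 hc.2.1)).1]
    exact Or.inr ⟨_, hc⟩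
  · exact absurd hu (not_eventually_left h hc h2 u)
  · obtain ⟨n, hn, hn'⟩ := (hu.and h4).exists
    rw [← hn, hn']
    exact Or.inl (h5 (hp.mem_X hy))
  · exact (not_eventually_both h hc hu h4).elim

theorem leftEnd_of_cells {p : ℕ} (hν : ν.IsKneading) (hp : ν.IsStarPeriodic p)
    (h : ∀ n, ν.Around s n (L n) (R n)) (hf : ∀ n, Fits x (L n).1 (R n).1)
    {u : Itinerary A × ℝ} (hu : ∀ᶠ n in atTop, R n = u) : ν.LeftEnd u x := by
  obtain ⟨y, hy, hf', h1⟩ := around_cases hν h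
  obtain rfl := eq_of_cells hν (fun n => (h n).1) hf hf'
  rcases h1 with ⟨n, hc⟩ | ⟨hc, h2, -⟩ | ⟨hc, v, -, -, ⟨-, h4, -⟩ | ⟨-, h4, h5⟩⟩
  · obtain ⟨m, hm, hnm⟩ := (hu.and (eventually_ge_atTop n)).exists
    rw [← hm, (cells_const h hnm (diff_eq_top_iff.1 hc.2.1)).2]
    exact Or.inr ⟨_, hc⟩
  · exact absurd hu (not_eventually_right h hc h2 u)
  · exact (not_eventually_both h hc h4 hu).elim
  · obtain ⟨n, hn, hn'⟩ := (hu.and h4).exists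
    rw [← hn, hn']
    exact Or.inl (h5 (hp.mem_X hy))

/-- The position of a point without `⋆`, compared with a value of the second component. -/
theorem lt_of_eventually_left (h : ∀ n, ν.Around s n (L n) (R n)) {a b : ℝ}
    (ha : Tendsto (fun n => (L n).2) atTop (𝓝 a)) (hb : Tendsto (fun n => (R n).2) atTop (𝓝 b))
    {u : Itinerary A × ℝ} (hu : ∀ᶠ n in atTop, L n = u) {ζ : ℝ} (hζ : ζ < 1) :
    toLex (u.2, ζ) < toLex ((a + b) / 2, evConst L - evConst R) := by
  have h1 : u.2 = a := tendsto_nhds_unique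
    (tendsto_snd_of_eventually hu) ha
  have h2 : a ≤ b := le_of_tendsto_of_tendsto' ha hb fun n => (h n).1.lt.le
  rw [Prod.Lex.toLex_lt_toLex]
  rcases h2.lt_or_eq with h3 | h3
  · left; simp only; linarith
  · right
    refine ⟨by simp only; linarith, ?_⟩
    rw [evConst_of_eventually hu, evConst_of_not]
    · simpa using hζ
    · intro v hv
      have h4 : v.2 = b := tendsto_nhds_unique
        (tendsto_snd_of_eventually hv) hb
      obtain ⟨n, hn, hn'⟩ := (hu.and hv).exists
      have h5 := (h n).1.lt
      rw [hn, hn'] at h5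
      linarith

theorem lt_of_eventually_right (h : ∀ n, ν.Around s n (L n) (R n)) {a b : ℝ}
    (ha : Tendsto (fun n => (L n).2) atTop (𝓝 a)) (hb : Tendsto (fun n => (R n).2) atTop (𝓝 b))
    {u : Itinerary A × ℝ} (hu : ∀ᶠ n in atTop, R n = u) {ζ : ℝ} (hζ : -1 < ζ) :
    toLex ((a + b) / 2, evConst L - evConst R) < toLex (u.2, ζ) := by
  have h1 : u.2 = b := tendsto_nhds_unique
    (tendsto_snd_of_eventually hu) hb
  have h2 : a ≤ b := le_of_tendsto_of_tendsto' ha hb fun n => (h n).1.lt.le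
  rw [Prod.Lex.toLex_lt_toLex]
  rcases h2.lt_or_eq with h3 | h3
  · left; simp only; linarith
  · right
    refine ⟨by simp only; linarith, ?_⟩
    rw [evConst_of_eventually hu, evConst_of_not]
    · simpa using hζ
    · intro v hv
      have h4 : v.2 = a := tendsto_nhds_unique
        (tendsto_snd_of_eventually hv) ha
      obtain ⟨n, hn, hn'⟩ := (hu.and hv).exists
      have h5 := (h n).1.lt
      rw [hn, hn'] at h5
      linarith

end Ends

end Itinerary

namespace CriticalPath

open Itinerary

variable {A : Type*} {ν : Itinerary A} [hK : Fact ν.IsKneading]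

/-! ### The two sides of a point -/

section Sides

variable {z c : CriticalPath ν} {L R : ℕ → Itinerary A × ℝ} {a b : ℝ} {x : Itinerary A}

/-- A point to the right of `z` is beyond the right end of some cell around `z`, or it lies in the
Fatou interval to the right of `z`. -/
theorem right_cases (hz : z.1 = .itinerary x)
    (h : ∀ n, ν.Around z.pos n (L n) (R n) ∧ Fits x (L n).1 (R n).1)
    (ha : Tendsto (fun n => (L n).2) atTop (𝓝 a)) (hb : Tendsto (fun n => (R n).2) atTop (𝓝 b))
    (hs : z.pos = toLex ((a + b) / 2, evConst L - evConst R)) (hzc : z < c) :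
    (∃ n, toLex ((R n).2, 0) ≤ c.pos) ∨ ∃ u t, c.1 = .fatou u.1 x t ∧ ν.LeftEnd u x ∧
      (∀ᶠ n in atTop, R n = u) ∧ c.pos = toLex (u.2, (t : ℝ) - 1) := by
  have hν := hK.out
  by_cases h1 : ∃ n, toLex ((R n).2, 0) ≤ c.pos
  · exact Or.inl h1
  right
  push Not at h1
  have h2 : ∀ n, ν.Around c.pos n (L n) (R n) := fun n =>
    ⟨(h n).1.1, (h n).1.2.1.trans hzc, h1 n⟩
  rcases c.onPath.kind hν with ⟨u, ⟨m, hu⟩, -, h3⟩ | ⟨-, L', R', h3, h4⟩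
  · exact absurd h3 ((h2 m).not_mem hu)
  obtain ⟨rfl, rfl⟩ : L = L' ∧ R = R' :=
    ⟨funext fun n => ((h2 n).unique (h3 n).1).1, funext fun n => ((h2 n).unique (h3 n).1).2⟩
  have h5 : c.1.body = x := eq_of_cells hν (fun n => (h n).1.1) (fun n => (h3 n).2)
    (fun n => (h n).2)
  rw [h5] at h4
  rcases h4 with ⟨h4, -⟩ | ⟨u, t, -, -, h6, h7⟩ | ⟨u, t, h8, h9, h6, h7⟩
  · exact absurd (Subtype.ext (hz.trans h4.symm)) hzc.ne
  · have h8 := lt_of_eventually_left (fun n => (h n).1) ha hb h6 (ζ := 1 - (t : ℝ))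
      (by linarith [t.2.1])
    rw [← hs, ← h7] at h8
    exact absurd h8 (not_lt.2 hzc.le)
  · exact ⟨u, t, h8, h9, h6, h7⟩

theorem left_cases (hz : z.1 = .itinerary x)
    (h : ∀ n, ν.Around z.pos n (L n) (R n) ∧ Fits x (L n).1 (R n).1)
    (ha : Tendsto (fun n => (L n).2) atTop (𝓝 a)) (hb : Tendsto (fun n => (R n).2) atTop (𝓝 b))
    (hs : z.pos = toLex ((a + b) / 2, evConst L - evConst R)) (hzc : c < z) :
    (∃ n, c.pos ≤ toLex ((L n).2, 0)) ∨ ∃ u t, c.1 = .fatou u.1 x t ∧ ν.RightEnd u x ∧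
      (∀ᶠ n in atTop, L n = u) ∧ c.pos = toLex (u.2, 1 - (t : ℝ)) := by
  have hν := hK.out
  by_cases h1 : ∃ n, c.pos ≤ toLex ((L n).2, 0)
  · exact Or.inl h1
  right
  push Not at h1
  have h2 : ∀ n, ν.Around c.pos n (L n) (R n) := fun n =>
    ⟨(h n).1.1, h1 n, lt_trans hzc (h n).1.2.2⟩
  rcases c.onPath.kind hν with ⟨u, ⟨m, hu⟩, -, h3⟩ | ⟨-, L', R', h3, h4⟩
  · exact absurd h3 ((h2 m).not_mem hu)
  obtain ⟨rfl, rfl⟩ : L = L' ∧ R = R' :=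
    ⟨funext fun n => ((h2 n).unique (h3 n).1).1, funext fun n => ((h2 n).unique (h3 n).1).2⟩
  have h5 : c.1.body = x := eq_of_cells hν (fun n => (h n).1.1) (fun n => (h3 n).2)
    (fun n => (h n).2)
  rw [h5] at h4
  rcases h4 with ⟨h4, -⟩ | ⟨u, t, h8, h9, h6, h7⟩ | ⟨u, t, -, -, h6, h7⟩
  · exact absurd (Subtype.ext (hz.trans h4.symm)) hzc.ne'
  · exact ⟨u, t, h8, h9, h6, h7⟩
  · have h8 := lt_of_eventually_right (fun n => (h n).1) ha hb h6 (ζ := (t : ℝ) - 1)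
      (by linarith [t.2.1])
    rw [← hs, ← h7] at h8
    exact absurd h8 (not_lt.2 hzc.le)

end Sides

/-- Along `x`, the track of `e` is left infinitely often, and almost always this is witnessed by a
precritical point in `S`. -/
def Germ (x e : Itinerary A) (S : Set (CriticalPath ν)) : Prop :=
  (∀ K, ∃ k ≥ K, ν.Leaves x e k) ∧
    ∃ K, ∀ k ≥ K, ν.Leaves x e k → ∃ w ∈ S, w.1 = .itinerary (starAt ν x k)

section Germs

variable {z c : CriticalPath ν} {s : ℝ ×ₗ ℝ} {L R : ℕ → Itinerary A × ℝ} {x : Itinerary A}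

/-- From some stage on the right bounds lie strictly between `z` and `c`. Each later time at which
the track of ν leaves `x` is the time of a subdivision whose inserted point becomes the new right
bound. -/
theorem germ_right_of_cells (h : ∀ n, ν.Around s n (L n) (R n))
    (hf : ∀ n, Fits x (L n).1 (R n).1) (hR : ∀ u, ¬ ∀ᶠ n in atTop, R n = u)
    (hz : ∀ n, z.pos < toLex ((R n).2, 0)) {n : ℕ} (hc : toLex ((R n).2, 0) ≤ c.pos) :
    Germ x ν (Ioo z c) := by
  have hν := hK.out
  refine ⟨leaves_self hν h hf hR, ?_⟩
  obtain ⟨m, hnm, hm⟩ : ∃ m ≥ n, R m ≠ R n := by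
    by_contra! hcon
    exact hR (R n) (eventually_atTop.2 ⟨n, hcon⟩)
  have hlt : (R m).2 < (R n).2 := lt_of_le_of_ne (cells_mono h hnm).2 fun he =>
    hm (InStages.eq_of_snd_eq ⟨m, (h m).1.mem_right⟩ ⟨n, (h n).1.mem_right⟩ he)
  have hcc : ∀ i, ¬ Compat (L i).1 (R i).1 := fun i hi =>
    hR (R i) (eventually_atTop.2 ⟨i, fun j hj => (cells_const h hj hi).2⟩)
  obtain ⟨K, hK'⟩ := cells_of_leaves hν h hf hcc m
  refine ⟨K, fun k hk hl => ?_⟩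
  obtain ⟨i, hi, hi'⟩ := (hK' k hk).2 hl
  refine ⟨ofOnPath (.precritical (R (i + 1)) ⟨i + 1, (h _).1.mem_right⟩), ⟨?_, ?_⟩, ?_⟩
  · rw [lt_iff, pos_ofOnPath]; exact hz _
  · rw [lt_iff, pos_ofOnPath]
    refine lt_of_lt_of_le ?_ hc
    rw [lex_zero_lt]
    exact (cells_mono h (hi.trans i.le_succ)).2.trans_lt hlt
  · exact congrArg _ hi'

theorem germ_left_of_cells (h : ∀ n, ν.Around s n (L n) (R n))
    (hf : ∀ n, Fits x (L n).1 (R n).1) (hL : ∀ u, ¬ ∀ᶠ n in atTop, L n = u)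
    (hz : ∀ n, toLex ((L n).2, 0) < z.pos) {n : ℕ} (hc : c.pos ≤ toLex ((L n).2, 0)) :
    Germ x ν.star (Ioo c z) := by
  have hν := hK.out
  refine ⟨leaves_star hν h hf hL, ?_⟩
  obtain ⟨m, hnm, hm⟩ : ∃ m ≥ n, L m ≠ L n := by
    by_contra! hcon
    exact hL (L n) (eventually_atTop.2 ⟨n, hcon⟩)
  have hlt : (L n).2 < (L m).2 := lt_of_le_of_ne (cells_mono h hnm).1 fun he =>
    hm (InStages.eq_of_snd_eq ⟨m, (h m).1.mem_left⟩ ⟨n, (h n).1.mem_left⟩ he.symm)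
  have hcc : ∀ i, ¬ Compat (L i).1 (R i).1 := fun i hi =>
    hL (L i) (eventually_atTop.2 ⟨i, fun j hj => (cells_const h hj hi).1⟩)
  obtain ⟨K, hK'⟩ := cells_of_leaves hν h hf hcc m
  refine ⟨K, fun k hk hl => ?_⟩
  obtain ⟨i, hi, hi'⟩ := (hK' k hk).1 hl
  refine ⟨ofOnPath (.precritical (L (i + 1)) ⟨i + 1, (h _).1.mem_left⟩), ⟨?_, ?_⟩, ?_⟩
  · rw [lt_iff, pos_ofOnPath]
    refine lt_of_le_of_lt hc ?_
    rw [lex_zero_lt]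
    exact hlt.trans_le (cells_mono h (hi.trans i.le_succ)).1
  · rw [lt_iff, pos_ofOnPath]; exact hz _
  · exact congrArg _ hi'

end Germs

variable {z c : CriticalPath ν} {y : Itinerary A}

/-- What there is immediately to the right of a point. -/
theorem exists_germ_right (hz : z.1 = .itinerary y) (hy : y.StarFree ∨ ν.IsNonperiodic)
    (hzc : z < c) :
    (∃ x, x.StarFree ∧ Compat y x ∧ Germ x ν (Ioo z c)) ∨
      ∃ a t, ∃ w ∈ Ioo z c, w.1 = .fatou a y t := by
  have hν := hK.out
  rcases z.onPath.kind hν with ⟨u, hu, h1, h2⟩ | ⟨h0, L, R, h, h1⟩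
  · obtain rfl : y = u.1 := by rw [hz] at h1; exact TreePoint.itinerary.inj h1
    have hn : ν.IsNonperiodic := hy.elim (fun h => (hu.starFree hν h).2) id
    have hz0 : c.pos = toLex ((ofLex c.pos).1, 0) := by
      rw [← c.onPath.snd_eq_zero hn]; rfl
    have hlt : u.2 < (ofLex c.pos).1 := by
      have := lt_iff.1 hzc
      rwa [h2, hz0, lex_zero_lt] at this
    have hc1 : (ofLex c.pos).1 ≤ 1 := by
      have := (c.onPath.mem_Icc hν).2
      rw [hz0, ← not_lt, lex_zero_lt, not_lt] at this
      exact this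
    -- For non-periodic ν no point of the path is at this position; it only serves to select the
    -- cells immediately to the right of `u`.
    obtain ⟨L, R, h⟩ := exists_cells (ν := ν) (s := toLex (u.2, (1 / 2 : ℝ)))
      (by rw [Prod.Lex.toLex_lt_toLex]; rcases hu.mem_Icc.1.lt_or_eq with h | h
          · exact Or.inl h
          · exact Or.inr ⟨h, by norm_num⟩)
      (by rw [Prod.Lex.toLex_lt_toLex]; exact Or.inl (hlt.trans_le hc1))
      (fun v _ hc => by have := congrArg (fun s => (ofLex s).2) hc; norm_num at this)
    have hcc := fun n => (h n).1.not_compat hn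
    obtain ⟨x, hx, hf, ⟨n, hc⟩ | ⟨-, h3, -⟩ | ⟨-, v, h3, h4, ⟨-, h5, -⟩ | ⟨h4, -, -⟩⟩⟩ :=
      around_cases hν h
    · exact absurd (diff_eq_top_iff.1 hc.2.1) (hcc n)
    · exact absurd rfl (h3 u hu)
    · obtain rfl := h3.eq_of_snd_eq hu h4
      left
      have ht := (cells_tendsto h hcc).2
      obtain ⟨n, hn'⟩ := (ht.eventually (gt_mem_nhds hlt)).exists
      have hvR : ∀ n, z.pos < toLex ((R n).2, 0) := fun n => by
        refine lt_trans ?_ (h n).2.2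
        rw [h2, Prod.Lex.toLex_lt_toLex]
        exact Or.inr ⟨rfl, by norm_num⟩
      refine ⟨x, hx, fun i => ?_, germ_right_of_cells h hf
        (fun w hw => not_eventually_both h hcc h5 hw) hvR (n := n) ?_⟩
      · obtain ⟨m, hm, hm'⟩ := (h5.and (eventually_gt_atTop i)).exists
        rw [← hm]
        rcases (hf m (i + 1) i (by omega) fun j hj => (h m).1.agree hν (by omega)).1 with h6 | h6
        · exact Or.inr (Or.inr h6)
        · exact Or.inl h6
      · rw [hz0]; exact (lex_zero_lt.2 hn').le
    · norm_num at h4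
  have hb : z.1.body = y := by rw [hz]; rfl
  rw [hb] at h0 h h1
  obtain ⟨-, a, b, h2, h3, h4⟩ | ⟨u, t, h1, -⟩ | ⟨u, t, h1, -⟩ := h1
  · have hcas := right_cases hz h h2 h3 h4 hzc
    by_cases hR : ∃ v, ∀ᶠ n in atTop, R n = v
    · obtain ⟨v, hv⟩ := hR
      -- For non-periodic ν the cells shrink to `z`, so a constant right bound would have the
      -- position of `z`. Thus ν is ⋆-periodic, and the constant bound is the precritical end of a
      -- Fatou interval.
      rcases id hν with hn | ⟨p, -, hp⟩
      · have hcc := fun n => (h n).1.1.not_compat hn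
        have h5 : z.pos = toLex (v.2, 0) := by
          have h6 := z.onPath.snd_eq_zero hn
          have h7 := tendsto_nhds_unique (tendsto_snd_of_eventually hv) (cells_tendsto (fun n => (h n).1) hcc).2
          rw [h7, ← h6]; rfl
        obtain ⟨n, hn⟩ := hv.exists
        exact absurd h5 ((h n).1.not_mem (hn ▸ (h n).1.1.mem_right))
      right
      have hve := leftEnd_of_cells hν hp (fun n => (h n).1) (fun n => (h n).2) hv
      obtain ⟨t, ht⟩ : ∃ t : Ioo (0 : ℝ) 1, toLex (v.2, (t : ℝ) - 1) < c.pos := by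
        rcases hcas with ⟨n, hn⟩ | ⟨u, t, -, -, h5, h6⟩
        · refine ⟨⟨1 / 2, by norm_num, by norm_num⟩, lt_of_lt_of_le ?_ hn⟩
          obtain ⟨m, hm, hnm⟩ := (hv.and (eventually_ge_atTop n)).exists
          have := (cells_mono (fun n => (h n).1) hnm).2
          rw [hm] at this
          rw [Prod.Lex.toLex_lt_toLex]
          rcases this.lt_or_eq with h7 | h7
          · exact Or.inl h7
          · exact Or.inr ⟨h7, by norm_num⟩
        · obtain ⟨m, hm, hm'⟩ := (hv.and h5).exists
          rw [hm] at hm'; subst hm'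
          have := t.2.1; have := t.2.2
          refine ⟨⟨t / 2, by linarith, by linarith⟩, ?_⟩
          rw [h6, Prod.Lex.toLex_lt_toLex]
          exact Or.inr ⟨rfl, by simp only; linarith⟩
      refine ⟨v.1, t, ofOnPath (.fatouLeft p hp v y hve t), ⟨?_, ?_⟩, rfl⟩
      · rw [lt_iff, pos_ofOnPath, h4]
        exact lt_of_eventually_right (fun n => (h n).1) h2 h3 hv (by linarith [t.2.1])
      · rwa [lt_iff, pos_ofOnPath]
    · rw [not_exists] at hR
      left
      rcases hcas with ⟨n, hn⟩ | ⟨u, t, -, -, h5, h6⟩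
      · exact ⟨y, h0, fun i => Or.inr (Or.inr rfl), germ_right_of_cells (fun n => (h n).1)
          (fun n => (h n).2) hR (fun n => (h n).1.2.2) hn⟩
      · exact absurd h5 (hR u)
  · rw [hz] at h1; cases h1
  · rw [hz] at h1; cases h1

/-- What there is immediately to the left of a point. -/
theorem exists_germ_left (hz : z.1 = .itinerary y) (hy : y.StarFree ∨ ν.IsNonperiodic)
    (hzc : c < z) :
    (∃ x, x.StarFree ∧ Compat y x ∧ Germ x ν.star (Ioo c z)) ∨
      ∃ a t, ∃ w ∈ Ioo c z, w.1 = .fatou a y t := by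
  have hν := hK.out
  rcases z.onPath.kind hν with ⟨u, hu, h1, h2⟩ | ⟨h0, L, R, h, h1⟩
  · obtain rfl : y = u.1 := by rw [hz] at h1; exact TreePoint.itinerary.inj h1
    have hn : ν.IsNonperiodic := hy.elim (fun h => (hu.starFree hν h).2) id
    have hz0 : c.pos = toLex ((ofLex c.pos).1, 0) := by
      rw [← c.onPath.snd_eq_zero hn]; rfl
    have hlt : (ofLex c.pos).1 < u.2 := by
      have := lt_iff.1 hzc
      rwa [h2, hz0, lex_zero_lt] at this
    have hc1 : 0 ≤ (ofLex c.pos).1 := by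
      have := (c.onPath.mem_Icc hν).1
      rw [hz0, ← not_lt, lex_zero_lt, not_lt] at this
      exact this
    obtain ⟨L, R, h⟩ := exists_cells (ν := ν) (s := toLex (u.2, (-1 / 2 : ℝ)))
      (by rw [Prod.Lex.toLex_lt_toLex]; exact Or.inl (hc1.trans_lt hlt))
      (by rw [Prod.Lex.toLex_lt_toLex]; rcases hu.mem_Icc.2.lt_or_eq with h | h
          · exact Or.inl h
          · exact Or.inr ⟨h, by norm_num⟩)
      (fun v _ hc => by have := congrArg (fun s => (ofLex s).2) hc; norm_num at this)
    have hcc := fun n => (h n).1.not_compat hn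
    obtain ⟨x, hx, hf, ⟨n, hc⟩ | ⟨-, h3, -⟩ | ⟨-, v, h3, h4, ⟨h4, -, -⟩ | ⟨-, h5, -⟩⟩⟩ :=
      around_cases hν h
    · exact absurd (diff_eq_top_iff.1 hc.2.1) (hcc n)
    · exact absurd rfl (h3 u hu)
    · norm_num at h4
    · obtain rfl := h3.eq_of_snd_eq hu h4
      left
      have ht := (cells_tendsto h hcc).1
      obtain ⟨n, hn'⟩ := (ht.eventually (lt_mem_nhds hlt)).exists
      have hvL : ∀ n, toLex ((L n).2, 0) < z.pos := fun n => by
        refine lt_trans (h n).2.1 ?_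
        rw [h2, Prod.Lex.toLex_lt_toLex]
        exact Or.inr ⟨rfl, by norm_num⟩
      refine ⟨x, hx, fun i => ?_, germ_left_of_cells h hf
        (fun w hw => not_eventually_both h hcc hw h5) hvL (n := n) ?_⟩
      · obtain ⟨m, hm, hm'⟩ := (h5.and (eventually_gt_atTop i)).exists
        rw [← hm]
        rcases (hf m (i + 1) i (by omega) fun j hj => (h m).1.agree hν (by omega)).2 with h6 | h6
        · exact Or.inr (Or.inr h6)
        · exact Or.inl h6
      · rw [hz0]; exact (lex_zero_lt.2 hn').le
  have hb : z.1.body = y := by rw [hz]; rfl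
  rw [hb] at h0 h h1
  obtain ⟨-, a, b, h2, h3, h4⟩ | ⟨u, t, h1, -⟩ | ⟨u, t, h1, -⟩ := h1
  · have hcas := left_cases hz h h2 h3 h4 hzc
    by_cases hL : ∃ v, ∀ᶠ n in atTop, L n = v
    · obtain ⟨v, hv⟩ := hL
      rcases id hν with hn | ⟨p, -, hp⟩
      · have hcc := fun n => (h n).1.1.not_compat hn
        have h5 : z.pos = toLex (v.2, 0) := by
          have h6 := z.onPath.snd_eq_zero hn
          have h7 := tendsto_nhds_unique (tendsto_snd_of_eventually hv) (cells_tendsto (fun n => (h n).1) hcc).1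
          rw [h7, ← h6]; rfl
        obtain ⟨n, hn⟩ := hv.exists
        exact absurd h5 ((h n).1.not_mem (hn ▸ (h n).1.1.mem_left))
      right
      have hve := rightEnd_of_cells hν hp (fun n => (h n).1) (fun n => (h n).2) hv
      obtain ⟨t, ht⟩ : ∃ t : Ioo (0 : ℝ) 1, c.pos < toLex (v.2, 1 - (t : ℝ)) := by
        rcases hcas with ⟨n, hn⟩ | ⟨u, t, -, -, h5, h6⟩
        · refine ⟨⟨1 / 2, by norm_num, by norm_num⟩, lt_of_le_of_lt hn ?_⟩
          obtain ⟨m, hm, hnm⟩ := (hv.and (eventually_ge_atTop n)).exists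
          have := (cells_mono (fun n => (h n).1) hnm).1
          rw [hm] at this
          rw [Prod.Lex.toLex_lt_toLex]
          rcases this.lt_or_eq with h7 | h7
          · exact Or.inl h7
          · exact Or.inr ⟨h7, by norm_num⟩
        · obtain ⟨m, hm, hm'⟩ := (hv.and h5).exists
          rw [hm] at hm'; subst hm'
          have := t.2.1; have := t.2.2
          refine ⟨⟨t / 2, by linarith, by linarith⟩, ?_⟩
          rw [h6, Prod.Lex.toLex_lt_toLex]
          exact Or.inr ⟨rfl, by simp only; linarith⟩
      refine ⟨v.1, t, ofOnPath (.fatouRight p hp v y hve t), ⟨?_, ?_⟩, rfl⟩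
      · rwa [lt_iff, pos_ofOnPath]
      · rw [lt_iff, pos_ofOnPath, h4]
        exact lt_of_eventually_left (fun n => (h n).1) h2 h3 hv (by linarith [t.2.1])
    · rw [not_exists] at hL
      left
      rcases hcas with ⟨n, hn⟩ | ⟨u, t, -, -, h5, h6⟩
      · exact ⟨y, h0, fun i => Or.inr (Or.inr rfl), germ_left_of_cells (fun n => (h n).1)
          (fun n => (h n).2) hL (fun n => (h n).1.2.1) hn⟩
      · exact absurd h5 (hL u)
  · rw [hz] at h1; cases h1
  · rw [hz] at h1; cases h1

end CriticalPath

namespace Itinerary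

variable {A : Type*} {ν : Itinerary A}

/-! ### Which points lie on the critical path -/

/-- By compatibility with `x` both tracks consist of shifts, so merging gives a common tail. Going
backwards, each earlier entry is the symbol of `x` or ⋆, and by properness the tail behind it
decides which. -/
theorem Proper.eq_of_merge {x a b : Itinerary A} (ha : ν.Proper a) (hb : ν.Proper b)
    (hx : x.StarFree) (hax : Compat a x) (hbx : Compat b x) (h : ν.Merge x a b) : a = b := by
  have key : ∀ {a : Itinerary A}, Compat a x → ∀ i, a i = x i ∨ a i = none := fun h i => by
    rcases h i with h | h | h
    exacts [Or.inr h, absurd h (hx i), Or.inl h]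
  obtain ⟨n, hn⟩ := h
  rw [ha.track_eq_drop fun i _ => key hax i, hb.track_eq_drop fun i _ => key hbx i] at hn
  induction n with
  | zero => simpa using hn
  | succ n ih =>
    apply ih
    funext i
    rcases i with _ | i
    · rw [drop_apply, drop_apply, zero_add]
      have h1 := (ha n).trans ((by rw [hn] : Itinerary.drop (n + 1) a = ν ↔ Itinerary.drop (n + 1) b = ν).trans
        (hb n).symm)
      rcases key hax n with h2 | h2
      · rcases key hbx n with h3 | h3
        · rw [h2, h3]
        · rw [h3, h1.2 h3]
      · rw [h2, h1.1 h2]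
    · have := congrFun hn i
      simp only [drop_apply] at this ⊢
      rwa [show i + 1 + n = i + (n + 1) by omega]

/-- This is the converse of `not_merge_of_fits` for ⋆-periodic ν. The fitting cells are nested; over
the supremum of the left bounds, one of the heights `1`, `-1`, `0` gives a position inside all of
them, depending on whether a left or a right bound reaches this value. -/
theorem exists_onPath_itinerary {p : ℕ} (hν : ν.IsKneading) (hp : ν.IsStarPeriodic p)
    {x : Itinerary A} (hx : x.StarFree) (hm : ¬ ν.Merge x ν.star ν) :
    ∃ s, OnPath ν (.itinerary x) s := by
  choose L R h1 hf _ using exists_adjacent_fits hν hx hm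
  have hmono : ∀ n, (L n).2 ≤ (L (n + 1)).2 ∧ (R (n + 1)).2 ≤ (R n).2 := by
    intro n
    rcases (h1 (n + 1)).cases with ⟨h2, -⟩ | ⟨w, k, h2, h3, h4⟩ | ⟨w, k, h2, h3, h4⟩
    · obtain ⟨h3, h4⟩ := h2.eq_of_fits hν (h1 n) (hf (n + 1)) (hf n)
      rw [h3, h4]; exact ⟨le_rfl, le_rfl⟩
    · have h5 := hf (n + 1)
      rw [h4] at h5
      obtain ⟨N, hN, -⟩ := h2.exists_reduces hν
      obtain ⟨h6, h7⟩ := h2.eq_of_fits hν (h1 n) (h5.of_child hν hN (h2.isMid hν h3)) (hf n)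
      have h8 := h2.lt
      rw [h6, h7] at h4 h8
      rw [h4, h6]
      refine ⟨le_rfl, ?_⟩
      simp only [mid]; linarith
    · have h5 := hf (n + 1)
      rw [h4] at h5
      obtain ⟨N, hN, -⟩ := h2.exists_reduces hν
      obtain ⟨h6, h7⟩ := h2.eq_of_fits hν (h1 n)
        (h5.symm.of_child hν hN.symm (h2.isMid hν h3).symm).symm (hf n)
      have h8 := h2.lt
      rw [h6, h7] at h4 h8
      rw [h4, h7]
      refine ⟨?_, le_rfl⟩
      simp only [mid]; linarith
  have hL : Monotone fun n => (L n).2 := monotone_nat_of_le_succ fun n => (hmono n).1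
  have hR : Antitone fun n => (R n).2 := antitone_nat_of_succ_le fun n => (hmono n).2
  have hLR : ∀ m n, (L m).2 < (R n).2 := fun m n =>
    (hL (le_max_left m n)).trans_lt ((h1 _).lt.trans_le (hR (le_max_right m n)))
  have hbdd : BddAbove (range fun n => (L n).2) := ⟨(R 0).2, by
    rintro _ ⟨n, rfl⟩; exact (hLR n 0).le⟩
  set y := ⨆ n, (L n).2
  have hy1 : ∀ n, (L n).2 ≤ y := fun n => le_ciSup hbdd n
  have hy2 : ∀ n, y ≤ (R n).2 := fun n => ciSup_le fun m => (hLR m n).le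
  obtain ⟨s, hs⟩ : ∃ s, ∀ n, ν.Around s n (L n) (R n) := by
    by_cases hc1 : ∃ m, (L m).2 = y
    · obtain ⟨m, hm⟩ := hc1
      refine ⟨toLex (y, 1), fun n => ⟨h1 n, ?_, ?_⟩⟩
      · rw [Prod.Lex.toLex_lt_toLex]
        rcases (hy1 n).lt_or_eq with h | h
        · exact Or.inl h
        · exact Or.inr ⟨h, one_pos⟩
      · rw [Prod.Lex.toLex_lt_toLex]
        exact Or.inl (hm ▸ hLR m n)
    by_cases hc2 : ∃ m, (R m).2 = y
    · obtain ⟨m, hm⟩ := hc2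
      refine ⟨toLex (y, -1), fun n => ⟨h1 n, ?_, ?_⟩⟩
      · rw [Prod.Lex.toLex_lt_toLex]
        exact Or.inl (hm ▸ hLR n m)
      · rw [Prod.Lex.toLex_lt_toLex]
        rcases (hy2 n).lt_or_eq with h | h
        · exact Or.inl h
        · exact Or.inr ⟨h, by norm_num⟩
    push Not at hc1 hc2
    exact ⟨toLex (y, 0), fun n => ⟨h1 n, lex_zero_lt.2 (lt_of_le_of_ne (hy1 n) (hc1 n)),
      lex_zero_lt.2 (lt_of_le_of_ne (hy2 n) (hc2 n).symm)⟩⟩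
  obtain ⟨x', hx', hf', h2⟩ := around_cases hν hs
  obtain rfl := eq_of_cells hν h1 hf hf'
  rcases h2 with ⟨n, hc⟩ | ⟨-, -, h2⟩ | ⟨-, v, -, -, ⟨-, -, h2⟩ | ⟨-, -, h2⟩⟩
  · exact ⟨_, .central _ _ _ hc⟩
  · exact ⟨_, .innerLimit _ _ h2⟩
  · exact ⟨_, .rightLimit p hp _ _ (h2 (hp.mem_X hx))⟩
  · exact ⟨_, .leftLimit p hp _ _ (h2 (hp.mem_X hx))⟩

theorem Proper.not_leaves {x a : Itinerary A} (ha : ν.Proper a) (hx : x.StarFree)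
    (hc : Compat a x) (n : ℕ) : ¬ ν.Leaves x a n := by
  intro h
  unfold Leaves at h
  rw [ha.track_eq_drop fun i _ => ?_, drop_apply, zero_add] at h
  · rcases hc n with h1 | h1 | h1
    exacts [h.1 h1, hx n h1, h.2 h1]
  · rcases hc i with h | h | h
    exacts [Or.inr h, absurd h (hx i), Or.inl h]

theorem Merge.leaves_iff {x a b : Itinerary A} (h : ν.Merge x a b) :
    ∃ K, ∀ k ≥ K, (ν.Leaves x a k ↔ ν.Leaves x b k) := by
  obtain ⟨K, hK⟩ := h
  exact ⟨K, fun k hk => by unfold Leaves; rw [track_eq_of_le hk hK]⟩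

/-- Two points which are compatible and on the same side of a point on the critical path bound a
Fatou interval. -/
theorem exists_end {p : ℕ} (hν : ν.IsKneading) (hp : ν.IsStarPeriodic p)
    {x a : Itinerary A} (hx : x.StarFree) (hm : ¬ ν.Merge x ν.star ν) (ha : ν.Proper a)
    (hc : Compat a x) (h : ν.Merge x a ν.star ∨ ν.Merge x a ν) :
    ∃ u, u.1 = a ∧ (ν.RightEnd u x ∨ ν.LeftEnd u x) := by
  obtain ⟨s, hs⟩ := exists_onPath_itinerary hν hp hx hm
  rcases hs.kind hν with ⟨u, hu, h1, -⟩ | ⟨-, L, R, h1, -⟩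
  · have : u.1 = x := (TreePoint.itinerary.inj h1).symm
    exact absurd (hu.starFree hν (this ▸ hx)).2 hp.not_isNonperiodic
  rcases h with h | h
  · by_cases hL : ∃ u, ∀ᶠ n in atTop, L n = u
    · obtain ⟨u, hu⟩ := hL
      have h2 := rightEnd_of_cells hν hp (fun n => (h1 n).1) (fun n => (h1 n).2) hu
      refine ⟨u, ?_, Or.inl h2⟩
      exact (h2.inStages.proper hν).eq_of_merge ha hx (h2.compat hν) hc
        ((h2.not_merge hν).2.trans h.symm)
    -- If the left bounds moved for ever, then the track of ⋆ν and hence that of `a` would leave `x`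
    -- infinitely often; a proper sequence compatible with `x` never does.
    · rw [not_exists] at hL
      obtain ⟨K, hK⟩ := h.leaves_iff
      obtain ⟨k, hk, hl⟩ := leaves_star hν (fun n => (h1 n).1) (fun n => (h1 n).2) hL K
      exact absurd ((hK k hk).2 hl) (ha.not_leaves hx hc k)
  · by_cases hR : ∃ u, ∀ᶠ n in atTop, R n = u
    · obtain ⟨u, hu⟩ := hR
      have h2 := leftEnd_of_cells hν hp (fun n => (h1 n).1) (fun n => (h1 n).2) hu
      refine ⟨u, ?_, Or.inr h2⟩
      exact (h2.inStages.proper hν).eq_of_merge ha hx (h2.compat hν) hc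
        ((h2.not_merge hν).2.trans h.symm)
    · rw [not_exists] at hR
      obtain ⟨K, hK⟩ := h.leaves_iff
      obtain ⟨k, hk, hl⟩ := leaves_self hν (fun n => (h1 n).1) (fun n => (h1 n).2) hR K
      exact absurd ((hK k hk).2 hl) (ha.not_leaves hx hc k)

/-! ### Lifting points of the tree to the critical path -/

/-- The sequence `sa`. -/
def cons (s : Option A) (a : Itinerary A) : Itinerary A
  | 0 => s
  | i + 1 => a i

theorem drop_one_cons (s : Option A) (a : Itinerary A) : drop 1 (cons s a) = a := rfl

theorem StarFree.cons {s : Option A} {a : Itinerary A} (hs : s ≠ none) (ha : a.StarFree) :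
    (cons s a).StarFree := fun i => by
  rcases i with _ | i
  exacts [hs, ha i]

/-- A preimage of `y` is sought that separates `P` from `Q` and has a preimage of `a` on one of
these two sides. If `P` and `Q` begin with different symbols, each choice of symbol replaces one of
the shifts by ν. The symbol of `Q` works if ν is on the side of the shift of `P`, or if `a` is
neither with that shift nor with ν; in the remaining case the symbol of `P` works. -/
theorem exists_symbol {y P Q a : Itinerary A} (hP : P 0 = none → drop 1 P = ν) (hQ : Q 0 ≠ none)
    (h : ¬ ν.Merge y (drop 1 P) (drop 1 Q))
    (ha : ν.Merge y a (drop 1 P) ∨ ν.Merge y a (drop 1 Q)) :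
    ∃ s : Option A, s ≠ none ∧ ¬ ν.Merge y (step ν s P) (step ν s Q) ∧
      (ν.Merge y a (step ν s P) ∨ ν.Merge y a (step ν s Q)) := by
  by_cases hP0 : P 0 = none
  · refine ⟨Q 0, hQ, ?_⟩
    have h1 : step ν (Q 0) P = drop 1 P :=
      (step_of_ne (by rw [hP0]; exact hQ.symm)).trans (hP hP0).symm
    have h2 : step ν (Q 0) Q = drop 1 Q := step_of_eq rfl
    rw [h1, h2]
    exact ⟨h, ha⟩
  by_cases hPQ : P 0 = Q 0
  · refine ⟨Q 0, hQ, ?_⟩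
    have h1 : step ν (Q 0) P = drop 1 P := step_of_eq hPQ
    have h2 : step ν (Q 0) Q = drop 1 Q := step_of_eq rfl
    rw [h1, h2]
    exact ⟨h, ha⟩
  have h1 : step ν (P 0) P = drop 1 P := step_of_eq rfl
  have h2 : step ν (P 0) Q = ν := step_of_ne fun h => hPQ h.symm
  have h3 : step ν (Q 0) Q = drop 1 Q := step_of_eq rfl
  have h4 : step ν (Q 0) P = ν := step_of_ne hPQ
  have tr : ∀ {a b c : Itinerary A}, ν.Merge y a b → ν.Merge y b c → ν.Merge y a c :=
    fun h h' => h.trans h'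
  by_cases hc : ν.Merge y (drop 1 P) ν ∨ ¬ (ν.Merge y a (drop 1 P) ∨ ν.Merge y a ν)
  · refine ⟨Q 0, hQ, ?_⟩
    rw [h3, h4]
    rcases hc with hc | hc
    · exact ⟨fun h' => h (tr hc h'), ha.imp_left fun h' => tr h' hc⟩
    · rw [not_or] at hc
      have := ha.resolve_left hc.1
      exact ⟨fun h' => hc.2 (tr this h'.symm), Or.inr this⟩
  · rw [not_or, not_not] at hc
    refine ⟨P 0, hP0, ?_⟩
    rw [h1, h2]
    exact hc

/-- The preimage of ν is ⋆ν for every symbol; any other `a` is simply preceded by `s`. -/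
theorem exists_cons {y a : Itinerary A} (hν : ν.IsKneading) (ha : ν.Proper a)
    (hc : Compat a y) {s : Option A} (hs : s ≠ none) : ∃ b, ν.Proper b ∧
      Compat b (cons s y) ∧ drop 1 b = a ∧ step ν s b = a := by
  by_cases h : a = ν
  · refine ⟨ν.star, hν.proper_star, fun i => ?_, h.symm, step_star.trans h.symm⟩
    rcases i with _ | i
    · exact Or.inl rfl
    · rw [h] at hc; exact hc i
  · refine ⟨cons s a, fun i => ?_, fun i => ?_, rfl, step_of_eq rfl⟩
    · rcases i with _ | i
      · exact ⟨fun h' => absurd h' hs, fun h' => absurd h' h⟩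
      · exact ha i
    · rcases i with _ | i
      · exact Or.inr (Or.inr rfl)
      · exact hc i

/-- Preimages are chosen one at a time by `exists_symbol`, going down to the pair ⋆ν, ν. The bound
`k + 2 ≤ p` ensures that ⋆ν itself is the only point met that begins with ⋆. -/
theorem exists_lift {p : ℕ} (hν : ν.IsKneading) (hp : ν.IsStarPeriodic p) (k : ℕ) (hk : k + 2 ≤ p)
    {y a : Itinerary A} (hy : y.StarFree)
    (h : ¬ ν.Merge y (drop k ν.star) (drop (k + 1) ν.star))
    (ha : ν.Merge y a (drop k ν.star) ∨ ν.Merge y a (drop (k + 1) ν.star)) :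
    ∃ x, x.StarFree ∧ drop k x = y ∧ ¬ ν.Merge x ν.star ν ∧
      (ν.Proper a → Compat a y → ∃ b, ν.Proper b ∧ Compat b x ∧ drop k b = a ∧
        (ν.Merge x b ν.star ∨ ν.Merge x b ν)) := by
  induction k generalizing y a with
  | zero => exact ⟨y, hy, rfl, h, fun h1 h2 => ⟨a, h1, h2, rfl, ha⟩⟩
  | succ k ih =>
    have hshift : ∀ k, drop 1 (drop k ν.star) = drop (k + 1) ν.star := fun k => drop_drop _ _ _
    have hnone : ∀ k, drop k ν.star 0 = none ↔ p ∣ k := fun k => by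
      rw [drop_apply, zero_add, hp.star_eq_none]
    obtain ⟨s, hs, h1, h2⟩ := exists_symbol (ν := ν) (P := drop k ν.star)
      (Q := drop (k + 1) ν.star) (a := a) (y := y)
      (fun h0 => by
        rw [hnone] at h0
        have : k = 0 := Nat.eq_zero_of_dvd_of_lt h0 (by omega)
        rw [this]; rfl)
      (fun h0 => by
        rw [hnone] at h0
        exact absurd (Nat.eq_zero_of_dvd_of_lt h0 (by omega)) (by omega))
      (by rwa [hshift, hshift]) (by rwa [hshift, hshift])
    have key : ∀ b c : Itinerary A, ν.Merge (cons s y) b c ↔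
        ν.Merge y (step ν s b) (step ν s c) := fun b c => by
      rw [← merge_track_iff 1]; rfl
    by_cases ha' : ν.Proper a ∧ Compat a y
    · obtain ⟨b, hb1, hb2, hb3, hb4⟩ := exists_cons hν ha'.1 ha'.2 hs
      obtain ⟨x, hx, hx1, hx2, hx3⟩ := ih (by omega) (hy.cons hs) (a := b)
        (by rwa [key]) (by rw [key, key, hb4]; exact h2)
      refine ⟨x, hx, ?_, hx2, fun _ _ => ?_⟩
      · rw [← drop_drop, hx1, drop_one_cons]
      · obtain ⟨b', h3, h4, h5, h6⟩ := hx3 hb1 hb2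
        exact ⟨b', h3, h4, by rw [← drop_drop, h5, hb3], h6⟩
    · obtain ⟨x, hx, hx1, hx2, -⟩ := ih (by omega) (hy.cons hs) (a := drop k ν.star)
        (by rwa [key]) (Or.inl ⟨0, rfl⟩)
      refine ⟨x, hx, ?_, hx2, fun h1 h2 => absurd ⟨h1, h2⟩ ha'⟩
      rw [← drop_drop, hx1, drop_one_cons]

/-- Walk from `c i` to `c j` one index at a time and stop at the first pair separated by `y`. Up to
there all points are on the side of `a`. -/
theorem exists_adjacent_of_not_merge {y a : Itinerary A} {c : ℕ → Itinerary A} {i j p : ℕ}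
    (hi : i < p) (hj : j < p) (h : ¬ ν.Merge y (c i) (c j)) (ha : ν.Merge y a (c i)) :
    ∃ k, k + 2 ≤ p ∧ ¬ ν.Merge y (c k) (c (k + 1)) ∧
      (ν.Merge y a (c k) ∨ ν.Merge y a (c (k + 1))) := by
  rcases lt_trichotomy i j with hij | rfl | hij
  · obtain ⟨d, rfl⟩ := Nat.exists_eq_add_of_lt hij
    induction d generalizing i with
    | zero => exact ⟨i, by omega, h, Or.inl ha⟩
    | succ d ih =>
      by_cases h1 : ν.Merge y (c i) (c (i + 1))
      · refine ih (i := i + 1) (by omega) (ha.trans h1) (by omega) ?_ (by omega)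
        intro h2
        rw [show i + 1 + d + 1 = i + (d + 1) + 1 by omega] at h2
        exact h (h1.trans h2)
      · exact ⟨i, by omega, h1, Or.inl ha⟩
  · exact absurd ⟨0, rfl⟩ h
  · obtain ⟨d, rfl⟩ := Nat.exists_eq_add_of_lt hij
    induction d with
    | zero => exact ⟨j, by omega, fun h' => h h'.symm, Or.inr ha⟩
    | succ d ih =>
      by_cases h1 : ν.Merge y (c (j + d + 1)) (c (j + (d + 1) + 1))
      · exact ih (by omega) (fun h2 => h (h1.symm.trans h2)) (ha.trans h1.symm) (by omega)
      · exact ⟨j + d + 1, by omega, h1, Or.inr ha⟩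

/-- If `ν` is `⋆`-periodic of period `p` then each point of the tree is an image of a point of the
critical path under less than `p` iterations. -/
theorem exists_lift_of_not_merge {p : ℕ} (hν : ν.IsKneading) (hp : ν.IsStarPeriodic p)
    {y a : Itinerary A} (hy : y.StarFree) (h : ¬ ν.Merge y ν.star ν)
    (ha : ν.Merge y a ν.star ∨ ν.Merge y a ν) (n : ℕ) :
    ∃ k < p, ∃ x, x.StarFree ∧ drop k x = drop n y ∧ ¬ ν.Merge x ν.star ν ∧
      (ν.Proper a → Compat a y → ∃ b, ν.Proper b ∧ Compat b x ∧ drop k b = drop n a ∧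
        (ν.Merge x b ν.star ∨ ν.Merge x b ν)) := by
  have hcrit : ∀ {P : Itinerary A}, ν.Crit P → ∃ i < p, P = drop i ν.star := by
    rintro _ ⟨m, rfl⟩
    exact ⟨m % p, Nat.mod_lt _ hp.1, hp.drop_star_of_modEq (Nat.mod_modEq m p).symm⟩
  obtain ⟨i, hi, hP⟩ := hcrit (crit_star.track y n)
  obtain ⟨j, hj, hQ⟩ := hcrit (crit_self.track y n)
  rw [← merge_track_iff n, hP, hQ] at h
  rw [← merge_track_iff n, ← merge_track_iff (b := ν) n, hP, hQ] at ha
  -- After `n` steps the tracks of ⋆ν and ν are critical orbit points with indices below `p`. Since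
  -- `drop n y` separates them, it separates two consecutive points of the critical orbit.
  obtain ⟨k, hk, h1, h2⟩ : ∃ k, k + 2 ≤ p ∧
      ¬ ν.Merge (drop n y) (drop k ν.star) (drop (k + 1) ν.star) ∧
      (ν.Merge (drop n y) (track ν y n a) (drop k ν.star) ∨
        ν.Merge (drop n y) (track ν y n a) (drop (k + 1) ν.star)) := by
    rcases ha with ha | ha
    · exact exists_adjacent_of_not_merge (c := fun i => drop i ν.star) hi hj h ha
    · exact exists_adjacent_of_not_merge (c := fun i => drop i ν.star) hj hi
        (fun h' => h h'.symm) ha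
  obtain ⟨x, h3, h4, h5, h6⟩ := exists_lift hν hp k hk (hy.drop n) h1 h2
  refine ⟨k, by omega, x, h3, h4, h5, fun h7 h8 => ?_⟩
  have h9 : track ν y n a = drop n a := h7.track_eq_drop fun i _ => by
    rcases h8 i with h | h | h
    exacts [Or.inr h, absurd h (hy i), Or.inl h]
  rw [h9] at h6
  exact h6 (h7.drop n) (h8.drop n)

end Itinerary

/-! ### Iterates of `σ` on points. -/

namespace TreePoint

open Itinerary

variable {A : Type*} {ν : Itinerary A} (h : FatouMaps A)

theorem iterate_map_itinerary (n : ℕ) (a : Itinerary A) :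
    (map h)^[n] (.itinerary a) = .itinerary (drop n a) := by
  induction n with
  | zero => rfl
  | succ n ih => rw [Function.iterate_succ_apply', ih]; exact congrArg _ (shift_drop n a)

theorem iterate_map_fatou (n : ℕ) (a b : Itinerary A) :
    ∃ e : Set.Ioo (0 : ℝ) 1 ≃o Set.Ioo (0 : ℝ) 1, ∀ t,
      (map h)^[n] (.fatou a b t) = .fatou (drop n a) (drop n b) (e t) := by
  induction n with
  | zero => exact ⟨OrderIso.refl _, fun t => rfl⟩
  | succ n ih =>
    obtain ⟨e, he⟩ := ih
    refine ⟨e.trans (h (drop n a) (drop n b)), fun t => ?_⟩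
    rw [Function.iterate_succ_apply', he, map, shift_drop, shift_drop]
    rfl

theorem body_iterate_map (n : ℕ) (z : TreePoint A) : ((map h)^[n] z).body = drop n z.body := by
  rcases z with a | ⟨a, b, t⟩
  · rw [iterate_map_itinerary]; rfl
  · obtain ⟨e, he⟩ := iterate_map_fatou h n a b
    rw [he]; rfl

theorem rep_iterate_map (n : ℕ) (z : TreePoint A) : ((map h)^[n] z).rep = drop n z.rep := by
  rcases z with a | ⟨a, b, t⟩
  · rw [iterate_map_itinerary]; rfl
  · obtain ⟨e, he⟩ := iterate_map_fatou h n a b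
    rw [he]; rfl

end TreePoint

/-! ### Fewer than p images of the critical path cover a ⋆-periodic tree. -/

namespace CriticalPath

open Itinerary

variable {A : Type*} {ν : Itinerary A} [hK : Fact ν.IsKneading]

/-- The tree is defined with all iterates, its topology only with those below `p`; this closes the
difference. The two ends of a Fatou interval have to be lifted simultaneously, and a precritical
point is lifted together with a Fatou interval next to it. -/
theorem exists_lift {p : ℕ} (hp : ν.IsStarPeriodic p) (h : FatouMaps A) (n : ℕ)
    (z : CriticalPath ν) : ∃ k < p, ∃ w : CriticalPath ν,
      (TreePoint.map h)^[k] w.1 = (TreePoint.map h)^[n] z.1 := by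
  have hν := hK.out
  have key : ∀ (u : Itinerary A × ℝ) (b : Itinerary A), ν.RightEnd u b ∨ ν.LeftEnd u b →
      ∃ k < p, ∃ v x, (ν.RightEnd v x ∨ ν.LeftEnd v x) ∧ drop k v.1 = drop n u.1 ∧
        drop k x = drop n b := by
    intro u b hub
    obtain ⟨h1, h2, h3, h4, h5⟩ : b.StarFree ∧ ¬ ν.Merge b ν.star ν ∧
        (ν.Merge b u.1 ν.star ∨ ν.Merge b u.1 ν) ∧ Compat u.1 b ∧ ν.InStages u := by
      rcases hub with h | h
      · exact ⟨h.starFree, (h.not_merge hν).1, Or.inl (h.not_merge hν).2, h.compat hν, h.inStages⟩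
      · exact ⟨h.starFree, (h.not_merge hν).1, Or.inr (h.not_merge hν).2, h.compat hν, h.inStages⟩
    obtain ⟨k, hk, x, hx1, hx2, hx3, hx4⟩ := exists_lift_of_not_merge hν hp h1 h2 h3 n
    obtain ⟨a, ha1, ha2, ha3, ha4⟩ := hx4 (h5.proper hν) h4
    obtain ⟨v, hv1, hv2⟩ := exists_end hν hp hx1 hx3 ha1 ha2 ha4
    exact ⟨k, hk, v, x, hv2, by rw [hv1, ha3], hx2⟩
  rcases z.onPath.kind hν with ⟨u, hu, h1, -⟩ | ⟨h0, L, R, h2, ⟨h1, -⟩ | ⟨u, t, h1, h3, -⟩ |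
    ⟨u, t, h1, h3, -⟩⟩
  · obtain ⟨b, hb⟩ : ∃ b, ν.RightEnd u b ∨ ν.LeftEnd u b := by
      by_cases h2 : u.2 < 1
      · obtain ⟨b, hb⟩ := exists_rightEnd hν hp hu h2
        exact ⟨b, Or.inl hb⟩
      · obtain ⟨b, hb⟩ := exists_leftEnd hν hp hu (by linarith)
        exact ⟨b, Or.inr hb⟩
    obtain ⟨k, hk, v, x, hv, h3, -⟩ := key u b hb
    have hv' : ν.InStages v := hv.elim (fun h => h.inStages) fun h => h.inStages
    refine ⟨k, hk, ofOnPath (.precritical v hv'), ?_⟩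
    rw [h1, TreePoint.iterate_map_itinerary, ← h3]
    exact TreePoint.iterate_map_itinerary h k v.1
  · obtain ⟨k, hk, x, hx1, hx2, hx3, -⟩ := exists_lift_of_not_merge hν hp h0
      (not_merge_of_fits hν fun n => ⟨_, _, (h2 n).1.1, (h2 n).2⟩) (Or.inl ⟨0, rfl⟩) n
    obtain ⟨s, hs⟩ := exists_onPath_itinerary hν hp hx1 hx3
    refine ⟨k, hk, ofOnPath hs, ?_⟩
    rw [h1, TreePoint.iterate_map_itinerary, ← hx2]
    exact TreePoint.iterate_map_itinerary h k x
  all_goals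
    obtain ⟨k, hk, v, x, hv, h4, h5⟩ := key u _ (by first | exact Or.inl h3 | exact Or.inr h3)
    obtain ⟨e, he⟩ := TreePoint.iterate_map_fatou h n u.1 z.1.body
    obtain ⟨e', he'⟩ := TreePoint.iterate_map_fatou h k v.1 x
    have h6 : (TreePoint.map h)^[k] (.fatou v.1 x (e'.symm (e t))) = (TreePoint.map h)^[n] z.1 := by
      rw [h1, he, he', h4, h5, OrderIso.apply_symm_apply]
    rcases hv with hv | hv
    · exact ⟨k, hk, ofOnPath (.fatouRight p hp v x hv (e'.symm (e t))), h6⟩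
    · exact ⟨k, hk, ofOnPath (.fatouLeft p hp v x hv (e'.symm (e t))), h6⟩

end CriticalPath

namespace CriticalPath

open Itinerary

variable {A : Type*} {ν : Itinerary A} [hK : Fact ν.IsKneading]

/-! ### The sides of a point in the periodic case -/

theorem rep_eq_or (z : CriticalPath ν) : z.1.rep = z.1.body ∨
    z.1.body.StarFree ∧ Compat z.1.rep z.1.body := by
  have hν := hK.out
  have h := z.onPath
  rcases hz : z.1 with a | ⟨a, b, t⟩
  · exact Or.inl rfl
  · rw [hz] at h
    obtain ⟨-, u, rfl, ⟨h, -⟩ | ⟨h, -⟩⟩ := h.of_fatou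
    exacts [Or.inr ⟨h.starFree, h.compat hν⟩, Or.inr ⟨h.starFree, h.compat hν⟩]

theorem merge_rep (z : CriticalPath ν) {x : Itinerary A} (hx : x.StarFree) (h : z.1.body ≠ x) :
    ν.Merge x z.1.rep z.1.body := by
  rcases z.rep_eq_or with h1 | ⟨h1, h2⟩
  · rw [h1]
  · exact (z.onPath.proper_rep hK.out).merge_of_compat h2 hx h1 h

section Merge

variable {x : Itinerary A} {z c : CriticalPath ν}

/-- A point whose itinerary agrees with that of a bound of a cell until the cell is divided. -/
theorem merge_of_fits_mid {a b m e : Itinerary A} {k : ℕ} (hx : x.StarFree)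
    (hm : m = starAt ν x k) (hmid : ν.IsMid a b k m) (hk : a k ≠ x k)
    (he : track ν x k e = drop k a) (hf : Fits c.1.body a m) : ν.Merge x c.1.rep e := by
  have h1 : ∀ i ≤ k, (a i = c.1.body i ∨ a i = none) ∧ (m i = c.1.body i ∨ m i = none) :=
    fun i hi => hf (k + 1) i (by omega) fun j hj => by
      rcases (hj.trans hi).lt_or_eq with h | h
      · rcases (hmid.lt j h).2.1 with h' | h'
        exacts [Or.inr (Or.inr h'), Or.inl h']
      · rw [h]; exact Or.inr (Or.inl hmid.eq)
  have h2 : ∀ i < k, c.1.body i = x i := fun i hi => by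
    rcases (h1 i hi.le).2 with h | h
    · rw [← h, hm, starAt_of_lt hi]
    · exact absurd h (hmid.lt i hi).1
  have h3 : c.1.body k ≠ x k := by
    rw [← (h1 k le_rfl).1.resolve_right hmid.split.ne.1]; exact hk
  refine (c.merge_rep hx fun h => h3 (by rw [h])).trans ⟨k + 1, ?_⟩
  rw [track_succ, track_succ, he, track_eq_drop fun i hi => Or.inl (h2 i hi), step_of_ne,
    step_of_ne]
  · rw [drop_apply, zero_add]; exact hk
  · rw [drop_apply, zero_add]; exact h3

/-- Take the first cell around `z` whose right bound does not exceed `c`. If it is the whole path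
then `c` is ν. Otherwise `c` is in the half discarded by the last subdivision or at the division
point; then its track and that of ν have coincided by time `k + 1`, where `k` is the position of the
division. If no cell excludes `c`, it lies in the adjacent Fatou interval. -/
theorem merge_right {p : ℕ} (hp : ν.IsStarPeriodic p) (hz : z.1 = .itinerary x)
    (hx : x.StarFree) (hzc : z < c) : ν.Merge x c.1.rep ν := by
  classical
  have hν := hK.out
  rcases z.onPath.kind hν with ⟨u, hu, h1, -⟩ | ⟨-, L, R, h, h1⟩
  · have : u.1 = x := TreePoint.itinerary.inj (h1.symm.trans hz)
    exact absurd (hu.starFree hν (this ▸ hx)).2 hp.not_isNonperiodic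
  have hb : z.1.body = x := by rw [hz]; rfl
  rw [hb] at h h1
  obtain ⟨-, a, b, h2, h3, h4⟩ | ⟨u, t, h1, -⟩ | ⟨u, t, h1, -⟩ := h1
  · rcases right_cases hz h h2 h3 h4 hzc with h5 | ⟨u, t, h5, h6, -⟩
    swap
    · rw [h5]; exact (h6.not_merge hν).2
    rcases hn : Nat.find h5 with _ | n
    · have h6 := Nat.find_spec h5
      rw [hn, (adjacent_zero.1 (h 0).1.1).2] at h6
      have h7 := le_antisymm h6 (c.onPath.mem_Icc hν).2
      have h8 := c.onPath
      rw [← h7] at h8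
      rw [h8.unique_point hν (.precritical (ν, 1) ⟨0, self_mem_stage 0⟩)]
      exact ⟨0, rfl⟩
    · have h6 := Nat.find_spec h5
      have h7 := Nat.find_min h5 (m := n) (by omega)
      rw [hn] at h6
      have h8 : ¬ Compat (L n).1 (R n).1 := fun hc =>
        h7 (by rwa [(cells_const (fun n => (h n).1) n.le_succ hc).2] at h6)
      obtain ⟨k, -, hs, hmid, -, hr, hor, -⟩ := cells_succ hν (fun n => (h n).1)
        (fun n => (h n).2) h8
      rcases hor with ⟨h9, -, h10⟩ | ⟨-, h10, -⟩
      swap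
      · rw [h10] at h6; exact absurd h6 h7
      rw [h10] at h6
      have hk : (R n).1 k ≠ x k := h9 ▸ hs.ne.2.2.symm
      rcases h6.lt_or_eq with h6 | h6
      · exact merge_of_fits_mid hx hmid ((h n).1.1.isMid hν hs).symm hk hr
          (c.onPath.body_fits hν ⟨(h n).1.1.succ_right hs, h6, not_le.1 h7⟩).symm
      · have h11 := c.onPath
        rw [← h6] at h11
        rw [h11.unique_point hν (.precritical (ν.mid (L n) (R n))
          ⟨n + 1, ((h n).1.1.succ_right hs).mem_left⟩)]
        refine ⟨k + 1, ?_⟩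
        rw [TreePoint.rep, hmid, track_succ, track_succ, track_starAt, hr, step_star, step_of_ne]
        rwa [drop_apply, zero_add]
  · rw [hz] at h1; cases h1
  · rw [hz] at h1; cases h1

theorem merge_left {p : ℕ} (hp : ν.IsStarPeriodic p) (hz : z.1 = .itinerary x)
    (hx : x.StarFree) (hzc : c < z) : ν.Merge x c.1.rep ν.star := by
  classical
  have hν := hK.out
  rcases z.onPath.kind hν with ⟨u, hu, h1, -⟩ | ⟨-, L, R, h, h1⟩
  · have : u.1 = x := TreePoint.itinerary.inj (h1.symm.trans hz)
    exact absurd (hu.starFree hν (this ▸ hx)).2 hp.not_isNonperiodic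
  have hb : z.1.body = x := by rw [hz]; rfl
  rw [hb] at h h1
  obtain ⟨-, a, b, h2, h3, h4⟩ | ⟨u, t, h1, -⟩ | ⟨u, t, h1, -⟩ := h1
  · rcases left_cases hz h h2 h3 h4 hzc with h5 | ⟨u, t, h5, h6, -⟩
    swap
    · rw [h5]; exact (h6.not_merge hν).2
    rcases hn : Nat.find h5 with _ | n
    · have h6 := Nat.find_spec h5
      rw [hn, (adjacent_zero.1 (h 0).1.1).1] at h6
      have h7 := le_antisymm h6 (c.onPath.mem_Icc hν).1
      have h8 := c.onPath
      rw [h7] at h8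
      rw [h8.unique_point hν (.precritical (ν.star, 0) ⟨0, star_mem_stage 0⟩)]
      exact ⟨0, rfl⟩
    · have h6 := Nat.find_spec h5
      have h7 := Nat.find_min h5 (m := n) (by omega)
      rw [hn] at h6
      have h8 : ¬ Compat (L n).1 (R n).1 := fun hc =>
        h7 (by rwa [(cells_const (fun n => (h n).1) n.le_succ hc).1] at h6)
      obtain ⟨k, -, hs, hmid, hl, -, hor, -⟩ := cells_succ hν (fun n => (h n).1)
        (fun n => (h n).2) h8
      rcases hor with ⟨-, h10, -⟩ | ⟨h9, -, h10⟩
      · rw [h10] at h6; exact absurd h6 h7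
      rw [h10] at h6
      have hk : (L n).1 k ≠ x k := h9 ▸ hs.ne.2.2
      rcases h6.lt_or_eq with h6 | h6
      · exact merge_of_fits_mid hx hmid ((h n).1.1.isMid hν hs) hk hl
          (c.onPath.body_fits hν ⟨(h n).1.1.succ_left hs, not_le.1 h7, h6⟩)
      · have h11 := c.onPath
        rw [h6] at h11
        rw [h11.unique_point hν (.precritical (ν.mid (L n) (R n))
          ⟨n + 1, ((h n).1.1.succ_right hs).mem_left⟩)]
        refine ⟨k + 1, ?_⟩
        rw [TreePoint.rep, hmid, track_succ, track_succ, track_starAt, hl, step_star, step_of_ne]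
        rwa [drop_apply, zero_add]
  · rw [hz] at h1; cases h1
  · rw [hz] at h1; cases h1

/-- Either `x` is left infinitely often by the track of `ν`, or there is a Fatou interval to the
right of it. -/
theorem right_side {p : ℕ} (hp : ν.IsStarPeriodic p) (hz : z.1 = .itinerary x)
    (hx : x.StarFree) : (∀ K, ∃ k ≥ K, ν.Leaves x ν k) ∨
      ∃ v, ν.Proper v ∧ Compat v x ∧ ∀ t₀ : Ioo (0 : ℝ) 1, ∃ c > z, ∀ z' ∈ Ioo z c,
        ∃ t < t₀, z'.1 = .fatou v x t := by
  have hν := hK.out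
  rcases z.onPath.kind hν with ⟨u, hu, h1, -⟩ | ⟨-, L, R, h, h1⟩
  · have : u.1 = x := TreePoint.itinerary.inj (h1.symm.trans hz)
    exact absurd (hu.starFree hν (this ▸ hx)).2 hp.not_isNonperiodic
  have hb : z.1.body = x := by rw [hz]; rfl
  rw [hb] at h h1
  obtain ⟨-, a, b, h2, h3, h4⟩ | ⟨u, t, h1, -⟩ | ⟨u, t, h1, -⟩ := h1
  · by_cases hR : ∃ v, ∀ᶠ n in atTop, R n = v
    · obtain ⟨v, hv⟩ := hR
      have hve := leftEnd_of_cells hν hp (fun n => (h n).1) (fun n => (h n).2) hv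
      refine Or.inr ⟨v.1, hve.inStages.proper hν, hve.compat hν, fun t₀ =>
        ⟨ofOnPath (.fatouLeft p hp v x hve t₀), ?_, fun z' hz' => ?_⟩⟩
      · rw [gt_iff_lt, lt_iff, pos_ofOnPath, h4]
        exact lt_of_eventually_right (fun n => (h n).1) h2 h3 hv (by linarith [t₀.2.1])
      · have hlt := hz'.2
        rw [lt_iff, pos_ofOnPath] at hlt
        rcases right_cases hz h h2 h3 h4 hz'.1 with ⟨n, hn⟩ | ⟨u, t, h5, -, h6, h7⟩
        · obtain ⟨m, hm, hnm⟩ := (hv.and (eventually_ge_atTop n)).exists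
          have h8 := (cells_mono (fun n => (h n).1) hnm).2
          rw [hm] at h8
          have h9 := hn.trans_lt hlt
          rw [Prod.Lex.toLex_lt_toLex] at h9
          have := t₀.2.2
          rcases h9 with h9 | h9
          · exact absurd h9 (not_lt.2 h8)
          · have := h9.2; simp only at this; linarith
        · obtain ⟨m, hm, hm'⟩ := (hv.and h6).exists
          rw [hm] at hm'; subst hm'
          refine ⟨t, ?_, h5⟩
          rw [h7, Prod.Lex.toLex_lt_toLex] at hlt
          have h8 := (hlt.resolve_left (lt_irrefl _)).2
          exact Subtype.coe_lt_coe.1 (by simp only at h8; linarith)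
    · rw [not_exists] at hR
      exact Or.inl (leaves_self hν (fun n => (h n).1) (fun n => (h n).2) hR)
  · rw [hz] at h1; cases h1
  · rw [hz] at h1; cases h1

theorem left_side {p : ℕ} (hp : ν.IsStarPeriodic p) (hz : z.1 = .itinerary x)
    (hx : x.StarFree) : (∀ K, ∃ k ≥ K, ν.Leaves x ν.star k) ∨
      ∃ v, ν.Proper v ∧ Compat v x ∧ ∀ t₀ : Ioo (0 : ℝ) 1, ∃ c < z, ∀ z' ∈ Ioo c z,
        ∃ t < t₀, z'.1 = .fatou v x t := by
  have hν := hK.out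
  rcases z.onPath.kind hν with ⟨u, hu, h1, -⟩ | ⟨-, L, R, h, h1⟩
  · have : u.1 = x := TreePoint.itinerary.inj (h1.symm.trans hz)
    exact absurd (hu.starFree hν (this ▸ hx)).2 hp.not_isNonperiodic
  have hb : z.1.body = x := by rw [hz]; rfl
  rw [hb] at h h1
  obtain ⟨-, a, b, h2, h3, h4⟩ | ⟨u, t, h1, -⟩ | ⟨u, t, h1, -⟩ := h1
  · by_cases hL : ∃ v, ∀ᶠ n in atTop, L n = v
    · obtain ⟨v, hv⟩ := hL
      have hve := rightEnd_of_cells hν hp (fun n => (h n).1) (fun n => (h n).2) hv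
      refine Or.inr ⟨v.1, hve.inStages.proper hν, hve.compat hν, fun t₀ =>
        ⟨ofOnPath (.fatouRight p hp v x hve t₀), ?_, fun z' hz' => ?_⟩⟩
      · rw [lt_iff, pos_ofOnPath, h4]
        exact lt_of_eventually_left (fun n => (h n).1) h2 h3 hv (by linarith [t₀.2.1])
      · have hlt := hz'.1
        rw [lt_iff, pos_ofOnPath] at hlt
        rcases left_cases hz h h2 h3 h4 hz'.2 with ⟨n, hn⟩ | ⟨u, t, h5, -, h6, h7⟩
        · obtain ⟨m, hm, hnm⟩ := (hv.and (eventually_ge_atTop n)).exists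
          have h8 := (cells_mono (fun n => (h n).1) hnm).1
          rw [hm] at h8
          have h9 := hlt.trans_le hn
          rw [Prod.Lex.toLex_lt_toLex] at h9
          have := t₀.2.2
          rcases h9 with h9 | h9
          · exact absurd h9 (not_lt.2 h8)
          · have := h9.2; simp only at this; linarith
        · obtain ⟨m, hm, hm'⟩ := (hv.and h6).exists
          rw [hm] at hm'; subst hm'
          refine ⟨t, ?_, h5⟩
          rw [h7, Prod.Lex.toLex_lt_toLex] at hlt
          have h8 := (hlt.resolve_left (lt_irrefl _)).2
          exact Subtype.coe_lt_coe.1 (by simp only at h8; linarith)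
    · rw [not_exists] at hL
      exact Or.inl (leaves_star hν (fun n => (h n).1) (fun n => (h n).2) hL)
  · rw [hz] at h1; cases h1
  · rw [hz] at h1; cases h1

end Merge

end CriticalPath

namespace Itinerary

variable {A : Type*} {ν : Itinerary A}

/-! ### The topology of `X_ν` -/

/-- The sequence `b` is `a`, or it agrees with `a` up to a given position, with symbols instead of
`⋆`. -/
def Near (M : ℕ) (a b : Itinerary A) : Prop :=
  b = a ∨ ∀ i < M, b i ≠ none ∧ (a i = b i ∨ a i = none)

theorem Near.mono {M N : ℕ} {a b : Itinerary A} (h : Near N a b) (hMN : M ≤ N) : Near M a b :=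
  h.imp_right fun h i hi => h i (hi.trans_le hMN)

theorem IsNonperiodic.eq_of_star_eq_none (hn : ν.IsNonperiodic) {i : ℕ} (h : ν.star i = none) :
    i = 0 := by
  rcases i with _ | i
  exacts [rfl, absurd h (hn.1 i)]

theorem Proper.mem_X_of_nonperiodic (hn : ν.IsNonperiodic) {a : Itinerary A} (ha : ν.Proper a) :
    a ∈ ν.X := by
  by_cases h : a.StarFree
  · exact ha.mem_X h
  unfold StarFree at h
  push Not at h
  obtain ⟨i, hi⟩ := h
  have h1 := (ha i).1 hi
  have h2 : ∀ j < i, (a j).isSome := fun j hj => by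
    rw [Option.isSome_iff_ne_none]
    intro hj'
    have h3 := (ha j).1 hj'
    have h4 := congrFun h3 (i - j - 1)
    rw [drop_apply, show i - j - 1 + (j + 1) = i by omega, hi] at h4
    exact hn.1 _ h4.symm
  refine Or.inl ⟨i + 1, List.ofFn fun j : Fin i => (a j).get (h2 j j.2), by simp, ?_⟩
  funext j
  unfold prepend
  split_ifs with hj
  · simp
  · simp only [List.length_ofFn, not_lt] at hj ⊢
    obtain ⟨d, rfl⟩ := Nat.exists_eq_add_of_le hj
    rw [Nat.add_sub_cancel_left]
    rcases d with _ | d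
    · exact hi
    · have := congrFun h1 d
      rw [drop_apply] at this
      rw [show i + (d + 1) = d + (i + 1) by omega, this]; rfl

/-- The basic open sets of `X_ν`. -/
theorem mem_basic_iff (hn : ν.IsNonperiodic) {a b : Itinerary A} {k : ℕ} (hb : b ∈ ν.X) :
    b ∈ ν.cylinder k a \ ν.cylinderBoundary k a ↔
      b = a ∨ ∀ i, i + 1 < k → b i ≠ none ∧ (a i = b i ∨ a i = none) := by
  have hpre : ∀ n, ν.IsPrecritical b n → ∀ i, b i = none → i + 1 = n := by
    rintro n ⟨w, hw, rfl⟩ i hi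
    unfold prepend at hi
    split_ifs at hi with h
    have := hn.eq_of_star_eq_none hi
    omega
  constructor
  · rintro ⟨⟨-, h1⟩, h2⟩
    by_cases hba : b = a
    · exact Or.inl hba
    right
    rw [le_diff_iff] at h1
    intro i hi
    have h3 : b i ≠ none := by
      intro h3
      rcases id hb with ⟨n, h4⟩ | ⟨h4, -⟩
      · refine h2 ⟨⟨hb, le_diff_iff.2 h1⟩, hba, fun h5 => ?_, n, ?_, h4⟩
        · exact hn.1 i (h5 ▸ h3)
        · rw [← hpre n h4 i h3]; omega
      · exact h4 i h3
    refine ⟨h3, ?_⟩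
    rcases h1 i hi with h4 | h4 | h4
    exacts [Or.inr h4, absurd h4 h3, Or.inl h4]
  · rintro h
    refine ⟨⟨hb, ?_⟩, ?_⟩
    · rw [le_diff_iff]
      rcases h with rfl | h
      · exact fun i _ => Or.inr (Or.inr rfl)
      · intro i hi
        rcases (h i hi).2 with h1 | h1
        exacts [Or.inr (Or.inr h1), Or.inl h1]
    · rintro ⟨-, h1, -, n, h3, w, h4, h5⟩
      refine ((h.resolve_left h1) w.length (by omega)).1 ?_
      have : b = prepend w ν.star := h5
      rw [this]
      simp [prepend, star]

/-- Sequences near `b ≠ x` are on the same side of `x` as `b`. -/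
theorem exists_near_merge (hn : ν.IsNonperiodic) {x b : Itinerary A} (hx : ν.Proper x)
    (hx' : x.StarFree) (hb : ν.Proper b) (hbx : b ≠ x) :
    ∃ M, ∀ z, Near M b z → z ≠ x ∧ ν.Merge x z b := by
  classical
  have hex : ∃ n, b n ≠ x n := by
    by_contra! h
    exact hbx (funext h)
  have hmin : ∀ i < Nat.find hex, b i = x i := fun i hi => not_not.1 (Nat.find_min hex hi)
  have hdiff := Nat.find_spec hex
  generalize Nat.find hex = n at hmin hdiff
  have hagree : ∀ {N : ℕ} {z : Itinerary A}, n ≤ N →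
      (∀ i < N, z i ≠ none ∧ (b i = z i ∨ b i = none)) → ∀ i < n, z i = x i := by
    intro N z hN h i hi
    rw [← hmin i hi]
    rcases (h i (hi.trans_le hN)).2 with h1 | h1
    · exact h1.symm
    · exact absurd ((hmin i hi).symm.trans h1) (hx' i)
  have htb : track ν x n b = drop n b := track_eq_drop fun i hi => Or.inl (hmin i hi)
  have htb' : track ν x n b 0 ≠ x n := by rwa [htb, drop_apply, zero_add]
  by_cases h0 : b n = none
  swap
  · refine ⟨n + 1, fun z hz => ?_⟩
    rcases hz with rfl | hz
    · exact ⟨hbx, 0, rfl⟩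
    have h1 : z n ≠ x n := by rwa [← (hz n n.lt_succ_self).2.resolve_right h0]
    refine ⟨fun h => h1 (by rw [h]), merge_of_ne (n := n) ?_ htb'⟩
    rwa [track_eq_drop fun i hi => Or.inl (hagree n.le_succ hz i hi), drop_apply, zero_add]
  -- Here `b` has ⋆ at its first disagreement with `x`. A nearby point may show the symbol of `x` in
  -- that place; but then it continues like ν for a while and leaves `x` at the first place `q`
  -- where ν does, simultaneously with the track of `b`.
  have hbν := (hb n).1 h0
  have hex2 : ∃ q, x (q + (n + 1)) ≠ ν q := by
    by_contra! h
    exact hx' n ((hx n).2 (funext h))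
  have hmin2 : ∀ i < Nat.find hex2, x (i + (n + 1)) = ν i := fun i hi =>
    not_not.1 (Nat.find_min hex2 hi)
  have hdiff2 := Nat.find_spec hex2
  generalize Nat.find hex2 = q at hmin2 hdiff2
  refine ⟨q + (n + 1) + 1, fun z hz => ?_⟩
  rcases hz with rfl | hz
  · exact ⟨hbx, 0, rfl⟩
  have h1 : ∀ j ≤ q, z (j + (n + 1)) = ν j := fun j hj => by
    have h2 : b (j + (n + 1)) = ν j := congrFun hbν j
    rw [← h2]
    exact ((hz _ (by omega)).2.resolve_right (by rw [h2]; exact hn.1 j)).symm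
  have hagr := hagree (by omega) hz
  have hzx : z ≠ x := fun h => hdiff2 (by rw [← h1 q le_rfl, h])
  refine ⟨hzx, ?_⟩
  by_cases h2 : z n = x n
  · refine merge_of_ne (n := q + (n + 1)) ?_ ?_
    · rw [track_eq_drop, drop_apply, zero_add, h1 q le_rfl]
      · exact hdiff2.symm
      · intro i hi
        left
        rcases lt_trichotomy i n with h3 | rfl | h3
        · exact hagr i h3
        · exact h2
        · obtain ⟨j, rfl⟩ := Nat.exists_eq_add_of_le (show n + 1 ≤ i from h3)
          rw [add_comm (n + 1) j, h1 j (by omega), hmin2 j (by omega)]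
    · rw [add_comm q, track_add, track_succ, step_of_ne htb', track_eq_drop, drop_apply, zero_add,
        add_comm (n + 1)]
      · exact hdiff2.symm
      · intro i hi
        left
        rw [drop_apply, hmin2 i hi]
  · refine merge_of_ne (n := n) ?_ htb'
    rwa [track_eq_drop fun i hi => Or.inl (hagr i hi), drop_apply, zero_add]

theorem IsStarPeriodic.not_starFree_drop {p : ℕ} (hp : ν.IsStarPeriodic p) {a : Itinerary A}
    (ha : ν.Proper a) (h : ¬ a.StarFree) (n : ℕ) : ¬ (drop n a).StarFree := by
  unfold StarFree at h
  push Not at h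
  obtain ⟨i, hi⟩ := h
  have h1 := (ha i).1 hi
  intro h2
  have h3 : ν (n * p + p - 1) = none := (hp.2.2 _).2 (by
    rw [Nat.sub_add_cancel (by have := hp.1; omega)]
    exact ⟨n + 1, by ring⟩)
  have h4 : n ≤ n * p := Nat.le_mul_of_pos_right n hp.1
  have := hp.1
  apply h2 (n * p + p - 1 + (i + 1) - n)
  rw [drop_apply, Nat.sub_add_cancel (by omega), ← h3, ← h1, drop_apply]

end Itinerary

namespace HubbardTree

open Itinerary

variable {A : Type*} {ν : Itinerary A} {h : FatouMaps A}

/-! ### Points of the Hubbard tree -/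

theorem σ_val (z : HubbardTree ν h) : (σ z).1 = z.1.map h := rfl

theorem iterate_σ_val (n : ℕ) (z : HubbardTree ν h) : (σ^[n] z).1 = (TreePoint.map h)^[n] z.1 := by
  induction n with
  | zero => rfl
  | succ n ih => rw [Function.iterate_succ_apply', Function.iterate_succ_apply', σ_val, ih]

theorem rep_iterate_σ (n : ℕ) (z : HubbardTree ν h) : (σ^[n] z).1.rep = drop n z.1.rep := by
  rw [iterate_σ_val, TreePoint.rep_iterate_map]

theorem body_iterate_σ (n : ℕ) (z : HubbardTree ν h) : (σ^[n] z).1.body = drop n z.1.body := by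
  rw [iterate_σ_val, TreePoint.body_iterate_map]

theorem rep_σ (z : HubbardTree ν h) : (σ z).1.rep = drop 1 z.1.rep := rep_iterate_σ 1 z

theorem rep_ofPath (n : ℕ) (c : CriticalPath ν) : (ofPath ν h n c).1.rep = drop n c.1.rep :=
  TreePoint.rep_iterate_map h n c.1

theorem body_ofPath (n : ℕ) (c : CriticalPath ν) : (ofPath ν h n c).1.body = drop n c.1.body :=
  TreePoint.body_iterate_map h n c.1

theorem itin_eq_body (z : HubbardTree ν h) : z.itin = z.1.body := by
  unfold itin
  rcases z.1 with a | ⟨a, b, t⟩ <;> rfl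

theorem criticalPoint_val : (criticalPoint ν h).1 = .itinerary ν.star := rfl

/-- The iterates of `σ` that are used for the topology of the tree. -/
def Level (ν : Itinerary A) (k : ℕ) : Prop :=
  ν.IsNonperiodic ∨ ∃ p, ν.IsStarPeriodic p ∧ k < p

theorem Level.mono {k l : ℕ} (hk : Level ν k) (hl : l ≤ k) : Level ν l :=
  hk.imp_right fun ⟨p, hp, hk⟩ => ⟨p, hp, hl.trans_lt hk⟩

section

variable [hK : Fact ν.IsKneading]

theorem exists_ofPath (z : HubbardTree ν h) : ∃ k, Level ν k ∧ ∃ c, ofPath ν h k c = z := by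
  obtain ⟨z, n, c, rfl⟩ := z
  rcases hK.out with hn | ⟨p, -, hp⟩
  · exact ⟨n, Or.inl hn, c, rfl⟩
  · obtain ⟨k, hk, w, hw⟩ := CriticalPath.exists_lift hp h n c
    exact ⟨k, Or.inr ⟨p, hp, hk⟩, w, Subtype.ext hw⟩

theorem proper_rep (z : HubbardTree ν h) : ν.Proper z.1.rep := by
  obtain ⟨k, -, c, rfl⟩ := exists_ofPath z
  rw [rep_ofPath]
  exact (c.onPath.proper_rep hK.out).drop k

theorem fatou_cases {z : HubbardTree ν h} {a b : Itinerary A} {t : Ioo (0 : ℝ) 1}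
    (hz : z.1 = .fatou a b t) : (∃ p, ν.IsStarPeriodic p) ∧ ν.Proper a ∧ ¬ a.StarFree ∧
      b.StarFree ∧ Compat a b := by
  have hν := hK.out
  have h0 := z.proper_rep
  rw [hz] at h0
  obtain ⟨k, -, c, rfl⟩ := exists_ofPath z
  have h1 := c.onPath
  have h2 := body_ofPath (h := h) k c
  have h3 := rep_ofPath (h := h) k c
  rw [hz] at h2 h3
  rcases hc : c.1 with a' | ⟨a', b', t'⟩
  · have h4 := TreePoint.iterate_map_itinerary h k a'
    rw [← hc] at h4
    exact absurd (hz.symm.trans h4) (by simp)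
  rw [hc] at h1 h2 h3
  obtain ⟨⟨p, hp⟩, u, hu, h4⟩ := h1.of_fatou
  have h5 : ν.InStages u ∧ b'.StarFree ∧ Compat u.1 b' := by
    rcases h4 with ⟨h4, -⟩ | ⟨h4, -⟩
    exacts [⟨h4.inStages, h4.starFree, h4.compat hν⟩, ⟨h4.inStages, h4.starFree, h4.compat hν⟩]
  have h6 : ¬ u.1.StarFree := fun h => hp.not_isNonperiodic (h5.1.starFree hν h).2
  simp only [TreePoint.body, TreePoint.rep] at h2 h3
  subst hu h2 h3
  exact ⟨⟨p, hp⟩, h0, hp.not_starFree_drop (h5.1.proper hν) h6 k, h5.2.1.drop k, h5.2.2.drop k⟩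

theorem val_eq_of_starFree {z : HubbardTree ν h} (hz : z.1.rep.StarFree) :
    z.1 = .itinerary z.1.rep := by
  rcases hz' : z.1 with a | ⟨a, b, t⟩
  · rfl
  · rw [hz'] at hz
    exact absurd hz (fatou_cases hz').2.2.1

theorem eq_of_rep_eq {z w : HubbardTree ν h} (hz : z.1.rep.StarFree) (hw : w.1.rep = z.1.rep) :
    w = z := by
  apply Subtype.ext
  rw [val_eq_of_starFree hz, val_eq_of_starFree (hw ▸ hz), hw]

theorem rep_eq_or (z : HubbardTree ν h) : z.1.rep = z.1.body ∨
    z.1.body.StarFree ∧ Compat z.1.rep z.1.body := by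
  rcases hz : z.1 with a | ⟨a, b, t⟩
  · exact Or.inl rfl
  · exact Or.inr (fatou_cases hz).2.2.2

theorem rep_eq_body (hn : ν.IsNonperiodic) (z : HubbardTree ν h) : z.1.rep = z.1.body := by
  rcases hz : z.1 with a | ⟨a, b, t⟩
  · rfl
  · obtain ⟨p, hp⟩ := (fatou_cases hz).1
    exact absurd hn hp.not_isNonperiodic

theorem merge_rep (z : HubbardTree ν h) {x : Itinerary A} (hx : x.StarFree) (hz : z.1.body ≠ x) :
    ν.Merge x z.1.rep z.1.body := by
  rcases z.rep_eq_or with h1 | ⟨h1, h2⟩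
  · rw [h1]
  · exact z.proper_rep.merge_of_compat h2 hx h1 hz

theorem body_zero_eq_none {z : HubbardTree ν h} : z.1.body 0 = none ↔ z = criticalPoint ν h := by
  constructor
  · intro hz
    have h1 := z.proper_rep
    rcases hz' : z.1 with a | ⟨a, b, t⟩
    · rw [hz'] at hz h1
      exact Subtype.ext (hz'.trans (congrArg _ (show a = ν.star from h1.eq_star hz)))
    · rw [hz'] at hz
      exact absurd hz ((fatou_cases hz').2.2.2.1 0)
  · rintro rfl; rfl

/-! ### The topology -/

open Classical in
theorem isOpen_iff_of_starPeriodic {p : ℕ} (hp : ν.IsStarPeriodic p) {U : Set (HubbardTree ν h)} :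
    IsOpen U ↔ ∀ k < p, IsOpen (ofPath ν h k ⁻¹' U) := by
  change IsOpen[if ν.IsNonperiodic then TopologicalSpace.induced itin ν.topologyX
    else ⨆ (p : ℕ) (_ : ν.IsStarPeriodic p) (k : ℕ) (_ : k < p),
    TopologicalSpace.coinduced (ofPath ν h k) inferInstance] U ↔ _
  rw [if_neg hp.not_isNonperiodic]
  simp only [isOpen_iSup_iff, isOpen_coinduced]
  refine ⟨fun h => h p hp, fun h q hq => ?_⟩
  -- The topology is a supremum over all possible periods, but the places of ⋆ determine the period.
  have : q = p := Nat.dvd_antisymm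
    ((hq.drop_star_eq_iff (m := p) (n := 0)).1 (hp.drop_star_eq_iff.2 (by simp [Nat.ModEq])) |>
      fun h => (Nat.modEq_zero_iff_dvd.1 h))
    ((hp.drop_star_eq_iff (m := q) (n := 0)).1 (hq.drop_star_eq_iff.2 (by simp [Nat.ModEq])) |>
      fun h => (Nat.modEq_zero_iff_dvd.1 h))
  rwa [this]

-- In terms of `Near`, passing from a cylinder to a basic open set means that ⋆ is forbidden at
-- early positions, except at the centre itself.
open Classical in
theorem isOpen_iff_of_nonperiodic (hn : ν.IsNonperiodic) {U : Set (HubbardTree ν h)} :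
    IsOpen U ↔ ∀ y ∈ U, ∃ M, ∀ z : HubbardTree ν h, Near M y.1.body z.1.body → z ∈ U := by
  have hX : ∀ z : HubbardTree ν h, z.1.body ∈ ν.X := fun z => by
    rw [← rep_eq_body hn]
    exact z.proper_rep.mem_X_of_nonperiodic hn
  change IsOpen[if ν.IsNonperiodic then TopologicalSpace.induced itin ν.topologyX
    else ⨆ (p : ℕ) (_ : ν.IsStarPeriodic p) (k : ℕ) (_ : k < p),
    TopologicalSpace.coinduced (ofPath ν h k) inferInstance] U ↔ _
  rw [if_pos hn]
  constructor
  · rintro ⟨O, hO, rfl⟩ y hy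
    have key : ∀ b ∈ O, b ∈ ν.X → ∃ M, ∀ z ∈ ν.X, Near M b z → z ∈ O := by
      clear hy
      induction hO with
      | basic U hU =>
        obtain ⟨a, ha, k, hk, rfl⟩ := hU
        intro b hb hbX
        rw [mem_basic_iff hn hbX] at hb
        refine ⟨k - 1, fun z hz hbz => ?_⟩
        rw [mem_basic_iff hn hz]
        rcases hbz with rfl | hbz
        · exact hb
        right
        intro i hi
        have h1 := hbz i (by omega)
        refine ⟨h1.1, ?_⟩
        rcases hb with rfl | hb
        · exact h1.2
        · have h2 := hb i hi
          rw [← h1.2.resolve_right h2.1]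
          exact h2.2
      | univ => exact fun b _ _ => ⟨0, fun z _ _ => trivial⟩
      | inter U V _ _ hU hV =>
        intro b hb hbX
        obtain ⟨M, hM⟩ := hU b hb.1 hbX
        obtain ⟨N, hN⟩ := hV b hb.2 hbX
        exact ⟨max M N, fun z hz hbz => ⟨hM z hz (hbz.mono (le_max_left _ _)),
          hN z hz (hbz.mono (le_max_right _ _))⟩⟩
      | sUnion S _ hS =>
        rintro b ⟨U, hU, hb⟩ hbX
        obtain ⟨M, hM⟩ := hS U hU b hb hbX
        exact ⟨M, fun z hz hbz => ⟨U, hU, hM z hz hbz⟩⟩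
    rw [mem_preimage, itin_eq_body] at hy
    obtain ⟨M, hM⟩ := key _ hy (hX y)
    refine ⟨M, fun z hz => ?_⟩
    rw [mem_preimage, itin_eq_body]
    exact hM _ (hX z) hz
  · intro hU
    choose M hM using hU
    refine ⟨⋃ (y : HubbardTree ν h) (hy : y ∈ U), ν.cylinder (M y hy + 1) y.1.body \
      ν.cylinderBoundary (M y hy + 1) y.1.body, ?_, ?_⟩
    · refine @isOpen_iUnion _ _ ν.topologyX _ fun y => @isOpen_iUnion _ _ ν.topologyX _ fun hy => ?_
      exact TopologicalSpace.isOpen_generateFrom_of_mem ⟨_, hX y, _, by omega, rfl⟩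
    · ext z
      simp only [mem_preimage, mem_iUnion, itin_eq_body]
      simp only [mem_basic_iff hn (hX z), add_lt_add_iff_right]
      constructor
      · rintro ⟨y, hy, h1⟩
        exact hM y hy z h1
      · exact fun hz => ⟨z, hz, Or.inl rfl⟩

theorem isOpen_of_forall {U : Set (HubbardTree ν h)}
    (h1 : ν.IsNonperiodic → ∀ y ∈ U, ∃ M, ∀ z : HubbardTree ν h,
      Near M y.1.body z.1.body → z ∈ U)
    (h2 : ∀ p, ν.IsStarPeriodic p → ∀ k < p, ∀ c, ofPath ν h k c ∈ U → ∃ O : Set (CriticalPath ν),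
      IsOpen O ∧ c ∈ O ∧ ∀ c' ∈ O, ofPath ν h k c' ∈ U) : IsOpen U := by
  rcases hK.out with hn | ⟨p, -, hp⟩
  · exact (isOpen_iff_of_nonperiodic hn).2 (h1 hn)
  · refine (isOpen_iff_of_starPeriodic hp).2 fun k hk => isOpen_iff_mem_nhds.2 fun c hc => ?_
    obtain ⟨O, hO, hcO, hOU⟩ := h2 p hp k hk c hc
    exact mem_of_superset (hO.mem_nhds hcO) hOU

theorem continuous_ofPath {k : ℕ} (hk : Level ν k) : Continuous (ofPath ν h k) := by
  refine continuous_def.2 fun U hU => ?_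
  rcases hk with hn | ⟨p, hp, hk⟩
  · rw [isOpen_iff_of_nonperiodic hn] at hU
    refine isOpen_iff_mem_nhds.2 fun c hc => ?_
    obtain ⟨M, hM⟩ := hU _ hc
    obtain ⟨O, hO, hcO, h1⟩ := c.exists_isOpen_near (M + k)
    refine mem_of_superset (hO.mem_nhds hcO) fun c' hc' => hM _ ?_
    rcases h1 c' hc' with rfl | h1
    · exact Or.inl rfl
    · right
      intro i hi
      rw [body_ofPath, body_ofPath, drop_apply, drop_apply]
      exact h1 (i + k) (by omega)
  · exact (isOpen_iff_of_starPeriodic hp).1 hU k hk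

theorem isOpen_sector (s : Option A) (hs : s ≠ none) :
    IsOpen {z : HubbardTree ν h | z.1.body 0 = s} := by
  refine isOpen_of_forall (fun _ y hy => ⟨1, fun z hz => ?_⟩) fun p hp k hk c hc => ?_
  · rcases hz with h1 | h1
    · rw [mem_ofPred_eq, h1]; exact hy
    · have h2 := (h1 0 one_pos).2.resolve_right (by rw [show y.1.body 0 = s from hy]; exact hs)
      exact h2.symm.trans hy
  · obtain ⟨O, hO, hcO, h1⟩ := c.exists_isOpen_near (k + 1)
    refine ⟨O, hO, hcO, fun c' hc' => ?_⟩
    rw [mem_ofPred_eq, body_ofPath, drop_apply] at hc ⊢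
    rcases h1 c' hc' with rfl | h1
    · exact hc
    · have h2 := (h1 (0 + k) (by omega)).2.resolve_right (by rw [hc]; exact hs)
      exact h2.symm.trans hc

theorem isClosed_criticalPoint : IsClosed {criticalPoint ν h} := by
  rw [← isOpen_compl_iff]
  have : ({criticalPoint ν h}ᶜ : Set (HubbardTree ν h)) =
      ⋃ (s : Option A) (_ : s ≠ none), {z : HubbardTree ν h | z.1.body 0 = s} := by
    ext z
    simp only [mem_compl_iff, mem_singleton_iff, ← body_zero_eq_none, mem_iUnion, mem_ofPred_eq]
    exact ⟨fun h => ⟨_, h, rfl⟩, fun ⟨s, hs, h⟩ => h ▸ hs⟩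
  rw [this]
  exact isOpen_iUnion fun s => isOpen_iUnion fun hs => isOpen_sector s hs

/-- The points on the side of `x` described by `a`. -/
def side (h : FatouMaps A) (ν x a : Itinerary A) : Set (HubbardTree ν h) :=
  {z | z.1.rep ≠ x ∧ ν.Merge x z.1.rep a}

-- Near a point without ⋆ the itinerary is constant up to the first difference from `x`, which
-- decides the side. Near any other point of a ⋆-periodic tree, `rep` is locally constant along the
-- path. The non-periodic case is `exists_near_merge`.
open Classical in
theorem isOpen_side {x : Itinerary A} (hx : x.StarFree) (hx' : ν.Proper x) (a : Itinerary A) :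
    IsOpen (side h ν x a) := by
  refine isOpen_of_forall (fun hn y hy => ?_) fun p hp k hk c hc => ?_
  · rw [← rep_eq_body hn]
    obtain ⟨M, hM⟩ := exists_near_merge hn hx' hx y.proper_rep hy.1
    refine ⟨M, fun z hz => ?_⟩
    rw [← rep_eq_body hn] at hz
    exact ⟨(hM _ hz).1, (hM _ hz).2.trans hy.2⟩
  · unfold side at hc ⊢
    simp only [mem_ofPred_eq, rep_ofPath] at hc ⊢
    by_cases h0 : c.1.rep.StarFree
    · have hb : c.1.body = c.1.rep := congrArg TreePoint.body
        (val_eq_of_starFree (z := ofPath ν h 0 c) h0 : c.1 = .itinerary c.1.rep)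
      have hex : ∃ n, drop k c.1.rep n ≠ x n := by
        by_contra! h1
        exact hc.1 (funext h1)
      have hmin : ∀ i < Nat.find hex, drop k c.1.rep i = x i := fun i hi =>
        not_not.1 (Nat.find_min hex hi)
      have hdiff := Nat.find_spec hex
      generalize Nat.find hex = n at hmin hdiff
      obtain ⟨O, hO, hcO, h1⟩ := c.exists_isOpen_near (n + k + 1)
      refine ⟨O, hO, hcO, fun c' hc' => ?_⟩
      rcases h1 c' hc' with rfl | h1
      · exact hc
      have h2 : ∀ i ≤ n, (ofPath ν h k c').1.body i = drop k c.1.rep i := fun i hi => by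
        rw [body_ofPath, drop_apply, drop_apply, ← hb]
        exact ((h1 (i + k) (by omega)).2.resolve_right (by rw [hb]; exact h0 _)).symm
      have h3 : (ofPath ν h k c').1.body ≠ x := fun h => hdiff (by rw [← h2 n le_rfl, h])
      rw [← rep_ofPath (h := h)]
      refine ⟨fun h4 => h3 ?_, (merge_rep _ hx h3).trans
        ((merge_of_ne (n := n) ?_ ?_).trans hc.2)⟩
      · rw [val_eq_of_starFree (h4 ▸ hx)]; exact h4
      · rw [track_eq_drop fun i hi => Or.inl ((h2 i hi.le).trans (hmin i hi)), drop_apply, zero_add,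
          h2 n le_rfl]
        exact hdiff
      · rw [track_eq_drop fun i hi => Or.inl (hmin i hi), drop_apply, zero_add]
        exact hdiff
    · obtain ⟨O, hO, hcO, h1⟩ := CriticalPath.exists_isOpen_rep_eq hp h0
      exact ⟨O, hO, hcO, fun c' hc' => by rw [h1 c' hc']; exact hc⟩

end

end HubbardTree

namespace Itinerary

variable {A : Type*} {ν : Itinerary A}

theorem leaves_add {x e : Itinerary A} (m k : ℕ) :
    ν.Leaves x e (m + k) ↔ ν.Leaves (drop m x) (track ν x m e) k := by
  unfold Leaves
  rw [track_add, drop_apply, add_comm k m]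

theorem Leaves.merge {x e : Itinerary A} {k : ℕ} (hx : x.StarFree) (h : ν.Leaves x e k) :
    ν.Merge x (starAt ν x k) e :=
  merge_of_ne (n := k) (by rw [track_starAt]; exact (hx k).symm) h.2

end Itinerary

/-! ### Components of the complement of a point. -/

namespace HubbardTree

open Itinerary

variable {A : Type*} {ν : Itinerary A} {h : FatouMaps A} [hK : Fact ν.IsKneading]

theorem isOpen_fatou (a b : Itinerary A) {T : Set (Ioo (0 : ℝ) 1)} (hT : IsOpen T)
    (hT' : T.OrdConnected) : IsOpen {z : HubbardTree ν h | ∃ t ∈ T, z.1 = .fatou a b t} ∧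
    IsPreconnected {z : HubbardTree ν h | ∃ t ∈ T, z.1 = .fatou a b t} := by
  have key : ∀ (k : ℕ) (c : CriticalPath ν) (t : Ioo (0 : ℝ) 1),
      (ofPath ν h k c).1 = .fatou a b t → ∃ a' b', ∃ e : Ioo (0 : ℝ) 1 ≃o Ioo (0 : ℝ) 1,
        (∃ t', c.1 = .fatou a' b' t') ∧ ∀ (c' : CriticalPath ν) (t : Ioo (0 : ℝ) 1),
          c'.1 = .fatou a' b' t → (ofPath ν h k c').1 = .fatou a b (e t) := by
    intro k c t hc
    rcases hc' : c.1 with a' | ⟨a', b', t'⟩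
    · have h4 := TreePoint.iterate_map_itinerary h k a'
      rw [← hc'] at h4
      exact absurd (hc.symm.trans h4) (by simp)
    · obtain ⟨e, he⟩ := TreePoint.iterate_map_fatou h k a' b'
      have h1 := he t'
      rw [← hc'] at h1
      have h2 := hc.symm.trans h1
      simp only [TreePoint.fatou.injEq] at h2
      refine ⟨a', b', e, ⟨t', rfl⟩, fun c' t'' h3 => ?_⟩
      have h4 := he t''
      rw [← h3] at h4
      rw [h2.1, h2.2.1]
      exact h4
  have hpre : ∀ e : Ioo (0 : ℝ) 1 ≃o Ioo (0 : ℝ) 1, IsOpen (e ⁻¹' T) ∧ (e ⁻¹' T).OrdConnected :=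
    fun e => ⟨hT.preimage e.continuous, hT'.preimage_mono e.monotone⟩
  constructor
  · refine isOpen_of_forall (fun hn y ⟨t, _, hy⟩ => ?_) fun p hp k hk c ⟨t, ht, hc⟩ => ?_
    · obtain ⟨p, hp⟩ := (fatou_cases hy).1
      exact absurd hn hp.not_isNonperiodic
    · obtain ⟨a', b', e, ⟨t', ht'⟩, he⟩ := key k c t hc
      refine ⟨_, (CriticalPath.isOpen_fatou a' b' (hpre e).1 (hpre e).2).1, ⟨t', ?_, ht'⟩, ?_⟩
      · have := (he c t' ht').symm.trans hc
        simp only [TreePoint.fatou.injEq, true_and] at this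
        rw [mem_preimage, this]; exact ht
      · rintro c' ⟨t'', h1, h2⟩
        exact ⟨_, h1, he c' t'' h2⟩
  · rcases Set.eq_empty_or_nonempty {z : HubbardTree ν h | ∃ t ∈ T, z.1 = .fatou a b t} with
      h1 | ⟨z, t, ht, hz⟩
    · rw [h1]; exact isPreconnected_empty
    obtain ⟨k, hk, c, rfl⟩ := exists_ofPath z
    obtain ⟨a', b', e, ⟨t', ht'⟩, he⟩ := key k c t hz
    have h1 := (CriticalPath.isOpen_fatou (ν := ν) a' b' (hpre e).1 (hpre e).2).2.image _
      (continuous_ofPath (h := h) hk).continuousOn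
    convert h1 using 1
    ext w
    constructor
    · rintro ⟨s, hs, hw⟩
      obtain ⟨F, hF, -⟩ := CriticalPath.exists_fatou ht'
      refine ⟨F (e.symm s), ⟨e.symm s, by simpa using hs, hF _⟩, Subtype.ext ?_⟩
      rw [he _ _ (hF _), hw, OrderIso.apply_symm_apply]
    · rintro ⟨c', ⟨s, hs, hc'⟩, rfl⟩
      exact ⟨_, hs, he c' s hc'⟩

theorem exists_fatou {a b : Itinerary A} {t : Ioo (0 : ℝ) 1} {z : HubbardTree ν h}
    (hz : z.1 = .fatou a b t) (s : Ioo (0 : ℝ) 1) : ∃ w : HubbardTree ν h, w.1 = .fatou a b s := by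
  obtain ⟨k, hk, c, rfl⟩ := exists_ofPath z
  rcases hc' : c.1 with a' | ⟨a', b', t'⟩
  · have h4 := TreePoint.iterate_map_itinerary h k a'
    rw [← hc'] at h4
    exact absurd (hz.symm.trans h4) (by simp)
  · obtain ⟨e, he⟩ := TreePoint.iterate_map_fatou h k a' b'
    obtain ⟨F, hF, -⟩ := CriticalPath.exists_fatou hc'
    have h1 := he t'
    rw [← hc'] at h1
    have h2 := hz.symm.trans h1
    simp only [TreePoint.fatou.injEq] at h2
    have h3 := he (e.symm s)
    rw [← hF (e.symm s), OrderIso.apply_symm_apply, ← h2.1, ← h2.2.1] at h3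
    exact ⟨ofPath ν h k (F (e.symm s)), h3⟩

theorem compl_eq_sides {x : Itinerary A} (hx : x.StarFree) {τ : HubbardTree ν h}
    (hτ : τ.1 = .itinerary x) : ({τ}ᶜ : Set (HubbardTree ν h)) = {z | z.1.rep ≠ x} := by
  ext z
  have h1 : τ.1.rep = x := by rw [hτ]; rfl
  rw [mem_compl_iff, mem_singleton_iff, mem_ofPred_eq, not_iff_not]
  exact ⟨fun h => h ▸ h1, fun h => eq_of_rep_eq (h1 ▸ hx) (h.trans h1.symm)⟩

theorem isClosed_singleton_of_starFree {x : Itinerary A} (hx : x.StarFree) {τ : HubbardTree ν h}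
    (hτ : τ.1 = .itinerary x) : IsClosed {τ} := by
  rw [← isOpen_compl_iff, compl_eq_sides hx hτ]
  have h1 : ν.Proper x := by have := τ.proper_rep; rwa [hτ] at this
  have : {z : HubbardTree ν h | z.1.rep ≠ x} = ⋃ a, side h ν x a := by
    ext z
    rw [mem_iUnion]
    exact ⟨fun h => ⟨z.1.rep, h, ⟨0, rfl⟩⟩, fun ⟨a, h⟩ => h.1⟩
  rw [this]
  exact isOpen_iUnion fun a => isOpen_side hx h1 a

theorem isOpen_compl_side {x : Itinerary A} (hx : x.StarFree) (hx' : ν.Proper x)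
    (a : Itinerary A) : IsOpen {z : HubbardTree ν h | z.1.rep ≠ x ∧ ¬ ν.Merge x z.1.rep a} := by
  have : {z : HubbardTree ν h | z.1.rep ≠ x ∧ ¬ ν.Merge x z.1.rep a} =
      ⋃ (b : Itinerary A) (_ : ¬ ν.Merge x b a), side h ν x b := by
    ext z
    simp only [mem_iUnion]
    exact ⟨fun h => ⟨z.1.rep, h.2, h.1, ⟨0, rfl⟩⟩,
      fun ⟨b, hb, h1, h2⟩ => ⟨h1, fun h3 => hb (h2.symm.trans h3)⟩⟩
  rw [this]
  exact isOpen_iUnion fun b => isOpen_iUnion fun _ => isOpen_side hx hx' b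

/-- The two ends of the critical path satisfy σ(⋆ν) = ν, so consecutive images of the path overlap;
this links all levels of the tree. -/
theorem ofPath_succ_star (k : ℕ) : ∃ c c' : CriticalPath ν, ofPath ν h k c = ofPath ν h (k + 1) c' :=
  ⟨CriticalPath.ofOnPath (.precritical _ ⟨0, self_mem_stage 0⟩),
    CriticalPath.ofOnPath (.precritical _ ⟨0, star_mem_stage 0⟩), rfl⟩

instance : PreconnectedSpace (HubbardTree ν h) := ⟨by
  have h1 : (univ : Set (HubbardTree ν h)) = ⋃ k ∈ {k | Level ν k}, range (ofPath ν h k) := by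
    ext z
    simp only [mem_univ, mem_iUnion, true_iff]
    obtain ⟨k, hk, c, hc⟩ := exists_ofPath z
    exact ⟨k, hk, c, hc⟩
  rw [h1]
  refine IsPreconnected.biUnion_of_chain ⟨fun a _ b hb c hc => Level.mono hb hc.2⟩
    (fun k hk => isPreconnected_range (continuous_ofPath hk)) fun k _ _ => ?_
  obtain ⟨c, c', hc⟩ := ofPath_succ_star (ν := ν) (h := h) k
  exact ⟨_, ⟨c, rfl⟩, ⟨c', hc.symm⟩⟩⟩

/-- A union of components of the complement of `z` is met by an interval of the critical path which
ends at a preimage of `z`. -/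
theorem exists_approach {z : HubbardTree ν h} {V : Set (HubbardTree ν h)} (hz : IsClosed {z})
    (hV : IsOpen V) (hVz : IsClosed (V ∪ {z})) (hzV : z ∉ V) (hne : V.Nonempty) :
    ∃ k, ∃ x c : CriticalPath ν, ofPath ν h k x = z ∧
      ((x < c ∧ ∀ w ∈ Ioc x c, ofPath ν h k w ∈ V) ∨
        (c < x ∧ ∀ w ∈ Ico c x, ofPath ν h k w ∈ V)) := by
  have hsub : ∀ S : Set (HubbardTree ν h), IsPreconnected S → z ∉ S → (S ∩ V).Nonempty → S ⊆ V := by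
    intro S hS hzS hSV
    refine hS.subset_left_of_subset_union hV hVz.isOpen_compl ?_ ?_ hSV
    · exact disjoint_left.2 fun w hw hw' => hw' (Or.inl hw)
    · intro w hw
      by_cases h1 : w ∈ V
      · exact Or.inl h1
      · refine Or.inr fun h2 => ?_
        rcases h2 with h2 | rfl
        exacts [h1 h2, hzS hw]
  by_cases hk : ∃ k, Level ν k ∧ (∃ x, ofPath ν h k x = z) ∧ ∃ c, ofPath ν h k c ∈ V
  · obtain ⟨k, hk, ⟨x₀, hx₀⟩, c, hc⟩ := hk
    have hcont := continuous_ofPath (h := h) hk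
    obtain ⟨x, hx, h1⟩ := CriticalPath.exists_nearest_of_isClosed (hz.preimage hcont)
      ⟨x₀, hx₀⟩ (c := c) fun hcS => hzV (by rwa [← (show ofPath ν h k c = z from hcS)])
    refine ⟨k, x, c, hx, h1.imp ?_ ?_⟩
    · rintro ⟨h2, h3⟩
      refine ⟨h2, fun w hw => hsub _ (isPreconnected_Ioc.image _ hcont.continuousOn) ?_
        ⟨_, ⟨c, ⟨h2, le_rfl⟩, rfl⟩, hc⟩ ⟨w, hw, rfl⟩⟩
      rintro ⟨w', hw', h4⟩
      exact disjoint_left.1 h3 hw' h4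
    · rintro ⟨h2, h3⟩
      refine ⟨h2, fun w hw => hsub _ (isPreconnected_Ico.image _ hcont.continuousOn) ?_
        ⟨_, ⟨c, ⟨le_rfl, h2⟩, rfl⟩, hc⟩ ⟨w, hw, rfl⟩⟩
      rintro ⟨w', hw', h4⟩
      exact disjoint_left.1 h3 hw' h4
  exfalso
  -- If no level contains both `z` and a point of `V`, then a level meeting `V` is contained in it.
  -- The overlaps carry this to every level, including one that contains `z`.
  have hall : ∀ k, Level ν k → (∃ c, ofPath ν h k c ∈ V) → ∀ c, ofPath ν h k c ∈ V := by
    intro k hkl ⟨c, hc⟩ c'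
    refine hsub _ (isPreconnected_range (continuous_ofPath hkl)) ?_ ⟨_, ⟨c, rfl⟩, hc⟩ ⟨c', rfl⟩
    rintro ⟨x, hx⟩
    exact hk ⟨k, hkl, ⟨x, hx⟩, c, hc⟩
  have hdown : ∀ k, Level ν k → (∃ c, ofPath ν h k c ∈ V) → ∃ c, ofPath ν h 0 c ∈ V := by
    intro k
    induction k with
    | zero => exact fun _ h => h
    | succ k ih =>
      intro hkl hc
      obtain ⟨c, c', hcc⟩ := ofPath_succ_star (ν := ν) (h := h) k
      exact ih (hkl.mono k.le_succ) ⟨c, hcc ▸ hall _ hkl hc c'⟩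
  have hup : ∀ k, Level ν k → (∃ c, ofPath ν h 0 c ∈ V) → ∃ c, ofPath ν h k c ∈ V := by
    intro k
    induction k with
    | zero => exact fun _ h => h
    | succ k ih =>
      intro hkl hc
      obtain ⟨c, c', hcc⟩ := ofPath_succ_star (ν := ν) (h := h) k
      have hkl' := hkl.mono k.le_succ
      exact ⟨c', hcc ▸ hall _ hkl' (ih hkl' hc) c⟩
  obtain ⟨y, hy⟩ := hne
  obtain ⟨k, hkl, c, rfl⟩ := exists_ofPath y
  obtain ⟨l, hll, c', hc'⟩ := exists_ofPath z
  exact hk ⟨l, hll, ⟨c', hc'⟩, hup l hll (hdown k hkl ⟨c, hy⟩)⟩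

/-- What the tree looks like locally at an end of a union of components of the complement of a
point. -/
theorem exists_germ {z : HubbardTree ν h} {V : Set (HubbardTree ν h)} {y : Itinerary A}
    (hz : IsClosed {z}) (hV : IsOpen V) (hVz : IsClosed (V ∪ {z})) (hzV : z ∉ V) (hne : V.Nonempty)
    (hzy : z.1 = .itinerary y) (hy : y.StarFree ∨ ν.IsNonperiodic) :
    (∃ x e, x.StarFree ∧ Compat y x ∧ ν.Crit e ∧ (∀ K, ∃ k ≥ K, ν.Leaves x e k) ∧
      ∃ K, ∀ k ≥ K, ν.Leaves x e k → ∃ w ∈ V, w.1 = .itinerary (starAt ν x k)) ∨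
    ∃ a t, ∃ w ∈ V, w.1 = .fatou a y t := by
  obtain ⟨k, x, c, hx, h1⟩ := exists_approach hz hV hVz hzV hne
  have hx' : (TreePoint.map h)^[k] x.1 = .itinerary y := by rw [← hzy, ← hx]; rfl
  obtain ⟨y', hy', rfl⟩ : ∃ y', x.1 = .itinerary y' ∧ drop k y' = y := by
    rcases hc : x.1 with y' | ⟨a, b, t⟩
    · rw [hc, TreePoint.iterate_map_itinerary] at hx'
      exact ⟨y', rfl, TreePoint.itinerary.inj hx'⟩
    · obtain ⟨e, he⟩ := TreePoint.iterate_map_fatou h k a b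
      rw [hc, he] at hx'
      cases hx'
  have hy2 : y'.StarFree ∨ ν.IsNonperiodic := by
    rcases hK.out with hn | ⟨p, -, hp⟩
    · exact Or.inr hn
    · left
      by_contra h2
      have h3 := x.onPath.proper_rep hK.out
      rw [hy'] at h3
      exact (hp.not_starFree_drop h3 h2 k) (hy.resolve_right hp.not_isNonperiodic)
  have hfatou : ∀ w : CriticalPath ν, ∀ a t, w.1 = .fatou a y' t → ∃ a t,
      (ofPath ν h k w).1 = .fatou a (drop k y') t := by
    intro w a t hw
    obtain ⟨e, he⟩ := TreePoint.iterate_map_fatou h k a y'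
    have := he t
    rw [← hw] at this
    exact ⟨_, _, this⟩
  have hgerm : ∀ x' e S, x'.StarFree → Compat y' x' → ν.Crit e → CriticalPath.Germ x' e S →
      (∀ w ∈ S, ofPath ν h k w ∈ V) →
      (∃ x e, x.StarFree ∧ Compat (drop k y') x ∧ ν.Crit e ∧ (∀ K, ∃ k ≥ K, ν.Leaves x e k) ∧
      ∃ K, ∀ k ≥ K, ν.Leaves x e k → ∃ w ∈ V, w.1 = .itinerary (starAt ν x k)) := by
    rintro x' e S h2 h3 h4 ⟨h5, K, hK'⟩ h6
    refine ⟨drop k x', track ν x' k e, h2.drop k, h3.drop k, h4.track _ _, fun M => ?_, K,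
      fun j hj hl => ?_⟩
    · obtain ⟨j, hj, hl⟩ := h5 (k + M)
      obtain ⟨i, rfl⟩ := Nat.exists_eq_add_of_le ((Nat.le_add_right k M).trans hj)
      exact ⟨i, by omega, (leaves_add k i).1 hl⟩
    · obtain ⟨w, hw, hw'⟩ := hK' (k + j) (by omega) ((leaves_add k j).2 hl)
      refine ⟨_, h6 w hw, ?_⟩
      rw [← drop_starAt_add, ← TreePoint.iterate_map_itinerary h, ← hw']
      rfl
  rcases h1 with ⟨h1, h2⟩ | ⟨h1, h2⟩
  · rcases CriticalPath.exists_germ_right hy' hy2 h1 with ⟨x', h3, h4, h5⟩ | ⟨a, t, w, hw, h3⟩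
    · exact Or.inl (hgerm x' ν _ h3 h4 crit_self h5 fun w hw => h2 w ⟨hw.1, hw.2.le⟩)
    · obtain ⟨a, t, h4⟩ := hfatou w a t h3
      exact Or.inr ⟨a, t, _, h2 w ⟨hw.1, hw.2.le⟩, h4⟩
  · rcases CriticalPath.exists_germ_left hy' hy2 h1 with ⟨x', h3, h4, h5⟩ | ⟨a, t, w, hw, h3⟩
    · exact Or.inl (hgerm x' ν.star _ h3 h4 crit_star h5 fun w hw => h2 w ⟨hw.1.le, hw.2⟩)
    · obtain ⟨a, t, h4⟩ := hfatou w a t h3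
      exact Or.inr ⟨a, t, _, h2 w ⟨hw.1.le, hw.2⟩, h4⟩

theorem eq_of_compat {x y : Itinerary A} (hx : x.StarFree) (hy : y.StarFree) (h : Compat y x) :
    x = y := funext fun i => (((h i).resolve_left (hy i)).resolve_left (hx i)).symm

/-- Two germs with the same track have points in common. -/
theorem germ_inter {x e e' : Itinerary A} {V V' : Set (HubbardTree ν h)} (hm : ν.Merge x e e')
    (h1 : ∀ K, ∃ k ≥ K, ν.Leaves x e k)
    (h2 : ∃ K, ∀ k ≥ K, ν.Leaves x e k → ∃ w ∈ V, w.1 = .itinerary (starAt ν x k))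
    (h3 : ∃ K, ∀ k ≥ K, ν.Leaves x e' k → ∃ w ∈ V', w.1 = .itinerary (starAt ν x k)) :
    (V ∩ V').Nonempty := by
  obtain ⟨K, hK⟩ := h2
  obtain ⟨K', hK'⟩ := h3
  obtain ⟨M, hM⟩ := hm.leaves_iff
  obtain ⟨k, hk, hl⟩ := h1 (max M (max K K'))
  have hk1 := (le_max_left _ _).trans hk
  have hk2 := (le_max_left _ _).trans ((le_max_right _ _).trans hk)
  have hk3 := (le_max_right _ _).trans ((le_max_right _ _).trans hk)
  obtain ⟨w, hw, h4⟩ := hK k hk2 hl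
  obtain ⟨w', hw', h5⟩ := hK' k hk3 ((hM k hk1).1 hl)
  obtain rfl : w = w' := Subtype.ext (h4.trans h5.symm)
  exact ⟨w, hw, hw'⟩

/-- In a separation of the side both pieces end only at `τ`, so `exists_germ` applies to each. The
resulting germ, a track leaving `x` infinitely often or a Fatou interval ending at `x`, belongs to
the class of `a`, and this forces the two pieces to intersect. -/
theorem isPreconnected_side {x : Itinerary A} (hx : x.StarFree) {τ : HubbardTree ν h}
    (hτ : τ.1 = .itinerary x) (a : Itinerary A) : IsPreconnected (side h ν x a) := by
  have hcl := isClosed_singleton_of_starFree hx hτ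
  have hx' : ν.Proper x := by have := τ.proper_rep; rwa [hτ] at this
  have hτV : τ ∉ side h ν x a := fun h1 => h1.1 (by rw [hτ]; rfl)
  rw [isPreconnected_iff_subset_of_disjoint]
  intro V V' hV hV' hsub hdis
  by_contra hcon
  rw [not_or, not_subset, not_subset] at hcon
  obtain ⟨⟨y', hy', hy'V⟩, ⟨y, hy, hyV⟩⟩ := hcon
  have hyV' := (hsub hy).resolve_right hyV
  have hy'V' := (hsub hy').resolve_left hy'V
  have hso := isOpen_side (h := h) hx hx' a
  have key : ∀ W W' : Set (HubbardTree ν h), IsOpen W → IsOpen W' → side h ν x a ⊆ W ∪ W' →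
      side h ν x a ∩ (W ∩ W') = ∅ → (∃ y ∈ side h ν x a, y ∈ W) →
      (∃ e, ν.Merge x e a ∧ (∀ K, ∃ k ≥ K, ν.Leaves x e k) ∧ ∃ K, ∀ k ≥ K, ν.Leaves x e k →
        ∃ w ∈ side h ν x a ∩ W, w.1 = .itinerary (starAt ν x k)) ∨
      ∃ b t, ν.Merge x b a ∧ ∃ w ∈ side h ν x a ∩ W, w.1 = .fatou b x t := by
    rintro W W' hW hW' h1 h2 ⟨y, hy, hyW⟩
    have hclW : IsClosed (side h ν x a ∩ W ∪ {τ}) := by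
      rw [← isOpen_compl_iff]
      have : (side h ν x a ∩ W ∪ {τ})ᶜ = (side h ν x a ∩ W') ∪
          {z : HubbardTree ν h | z.1.rep ≠ x ∧ ¬ ν.Merge x z.1.rep a} := by
        ext z
        have h3 : z ∈ ({τ}ᶜ : Set (HubbardTree ν h)) ↔ z.1.rep ≠ x := by
          rw [compl_eq_sides hx hτ]; rfl
        rw [compl_union, mem_inter_iff, h3]
        constructor
        · rintro ⟨h4, h5⟩
          by_cases h6 : ν.Merge x z.1.rep a
          · have h7 : z ∈ side h ν x a := ⟨h5, h6⟩
            exact Or.inl ⟨h7, (h1 h7).resolve_left fun h8 => h4 ⟨h7, h8⟩⟩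
          · exact Or.inr ⟨h5, h6⟩
        · rintro (⟨h4, h5⟩ | h4)
          · refine ⟨fun h6 => ?_, h4.1⟩
            exact (h2 ▸ (⟨h4, h6.2, h5⟩ : z ∈ side h ν x a ∩ (W ∩ W')) : z ∈ (∅ : Set _))
          · exact ⟨fun h5 => h4.2 h5.1.2, h4.1⟩
      rw [this]
      exact (hso.inter hW').union (isOpen_compl_side hx hx' a)
    rcases exists_germ hcl (hso.inter hW) hclW (fun h3 => hτV h3.1) ⟨y, hy, hyW⟩ hτ (Or.inl hx) with
      ⟨x', e, h3, h4, -, h5, h6⟩ | ⟨b, t, w, h3, h4⟩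
    · obtain rfl := eq_of_compat h3 hx h4
      refine Or.inl ⟨e, ?_, h5, h6⟩
      obtain ⟨K, hK⟩ := h6
      obtain ⟨k, hk, hl⟩ := h5 K
      obtain ⟨w, hw, hw'⟩ := hK k hk hl
      have h7 := hw.1.2
      rw [hw'] at h7
      exact (hl.merge hx).symm.trans h7
    · refine Or.inr ⟨b, t, ?_, w, h3, h4⟩
      have h7 := h3.1.2
      rw [h4] at h7
      exact h7
  -- The two sorts of germs exclude each other on one side: the precritical end of a Fatou interval
  -- is compatible with `x`, so its track never leaves `x`.
  have hleaf : ∀ e b t (w : HubbardTree ν h), ν.Merge x e a → (∀ K, ∃ k ≥ K, ν.Leaves x e k) →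
      ν.Merge x b a → w.1 = .fatou b x t → False := by
    intro e b t w h1 h2 h3 h4
    obtain ⟨-, h5, -, -, h6⟩ := fatou_cases h4
    obtain ⟨M, hM⟩ := (h1.trans h3.symm).leaves_iff
    obtain ⟨k, hk, hl⟩ := h2 M
    exact h5.not_leaves hx h6 k ((hM k hk).1 hl)
  have hdis' : side h ν x a ∩ (V' ∩ V) = ∅ := by rwa [inter_comm V' V]
  have hbad : ∀ w, w ∈ side h ν x a → w ∈ V → w ∈ V' → False := fun w h1 h2 h3 =>
    (hdis ▸ (⟨h1, h2, h3⟩ : w ∈ side h ν x a ∩ (V ∩ V')) : w ∈ (∅ : Set _))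
  rcases key V V' hV hV' hsub hdis ⟨y, hy, hyV'⟩ with ⟨e, h1, h2, h3⟩ | ⟨b, t, h1, w, h2, h3⟩ <;>
  rcases key V' V hV' hV (by rwa [union_comm]) hdis' ⟨y', hy', hy'V'⟩ with
    ⟨e', h1', h2', h3'⟩ | ⟨b', t', h1', w', h2', h3'⟩
  · obtain ⟨w, hw, hw'⟩ := germ_inter (h1.trans h1'.symm) h2 h3 h3'
    exact hbad w hw.1 hw.2 hw'.2
  · exact hleaf e b' t' w' h1 h2 h1' h3'
  · exact hleaf e' b t w h1' h2' h1 h3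
  · obtain ⟨-, h4, h4n, -, h5⟩ := fatou_cases h3
    obtain ⟨-, h6, -, -, h7⟩ := fatou_cases h3'
    -- Two Fatou intervals ending at `x` on the same side have the same precritical end. The
    -- interval is then connected and meets both pieces.
    obtain rfl := h4.eq_of_merge h6 hx h5 h7 (h1.trans h1'.symm)
    have h8 := (isOpen_fatou (h := h) (ν := ν) b x isOpen_univ ordConnected_univ).2
    have h9 : {z : HubbardTree ν h | ∃ t ∈ univ, z.1 = .fatou b x t} ⊆ side h ν x a := by
      rintro z ⟨s, -, hz⟩
      have : z.1.rep = b := by rw [hz]; rfl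
      refine ⟨?_, this ▸ h1⟩
      rw [this]
      rintro rfl
      exact h4n hx
    obtain ⟨z, hz, hzV, hzV'⟩ := h8 V V' hV hV' (h9.trans hsub) ⟨w, ⟨t, trivial, h3⟩, h2.2⟩
      ⟨w', ⟨t', trivial, h3'⟩, h2'.2⟩
    exact hbad z (h9 hz) hzV hzV'

/-- The components of the complement of a point without `⋆`. -/
theorem connectedComponentIn_eq_side {x : Itinerary A} (hx : x.StarFree) {τ : HubbardTree ν h}
    (hτ : τ.1 = .itinerary x) {y : HubbardTree ν h} (hy : y ≠ τ) :
    connectedComponentIn {τ}ᶜ y = side h ν x y.1.rep := by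
  have hx' : ν.Proper x := by have := τ.proper_rep; rwa [hτ] at this
  have hsub : side h ν x y.1.rep ⊆ {τ}ᶜ := by
    rw [compl_eq_sides hx hτ]; exact fun z hz => hz.1
  have hyx : y.1.rep ≠ x := by
    have : y ∈ ({τ}ᶜ : Set (HubbardTree ν h)) := hy
    rwa [compl_eq_sides hx hτ] at this
  have hmem : y ∈ side h ν x y.1.rep := ⟨hyx, ⟨0, rfl⟩⟩
  apply Subset.antisymm
  · refine isPreconnected_connectedComponentIn.subset_left_of_subset_union
      (isOpen_side hx hx' y.1.rep) (isOpen_compl_side hx hx' y.1.rep) ?_ ?_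
      ⟨y, mem_connectedComponentIn hy, hmem⟩
    · exact disjoint_left.2 fun z h1 h2 => h2.2 h1.2
    · intro z hz
      have h1 := connectedComponentIn_subset _ _ hz
      rw [compl_eq_sides hx hτ] at h1
      by_cases h2 : ν.Merge x z.1.rep y.1.rep
      exacts [Or.inl ⟨h1, h2⟩, Or.inr ⟨h1, h2⟩]
  · exact (isPreconnected_side hx hτ _).subset_connectedComponentIn hmem hsub

/-- The branches at the critical point, if `ν` is not periodic. -/
theorem isPreconnected_sector (hn : ν.IsNonperiodic) {s : Option A} (hs : s ≠ none) :
    IsPreconnected {z : HubbardTree ν h | z.1.body 0 = s} := by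
  rw [isPreconnected_iff_subset_of_disjoint]
  intro V V' hV hV' hsub hdis
  by_contra hcon
  rw [not_or, not_subset, not_subset] at hcon
  obtain ⟨⟨y', hy', hy'V⟩, ⟨y, hy, hyV⟩⟩ := hcon
  have hyV' := (hsub hy).resolve_right hyV
  have hy'V' := (hsub hy').resolve_left hy'V
  set S := {z : HubbardTree ν h | z.1.body 0 = s} with hS
  have hso : IsOpen S := isOpen_sector s hs
  have key : ∀ W W' : Set (HubbardTree ν h), IsOpen W → IsOpen W' → S ⊆ W ∪ W' →
      S ∩ (W ∩ W') = ∅ → (∃ y ∈ S, y ∈ W) →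
      ∃ e, ν.Merge ν (track ν (cons s ν) 1 e) ν.star ∧
        (∀ K, ∃ k ≥ K, ν.Leaves (cons s ν) e k) ∧
        ∃ K, ∀ k ≥ K, ν.Leaves (cons s ν) e k →
        ∃ w ∈ S ∩ W, w.1 = .itinerary (starAt ν (cons s ν) k) := by
    rintro W W' hW hW' h1 h2 ⟨y, hy, hyW⟩
    have hclW : IsClosed (S ∩ W ∪ {criticalPoint ν h}) := by
      rw [← isOpen_compl_iff]
      have : (S ∩ W ∪ {criticalPoint ν h})ᶜ = (S ∩ W') ∪
          ⋃ (t : Option A) (_ : t ≠ none) (_ : t ≠ s), {z : HubbardTree ν h | z.1.body 0 = t} := by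
        ext z
        rw [compl_union, mem_inter_iff, mem_compl_iff, mem_compl_iff, mem_singleton_iff,
          ← body_zero_eq_none]
        simp only [mem_union, mem_iUnion, mem_ofPred_eq]
        constructor
        · rintro ⟨h4, h5⟩
          by_cases h6 : z.1.body 0 = s
          · exact Or.inl ⟨h6, (h1 h6).resolve_left fun h8 => h4 ⟨h6, h8⟩⟩
          · exact Or.inr ⟨_, h5, h6, rfl⟩
        · rintro (⟨h4, h5⟩ | ⟨t, h4, h5, h6⟩)
          · refine ⟨fun h6 => ?_, by rw [show z.1.body 0 = s from h4]; exact hs⟩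
            exact (h2 ▸ (⟨h4, h6.2, h5⟩ : z ∈ S ∩ (W ∩ W')) : z ∈ (∅ : Set _))
          · exact ⟨fun h7 => h5 (h6.symm.trans h7.1), h6 ▸ h4⟩
      rw [this]
      exact (hso.inter hW').union (isOpen_iUnion fun t => isOpen_iUnion fun ht =>
        isOpen_iUnion fun _ => isOpen_sector t ht)
    rcases exists_germ isClosed_criticalPoint (hso.inter hW) hclW (fun h3 => hs h3.1.symm) ⟨y, hy, hyW⟩
      criticalPoint_val (Or.inr hn) with ⟨x, e, h3, h4, he, h5, h6⟩ | ⟨b, t, w, h3, h4⟩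
    -- Compatibility with ⋆ν fixes all positions but the first, as ν has no ⋆; the first symbol is
    -- that of the sector, read off at a nearby precritical point.
    · obtain rfl : x = cons s ν := by
        obtain ⟨K, hK⟩ := h6
        obtain ⟨k, hk, hl⟩ := h5 (K + 1)
        obtain ⟨w, hw, hw'⟩ := hK k (by omega) hl
        have h7 : w.1.body 0 = s := hw.1
        rw [hw'] at h7
        funext i
        rcases i with _ | i
        · rw [← starAt_of_lt (ν := ν) (x := x) (show 0 < k by omega)]; exact h7
        · exact ((((h4 (i + 1)).resolve_left (hn.1 i)).resolve_left (h3 _)).symm)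
      refine ⟨e, ?_, h5, h6⟩
      -- After one step the germ is at ν, where all other critical orbit points are on one side. The
      -- track is not at ν itself, since from there it would never leave.
      refine (he.track _ _).merge_star fun h7 => ?_
      obtain ⟨k, hk, hl⟩ := h5 1
      obtain ⟨j, rfl⟩ := Nat.exists_eq_add_of_le hk
      rw [leaves_add, h7] at hl
      exact hK.out.proper_star.self.not_leaves hn.1 (fun i => Or.inr (Or.inr rfl)) j hl
    · obtain ⟨p, hp⟩ := (fatou_cases h4).1
      exact absurd hn hp.not_isNonperiodic
  obtain ⟨e, h1, h2, h3⟩ := key V V' hV hV' hsub hdis ⟨y, hy, hyV'⟩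
  obtain ⟨e', h1', h2', h3'⟩ := key V' V hV' hV (by rwa [union_comm])
    (by rwa [inter_comm V' V]) ⟨y', hy', hy'V'⟩
  obtain ⟨w, hw, hw'⟩ := germ_inter ((merge_track_iff 1).1 (h1.trans h1'.symm)) h2 h3 h3'
  exact (hdis ▸ (⟨hw.1, hw.2, hw'.2⟩ : w ∈ S ∩ (V ∩ V')) : w ∈ (∅ : Set _))

/-- Each point other than the critical point has a connected neighbourhood which does not contain
the critical point. -/
theorem exists_nhd (τ : HubbardTree ν h) (hτ : τ ≠ criticalPoint ν h) :
    ∃ N : Set (HubbardTree ν h), IsOpen N ∧ IsConnected N ∧ τ ∈ N ∧ criticalPoint ν h ∉ N := by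
  have h0 : τ.1.body 0 ≠ none := fun h => hτ (body_zero_eq_none.1 h)
  rcases hK.out with hn | ⟨p, -, hp⟩
  · exact ⟨_, isOpen_sector _ h0, ⟨⟨τ, rfl⟩, isPreconnected_sector hn h0⟩, rfl, fun h => h0 h.symm⟩
  -- For ⋆-periodic ν this component is open because the critical path is locally connected and
  -- openness is tested on its images.
  · refine ⟨connectedComponentIn {criticalPoint ν h}ᶜ τ, ?_, ⟨⟨τ, mem_connectedComponentIn hτ⟩,
      isPreconnected_connectedComponentIn⟩, mem_connectedComponentIn hτ,
      fun h => connectedComponentIn_subset _ _ h rfl⟩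
    refine (isOpen_iff_of_starPeriodic hp).2 fun k hk => isOpen_iff_mem_nhds.2 fun c hc => ?_
    have hcont := continuous_ofPath (ν := ν) (h := h) (Or.inr ⟨p, hp, hk⟩)
    have h1 : ofPath ν h k ⁻¹' {criticalPoint ν h}ᶜ ∈ 𝓝 c :=
      (isClosed_criticalPoint.isOpen_compl.preimage hcont).mem_nhds
        (connectedComponentIn_subset {criticalPoint ν h}ᶜ τ hc)
    obtain ⟨W, hW, hW', hWs⟩ := locallyConnectedSpace_iff_connected_subsets.1 inferInstance c _ h1
    refine mem_of_superset hW fun w hw => ?_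
    have h2 := (hW'.image _ hcont.continuousOn).subset_connectedComponentIn
      (mem_image_of_mem _ (mem_of_mem_nhds hW)) (image_subset_iff.2 hWs)
    rw [mem_preimage, connectedComponentIn_eq hc]
    exact h2 (mem_image_of_mem _ hw)

end HubbardTree

namespace HubbardTree

open Itinerary

variable {A : Type*} {ν : Itinerary A} {h : FatouMaps A} [hK : Fact ν.IsKneading]

/-! ### Local arms at points without `⋆` -/

/-- The sequence `a ≠ x` represents a point of the tree. -/
def IsLabel (h : FatouMaps A) (ν x a : Itinerary A) : Prop :=
  a ≠ x ∧ ∃ y : HubbardTree ν h, y.1.rep = a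

theorem IsLabel.mem_side {x a : Itinerary A} (ha : IsLabel h ν x a) :
    ∃ y ∈ side h ν x a, y.1.rep = a := by
  obtain ⟨h1, y, rfl⟩ := ha
  exact ⟨y, ⟨h1, ⟨0, rfl⟩⟩, rfl⟩

theorem side_eq_side {x a b : Itinerary A} (ha : IsLabel h ν x a) :
    side h ν x a = side h ν x b ↔ ν.Merge x a b := by
  constructor
  · intro h1
    obtain ⟨y, hy, rfl⟩ := ha.mem_side
    rw [h1] at hy
    exact hy.2
  · intro h1
    ext z
    exact ⟨fun h2 => ⟨h2.1, h2.2.trans h1⟩, fun h2 => ⟨h2.1, h2.2.trans h1.symm⟩⟩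

theorem isLabel_star {x : Itinerary A} (hx : x.StarFree) : IsLabel h ν x ν.star :=
  ⟨fun h => hx 0 (by rw [← h]; rfl), criticalPoint ν h, rfl⟩

theorem IsLabel.step {x a : Itinerary A} (hx : x.StarFree) (hx' : ν.Proper x)
    (ha : IsLabel h ν x a) : IsLabel h ν (drop 1 x) (track ν x 1 a) := by
  obtain ⟨h1, y, rfl⟩ := ha
  by_cases h0 : y.1.rep 0 = x 0
  · have h2 : track ν x 1 y.1.rep = drop 1 y.1.rep := step_of_eq h0
    rw [h2]
    refine ⟨fun h3 => h1 (funext fun i => ?_), σ y, rep_σ y⟩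
    rcases i with _ | i
    exacts [h0, congrFun h3 i]
  · have h2 : track ν x 1 y.1.rep = ν := step_of_ne h0
    rw [h2]
    exact ⟨fun h3 => hx 0 ((hx' 0).2 h3.symm), criticalValue ν h, rfl⟩

theorem IsLabel.track {x a : Itinerary A} (hx : x.StarFree) (hx' : ν.Proper x)
    (ha : IsLabel h ν x a) (n : ℕ) : IsLabel h ν (drop n x) (track ν x n a) := by
  induction n with
  | zero => exact ha
  | succ n ih =>
    have := ih.step (hx.drop n) (hx'.drop n)
    rwa [← track_add, drop_drop] at this

theorem mem_arms_iff {x : Itinerary A} (hx : x.StarFree) {τ : HubbardTree ν h}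
    (hτ : τ.1 = .itinerary x) {G : Set (HubbardTree ν h)} :
    G ∈ arms τ ↔ ∃ a, IsLabel h ν x a ∧ G = side h ν x a := by
  have h1 : ∀ y : HubbardTree ν h, y ≠ τ ↔ y.1.rep ≠ x := fun y => by
    change y ∈ ({τ}ᶜ : Set _) ↔ _
    rw [compl_eq_sides hx hτ]; rfl
  constructor
  · rintro ⟨y, hy, rfl⟩
    exact ⟨_, ⟨(h1 y).1 hy, y, rfl⟩, connectedComponentIn_eq_side hx hτ hy⟩
  · rintro ⟨_, ⟨h2, y, rfl⟩, rfl⟩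
    exact ⟨y, (h1 y).2 h2, (connectedComponentIn_eq_side hx hτ ((h1 y).2 h2)).symm⟩

/-- Without the critical point the tree is a disjoint union of open sectors, one for each first
symbol. -/
theorem body_zero_eq {N : Set (HubbardTree ν h)} (hN : IsPreconnected N)
    (h0 : criticalPoint ν h ∉ N) {z w : HubbardTree ν h} (hz : z ∈ N) (hw : w ∈ N) :
    w.1.body 0 = z.1.body 0 := by
  have h1 : ∀ {z : HubbardTree ν h}, z ∈ N → z.1.body 0 ≠ none := fun hz h =>
    h0 (body_zero_eq_none.1 h ▸ hz)
  refine hN.subset_left_of_subset_union (isOpen_sector (z.1.body 0) (h1 hz))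
    (v := ⋃ (t : Option A) (_ : t ≠ none) (_ : t ≠ z.1.body 0),
      {w : HubbardTree ν h | w.1.body 0 = t})
    (isOpen_iUnion fun t => isOpen_iUnion fun ht => isOpen_iUnion fun _ => isOpen_sector t ht)
    ?_ ?_ ⟨z, hz, rfl⟩ hw
  · rw [disjoint_left]
    intro u hu hu'
    simp only [mem_iUnion] at hu'
    obtain ⟨t, -, ht, hu'⟩ := hu'
    exact ht (hu'.symm.trans hu)
  · intro u hu
    by_cases h2 : u.1.body 0 = z.1.body 0
    · exact Or.inl h2
    · exact Or.inr (mem_iUnion.2 ⟨_, mem_iUnion.2 ⟨h1 hu, mem_iUnion.2 ⟨h2, rfl⟩⟩⟩)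

theorem step_rep {x : Itinerary A} {w : HubbardTree ν h} (h0 : w.1.body 0 = x 0) :
    track ν x 1 w.1.rep = drop 1 w.1.rep := by
  refine w.proper_rep.track_eq_drop fun i hi => ?_
  obtain rfl : i = 0 := by omega
  rcases w.rep_eq_or with h1 | ⟨h1, h2⟩
  · left; rw [h1, h0]
  · rcases h2 0 with h2 | h2 | h2
    exacts [Or.inr h2, absurd h2 (h1 0), Or.inl (h2.trans h0)]

/-- Otherwise `G` would be open and closed in the connected tree. This ensures that an arm has
points in every neighbourhood of its base point. -/
theorem nhd_inter_nonempty {τ : HubbardTree ν h} {G N : Set (HubbardTree ν h)} (hG : IsOpen G)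
    (hG' : IsOpen (G ∪ {τ})ᶜ) (hτ : τ ∉ G) (hne : G.Nonempty) (hN : IsOpen N) (hτN : τ ∈ N) :
    (N ∩ G).Nonempty := by
  by_contra hcon
  rw [not_nonempty_iff_eq_empty] at hcon
  have hdis : ∀ w, w ∈ N → w ∉ G := fun w h1 h2 =>
    (hcon ▸ (⟨h1, h2⟩ : w ∈ N ∩ G) : w ∈ (∅ : Set _))
  have h1 : Gᶜ = (G ∪ {τ})ᶜ ∪ N := by
    ext w
    simp only [mem_compl_iff, mem_union, mem_singleton_iff, not_or]
    constructor
    · intro h2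
      by_cases h3 : w = τ
      exacts [Or.inr (h3 ▸ hτN), Or.inl ⟨h2, h3⟩]
    · rintro (h2 | h2)
      exacts [h2.1, hdis w h2]
  have h2 : IsClopen G := ⟨isOpen_compl_iff.1 (h1 ▸ hG'.union hN), hG⟩
  exact hτ (h2.eq_univ hne ▸ mem_univ τ)

theorem side_union_compl {x : Itinerary A} (hx : x.StarFree) {τ : HubbardTree ν h}
    (hτ : τ.1 = .itinerary x) (a : Itinerary A) : IsOpen (side h ν x a ∪ {τ})ᶜ := by
  have hx' : ν.Proper x := by have := τ.proper_rep; rwa [hτ] at this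
  have : (side h ν x a ∪ {τ})ᶜ = {z : HubbardTree ν h | z.1.rep ≠ x ∧ ¬ ν.Merge x z.1.rep a} := by
    rw [compl_union, compl_eq_sides hx hτ]
    ext z
    exact ⟨fun h => ⟨h.2, fun h' => h.1 ⟨h.2, h'⟩⟩, fun h => ⟨fun h' => h.2 h'.2, h.1⟩⟩
  rw [this]
  exact isOpen_compl_side hx hx' a

/-- A connected neighbourhood without ⋆ν has a constant first symbol, so there σ acts on itineraries
as one step of the track along `x`. That the image arm is unique relies on the existence of such a
neighbourhood (`exists_nhd`) and on its meeting the given arm. -/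
theorem mapsArm_iff {x a : Itinerary A} (hx : x.StarFree) {τ : HubbardTree ν h}
    (hτ : τ.1 = .itinerary x) (ha : IsLabel h ν x a) {G' : Set (HubbardTree ν h)} :
    MapsArm τ (side h ν x a) G' ↔ G' = side h ν (drop 1 x) (track ν x 1 a) := by
  have hx' : ν.Proper x := by have := τ.proper_rep; rwa [hτ] at this
  have hστ : (σ τ).1 = .itinerary (drop 1 x) := by rw [σ_val, hτ]; rfl
  have hτ0 : τ ≠ criticalPoint ν h := fun h => hx 0 (by
    have := body_zero_eq_none.2 h; rwa [hτ] at this)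
  have key : ∀ N : Set (HubbardTree ν h), IsPreconnected N → τ ∈ N → criticalPoint ν h ∉ N →
      ∀ w ∈ N, w ∈ side h ν x a → σ w ∈ side h ν (drop 1 x) (track ν x 1 a) := by
    intro N hN hτN h0 w hw hwa
    have h1 : w.1.body 0 = x 0 := by rw [body_zero_eq hN h0 hτN hw, hτ]; rfl
    have h2 := step_rep h1
    have h3 := IsLabel.step hx hx' (show IsLabel h ν x w.1.rep from ⟨hwa.1, w, rfl⟩)
    rw [h2, ← rep_σ] at h3
    refine ⟨h3.1, ?_⟩
    rw [rep_σ, ← h2, merge_track_iff]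
    exact hwa.2
  constructor
  · rintro ⟨-, h2, h3⟩
    obtain ⟨N, hN, hN', hτN, h0⟩ := exists_nhd τ hτ0
    obtain ⟨y, hy, -⟩ := ha.mem_side
    obtain ⟨w, hwN, hwG⟩ := nhd_inter_nonempty (isOpen_side hx hx' a) (side_union_compl hx hτ a)
      (fun h => h.1 (by rw [hτ]; rfl)) ⟨y, hy⟩ hN hτN
    have h4 := h3 N hN hN' hτN h0 ⟨w, ⟨hwN, hwG⟩, rfl⟩
    have h5 := key N hN'.isPreconnected hτN h0 w hwN hwG
    obtain ⟨b, hb, rfl⟩ := (mem_arms_iff (hx.drop 1) hστ).1 h2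
    rw [side_eq_side hb]
    exact h4.2.symm.trans h5.2
  · rintro rfl
    refine ⟨(mem_arms_iff hx hτ).2 ⟨a, ha, rfl⟩, (mem_arms_iff (hx.drop 1) hστ).2
      ⟨_, ha.step hx hx', rfl⟩, fun N _ hN hτN h0 => ?_⟩
    rintro _ ⟨w, hw, rfl⟩
    exact key N hN.isPreconnected hτN h0 w hw.1 hw.2

theorem returnsArm_iff {x a : Itinerary A} (hx : x.StarFree) {τ : HubbardTree ν h}
    (hτ : τ.1 = .itinerary x) (ha : IsLabel h ν x a) {G' : Set (HubbardTree ν h)} :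
    ReturnsArm τ (side h ν x a) G' ↔
      G' = side h ν (drop (Function.minimalPeriod σ τ) x)
        (track ν x (Function.minimalPeriod σ τ) a) := by
  have hx' : ν.Proper x := by have := τ.proper_rep; rwa [hτ] at this
  have hit : ∀ n, (σ^[n] τ).1 = .itinerary (drop n x) := fun n => by
    rw [iterate_σ_val, hτ, TreePoint.iterate_map_itinerary]
  have hstep : ∀ n G, MapsArm (σ^[n] τ) (side h ν (drop n x) (track ν x n a)) G ↔
      G = side h ν (drop (n + 1) x) (track ν x (n + 1) a) := fun n G => by
    rw [mapsArm_iff (hx.drop n) (hit n) (ha.track hx hx' n), ← track_add, drop_drop]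
  constructor
  · rintro ⟨c, h0, rfl, h2⟩
    have : ∀ n ≤ Function.minimalPeriod σ τ, c n = side h ν (drop n x) (track ν x n a) := by
      intro n
      induction n with
      | zero => exact fun _ => h0
      | succ n ih =>
        intro hn
        have := h2 n hn
        rw [ih (by omega), hstep] at this
        exact this
    exact this _ le_rfl
  · rintro rfl
    exact ⟨fun n => side h ν (drop n x) (track ν x n a), rfl, rfl, fun n _ => (hstep n _).2 rfl⟩

end HubbardTree

/-! ### Injective maps whose orbits all meet a given pair of points -/

/-- As `g` is periodic, `f^[j] g` is also `f^[q]` of an iterate of `g`, and `f^[q]` can be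
cancelled. The exponent `q * p - q + j` becomes congruent to `j` modulo `p` when `q` is added. -/
theorem Function.Injective.exists_iterate_eq {S : Type*} {f : S → S} (hf : f.Injective) {g s : S}
    {p q j : ℕ} (hp : 0 < p) (hg : f^[p] g = g) (h : f^[q] s = f^[j] g) : ∃ n, f^[n] g = s := by
  have h1 : f^[q * p] g = g := (Function.IsPeriodicPt.const_mul hg q)
  have h2 : q ≤ q * p := Nat.le_mul_of_pos_right q hp
  refine ⟨q * p - q + j, hf.iterate q ?_⟩
  rw [h, ← Function.iterate_add_apply, ← add_assoc, Nat.add_sub_cancel' h2, add_comm,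
    Function.iterate_add_apply, h1]

theorem Equiv.Perm.sameCycle_of_iterate {S : Type*} {ρ : Equiv.Perm S} {g x y : S} {m n : ℕ}
    (hx : ρ^[m] g = x) (hy : ρ^[n] g = y) : ρ.SameCycle x y := by
  have h : ∀ {k : ℕ} {z : S}, ρ^[k] g = z → ρ.SameCycle g z := fun {k} {z} hz =>
    ⟨k, by rw [zpow_natCast, Equiv.Perm.coe_pow]; exact hz⟩
  exact (h hx).symm.trans (h hy)

/-- If `g₀` is fixed, no other element is ever led to it; so all others are led to `g₁`, which is
therefore periodic, and by injectivity they form its orbit. If `f g₀ = g₁`, then `g₀` is periodic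
and its orbit is everything. In both cases the set is finite, which makes `f` bijective. -/
theorem Function.Injective.exists_perm_of_pair {S : Type*} {f : S → S} (hf : f.Injective)
    {g₀ g₁ : S} (hne : g₀ ≠ g₁) (hret : ∀ s, ∃ q, 0 < q ∧ (f^[q] s = g₀ ∨ f^[q] s = g₁))
    (h0 : f g₀ = g₀ ∨ f g₀ = g₁) : Finite S ∧ ∃ ρ : Equiv.Perm S, ⇑ρ = f ∧
      (ρ.IsCycleOn univ ∨ ρ g₀ = g₀ ∧ ρ.IsCycleOn {g₀}ᶜ) := by
  have hfin : ∀ {g : S} {p : ℕ}, 0 < p → f^[p] g = g → (range fun n => f^[n] g).Finite := by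
    intro g p hp hg
    refine ((finite_lt_nat p).image fun n => f^[n] g).subset ?_
    rintro _ ⟨n, rfl⟩
    exact ⟨n % p, Nat.mod_lt _ hp, (show Function.IsPeriodicPt f p g from hg).iterate_mod_apply n⟩
  rcases h0 with h0 | h0
  · have hfix : ∀ n, f^[n] g₀ = g₀ := fun n => Function.iterate_fixed h0 n
    have hret' : ∀ s, s ≠ g₀ → ∃ q, 0 < q ∧ f^[q] s = g₁ := fun s hs => by
      obtain ⟨q, hq, h1 | h1⟩ := hret s
      · exact absurd (hf.iterate q (h1.trans (hfix q).symm)) hs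
      · exact ⟨q, hq, h1⟩
    obtain ⟨p, hp, hg⟩ := hret' g₁ hne.symm
    have hall : ∀ s, s ≠ g₀ → ∃ n, f^[n] g₁ = s := fun s hs => by
      obtain ⟨q, -, h1⟩ := hret' s hs
      exact hf.exists_iterate_eq (j := 0) hp hg h1
    have hS : Finite S := by
      refine finite_univ_iff.1 (((hfin hp hg).insert g₀).subset fun s _ => ?_)
      by_cases hs : s = g₀
      exacts [Or.inl hs, Or.inr (hall s hs)]
    refine ⟨hS, Equiv.ofBijective f (Finite.injective_iff_bijective.1 hf), rfl, Or.inr ⟨h0, ?_, ?_⟩⟩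
    · refine ⟨fun s hs h => hs (hf (Eq.trans h h0.symm)), fun x _ y _ h => hf h, fun s hs => ?_⟩
      obtain ⟨r, rfl⟩ := (Finite.injective_iff_bijective.1 hf).2 s
      exact ⟨r, fun hr => hs ((congrArg f hr).trans h0), rfl⟩
    · intro x hx y hy
      obtain ⟨m, hm⟩ := hall x hx
      obtain ⟨n, hn⟩ := hall y hy
      exact Equiv.Perm.sameCycle_of_iterate hm hn
  · have hg : ∃ p, 0 < p ∧ f^[p] g₀ = g₀ := by
      obtain ⟨q, hq, h1 | h1⟩ := hret g₁
      · exact ⟨q + 1, q.succ_pos, by rw [Function.iterate_succ_apply, h0, h1]⟩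
      · refine ⟨q, hq, hf ?_⟩
        rw [← Function.iterate_succ_apply' f, Function.iterate_succ_apply, h0, h1]
    obtain ⟨p, hp, hg⟩ := hg
    have hall : ∀ s, ∃ n, f^[n] g₀ = s := fun s => by
      obtain ⟨q, -, h1 | h1⟩ := hret s
      · exact hf.exists_iterate_eq (j := 0) hp hg h1
      · exact hf.exists_iterate_eq (j := 1) hp hg (h1.trans h0.symm)
    have hS : Finite S := finite_univ_iff.1 ((hfin hp hg).subset fun s _ => hall s)
    refine ⟨hS, Equiv.ofBijective f (Finite.injective_iff_bijective.1 hf), rfl, Or.inl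
      ⟨(Equiv.bijective _).bijOn_univ, ?_⟩⟩
    intro x _ y _
    obtain ⟨m, hm⟩ := hall x
    obtain ⟨n, hn⟩ := hall y
    exact Equiv.Perm.sameCycle_of_iterate hm hn

namespace Itinerary

variable {A : Type*} {ν : Itinerary A}

/-! ### Sides of the points of a periodic orbit -/

/-- If no point on the orbit of `x` separates `⋆ν` from `ν`, then all points are on one side. -/
theorem merge_of_forall_merge {x : Itinerary A} (h : ∀ r, ν.Merge (drop r x) ν.star ν) (s : ℕ)
    {a : Itinerary A} (ha : a ≠ drop s x) : ν.Merge (drop s x) a ν := by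
  have key : ∀ j, ν.Merge (drop (s + j) x) (track ν (drop s x) j ν) ν := by
    intro j
    induction j with
    | zero => exact Merge.refl _ _
    | succ j ih =>
      have h1 := (merge_track_iff (ν := ν) 1).2 ih
      have h2 := (merge_track_iff (ν := ν) 1).2 (h (s + j))
      rw [drop_drop] at h1 h2
      rw [track_one_star] at h2
      have h3 : track ν (drop (s + j) x) 1 (track ν (drop s x) j ν) = track ν (drop s x) (j + 1) ν := by
        rw [track_add, drop_drop]
      rw [h3] at h1
      exact h1.trans h2.symm
  obtain ⟨n, hn⟩ := exists_track_ne (ν := ν) ha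
  have h1 : track ν (drop s x) (n + 1) a = ν := step_of_ne hn
  rw [← merge_track_iff (n + 1), h1, drop_drop]
  exact (key (n + 1)).symm

/-- Points that separate ⋆ν from ν are linearly ordered by betweenness (`eq_or_merge_of_drop_eq`),
so among finitely many of them one is nearest to ν. -/
theorem exists_nearest_critical {x : Itinerary A} (n : ℕ) : (∀ r < n, ν.Merge (drop r x) ν.star ν) ∨
    ∃ r₀, ¬ ν.Merge (drop r₀ x) ν.star ν ∧ ∀ r < n, ¬ ν.Merge (drop r x) ν.star ν →
      drop r x = drop r₀ x ∨ ν.Merge (drop r x) (drop r₀ x) ν := by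
  induction n with
  | zero => exact Or.inl fun r hr => absurd hr (Nat.not_lt_zero r)
  | succ n ih =>
    by_cases hn : ν.Merge (drop n x) ν.star ν
    · rcases ih with h | ⟨r₀, h1, h2⟩
      · left
        intro r hr
        rcases Nat.lt_succ_iff_lt_or_eq.1 hr with hr | rfl
        exacts [h r hr, hn]
      · refine Or.inr ⟨r₀, h1, fun r hr => ?_⟩
        rcases Nat.lt_succ_iff_lt_or_eq.1 hr with hr | rfl
        exacts [h2 r hr, fun h => absurd hn h]
    · right
      rcases ih with h | ⟨r₀, h1, h2⟩
      · refine ⟨n, hn, fun r hr hr' => ?_⟩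
        rcases Nat.lt_succ_iff_lt_or_eq.1 hr with hr | rfl
        exacts [absurd (h r hr) hr', Or.inl rfl]
      · by_cases hc : drop n x = drop r₀ x ∨ ν.Merge (drop n x) (drop r₀ x) ν
        · refine ⟨r₀, h1, fun r hr hr' => ?_⟩
          rcases Nat.lt_succ_iff_lt_or_eq.1 hr with hr | rfl
          exacts [h2 r hr hr', hc]
        · rw [not_or] at hc
          have hu : ν.Merge (drop r₀ x) ν (drop n x) :=
            (eq_or_merge_of_drop_eq hc.1 ν).resolve_left fun h => hc.2 h.symm
          refine ⟨n, hn, fun r hr hr' => ?_⟩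
          rcases Nat.lt_succ_iff_lt_or_eq.1 hr with hr | rfl
          swap
          · exact Or.inl rfl
          rcases h2 r hr hr' with h3 | h3
          · rw [h3]; exact Or.inr hu.symm
          · by_cases hwv : drop r x = drop n x
            · exact Or.inl hwv
            by_cases hwu : drop r x = drop r₀ x
            · rw [hwu]; exact Or.inr hu.symm
            right
            by_contra hcon
            have h4 : ν.Merge (drop n x) ν (drop r x) :=
              (eq_or_merge_of_drop_eq (Ne.symm hwv) ν).resolve_right fun h => hcon h.symm
            have h6 : ν.Merge (drop r₀ x) ν.star (drop r x) :=
              (eq_or_merge_of_drop_eq hwu ν.star).resolve_left fun h => hr' (h.trans h3)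
            rcases eq_or_merge_of_drop_eq hc.1 (drop r x) with h7 | h7
            · exact hc.2 (h7.symm.trans h4.symm)
            · exact h1 ((h6.trans h7).trans hu.symm)

variable {y : Itinerary A}

/-- At the `t`-th point of the orbit of `y`, the sequence is on the side of the critical value or
of another point of the orbit. -/
def TowardsOrbit (ν y : Itinerary A) (t : ℕ) (c : Itinerary A) : Prop :=
  ν.Merge (drop t y) c ν ∨ ∃ i, drop i y ≠ drop t y ∧ ν.Merge (drop t y) c (drop i y)

/-- A germ towards another orbit point goes to the germ towards its image if the first symbols
agree, and towards ν if not. A germ towards ν goes to one towards ν if ⋆ν is on the same side.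
Otherwise its base point separates ⋆ν from ν; then `y` is on the side of ν and can be used as the
orbit point. -/
theorem TowardsOrbit.step
    (hnear : ∀ r, ¬ ν.Merge (drop r y) ν.star ν → drop r y = y ∨ ν.Merge (drop r y) y ν)
    {t : ℕ} {c : Itinerary A} (h : TowardsOrbit ν y t c) (ht : drop t y ≠ y) :
    TowardsOrbit ν y (t + 1) (track ν (drop t y) 1 c) := by
  have h2 : ∀ i, drop i y ≠ drop t y → ν.Merge (drop t y) c (drop i y) →
      TowardsOrbit ν y (t + 1) (track ν (drop t y) 1 c) := by
    intro i hi hm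
    have h1 := (merge_track_iff (ν := ν) 1).2 hm
    rw [drop_drop] at h1
    by_cases h0 : drop i y 0 = drop t y 0
    · have h3 : track ν (drop t y) 1 (drop i y) = drop (i + 1) y :=
        (step_of_eq h0).trans (shift_drop i y)
      rw [h3] at h1
      refine Or.inr ⟨i + 1, fun h4 => hi (funext fun k => ?_), h1⟩
      rcases k with _ | k
      · exact h0
      · have := congrFun h4 k
        simp only [drop_apply] at this ⊢
        rwa [show k + 1 + i = k + (i + 1) by omega, show k + 1 + t = k + (t + 1) by omega]
    · have h3 : track ν (drop t y) 1 (drop i y) = ν := step_of_ne h0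
      rw [h3] at h1
      exact Or.inl h1
  rcases h with h | ⟨i, hi, hm⟩
  · by_cases hs : ν.Merge (drop t y) ν.star ν
    · have h1 := (merge_track_iff (ν := ν) 1).2 (h.trans hs.symm)
      rw [drop_drop, track_one_star] at h1
      exact Or.inl h1
    · exact h2 0 (Ne.symm ht) (h.trans ((hnear t hs).resolve_left ht).symm)
  · exact h2 i hi hm

/-- The invariant is kept until the next visit to `y`, less than `m` steps away. There all other
orbit points are on the side of ⋆ν, by `merge_star_of_nearest`. -/
theorem TowardsOrbit.merge
    (hnear : ∀ r, ¬ ν.Merge (drop r y) ν.star ν → drop r y = y ∨ ν.Merge (drop r y) y ν)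
    {m t : ℕ} (hm : 0 < m) (hy : ∀ r, drop r y = y ↔ m ∣ r) {c : Itinerary A}
    (h : TowardsOrbit ν y t c) : ∃ n < m, m ∣ t + n ∧
      (ν.Merge y (track ν (drop t y) n c) ν.star ∨ ν.Merge y (track ν (drop t y) n c) ν) := by
  classical
  -- Any `n` completing `t` to a multiple of `m` will do as a witness; the least one is used below.
  have hex : ∃ n, m ∣ t + n := ⟨(m - 1) * t, by
    rw [← one_add_mul, show 1 + (m - 1) = m by omega]; exact dvd_mul_right m t⟩
  have hlt : Nat.find hex < m := by
    by_contra hge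
    refine Nat.find_min hex (m := Nat.find hex - m) (by omega) ?_
    have := Nat.find_spec hex
    rw [← Nat.add_sub_assoc (by omega)]
    exact Nat.dvd_sub this (dvd_refl m)
  have key : ∀ n ≤ Nat.find hex, TowardsOrbit ν y (t + n) (track ν (drop t y) n c) := by
    intro n
    induction n with
    | zero => exact fun _ => h
    | succ n ih =>
      intro hn
      have := (ih (by omega)).step hnear fun h => Nat.find_min hex (m := n) hn ((hy _).1 h)
      rwa [← drop_drop, ← track_add] at this
  refine ⟨Nat.find hex, hlt, Nat.find_spec hex, ?_⟩
  have h1 := (hy _).2 (Nat.find_spec hex)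
  rcases key _ le_rfl with h2 | ⟨i, hi, h2⟩
  · rw [h1] at h2
    exact Or.inr h2
  · rw [h1] at hi h2
    exact Or.inl (h2.trans ((merge_star_of_nearest hnear i).resolve_left hi))

/-- The first step takes ⋆ν to ν, and the remaining `m - 1` steps lead to the very next visit to
`y`. -/
theorem merge_track_star_of_nearest
    (hnear : ∀ r, ¬ ν.Merge (drop r y) ν.star ν → drop r y = y ∨ ν.Merge (drop r y) y ν)
    {m : ℕ} (hm : 0 < m) (hy : ∀ r, drop r y = y ↔ m ∣ r) :
    ν.Merge y (track ν y m ν.star) ν.star ∨ ν.Merge y (track ν y m ν.star) ν := by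
  obtain ⟨n, hn, hd, h⟩ := TowardsOrbit.merge hnear hm hy
    (Or.inl (Merge.refl _ _) : TowardsOrbit ν y 1 ν)
  obtain rfl : m = 1 + n := Nat.le_antisymm (Nat.le_of_dvd (by omega) hd) (by omega)
  rwa [track_add, track_one_star]

/-- Every track of a sequence other than `y` leaves `y` at some time, and then it is at ν. -/
theorem exists_merge_track_of_nearest
    (hnear : ∀ r, ¬ ν.Merge (drop r y) ν.star ν → drop r y = y ∨ ν.Merge (drop r y) y ν)
    {m : ℕ} (hm : 0 < m) (hy : ∀ r, drop r y = y ↔ m ∣ r) {a : Itinerary A} (ha : a ≠ y) :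
    ∃ q, 0 < q ∧
      (ν.Merge y (track ν y (m * q) a) ν.star ∨ ν.Merge y (track ν y (m * q) a) ν) := by
  obtain ⟨k, hk⟩ := exists_track_ne (ν := ν) ha
  have h1 : track ν y (k + 1) a = ν := step_of_ne hk
  obtain ⟨n, -, ⟨q, hq⟩, h⟩ := TowardsOrbit.merge hnear hm hy
    (Or.inl (Merge.refl _ _) : TowardsOrbit ν y (k + 1) ν)
  refine ⟨q, Nat.pos_of_ne_zero ?_, ?_⟩
  · rintro rfl
    omega
  · rwa [← hq, track_add, h1]

end Itinerary

theorem Equiv.permCongr_zpow_apply {S T : Type*} (e : S ≃ T) (ρ : Equiv.Perm S) (n : ℤ) (s : S) :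
    (e.permCongr ρ ^ n) (e s) = e ((ρ ^ n) s) := by
  have h : e.permCongr (ρ ^ n) = e.permCongr ρ ^ n := map_zpow e.permCongrHom ρ n
  rw [← h, Equiv.permCongr_apply, Equiv.symm_apply_apply]

theorem Equiv.Perm.SameCycle.permCongr {S T : Type*} (e : S ≃ T) {ρ : Equiv.Perm S} {s t : S} :
    (e.permCongr ρ).SameCycle (e s) (e t) ↔ ρ.SameCycle s t :=
  exists_congr fun n => by rw [Equiv.permCongr_zpow_apply, e.apply_eq_iff_eq]

namespace HubbardTree

open Itinerary

variable {A : Type*} {ν : Itinerary A} {h : FatouMaps A}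

/-! ### Periodic orbits and their types -/

theorem mem_orbit_self (τ : HubbardTree ν h) : τ ∈ orbit τ := ⟨0, rfl⟩

theorem orbit_iterate_eq {τ : HubbardTree ν h} (hτ : τ ∈ Function.periodicPts (σ (ν := ν) (h := h)))
    (n : ℕ) : orbit (σ^[n] τ) = orbit τ := by
  obtain ⟨p, hp, hτ⟩ := hτ
  ext z
  constructor
  · rintro ⟨k, rfl⟩
    exact ⟨k + n, Function.iterate_add_apply _ _ _ _⟩
  · rintro ⟨k, rfl⟩
    refine ⟨n * p - n + k, ?_⟩
    rw [← Function.iterate_add_apply, show n * p - n + k + n = k + n * p by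
      have := Nat.le_mul_of_pos_right n hp
      omega, Function.iterate_add_apply, (Function.IsPeriodicPt.const_mul hτ n).eq]

theorem hasType_of_orbit_eq {τ τ' : HubbardTree ν h} (h1 : orbit τ = orbit τ') {t : OrbitType}
    (h2 : HasType τ t) : HasType τ' t := by
  cases t
  all_goals
    simp only [HasType] at h2 ⊢
    rwa [← h1]

theorem IsReturnPerm.eq {τ : HubbardTree ν h} {ρ ρ' : Equiv.Perm (arms τ)}
    (h1 : IsReturnPerm τ ρ) (h2 : IsReturnPerm τ ρ') : ρ = ρ' :=
  Equiv.ext fun G => Subtype.ext (((h2 G _).1 ((h1 G _).2 rfl)).symm)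

theorem IsEndpoint.ncard_arms_le {τ : HubbardTree ν h} (h1 : IsEndpoint τ) :
    (arms τ).ncard ≤ 1 := by
  have h2 : arms τ ⊆ {({τ}ᶜ : Set (HubbardTree ν h))} := by
    rintro _ ⟨y, hy, rfl⟩
    exact h1.isPreconnected.connectedComponentIn hy
  exact (ncard_le_ncard h2).trans (ncard_singleton _).le

theorem not_isCycleOn_one {S : Type*} {s : Set S} (hs : 1 < s.ncard) :
    ¬ (1 : Equiv.Perm s).IsCycleOn univ := by
  intro h1
  obtain ⟨a, ha, b, hb, hab⟩ := (one_lt_ncard (finite_of_ncard_pos (by omega))).1 hs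
  obtain ⟨n, hn⟩ := h1.2 (mem_univ ⟨a, ha⟩) (mem_univ ⟨b, hb⟩)
  rw [one_zpow] at hn
  exact hab (congrArg Subtype.val hn)

/-- An orbit has at most one type. -/
theorem HasType.eq {τ : HubbardTree ν h} {t t' : OrbitType} (h1 : HasType τ t)
    (h2 : HasType τ t') : t = t' := by
  have hτ := mem_orbit_self τ
  have h12 : ¬ (HasType τ .endpoints ∧ HasType τ .primitive) := fun ⟨h1, h2⟩ => by
    have := (h1 τ hτ).ncard_arms_le
    have := (h2 τ hτ).1
    omega
  have h13 : ¬ (HasType τ .endpoints ∧ HasType τ .satellite) := fun ⟨h1, k, hk, h2⟩ => by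
    have := (h1 τ hτ).ncard_arms_le
    have := (h2 τ hτ).1
    omega
  have h14 : ¬ (HasType τ .endpoints ∧ HasType τ .evil) := fun ⟨h1, ⟨k, hk, h2⟩, _⟩ => by
    have := (h1 τ hτ).ncard_arms_le
    have := (h2 τ hτ).1
    omega
  have h23 : ¬ (HasType τ .primitive ∧ HasType τ .satellite) := fun ⟨h1, k, hk, h2⟩ => by
    obtain ⟨h3, ρ, h4, h5⟩ := h2 τ hτ
    obtain rfl := h4.eq (h1 τ hτ).2
    exact not_isCycleOn_one (by omega) h5
  have h24 : ¬ (HasType τ .primitive ∧ HasType τ .evil) := fun ⟨h1, ⟨k, hk, h2⟩, _⟩ => by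
    have := (h1 τ hτ).1
    have := (h2 τ hτ).1
    omega
  have h34 : ¬ (HasType τ .satellite ∧ HasType τ .evil) := fun ⟨⟨l, hl, h1⟩, ⟨k, hk, h2⟩, _⟩ => by
    obtain ⟨-, ρ, h3, h4⟩ := h1 τ hτ
    obtain ⟨-, ρ', h5, h6⟩ := h2 τ hτ
    obtain rfl := h5.eq h3
    exact h6 fun G G' => h4.2 (mem_univ G) (mem_univ G')
  cases t <;> cases t' <;> first | rfl | (exfalso; tauto)

variable [hK : Fact ν.IsKneading]

/-! ### Transport along the orbit of a point without `⋆` -/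

/-- An arm has many labels, but they form one class of `Merge`; `merge_track_iff` gives both
independence of the label and injectivity. -/
theorem exists_armMap {x : Itinerary A} (hx : x.StarFree) {τ τ' : HubbardTree ν h}
    (hτ : τ.1 = .itinerary x) {n : ℕ} (hτ' : τ'.1 = .itinerary (drop n x)) :
    ∃ f : arms τ → arms τ', f.Injective ∧ ∀ (G : arms τ) a, IsLabel h ν x a →
      (G : Set _) = side h ν x a → (f G : Set _) = side h ν (drop n x) (track ν x n a) := by
  have hx' : ν.Proper x := by have := τ.proper_rep; rwa [hτ] at this
  have h1 : ∀ G : arms τ, ∃ a, IsLabel h ν x a ∧ (G : Set _) = side h ν x a := fun G =>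
    (mem_arms_iff hx hτ).1 G.2
  choose a ha hG using h1
  refine ⟨fun G => ⟨side h ν (drop n x) (track ν x n (a G)), (mem_arms_iff (hx.drop n) hτ').2
    ⟨_, (ha G).track hx hx' n, rfl⟩⟩, fun G G' hGG => Subtype.ext ?_, fun G b hb hGb => ?_⟩
  · have h2 := congrArg Subtype.val hGG
    simp only at h2
    rw [side_eq_side ((ha G).track hx hx' n), merge_track_iff] at h2
    rw [hG G, hG G', side_eq_side (ha G)]
    exact h2
  · rw [hG G, side_eq_side (ha G)] at hGb
    simp only
    rw [side_eq_side ((ha G).track hx hx' n), merge_track_iff]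
    exact hGb

theorem drop_minimalPeriod {x : Itinerary A} {τ : HubbardTree ν h} (hτ : τ.1 = .itinerary x)
    (r : ℕ) : drop r x = x ↔ Function.minimalPeriod σ τ ∣ r := by
  rw [← Function.isPeriodicPt_iff_minimalPeriod_dvd]
  have h1 : (σ^[r] τ).1 = .itinerary (drop r x) := by
    rw [iterate_σ_val, hτ, TreePoint.iterate_map_itinerary]
  constructor
  · intro h2
    exact Subtype.ext (by rw [h1, h2, hτ])
  · intro h2
    have h3 := congrArg Subtype.val h2.eq
    rw [h1, hτ] at h3
    exact TreePoint.itinerary.inj h3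

/-- The arm map `φ` along `n` steps is followed by the arm map `ψ` along `n * m - n` steps back to
`τ`, and together they make `n` returns: `ψ ∘ φ` is `ρ^[n]`. As both maps are injective, `φ` is
bijective, and it commutes with going once around the orbit. -/
theorem exists_returnPerm_iterate {x : Itinerary A} (hx : x.StarFree) {τ : HubbardTree ν h}
    (hτ : τ.1 = .itinerary x) (hper : τ ∈ Function.periodicPts (σ (ν := ν) (h := h)))
    {ρ : Equiv.Perm (arms τ)} (hρ : IsReturnPerm τ ρ) (n : ℕ) :
    ∃ e : arms τ ≃ arms (σ^[n] τ), IsReturnPerm (σ^[n] τ) (e.permCongr ρ) := by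
  have hx' : ν.Proper x := by have := τ.proper_rep; rwa [hτ] at this
  set m := Function.minimalPeriod σ τ with hm
  have hm0 : 0 < m := Function.minimalPeriod_pos_of_mem_periodicPts hper
  have hdrop : ∀ r, drop r x = x ↔ m ∣ r := drop_minimalPeriod hτ
  have hτn : (σ^[n] τ).1 = .itinerary (drop n x) := by
    rw [iterate_σ_val, hτ, TreePoint.iterate_map_itinerary]
  have hle : n ≤ n * m := Nat.le_mul_of_pos_right n hm0
  have hback : drop (n * m - n) (drop n x) = x := by
    rw [drop_drop, Nat.add_sub_cancel' hle, hdrop]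
    exact dvd_mul_left m n
  obtain ⟨φ, hφ, hφ'⟩ := exists_armMap hx hτ hτn
  obtain ⟨ψ, hψ, hψ'⟩ := exists_armMap (hx.drop n) (τ' := τ) hτn (n := n * m - n)
    (by rw [hτ, hback])
  have hρ' : ∀ (G : arms τ) a, IsLabel h ν x a → (G : Set _) = side h ν x a →
      (ρ G : Set _) = side h ν x (track ν x m a) := fun G a ha hG => by
    have h1 := (returnsArm_iff hx hτ ha).1 (hG ▸ (hρ G _).2 rfl)
    rwa [← hm, (hdrop m).2 dvd_rfl] at h1
  have hρn : ∀ (k : ℕ) (G : arms τ) a, IsLabel h ν x a → (G : Set _) = side h ν x a →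
      (ρ^[k] G : Set _) = side h ν x (track ν x (k * m) a) := by
    intro k
    induction k with
    | zero => intro G a _ hG; simpa using hG
    | succ k ih =>
      intro G a ha hG
      have h1 := ha.track hx hx' (k * m)
      rw [(hdrop _).2 (dvd_mul_left m k)] at h1
      rw [Function.iterate_succ_apply', hρ' _ _ h1 (ih G a ha hG), Nat.succ_mul, track_add,
        (hdrop _).2 (dvd_mul_left m k)]
  have hψφ : ∀ G, ψ (φ G) = ρ^[n] G := fun G => by
    obtain ⟨a, ha, hG⟩ := (mem_arms_iff hx hτ).1 G.2
    apply Subtype.ext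
    rw [hψ' _ _ (ha.track hx hx' n) (hφ' _ _ ha hG), hρn n G a ha hG, hback, ← track_add,
      Nat.add_sub_cancel' hle]
  have hψs : ψ.Surjective := fun G => by
    obtain ⟨G', rfl⟩ := ρ.surjective.iterate n G
    exact ⟨φ G', hψφ G'⟩
  have hφs : φ.Surjective := fun G => by
    obtain ⟨G', hG'⟩ := ρ.surjective.iterate n (ψ G)
    exact ⟨G', hψ ((hψφ G').trans hG')⟩
  refine ⟨Equiv.ofBijective φ ⟨hφ, hφs⟩, fun H H' => ?_⟩
  obtain ⟨G, rfl⟩ := hφs H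
  obtain ⟨a, ha, hG⟩ := (mem_arms_iff hx hτ).1 G.2
  have h1 : Function.minimalPeriod σ (σ^[n] τ) = m := Function.minimalPeriod_apply_iterate hper n
  have h2 : drop m x = x := (hdrop m).2 dvd_rfl
  have h3 := ha.track hx hx' m
  rw [h2] at h3
  have h4 : (Equiv.ofBijective φ ⟨hφ, hφs⟩).permCongr ρ (φ G) = φ (ρ G) := by
    have := Equiv.permCongr_zpow_apply (Equiv.ofBijective φ ⟨hφ, hφs⟩) ρ 1 G
    rw [zpow_one, zpow_one] at this
    exact this
  rw [h4, hφ' _ _ h3 (hρ' G a ha hG), hφ' _ _ ha hG,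
    returnsArm_iff (hx.drop n) hτn (ha.track hx hx' n), h1, drop_drop, ← track_add,
    add_comm n m, ← drop_drop, track_add, h2]
  exact eq_comm

end HubbardTree

namespace HubbardTree

open Itinerary

variable {A : Type*} {ν : Itinerary A} {h : FatouMaps A} [hK : Fact ν.IsKneading]

/-! ### Periodic points without `⋆` -/

theorem hasType_endpoints {x : Itinerary A} (hx : x.StarFree) {τ : HubbardTree ν h}
    (hτ : τ.1 = .itinerary x) (hcrit : criticalPoint ν h ∉ orbit τ)
    (hm : ∀ r, ν.Merge (drop r x) ν.star ν) : HasType τ .endpoints := by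
  rintro _ ⟨n, rfl⟩
  have hτn : (σ^[n] τ).1 = .itinerary (drop n x) := by
    rw [iterate_σ_val, hτ, TreePoint.iterate_map_itinerary]
  have h1 : ({σ^[n] τ}ᶜ : Set (HubbardTree ν h)) = side h ν (drop n x) ν := by
    rw [compl_eq_sides (hx.drop n) hτn]
    ext z
    exact ⟨fun hz => ⟨hz, merge_of_forall_merge hm n hz⟩, fun hz => hz.1⟩
  refine ⟨⟨criticalPoint ν h, fun h2 => hcrit ⟨n, h2.symm⟩⟩, ?_⟩
  rw [h1]
  exact isPreconnected_side (hx.drop n) hτn ν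

theorem criticalPoint_mem_side {x a : Itinerary A} (hx : x.StarFree) :
    criticalPoint ν h ∈ side h ν x a ↔ ν.Merge x ν.star a :=
  ⟨fun h1 => h1.2, fun h1 => ⟨(isLabel_star (h := h) hx).1, h1⟩⟩

theorem ne_of_periodic {x : Itinerary A} (hx : x.StarFree) {m : ℕ} (hm : 0 < m)
    (hxm : drop m x = x) : ν ≠ x := by
  rintro rfl
  rcases hK.out with h1 | ⟨p, -, hp⟩
  · exact h1.drop_ne hm hxm
  · exact hp.not_starFree hx

/-- Two characteristic points on the same orbit coincide. -/
theorem IsCharacteristic.eq {x y : Itinerary A} (hx : x.StarFree) (hy : y.StarFree)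
    (hνx : ν ≠ x) (hνy : ν ≠ y) {τ τ' : HubbardTree ν h} (hτ : τ.1 = .itinerary x)
    (hτ' : τ'.1 = .itinerary y) (h1 : IsCharacteristic τ) (h2 : IsCharacteristic τ')
    (h3 : τ' ∈ orbit τ) (h4 : τ ∈ orbit τ') : τ' = τ := by
  have key : ∀ {x y : Itinerary A}, x.StarFree → ν ≠ x → ∀ {τ τ' : HubbardTree ν h},
      τ.1 = .itinerary x → τ'.1 = .itinerary y → IsCharacteristic τ → τ' ∈ orbit τ → τ' ≠ τ →
      ¬ ν.Merge x ν y := by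
    intro x y hx hνx τ τ' hτ hτ' ⟨G, hG, h1, h2, h3⟩ h4 h5 h6
    obtain ⟨a, ha, rfl⟩ := (mem_arms_iff hx hτ).1 hG
    have h7 := h2 τ' h4 h5
    have h8 : τ'.1.rep = y := by rw [hτ']; rfl
    exact h3 ⟨hνx, h6.trans (h8 ▸ h7.2)⟩
  by_contra hne
  have hxy : x ≠ y := fun h => hne (Subtype.ext (by rw [hτ, hτ', h]))
  -- At one of the two points ν is on the side of the other point. A characteristic point, however,
  -- has the rest of its orbit on a side without ν.
  rcases eq_or_merge_of_drop_eq (ν := ν) hxy ν with h5 | h5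
  · exact key hx hνx hτ hτ' h1 h3 hne h5
  · exact key hy hνy hτ' hτ h2 h4 (Ne.symm hne) h5

section Nearest

variable {x : Itinerary A} {τ : HubbardTree ν h}

theorem isCharacteristic_of_nearest (hx : x.StarFree) (hτ : τ.1 = .itinerary x)
    (hb : ¬ ν.Merge x ν.star ν)
    (hnear : ∀ r, ¬ ν.Merge (drop r x) ν.star ν → drop r x = x ∨ ν.Merge (drop r x) x ν) :
    IsCharacteristic τ := by
  refine ⟨side h ν x ν.star, (mem_arms_iff hx hτ).2 ⟨_, isLabel_star hx, rfl⟩,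
    (criticalPoint_mem_side hx).2 (Merge.refl _ _), ?_, fun h1 => hb h1.2.symm⟩
  rintro _ ⟨n, rfl⟩ hne
  have h1 : (σ^[n] τ).1.rep = drop n x := by rw [rep_iterate_σ, hτ]; rfl
  have h2 : drop n x ≠ x := fun h2 => hne (Subtype.ext (by
    rw [iterate_σ_val, hτ, TreePoint.iterate_map_itinerary, h2]))
  refine ⟨h1 ▸ h2, ?_⟩
  rw [h1]
  exact (merge_star_of_nearest hnear n).resolve_left h2

/-- The pair in `Function.Injective.exists_perm_of_pair` consists of the arms towards ⋆ν and ν,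
which differ because `x` separates them. -/
theorem exists_returnPerm_of_nearest (hx : x.StarFree) (hτ : τ.1 = .itinerary x)
    (hper : τ ∈ Function.periodicPts (σ (ν := ν) (h := h))) (hb : ¬ ν.Merge x ν.star ν)
    (hnear : ∀ r, ¬ ν.Merge (drop r x) ν.star ν → drop r x = x ∨ ν.Merge (drop r x) x ν) :
    (arms τ).Finite ∧ 2 ≤ (arms τ).ncard ∧ ∃ ρ : Equiv.Perm (arms τ), IsReturnPerm τ ρ ∧
      (ρ.IsCycleOn univ ∨ (∀ G : arms τ, criticalPoint ν h ∈ (G : Set _) → ρ G = G) ∧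
        ρ.IsCycleOn {G : arms τ | criticalPoint ν h ∉ (G : Set _)}) := by
  have hx' : ν.Proper x := by have := τ.proper_rep; rwa [hτ] at this
  set m := Function.minimalPeriod σ τ with hm
  have hm0 : 0 < m := Function.minimalPeriod_pos_of_mem_periodicPts hper
  have hdrop : ∀ r, drop r x = x ↔ m ∣ r := drop_minimalPeriod hτ
  have hxm : drop m x = x := (hdrop m).2 dvd_rfl
  have hl0 : IsLabel h ν x ν.star := isLabel_star hx
  have hl1 : IsLabel h ν x ν := ⟨ne_of_periodic hx hm0 hxm, criticalValue ν h, rfl⟩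
  obtain ⟨f, hf, hf'⟩ := exists_armMap hx hτ (τ' := τ) (n := m) (by rw [hxm, hτ])
  rw [hxm] at hf'
  have hlab : ∀ {a}, IsLabel h ν x a → ∀ k, IsLabel h ν x (track ν x (m * k) a) :=
    fun ha k => by
      have := ha.track hx hx' (m * k)
      rwa [(hdrop _).2 (dvd_mul_right m k)] at this
  have hfn : ∀ (k : ℕ) (G : arms τ) a, IsLabel h ν x a → (G : Set _) = side h ν x a →
      (f^[k] G : Set _) = side h ν x (track ν x (m * k) a) := by
    intro k
    induction k with
    | zero => intro G a _ hG; simpa using hG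
    | succ k ih =>
      intro G a ha hG
      rw [Function.iterate_succ_apply', hf' _ _ (hlab ha k) (ih G a ha hG), Nat.mul_succ,
        track_add, (hdrop _).2 (dvd_mul_right m k)]
  let g₀ : arms τ := ⟨side h ν x ν.star, (mem_arms_iff hx hτ).2 ⟨_, hl0, rfl⟩⟩
  let g₁ : arms τ := ⟨side h ν x ν, (mem_arms_iff hx hτ).2 ⟨_, hl1, rfl⟩⟩
  have hne : g₀ ≠ g₁ := fun h1 => hb ((side_eq_side hl0).1 (congrArg Subtype.val h1))
  have hcrit : ∀ G : arms τ, criticalPoint ν h ∈ (G : Set _) ↔ G = g₀ := fun G => by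
    obtain ⟨a, ha, hG⟩ := (mem_arms_iff hx hτ).1 G.2
    rw [hG, criticalPoint_mem_side hx, Subtype.ext_iff, hG, eq_comm, side_eq_side hl0]
  obtain ⟨hfin, ρ, hρ, hcyc⟩ := hf.exists_perm_of_pair hne (fun G => by
    obtain ⟨a, ha, hG⟩ := (mem_arms_iff hx hτ).1 G.2
    obtain ⟨q, hq, h1⟩ := exists_merge_track_of_nearest hnear hm0 hdrop ha.1
    refine ⟨q, hq, h1.imp (fun h1 => Subtype.ext ?_) fun h1 => Subtype.ext ?_⟩
    all_goals exact (hfn q G a ha hG).trans ((side_eq_side (hlab ha q)).2 h1)) (by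
    have h3 := hlab hl0 1
    rw [mul_one] at h3
    refine (merge_track_star_of_nearest hnear hm0 hdrop).imp
      (fun h1 => Subtype.ext ?_) fun h1 => Subtype.ext ?_
    all_goals exact (hf' g₀ _ hl0 rfl).trans ((side_eq_side h3).2 h1))
  refine ⟨toFinite _, (one_lt_ncard (toFinite _)).2 ⟨g₀, g₀.2, g₁, g₁.2, fun h1 =>
    hne (Subtype.ext h1)⟩, ρ, fun G G' => ?_, hcyc.imp_right fun ⟨h1, h2⟩ => ⟨fun G hG => ?_, ?_⟩⟩
  · obtain ⟨a, ha, hG⟩ := (mem_arms_iff hx hτ).1 G.2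
    rw [hρ, hf' G a ha hG, hG, returnsArm_iff hx hτ ha, ← hm, hxm]
    exact eq_comm
  · rw [(hcrit G).1 hG, h1]
  · convert h2 using 1
    ext G
    exact (hcrit G).not

theorem exists_hasType_of_nearest (hx : x.StarFree) (hτ : τ.1 = .itinerary x)
    (hper : τ ∈ Function.periodicPts (σ (ν := ν) (h := h))) (hb : ¬ ν.Merge x ν.star ν)
    (hnear : ∀ r, ¬ ν.Merge (drop r x) ν.star ν → drop r x = x ∨ ν.Merge (drop r x) x ν) :
    ∃ t, HasType τ t := by
  obtain ⟨hfin, h2, ρ, hρ, hcyc⟩ := exists_returnPerm_of_nearest hx hτ hper hb hnear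
  have htrans := exists_returnPerm_iterate hx hτ hper hρ
  have hcard : ∀ z ∈ orbit τ, (arms z).ncard = (arms τ).ncard := by
    rintro _ ⟨n, rfl⟩
    obtain ⟨e, -⟩ := htrans n
    exact (Nat.card_congr e).symm
  rcases hcyc with hcyc | ⟨hfix, hcyc⟩
  · refine ⟨.satellite, _, h2, fun z hz => ⟨hcard z hz, ?_⟩⟩
    obtain ⟨n, rfl⟩ := hz
    obtain ⟨e, he⟩ := htrans n
    refine ⟨_, he, (Equiv.bijective _).bijOn_univ, fun a _ b _ => ?_⟩
    rw [← e.apply_symm_apply a, ← e.apply_symm_apply b, Equiv.Perm.SameCycle.permCongr]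
    exact hcyc.2 (mem_univ _) (mem_univ _)
  have hl0 : IsLabel h ν x ν.star := isLabel_star hx
  set g₀ : arms τ := ⟨side h ν x ν.star, (mem_arms_iff hx hτ).2 ⟨_, hl0, rfl⟩⟩ with hg₀
  have hg0 : criticalPoint ν h ∈ (g₀ : Set _) := (criticalPoint_mem_side hx).2 (Merge.refl _ _)
  have hcrit : ∀ G : arms τ, criticalPoint ν h ∈ (G : Set _) → G = g₀ := fun G hG => by
    obtain ⟨a, ha, hG'⟩ := (mem_arms_iff hx hτ).1 G.2
    rw [hG', criticalPoint_mem_side hx] at hG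
    exact Subtype.ext (hG'.trans ((side_eq_side hl0).2 hG).symm)
  obtain ⟨a, ha, b, hb', hab⟩ := (one_lt_ncard hfin).1 h2
  obtain ⟨g₁, hg₁⟩ : ∃ g₁ : arms τ, g₁ ≠ g₀ := by
    by_contra! hcon
    exact hab (congrArg Subtype.val ((hcon ⟨a, ha⟩).trans (hcon ⟨b, hb'⟩).symm))
  have hg1 : criticalPoint ν h ∉ (g₁ : Set _) := fun h => hg₁ (hcrit _ h)
  rcases h2.eq_or_lt with h2 | h2
  -- With only two arms and one of them fixed, the other one is fixed as well.
  · have hρ1 : ρ = 1 := by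
      have htwo : ∀ G : arms τ, G = g₀ ∨ G = g₁ := fun G => by
        by_contra! hcon
        have h5 : 2 < (arms τ).ncard := (two_lt_ncard_iff hfin).2 ⟨G, g₀, g₁, G.2, g₀.2, g₁.2,
          fun h => hcon.1 (Subtype.ext h), fun h => hcon.2 (Subtype.ext h),
          fun h => hg₁ (Subtype.ext h.symm)⟩
        omega
      ext1 G
      rcases htwo G with h4 | h4
      · rw [h4]
        exact hfix _ hg0
      · rw [h4]
        rcases htwo (ρ g₁) with h5 | h5
        · exact absurd hg0 (h5 ▸ hcyc.1.mapsTo hg1)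
        · exact h5
    refine ⟨.primitive, fun z hz => ⟨(hcard z hz).trans h2.symm, ?_⟩⟩
    obtain ⟨n, rfl⟩ := hz
    obtain ⟨e, he⟩ := htrans n
    rw [hρ1] at he
    convert he
    ext1 G
    simp
  · refine ⟨.evil, ⟨_, h2, fun z hz => ⟨hcard z hz, ?_⟩⟩, τ, mem_orbit_self τ,
      isCharacteristic_of_nearest hx hτ hb hnear, ?_, ρ, hρ, hfix, hcyc⟩
    · obtain ⟨n, rfl⟩ := hz
      obtain ⟨e, he⟩ := htrans n
      refine ⟨_, he, fun hcon => ?_⟩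
      have h5 := Equiv.Perm.SameCycle.permCongr e |>.1 (hcon (e g₀) (e g₁))
      exact hg₁ (h5.eq_of_left (hfix _ hg0)).symm
    · rintro _ ⟨n, rfl⟩ hy
      have hm0 : 0 < Function.minimalPeriod σ τ :=
        Function.minimalPeriod_pos_of_mem_periodicPts hper
      have hxm : drop (Function.minimalPeriod σ τ) x = x := (drop_minimalPeriod hτ _).2 dvd_rfl
      refine IsCharacteristic.eq hx (hx.drop n) (ne_of_periodic hx hm0 hxm)
        (ne_of_periodic (hx.drop n) hm0 ?_) hτ ?_ (isCharacteristic_of_nearest hx hτ hb hnear) hy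
        ⟨n, rfl⟩ ?_
      · rw [drop_drop, add_comm, ← drop_drop, hxm]
      · rw [iterate_σ_val, hτ, TreePoint.iterate_map_itinerary]
      · rw [orbit_iterate_eq hper]
        exact mem_orbit_self τ

end Nearest

theorem exists_hasType_of_starFree {x : Itinerary A} (hx : x.StarFree) {τ : HubbardTree ν h}
    (hτ : τ.1 = .itinerary x) (hper : τ ∈ Function.periodicPts (σ (ν := ν) (h := h)))
    (hcrit : criticalPoint ν h ∉ orbit τ) : ∃ t, HasType τ t := by
  have hm0 : 0 < Function.minimalPeriod σ τ := Function.minimalPeriod_pos_of_mem_periodicPts hper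
  set m := Function.minimalPeriod σ τ
  have hdrop : ∀ r, drop r x = x ↔ m ∣ r := drop_minimalPeriod hτ
  have hmod : ∀ r, drop (r % m) x = drop r x := fun r => by
    conv_rhs => rw [← Nat.mod_add_div r m, add_comm, ← drop_drop, (hdrop _).2 (dvd_mul_right m _)]
  rcases exists_nearest_critical (ν := ν) (x := x) m with h1 | ⟨r₀, hb, hnear⟩
  · exact ⟨.endpoints, hasType_endpoints hx hτ hcrit fun r => hmod r ▸ h1 _ (Nat.mod_lt r hm0)⟩
  · have hτr : (σ^[r₀] τ).1 = .itinerary (drop r₀ x) := by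
      rw [iterate_σ_val, hτ, TreePoint.iterate_map_itinerary]
    obtain ⟨p, hp, hpτ⟩ := hper
    obtain ⟨t, ht⟩ := exists_hasType_of_nearest (hx.drop r₀) hτr
      ⟨p, hp, hpτ.apply_iterate r₀⟩ hb fun r hr => by
        rw [drop_drop, ← hmod (r₀ + r)] at hr ⊢
        exact hnear _ (Nat.mod_lt _ hm0) hr
    exact ⟨t, hasType_of_orbit_eq (orbit_iterate_eq ⟨p, hp, hpτ⟩ r₀) ht⟩

end HubbardTree

/-! ### Auxiliary facts for points inside Fatou intervals. -/

namespace CriticalPath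

open Itinerary

variable {A : Type*} {ν : Itinerary A} [hK : Fact ν.IsKneading]

/-- An entry has at most one Fatou interval on each side, because positions determine points.
Finiteness allows neighbourhoods chosen for each interval to be intersected. -/
theorem finite_setOf_fatou (x : Itinerary A) :
    {b | ∃ (z : CriticalPath ν) (t : Ioo (0 : ℝ) 1), z.1 = .fatou x b t}.Finite := by
  have hν := hK.out
  by_cases hu : ∃ u, ν.InStages u ∧ u.1 = x
  swap
  · convert finite_empty using 1
    rw [eq_empty_iff_forall_notMem]
    rintro b ⟨z, t, hz⟩
    have h1 := z.onPath
    rw [hz] at h1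
    obtain ⟨-, u, h2, ⟨h3, -⟩ | ⟨h3, -⟩⟩ := h1.of_fatou
    · exact hu ⟨u, h3.inStages, h2⟩
    · exact hu ⟨u, h3.inStages, h2⟩
  obtain ⟨u, hu, rfl⟩ := hu
  let t₀ : Ioo (0 : ℝ) 1 := ⟨1 / 2, by norm_num, by norm_num⟩
  by_cases hp : ∃ p, ν.IsStarPeriodic p
  swap
  · convert finite_empty using 1
    rw [eq_empty_iff_forall_notMem]
    rintro b ⟨z, t, hz⟩
    have h1 := z.onPath
    rw [hz] at h1
    exact hp h1.of_fatou.1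
  obtain ⟨p, hp⟩ := hp
  have hR : {b | ν.RightEnd u b}.Subsingleton := fun b hb b' hb' => by
    have := (OnPath.fatouRight p hp u b hb t₀).unique_point hν (.fatouRight p hp u b' hb' t₀)
    simpa using this
  have hL : {b | ν.LeftEnd u b}.Subsingleton := fun b hb b' hb' => by
    have := (OnPath.fatouLeft p hp u b hb t₀).unique_point hν (.fatouLeft p hp u b' hb' t₀)
    simpa using this
  refine (hR.finite.union hL.finite).subset ?_
  rintro b ⟨z, t, hz⟩
  have h1 := z.onPath
  rw [hz] at h1
  obtain ⟨-, v, h2, ⟨h3, -⟩ | ⟨h3, -⟩⟩ := h1.of_fatou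
  · obtain rfl := h3.inStages.eq_of_fst_eq hν hu h2
    exact Or.inl h3
  · obtain rfl := h3.inStages.eq_of_fst_eq hν hu h2
    exact Or.inr h3

end CriticalPath

/-- In a separation of `U`, the connected set `F ∩ U` is in one part. The complement of the other
part is then open, being composed of the first part, `V` and `F`; so the other part is open and
closed in a connected space. -/
theorem IsPreconnected.of_open_cover {X : Type*} [TopologicalSpace X] [PreconnectedSpace X]
    {U V F : Set X} (hU : IsOpen U) (hV : IsOpen V) (hF : IsOpen F) (hcov : U ∪ V ∪ F = univ)
    (hdis : Disjoint U V) (hFU : IsPreconnected (F ∩ U)) (hne : F.Nonempty) : IsPreconnected U := by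
  rw [isPreconnected_iff_subset_of_disjoint]
  intro W W' hW hW' hsub hWW
  have key : ∀ W W' : Set X, IsOpen W → IsOpen W' → U ⊆ W ∪ W' → U ∩ (W ∩ W') = ∅ →
      F ∩ U ⊆ W → U ⊆ W := by
    intro W W' hW hW' hsub hWW hFW
    have h1 : (U ∩ W')ᶜ = U ∩ W ∪ V ∪ F := by
      ext z
      have h2 : z ∈ U ∪ V ∪ F := hcov ▸ mem_univ z
      constructor
      · intro h3
        rcases h2 with (h2 | h2) | h2
        · exact Or.inl (Or.inl ⟨h2, (hsub h2).resolve_right fun h => h3 ⟨h2, h⟩⟩)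
        · exact Or.inl (Or.inr h2)
        · exact Or.inr h2
      · rintro ((h3 | h3) | h3) ⟨h4, h5⟩
        · exact (hWW ▸ (⟨h4, h3.2, h5⟩ : z ∈ U ∩ (W ∩ W')) : z ∈ (∅ : Set X))
        · exact disjoint_left.1 hdis h4 h3
        · exact (hWW ▸ (⟨h4, hFW ⟨h3, h4⟩, h5⟩ : z ∈ U ∩ (W ∩ W')) : z ∈ (∅ : Set X))
    have h2 : IsClopen (U ∩ W') :=
      ⟨isOpen_compl_iff.1 (h1 ▸ ((hU.inter hW).union hV).union hF), hU.inter hW'⟩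
    intro z hz
    refine (hsub hz).resolve_right fun hz' => ?_
    have h3 := h2.eq_univ ⟨z, hz, hz'⟩
    obtain ⟨w, hw⟩ := hne
    have h4 : w ∈ U ∩ W' := h3 ▸ mem_univ w
    exact (hWW ▸ (⟨h4.1, hFW ⟨hw, h4.1⟩, h4.2⟩ : w ∈ U ∩ (W ∩ W')) : w ∈ (∅ : Set X))
  have hFUW : F ∩ U ∩ (W ∩ W') = ∅ := by
    rw [eq_empty_iff_forall_notMem] at hWW ⊢
    exact fun z hz => hWW z ⟨hz.1.2, hz.2⟩
  rcases isPreconnected_iff_subset_of_disjoint.1 hFU W W' hW hW'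
    (inter_subset_right.trans hsub) hFUW with h1 | h1
  · exact Or.inl (key W W' hW hW' hsub hWW h1)
  · exact Or.inr (key W' W hW' hW (by rwa [union_comm]) (by rwa [inter_comm W']) h1)

namespace HubbardTree

open Itinerary

variable {A : Type*} {ν : Itinerary A} {h : FatouMaps A}

/-! ### Fatou intervals -/

/-- The points which `fatou a b t` separates from the sequence `b`. -/
def above (h : FatouMaps A) (ν a b : Itinerary A) (t : Ioo (0 : ℝ) 1) : Set (HubbardTree ν h) :=
  {z | z ∈ side h ν b a ∧ ∀ t', z.1 = .fatou a b t' → t < t'}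

/-- The points which `fatou a b t` does not separate from the sequence `b`. -/
def below (h : FatouMaps A) (ν a b : Itinerary A) (t : Ioo (0 : ℝ) 1) : Set (HubbardTree ν h) :=
  {z | z.1.rep = b ∨ ¬ ν.Merge b z.1.rep a ∨ ∃ t' < t, z.1 = .fatou a b t'}

variable {a b : Itinerary A} {t : Ioo (0 : ℝ) 1}

theorem rep_fatou_ne (ha : ¬ a.StarFree) (hb : b.StarFree) : a ≠ b := fun h => ha (h ▸ hb)

theorem mem_above_fatou (ha : ¬ a.StarFree) (hb : b.StarFree) {z : HubbardTree ν h}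
    {s : Ioo (0 : ℝ) 1} (hz : z.1 = .fatou a b s) : z ∈ above h ν a b t ↔ t < s := by
  refine ⟨fun h1 => h1.2 s hz, fun h1 => ⟨⟨?_, ?_⟩, fun t' h2 => ?_⟩⟩
  · rw [hz]; exact rep_fatou_ne ha hb
  · rw [hz]; exact Merge.refl _ _
  · rw [hz] at h2
    cases h2
    exact h1

theorem mem_below_fatou (ha : ¬ a.StarFree) (hb : b.StarFree) {z : HubbardTree ν h}
    {s : Ioo (0 : ℝ) 1} (hz : z.1 = .fatou a b s) : z ∈ below h ν a b t ↔ s < t := by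
  constructor
  · rintro (h1 | h1 | ⟨t', h1, h2⟩)
    · rw [hz] at h1; exact absurd h1 (rep_fatou_ne ha hb)
    · rw [hz] at h1; exact absurd (Merge.refl _ _) h1
    · rw [hz] at h2
      cases h2
      exact h1
  · exact fun h1 => Or.inr (Or.inr ⟨s, h1, hz⟩)

theorem disjoint_above_below : Disjoint (above h ν a b t) (below h ν a b t) := by
  rw [disjoint_left]
  rintro z ⟨h1, h2⟩ (h3 | h3 | ⟨t', h3, h4⟩)
  exacts [h1.1 h3, h3 h1.2, absurd (h2 t' h4) h3.not_gt]

theorem above_union_below (ha : ¬ a.StarFree) (hb : b.StarFree) {τ : HubbardTree ν h}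
    (hτ : τ.1 = .fatou a b t) : above h ν a b t ∪ below h ν a b t = {τ}ᶜ := by
  ext z
  constructor
  · rintro h1 rfl
    rw [mem_union, mem_above_fatou ha hb hτ, mem_below_fatou ha hb hτ] at h1
    exact h1.elim (lt_irrefl t) (lt_irrefl t)
  · intro h1
    by_cases h2 : ∃ t', z.1 = .fatou a b t'
    · obtain ⟨t', h2⟩ := h2
      rcases lt_trichotomy t t' with h3 | rfl | h3
      · exact Or.inl ((mem_above_fatou ha hb h2).2 h3)
      · exact absurd (Subtype.ext (h2.trans hτ.symm)) h1
      · exact Or.inr ((mem_below_fatou ha hb h2).2 h3)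
    · by_cases h3 : z ∈ side h ν b a
      · exact Or.inl ⟨h3, fun t' h4 => absurd ⟨t', h4⟩ h2⟩
      · right
        by_cases h4 : z.1.rep = b
        · exact Or.inl h4
        · exact Or.inr (Or.inl fun h5 => h3 ⟨h4, h5⟩)

variable [hK : Fact ν.IsKneading]

/-- Within the open side of `a` at `b` one has to stay away from parameters up to `t` in the
interval of `a` and `b`. Near a precritical point all Fatou parameters are close to 1; near another
point without ⋆ the itinerary already differs from `b`; inside a Fatou interval the parameter varies
continuously. -/
theorem isOpen_above {p : ℕ} (hp : ν.IsStarPeriodic p) (ha : ¬ a.StarFree) (hb : b.StarFree)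
    (hb' : ν.Proper b) : IsOpen (above h ν a b t) := by
  have hsub : ∀ {a' b' : Itinerary A} {T : Set (Ioo (0 : ℝ) 1)}, IsOpen T → T.OrdConnected →
      ∀ {k}, k < p → IsOpen (ofPath ν h k ⁻¹' {z | ∃ t ∈ T, z.1 = .fatou a' b' t}) :=
    fun {_ _ _} hT hT' {k} hk => (isOpen_fatou _ _ hT hT').1.preimage (continuous_ofPath (Or.inr ⟨p, hp, hk⟩))
  refine (isOpen_iff_of_starPeriodic hp).2 fun k hk => isOpen_iff_mem_nhds.2 fun c hc => ?_
  rw [mem_preimage] at hc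
  have hside := ((isOpen_side (h := h) hb hb' a).preimage
    (continuous_ofPath (ν := ν) (h := h) (Or.inr ⟨p, hp, hk⟩))).mem_nhds hc.1
  rcases hz : (ofPath ν h k c).1 with x | ⟨a', b', t'⟩
  · rcases hc' : c.1 with y | ⟨a', b', t'⟩
    swap
    · obtain ⟨e, he⟩ := TreePoint.iterate_map_fatou h k a' b'
      have h4 := he t'
      rw [← hc'] at h4
      exact absurd (h4.symm.trans hz) (by simp)
    have hyx : drop k y = x := by
      have h4 := TreePoint.iterate_map_itinerary h k y
      rw [← hc'] at h4
      exact TreePoint.itinerary.inj (h4.symm.trans hz)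
    by_cases hy : y.StarFree
    · have hxb : x ≠ b := by
        have := hc.1.1
        rwa [hz] at this
      obtain ⟨n, hn⟩ : ∃ n, x n ≠ b n := by
        by_contra! hcon
        exact hxb (funext hcon)
      obtain ⟨O, hO, hcO, h1⟩ := c.exists_isOpen_near (n + k + 1)
      refine mem_of_superset (inter_mem hside (hO.mem_nhds hcO)) fun c' hc'' =>
        ⟨hc''.1, fun t' ht' => ?_⟩
      have h2 : (ofPath ν h k c').1.body n = b n := by rw [ht']; rfl
      rw [body_ofPath, drop_apply] at h2
      have h3 : c.1.body (n + k) = x n := by rw [hc', ← hyx]; rfl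
      rcases h1 c' hc''.2 with rfl | h1
      · exact absurd (h3.symm.trans h2) hn
      · have h4 := (h1 (n + k) (by omega)).2.resolve_right (by rw [hc']; exact hy _)
        exact absurd (h3.symm.trans (h4.trans h2)) hn
    · obtain ⟨O, hO, hcO, h1⟩ := CriticalPath.exists_isOpen_rep_eq hp (z := c)
        (by rw [hc']; exact hy)
      have h2 : ∀ b' : Itinerary A, ∃ O ∈ 𝓝 c, ∀ c' ∈ O, ∀ s, c'.1 = .fatou y b' s →
          ∀ t', (ofPath ν h k c').1 = .fatou a b t' → t < t' := by
        intro b'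
        obtain ⟨e, he⟩ := TreePoint.iterate_map_fatou h k y b'
        obtain ⟨O, hO, hcO, h1⟩ := CriticalPath.exists_isOpen_fatou_near hp hc' hy (e.symm t).2.2
        refine ⟨O, hO.mem_nhds hcO, fun c' hc' s hs t' ht' => ?_⟩
        have h3 : e.symm t < s := h1 c' hc' y b' s hs
        have h4 := he s
        rw [← hs] at h4
        have h5 := h4.symm.trans ht'
        simp only [TreePoint.fatou.injEq] at h5
        rw [← h5.2.2]
        exact (OrderIso.symm_apply_lt e).1 h3
      choose O' hO' h3 using h2
      have hfin := CriticalPath.finite_setOf_fatou (ν := ν) y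
      refine mem_of_superset (inter_mem (inter_mem hside (hO.mem_nhds hcO))
        ((biInter_mem hfin).2 fun b' _ => hO' b')) fun c' hc'' => ⟨hc''.1.1, fun t' ht' => ?_⟩
      rcases hc3 : c'.1 with y' | ⟨a', b', s⟩
      · have h4 := TreePoint.iterate_map_itinerary h k y'
        rw [← hc3] at h4
        exact absurd (h4.symm.trans ht') (by simp)
      · have h4 := h1 c' hc''.1.2
        rw [hc3, hc'] at h4
        obtain rfl : a' = y := h4
        exact h3 b' c' (mem_iInter₂.1 hc''.2 b' ⟨c', s, hc3⟩) s hc3 t' ht'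
  · by_cases hab : a' = a ∧ b' = b
    · obtain ⟨rfl, rfl⟩ := hab
      have h1 := hsub (a' := a') (b' := b') (isOpen_Ioi (a := t)) ordConnected_Ioi hk
      refine mem_of_superset (h1.mem_nhds ⟨t', hc.2 t' hz, hz⟩) fun c' hc' => ?_
      obtain ⟨s, hs, hs'⟩ := hc'
      exact (mem_above_fatou ha hb hs').2 hs
    · have h1 := hsub (a' := a') (b' := b') isOpen_univ ordConnected_univ hk
      refine mem_of_superset (inter_mem hside (h1.mem_nhds ⟨t', mem_univ _, hz⟩)) fun c' hc' => ?_
      obtain ⟨hs, s, -, hs'⟩ := hc'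
      refine ⟨hs, fun t'' ht'' => ?_⟩
      have h2 := hs'.symm.trans ht''
      simp only [TreePoint.fatou.injEq] at h2
      exact absurd ⟨h2.1, h2.2.1⟩ hab

/-- Near a point in front of `b`, the points on one side of it are on the other side of
`fatou a b t` than `a`. -/
theorem mem_below_of_germ {x e : Itinerary A} {k : ℕ} (ha' : ν.Proper a)
    (hb : b.StarFree) (hab : Compat a b) (hxb : drop k x = b)
    (hs : ∀ K, ∃ j ≥ K, ν.Leaves x e j) {c : CriticalPath ν} (hc : ν.Merge x c.1.rep e)
    (hk : track ν x k c.1.rep = drop k c.1.rep) : ofPath ν h k c ∈ below h ν a b t := by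
  refine Or.inr (Or.inl fun h1 => ?_)
  have h2 := (merge_track_iff (ν := ν) k).2 hc
  rw [hxb, hk, ← rep_ofPath (h := h)] at h2
  obtain ⟨K, hK⟩ := (h1.symm.trans h2).leaves_iff
  obtain ⟨j, hj, h3⟩ := hs (k + K)
  obtain ⟨i, rfl⟩ := Nat.exists_eq_add_of_le (show k ≤ j by omega)
  rw [leaves_add, hxb, ← hK i (by omega)] at h3
  exact ha'.not_leaves hb hab i h3

/-- The bound is the preimage of `t` under the increasing map to the image interval. If the image
has the precritical end `a`, its parameter is below `t`; otherwise its end is on another side of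
`b`, by `Proper.eq_of_merge`. -/
theorem mem_below_of_fatou {x v : Itinerary A} {k : ℕ} (ha' : ν.Proper a)
    (hb : b.StarFree) (hab : Compat a b) (hxb : drop k x = b) (hv : ν.Proper v)
    (hvx : Compat v x) : ∃ t₀ : Ioo (0 : ℝ) 1, ∀ (c : CriticalPath ν), ∀ s < t₀,
      c.1 = .fatou v x s → ofPath ν h k c ∈ below h ν a b t := by
  obtain ⟨e, he⟩ := TreePoint.iterate_map_fatou h k v x
  refine ⟨e.symm t, fun c s hs hc => ?_⟩
  have h1 := he s
  rw [← hc, hxb] at h1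
  by_cases hva : drop k v = a
  · refine Or.inr (Or.inr ⟨e s, (OrderIso.lt_symm_apply e).1 hs, ?_⟩)
    rw [← hva]
    exact h1
  · refine Or.inr (Or.inl fun h2 => hva ?_)
    have h3 : (ofPath ν h k c).1.rep = drop k v := congrArg TreePoint.rep h1
    rw [h3] at h2
    exact (hv.drop k).eq_of_merge ha' hb (hxb ▸ hvx.drop k) hab h2

/-- Only preimages of `b` on the path need care. On each side of such a point there is either a
Fatou interval or a germ whose track leaves infinitely often; the latter cannot be on the side of
`a`, which is compatible with `b`. -/
theorem isOpen_below {p : ℕ} (hp : ν.IsStarPeriodic p) (ha : ¬ a.StarFree) (ha' : ν.Proper a)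
    (hb : b.StarFree) (hb' : ν.Proper b) (hab : Compat a b) : IsOpen (below h ν a b t) := by
  refine (isOpen_iff_of_starPeriodic hp).2 fun k hk => isOpen_iff_mem_nhds.2 fun c hc => ?_
  have hcont := continuous_ofPath (ν := ν) (h := h) (Or.inr ⟨p, hp, hk⟩)
  rw [mem_preimage] at hc
  by_cases h1 : (ofPath ν h k c).1.rep = b
  swap
  · rcases hc.resolve_left h1 with h2 | ⟨t', h2, h3⟩
    · refine mem_of_superset (((isOpen_compl_side (h := h) hb hb' a).preimage hcont).mem_nhds
        ⟨h1, h2⟩) fun c' hc' => Or.inr (Or.inl hc'.2)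
    · refine mem_of_superset (((isOpen_fatou (h := h) a b (isOpen_Iio (a := t))
        ordConnected_Iio).1.preimage hcont).mem_nhds ⟨t', h2, h3⟩) ?_
      rintro c' ⟨s, hs, hs'⟩
      exact (mem_below_fatou ha hb hs').2 hs
  have hx : c.1.rep.StarFree := by
    by_contra h2
    have h3 : ν.Proper c.1.rep := (ofPath ν h 0 c).proper_rep
    exact hp.not_starFree_drop h3 h2 k (by rwa [← rep_ofPath (h := h), h1])
  have hcx : c.1 = .itinerary c.1.rep := val_eq_of_starFree (z := ofPath ν h 0 c) hx
  rw [rep_ofPath] at h1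
  set x := c.1.rep with hxdef
  have hbody : c.1.body = x := by rw [hcx]; rfl
  obtain ⟨O, hO, hcO, hnear⟩ := c.exists_isOpen_near k
  have htrack : ∀ c' ∈ O, track ν x k c'.1.rep = drop k c'.1.rep := fun c' hc' => by
    refine (ofPath ν h 0 c').proper_rep.track_eq_drop fun i hi => ?_
    change c'.1.rep i = x i ∨ c'.1.rep i = none
    have h2 : c'.1.body i = x i := by
      rcases hnear c' hc' with rfl | h2
      · rw [hbody]
      · rw [← hbody]
        exact ((h2 i hi).2.resolve_right (by rw [hbody]; exact hx i)).symm
    rcases c'.rep_eq_or with h3 | ⟨h3, h4⟩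
    · rw [h3]; exact Or.inl h2
    · rcases h4 i with h4 | h4 | h4
      exacts [Or.inr h4, absurd h4 (h3 i), Or.inl (h4.trans h2)]
  have hr : ∃ O' ∈ 𝓝 c, ∀ c' ∈ O', c < c' → ofPath ν h k c' ∈ below h ν a b t := by
    rcases CriticalPath.right_side hp hcx hx with h2 | ⟨v, hv, hvx, h2⟩
    · exact ⟨O, hO.mem_nhds hcO, fun c' hc' hlt => mem_below_of_germ ha' hb hab h1 h2
        (CriticalPath.merge_right hp hcx hx hlt) (htrack c' hc')⟩
    · obtain ⟨t₀, h3⟩ := mem_below_of_fatou (h := h) (t := t) ha' hb hab h1 hv hvx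
      obtain ⟨c₁, hc₁, h4⟩ := h2 t₀
      refine ⟨Iio c₁, Iio_mem_nhds hc₁, fun c' hc' hlt => ?_⟩
      obtain ⟨s, hs, hs'⟩ := h4 c' ⟨hlt, hc'⟩
      exact h3 c' s hs hs'
  have hl : ∃ O' ∈ 𝓝 c, ∀ c' ∈ O', c' < c → ofPath ν h k c' ∈ below h ν a b t := by
    rcases CriticalPath.left_side hp hcx hx with h2 | ⟨v, hv, hvx, h2⟩
    · exact ⟨O, hO.mem_nhds hcO, fun c' hc' hlt => mem_below_of_germ ha' hb hab h1 h2
        (CriticalPath.merge_left hp hcx hx hlt) (htrack c' hc')⟩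
    · obtain ⟨t₀, h3⟩ := mem_below_of_fatou (h := h) (t := t) ha' hb hab h1 hv hvx
      obtain ⟨c₁, hc₁, h4⟩ := h2 t₀
      refine ⟨Ioi c₁, Ioi_mem_nhds hc₁, fun c' hc' hlt => ?_⟩
      obtain ⟨s, hs, hs'⟩ := h4 c' ⟨hc', hlt⟩
      exact h3 c' s hs hs'
  obtain ⟨O₁, hO₁, h2⟩ := hr
  obtain ⟨O₂, hO₂, h3⟩ := hl
  refine mem_of_superset (inter_mem hO₁ hO₂) fun c' hc' => ?_
  rcases lt_trichotomy c c' with h4 | rfl | h4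
  exacts [h2 c' hc'.1 h4, hc, h3 c' hc'.2 h4]

end HubbardTree

namespace HubbardTree

open Itinerary

variable {A : Type*} {ν : Itinerary A} {h : FatouMaps A} [hK : Fact ν.IsKneading]
variable {a b : Itinerary A} {t : Ioo (0 : ℝ) 1} {τ : HubbardTree ν h}

/-! ### Local arms in Fatou intervals -/

theorem proper_end (hτ : τ.1 = .fatou a b t) : ν.Proper b := by
  obtain ⟨⟨p, hp⟩, -, -, hb, -⟩ := fatou_cases hτ
  intro i
  refine ⟨fun h1 => absurd h1 (hb i), fun h1 => ?_⟩
  exact absurd (h1 ▸ hb.drop (i + 1)) hp.not_starFree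

/-- The open Fatou interval `F` contains `τ` and meets each of the two sets in an interval of
parameters, so `IsPreconnected.of_open_cover` applies to both. -/
theorem isPreconnected_above (hτ : τ.1 = .fatou a b t) : IsPreconnected (above h ν a b t) ∧
    IsPreconnected (below h ν a b t) ∧ (above h ν a b t).Nonempty ∧
    (below h ν a b t).Nonempty := by
  obtain ⟨⟨p, hp⟩, ha', ha, hb, hab⟩ := fatou_cases hτ
  have hb' := proper_end hτ
  have hA : IsOpen (above h ν a b t) := isOpen_above hp ha hb hb'
  have hB : IsOpen (below h ν a b t) := isOpen_below hp ha ha' hb hb' hab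
  set F := {z : HubbardTree ν h | ∃ t ∈ (univ : Set (Ioo (0 : ℝ) 1)), z.1 = .fatou a b t} with hF
  have hFo : IsOpen F := (isOpen_fatou a b isOpen_univ ordConnected_univ).1
  have hτF : τ ∈ F := ⟨t, mem_univ t, hτ⟩
  have hcov : above h ν a b t ∪ below h ν a b t ∪ F = univ := by
    rw [above_union_below ha hb hτ, eq_univ_iff_forall]
    intro z
    by_cases hz : z = τ
    · exact Or.inr (hz ▸ hτF)
    · exact Or.inl hz
  have hFA : F ∩ above h ν a b t = {z | ∃ s ∈ Ioi t, z.1 = .fatou a b s} := by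
    ext z
    constructor
    · rintro ⟨⟨s, -, hs⟩, hz⟩
      exact ⟨s, (mem_above_fatou ha hb hs).1 hz, hs⟩
    · rintro ⟨s, hs, hz⟩
      exact ⟨⟨s, mem_univ s, hz⟩, (mem_above_fatou ha hb hz).2 hs⟩
  have hFB : F ∩ below h ν a b t = {z | ∃ s ∈ Iio t, z.1 = .fatou a b s} := by
    ext z
    constructor
    · rintro ⟨⟨s, -, hs⟩, hz⟩
      exact ⟨s, (mem_below_fatou ha hb hs).1 hz, hs⟩
    · rintro ⟨s, hs, hz⟩
      exact ⟨⟨s, mem_univ s, hz⟩, (mem_below_fatou ha hb hz).2 hs⟩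
  refine ⟨.of_open_cover hA hB hFo hcov disjoint_above_below ?_ ⟨τ, hτF⟩,
    .of_open_cover hB hA hFo ?_ disjoint_above_below.symm ?_ ⟨τ, hτF⟩, ?_, ?_⟩
  · rw [hFA]
    exact (isOpen_fatou a b isOpen_Ioi ordConnected_Ioi).2
  · rw [union_comm (below h ν a b t), hcov]
  · rw [hFB]
    exact (isOpen_fatou a b isOpen_Iio ordConnected_Iio).2
  · obtain ⟨s, hs⟩ := exists_gt t
    obtain ⟨w, hw⟩ := exists_fatou hτ s
    exact ⟨w, (mem_above_fatou ha hb hw).2 hs⟩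
  · obtain ⟨s, hs⟩ := exists_lt t
    obtain ⟨w, hw⟩ := exists_fatou hτ s
    exact ⟨w, (mem_below_fatou ha hb hw).2 hs⟩

theorem arms_eq_of_fatou (hτ : τ.1 = .fatou a b t) :
    arms τ = {above h ν a b t, below h ν a b t} := by
  obtain ⟨⟨p, hp⟩, ha', ha, hb, hab⟩ := fatou_cases hτ
  have hb' := proper_end hτ
  have hA : IsOpen (above h ν a b t) := isOpen_above hp ha hb hb'
  have hB : IsOpen (below h ν a b t) := isOpen_below hp ha ha' hb hb' hab
  have hcov := above_union_below ha hb hτ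
  obtain ⟨h1, h2, ⟨x, hx⟩, ⟨y, hy⟩⟩ := isPreconnected_above hτ
  have hcA : ∀ z ∈ above h ν a b t, connectedComponentIn {τ}ᶜ z = above h ν a b t := by
    intro z hz
    have hsub : above h ν a b t ⊆ {τ}ᶜ := hcov ▸ subset_union_left
    refine Subset.antisymm ?_ (h1.subset_connectedComponentIn hz hsub)
    refine isPreconnected_connectedComponentIn.subset_left_of_subset_union hA hB
      disjoint_above_below ?_ ⟨z, mem_connectedComponentIn (hsub hz), hz⟩
    rw [hcov]
    exact connectedComponentIn_subset _ _
  have hcB : ∀ z ∈ below h ν a b t, connectedComponentIn {τ}ᶜ z = below h ν a b t := by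
    intro z hz
    have hsub : below h ν a b t ⊆ {τ}ᶜ := hcov ▸ subset_union_right
    refine Subset.antisymm ?_ (h2.subset_connectedComponentIn hz hsub)
    refine isPreconnected_connectedComponentIn.subset_left_of_subset_union hB hA
      disjoint_above_below.symm ?_ ⟨z, mem_connectedComponentIn (hsub hz), hz⟩
    rw [union_comm, hcov]
    exact connectedComponentIn_subset _ _
  ext G
  constructor
  · rintro ⟨z, hz, rfl⟩
    rcases (hcov ▸ hz : z ∈ above h ν a b t ∪ below h ν a b t) with h3 | h3
    · exact Or.inl (hcA z h3)
    · exact Or.inr (hcB z h3)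
  · rintro (rfl | rfl)
    · exact ⟨x, hcov.subset (Or.inl hx), (hcA x hx).symm⟩
    · exact ⟨y, hcov.subset (Or.inr hy), (hcB y hy).symm⟩

theorem ncard_arms_of_fatou (hτ : τ.1 = .fatou a b t) : (arms τ).ncard = 2 := by
  rw [arms_eq_of_fatou hτ]
  obtain ⟨-, -, ⟨x, hx⟩, -⟩ := isPreconnected_above hτ
  exact ncard_pair fun h1 => disjoint_left.1 disjoint_above_below hx (h1 ▸ hx)

theorem track_one_fatou (hτ : τ.1 = .fatou a b t) : track ν b 1 a = drop 1 a := by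
  obtain ⟨-, ha', -, hb, hab⟩ := fatou_cases hτ
  refine ha'.track_eq_drop fun i _ => ?_
  rcases hab i with h1 | h1 | h1
  exacts [Or.inr h1, absurd h1 (hb i), Or.inl h1]

theorem merge_σ_iff (hτ : τ.1 = .fatou a b t) {w : HubbardTree ν h} (hw : w.1.body 0 = b 0) :
    ν.Merge (drop 1 b) (σ w).1.rep (drop 1 a) ↔ ν.Merge b w.1.rep a := by
  rw [rep_σ, ← step_rep hw, ← track_one_fatou hτ, merge_track_iff]

theorem σ_mem_above (hτ : τ.1 = .fatou a b t) {w : HubbardTree ν h} (hw : w.1.body 0 = b 0)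
    (h1 : w ∈ above h ν a b t) : σ w ∈ above h ν (drop 1 a) (drop 1 b) (h a b t) := by
  obtain ⟨⟨p, hp⟩, ha', ha, hb, hab⟩ := fatou_cases hτ
  refine ⟨⟨fun h2 => h1.1.1 ?_, (merge_σ_iff hτ hw).2 h1.1.2⟩, fun t' ht' => ?_⟩
  · rw [rep_σ] at h2
    have h3 : w.1.rep.StarFree := by
      by_contra h4
      exact hp.not_starFree_drop w.proper_rep h4 1 (h2 ▸ hb.drop 1)
    have h4 : w.1.body = w.1.rep := congrArg TreePoint.body (val_eq_of_starFree h3)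
    funext i
    rcases i with _ | i
    · rw [← h4, hw]
    · exact congrFun h2 i
  · rcases hw' : w.1 with x | ⟨a', b', s⟩
    · rw [σ_val, hw'] at ht'
      cases ht'
    obtain ⟨-, hp', -, -, hab'⟩ := fatou_cases hw'
    rw [σ_val, hw'] at ht'
    simp only [TreePoint.map, TreePoint.fatou.injEq] at ht'
    obtain ⟨h2, h3, rfl⟩ := ht'
    rw [hw'] at hw
    obtain rfl : b' = b := by
      funext i
      rcases i with _ | i
      exacts [hw, congrFun h3 i]
    have h4 := h1.1.2
    rw [hw'] at h4
    obtain rfl : a' = a := hp'.eq_of_merge ha' hb hab' hab h4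
    exact (h a' b').strictMono (h1.2 s hw')

theorem σ_mem_below (hτ : τ.1 = .fatou a b t) {w : HubbardTree ν h} (hw : w.1.body 0 = b 0)
    (h1 : w ∈ below h ν a b t) : σ w ∈ below h ν (drop 1 a) (drop 1 b) (h a b t) := by
  rcases h1 with h1 | h1 | ⟨s, hs, h1⟩
  · exact Or.inl (by rw [rep_σ, h1])
  · exact Or.inr (Or.inl ((merge_σ_iff hτ hw).not.2 h1))
  · exact Or.inr (Or.inr ⟨h a b s, (h a b).strictMono hs, by rw [σ_val, h1]; rfl⟩)

/-- The arm at a point of a Fatou interval that contains the precritical end of the interval. -/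
def upperArm (z : HubbardTree ν h) : Set (HubbardTree ν h) :=
  match z.1 with
  | .itinerary _ => ∅
  | .fatou a b t => above h ν a b t

/-- The other arm at a point of a Fatou interval. -/
def lowerArm (z : HubbardTree ν h) : Set (HubbardTree ν h) :=
  match z.1 with
  | .itinerary _ => ∅
  | .fatou a b t => below h ν a b t

theorem upperArm_eq (hτ : τ.1 = .fatou a b t) : upperArm τ = above h ν a b t := by
  rw [upperArm, hτ]

theorem lowerArm_eq (hτ : τ.1 = .fatou a b t) : lowerArm τ = below h ν a b t := by
  rw [lowerArm, hτ]

/-- The maps between Fatou intervals are increasing, so the arm towards the precritical end is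
mapped to the arm towards the precritical end, and likewise for the other one. The open Fatou
interval itself is a connected neighbourhood without ⋆ν and serves to identify the image arm. -/
theorem mapsArm_iff_of_fatou {Q : HubbardTree ν h → Set (HubbardTree ν h)}
    (hQ : Q = upperArm ∨ Q = lowerArm) (hτ : τ.1 = .fatou a b t) {G' : Set (HubbardTree ν h)} :
    MapsArm τ (Q τ) G' ↔ G' = Q (σ τ) := by
  have hσ : (σ τ).1 = .fatou (drop 1 a) (drop 1 b) (h a b t) := by rw [σ_val, hτ]; rfl
  obtain ⟨-, -, ha, hb, -⟩ := fatou_cases hτ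
  have hcrit : τ ≠ criticalPoint ν h := fun h1 => by
    have h2 := criticalPoint_val (ν := ν) (h := h)
    rw [← h1, hτ] at h2
    cases h2
  have key : ∀ N : Set (HubbardTree ν h), IsPreconnected N → τ ∈ N → criticalPoint ν h ∉ N →
      ∀ w ∈ N, w ∈ Q τ → σ w ∈ Q (σ τ) := by
    intro N hN hτN h0 w hw hwQ
    have h1 : w.1.body 0 = b 0 := by rw [body_zero_eq hN h0 hτN hw, hτ]; rfl
    rcases hQ with rfl | rfl
    · rw [upperArm_eq hτ] at hwQ
      rw [upperArm_eq hσ]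
      exact σ_mem_above hτ h1 hwQ
    · rw [lowerArm_eq hτ] at hwQ
      rw [lowerArm_eq hσ]
      exact σ_mem_below hτ h1 hwQ
  have hmem : ∀ {z : HubbardTree ν h} {a b t}, z.1 = .fatou a b t → Q z ∈ arms z := by
    intro z a b t hz
    rw [arms_eq_of_fatou hz]
    rcases hQ with rfl | rfl
    · exact Or.inl (upperArm_eq hz)
    · exact Or.inr (lowerArm_eq hz)
  constructor
  · rintro ⟨-, h2, h3⟩
    have hFo := isOpen_fatou (ν := ν) (h := h) a b isOpen_univ ordConnected_univ
    have hτF : τ ∈ {z : HubbardTree ν h | ∃ t ∈ (univ : Set (Ioo (0 : ℝ) 1)), z.1 = .fatou a b t} :=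
      ⟨t, mem_univ t, hτ⟩
    have hcF : criticalPoint ν h ∉
        {z : HubbardTree ν h | ∃ t ∈ (univ : Set (Ioo (0 : ℝ) 1)), z.1 = .fatou a b t} := by
      rintro ⟨s, -, hs⟩
      rw [criticalPoint_val] at hs
      cases hs
    obtain ⟨w, hwF, hwQ⟩ : ∃ w : HubbardTree ν h, (∃ s ∈ (univ : Set (Ioo (0 : ℝ) 1)),
        w.1 = .fatou a b s) ∧ w ∈ Q τ := by
      rcases hQ with rfl | rfl
      · obtain ⟨s, hs⟩ := exists_gt t
        obtain ⟨w, hw⟩ := exists_fatou hτ s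
        refine ⟨w, ⟨s, mem_univ s, hw⟩, ?_⟩
        rw [upperArm_eq hτ]
        exact (mem_above_fatou ha hb hw).2 hs
      · obtain ⟨s, hs⟩ := exists_lt t
        obtain ⟨w, hw⟩ := exists_fatou hτ s
        refine ⟨w, ⟨s, mem_univ s, hw⟩, ?_⟩
        rw [lowerArm_eq hτ]
        exact (mem_below_fatou ha hb hw).2 hs
    have h4 := h3 _ hFo.1 ⟨⟨τ, hτF⟩, hFo.2⟩ hτF hcF ⟨w, ⟨hwF, hwQ⟩, rfl⟩
    have h5 := key _ hFo.2 hτF hcF w hwF hwQ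
    have h6 := hmem hσ
    rw [arms_eq_of_fatou hσ] at h2 h6
    have hdis := disjoint_left.1 (disjoint_above_below (h := h) (ν := ν) (a := drop 1 a)
      (b := drop 1 b) (t := h a b t))
    rcases h2 with rfl | rfl <;> rcases h6 with h6 | h6
    · exact h6.symm
    · exact absurd (h6 ▸ h5) (hdis h4)
    · exact absurd h4 (hdis (h6 ▸ h5))
    · exact h6.symm
  · rintro rfl
    refine ⟨hmem hτ, hmem hσ, fun N _ hN hτN h0 => ?_⟩
    rintro _ ⟨w, hw, rfl⟩
    exact key N hN.isPreconnected hτN h0 w hw.1 hw.2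

theorem returnsArm_iff_of_fatou {Q : HubbardTree ν h → Set (HubbardTree ν h)}
    (hQ : Q = upperArm ∨ Q = lowerArm) (hτ : τ.1 = .fatou a b t) {G' : Set (HubbardTree ν h)} :
    ReturnsArm τ (Q τ) G' ↔ Q τ = G' := by
  have hstep : ∀ n G', MapsArm (σ^[n] τ) (Q (σ^[n] τ)) G' ↔ G' = Q (σ^[n + 1] τ) := fun n G' => by
    obtain ⟨e, he⟩ := TreePoint.iterate_map_fatou h n a b
    rw [Function.iterate_succ_apply']
    exact mapsArm_iff_of_fatou hQ (by rw [iterate_σ_val, hτ, he])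
  have hper : σ^[Function.minimalPeriod σ τ] τ = τ := Function.iterate_minimalPeriod
  constructor
  · rintro ⟨c, h0, rfl, h2⟩
    have : ∀ n ≤ Function.minimalPeriod σ τ, c n = Q (σ^[n] τ) := by
      intro n
      induction n with
      | zero => exact fun _ => h0
      | succ n ih =>
        intro hn
        have := h2 n hn
        rw [ih (by omega), hstep] at this
        exact this
    rw [this _ le_rfl, hper]
  · rintro rfl
    exact ⟨fun n => Q (σ^[n] τ), rfl, congrArg Q hper, fun n _ => (hstep n _).2 rfl⟩

theorem hasType_primitive (hτ : τ.1 = .fatou a b t) : HasType τ .primitive := by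
  rintro _ ⟨n, rfl⟩
  obtain ⟨e, he⟩ := TreePoint.iterate_map_fatou h n a b
  have hn : (σ^[n] τ).1 = .fatou (drop n a) (drop n b) (e t) := by rw [iterate_σ_val, hτ, he]
  refine ⟨ncard_arms_of_fatou hn, fun ⟨G, hG⟩ G' => ?_⟩
  rw [Equiv.Perm.one_apply]
  have hG' := hG
  rw [arms_eq_of_fatou hn] at hG'
  rcases hG' with rfl | rfl
  · simp only
    rw [← upperArm_eq hn]
    exact returnsArm_iff_of_fatou (Or.inl rfl) hn
  · simp only
    rw [← lowerArm_eq hn]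
    exact returnsArm_iff_of_fatou (Or.inr rfl) hn

theorem exists_hasType (hper : τ ∈ Function.periodicPts (σ (ν := ν) (h := h)))
    (hcrit : criticalPoint ν h ∉ orbit τ) : ∃ t, HasType τ t := by
  rcases hτ : τ.1 with x | ⟨a, b, t⟩
  -- A ⋆ at position `i` would make the `i`-th iterate the critical point.
  · refine exists_hasType_of_starFree (fun i hi => hcrit ⟨i, ?_⟩) hτ hper hcrit
    rw [← body_zero_eq_none, body_iterate_σ, hτ, drop_apply, zero_add]
    exact hi
  · exact ⟨.primitive, hasType_primitive hτ⟩

end HubbardTree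

/-- Let `A` be an alphabet with `d ∈ {2, 3, …, ∞}` symbols (at most countably many) and `ν` a
non-trivial kneading sequence over `A`. Every periodic orbit in the Hubbard tree of `ν` that does
not contain the critical point has exactly one of the four types. -/
theorem mainTheorem7 {A : Type*} [Countable A] [Nontrivial A] (ν : Itinerary A)
    (hν : ν.IsKneading) (h : FatouMaps A) (τ : HubbardTree ν h)
    (hτ : τ ∈ Function.periodicPts (HubbardTree.σ : HubbardTree ν h → HubbardTree ν h))
    (hcrit : HubbardTree.criticalPoint ν h ∉ HubbardTree.orbit τ) :
    ∃! t : HubbardTree.OrbitType, HubbardTree.HasType τ t := by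
  have : Fact ν.IsKneading := ⟨hν⟩
  obtain ⟨t, ht⟩ := HubbardTree.exists_hasType hτ hcrit
  exact ⟨t, ht, fun t' ht' => HubbardTree.HasType.eq ht' ht⟩
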